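/- Let $\ell$ be an odd prime and $n\ge 1$ an integer. **Bilinearly enhanced groups.** For a finite abelian $\ell$-group $G$ put $G^\vee=\mathrm{Hom}(G,\mathbb Q/\mathbb Z)$, let $\wedge^2G\subset G\otimes G$ be the subgroup spanned by the elements $x\wedge y=x\otimes y-y\otimes x$, and let $\mathrm{Sym}^2G=(G\otimes G)/\wedge^2G$. For $m\ge 0$, an element $\omega\in\wedge^2G$ defines a pairing $\omega_m$ on $G^\vee[\ell^m]\cong\mathrm{Hom}(G,\mathbb Z/\ell^m)$ with values in $\frac1{\ell^m}\mathbb Z/\mathbb Z\cong\mathbb Z/\ell^m$ by evaluating $\alpha\otimes\beta$ at $\omega$. An $\ell^n$-BEG is a triple $(G,\omega,\psi)$ of a finite abelian $\ell$-group $G$, an element $\omega\in(\wedge^2G)[\ell^n]$ and a homomorphism $\psi:G^\vee[\ell^n]\to G[\ell^n]$ such that for all $r\ge0$ and $\alpha,\beta\in G^\vee[\ell^{n+r}]$ $$\beta(\psi(\ell^r\alpha))=\alpha(\psi(\ell^r\beta))+2\,\omega_{n+r}(\alpha,\beta).$$ A morphism is a group homomorphism $f$ that pushes $\omega$ to $\omega$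 and $\psi$ to $\psi$ (i.e. $f\circ\psi\circ f^\vee$ is the $\psi$ of the target). $\mathrm{Surj}$ denotes the set of surjective morphisms, and $\mathcal C_{\ell,n}$ the discrete set of isomorphism classes. For a measure $\nu$ on $\mathcal C_{\ell,n}$ and an $\ell^n$-BEG $H^\bullet$, the $H^\bullet$-moment of $\nu$ is $\mathbb E_\nu\#\mathrm{Surj}(*,H^\bullet)$. **The nonlinear model.** Let $T=\mathbb Z_\ell^{2g}$ with basis $e_1,\dots,e_g,f_1,\dots,f_g$ and its standard symplectic pairing $\omega$, $\omega(e_i,f_i)=1$. Let $q\in\mathbb Z_\ell$ with $\ell^n\,\|\,q-1$, and let $\mathrm{GSp}^{(q)}_{2g}(\mathbb Z_\ell)$ be the set of endomorphisms $F$ of $T$ with $\omega(Fx,Fy)=q\,\omega(x,y)$ for all $x,y\in T$, a coset of $\mathrm{Sp}_{2g}(\mathbb Z_\ell)$, with its Haar probability measure. If $H=\mathrm{coker}(1-F)$ is finite, it is an $\ell^n$-BEG with $\omega_H$ the image of $\frac{q-1}{2\ell^n}\sum_i e_i\wedge f_i$ and $\psi_H\bigl(\tfrac1{\ell^n}\omega(\cdot,s)\bigr)=\tfrac1{\ell^n}(F-1)s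 \bmod (F-1)T$ for every $s\in T$ such that $\tfrac1{\ell^n}\omega(\cdot,s)\bmod\mathbb Z_\ell$ vanishes on $(1-F)T$. Let $\nu^n_g$ (depending on $q$) be the distribution on $\mathcal C_{\ell,n}$ of $(\mathrm{coker}(1-F),\omega_H,\psi_H)$ for Haar-random $F$. **The linear model.** Let $\mu_g$ be the distribution on $\mathcal C_{\ell,n}$ of the triple $(\mathrm{coker}(M+\ell^n),\omega_M,\psi_M)$ for a Haar-random $M$ in the additive group of $M\in\mathrm{End}(T)$ with $\omega(Mx,y)=-\omega(x,My)$, where $\omega_M$ is the image of $\sum_ie_i\wedge f_i$ and $\psi_M\bigl(\tfrac1{\ell^n}\omega(\cdot,s)\bigr)=\tfrac1{\ell^n}(M+\ell^n)s$. **Theorem.** 1. For all $q\in\mathbb Z_\ell$ with $\ell^n\,\|\,q-1$ and all $g\ge0$, $\mathrm{coker}(1-F)$ is finite for almost every $F$, so that $\nu^n_g$ is a probability measure. 2. For every $\ell^n$-BEG $H^\bullet=(H,\omega_H,\psi_H)$ there is $g_0=g_0(H^\bullet)$ such that for all $q\in\mathbb Z_\ell$ with $\ell^n\,\|\,q-1$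 and all $g\ge g_0$ $$\mathbb E_{\nu^n_g}\#\mathrm{Surj}(*,H^\bullet)=\frac1{|(\mathrm{Sym}^2H)[\ell^n]|}.$$ 3. There is exactly one probability measure $\mu$ on $\mathcal C_{\ell,n}$ with $\mathbb E_\mu\#\mathrm{Surj}(*,H^\bullet)=1/|(\mathrm{Sym}^2H)[\ell^n]|$ for every $\ell^n$-BEG $H^\bullet$ (the universal measure). As $g\to\infty$, the linear measures $\mu_g$ converge weakly to $\mu$, and for every $q\in\mathbb Z_\ell$ with $\ell^n\,\|\,q-1$ the nonlinear measures $\nu^n_g$ converge weakly to the same $\mu$; that is, the integral of every bounded function on $\mathcal C_{\ell,n}$ converges. -/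

import Mathlib

open scoped TensorProduct Matrix

noncomputable section

namespace BilinEnh

/-! ### Exterior and symmetric squares of abelian groups -/

section Squares

variable (G : Type*) [AddCommGroup G]

variable {G} in
/-- `x ∧ y = x ⊗ y - y ⊗ x` in `G ⊗ G`. -/
def wedge (x y : G) : G ⊗[ℤ] G := x ⊗ₜ[ℤ] y - y ⊗ₜ[ℤ] x

/-- `∧²G`, the subgroup of `G ⊗ G` spanned by all `x ∧ y`. -/
def wedgeSq : Submodule ℤ (G ⊗[ℤ] G) :=
  Submodule.span ℤ {z | ∃ x y : G, z = wedge x y}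

/-- `Sym²G`, the quotient of `G ⊗ G` by all `x ⊗ y - y ⊗ x`. -/
abbrev SymSq : Type _ := (G ⊗[ℤ] G) ⧸ wedgeSq G

/-- The order of the `N`-torsion subgroup of `Sym²G`. -/
def symSqTorsionCard (N : ℕ) : ℕ := Nat.card {z : SymSq G // N • z = 0}

variable {G} in
/-- The value on `G ⊗ G` of the tensor product `α ⊗ β` of two homomorphisms to `ℤ/N`. -/
def evalPair {N : ℕ} (α β : G →+ ZMod N) : (G ⊗[ℤ] G) →ₗ[ℤ] ZMod N :=
  LinearMap.mul' ℤ (ZMod N) ∘ₗ TensorProduct.map α.toIntLinearMap β.toIntLinearMap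

variable {G} in
theorem evalPair_tmul {N : ℕ} (α β : G →+ ZMod N) (x y : G) :
    evalPair α β (x ⊗ₜ[ℤ] y) = α x * β y := rfl

variable {G} in
/-- The map `Hom(G, ℤ/ℓ^(n+r)) → Hom(G, ℤ/ℓ^n)` given by reduction mod `ℓ^n`. Under the
identifications `Hom(G, ℤ/ℓ^m) = Hom(G, ℓ^(-m)ℤ/ℤ) = G^∨[ℓ^m]` (division by `ℓ^m`) this is
`α ↦ ℓ^r α`, from `G^∨[ℓ^(n+r)]` to `G^∨[ℓ^n]`. -/
def scaleDown {ℓ n : ℕ} (r : ℕ) (α : G →+ ZMod (ℓ ^ (n + r))) : G →+ ZMod (ℓ ^ n) :=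
  (ZMod.castHom (pow_dvd_pow ℓ (Nat.le_add_right n r)) (ZMod (ℓ ^ n))).toAddMonoidHom.comp α

end Squares

/-! ### Bilinearly enhanced groups -/

/-- An `ℓ^n`-bilinearly enhanced group `(G, ω, ψ)`: a finite abelian `ℓ`-group `G`, an element
`ω ∈ (∧²G)[ℓ^n]` and a homomorphism `ψ : G^∨[ℓ^n] → G[ℓ^n]` with
`⟨ℓ^r α, β⟩ = ⟨ℓ^r β, α⟩ + 2 ω(α, β)` for all `r ≥ 0` and `α, β ∈ G^∨[ℓ^(n+r)]`, where
`⟨γ, δ⟩ = δ(ψ(γ))`. Here `G^∨[ℓ^m]` is written as `Hom(G, ℤ/ℓ^m)`; as this group is killed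
by `ℓ^m`, the values of `ψ` lie in `G[ℓ^n]` automatically. -/
structure BEG (ℓ n : ℕ) where
  G : Type
  [grp : AddCommGroup G]
  [fin : Finite G]
  isPrimary : ∀ x : G, ∃ k : ℕ, ℓ ^ k • x = 0
  ω : G ⊗[ℤ] G
  ω_mem : ω ∈ wedgeSq G
  ω_torsion : ℓ ^ n • ω = 0
  ψ : (G →+ ZMod (ℓ ^ n)) →+ G
  compat : ∀ (r : ℕ) (α β : G →+ ZMod (ℓ ^ (n + r))),
    β (ψ (scaleDown r α)) = α (ψ (scaleDown r β)) + 2 * evalPair α β ω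

attribute [instance] BEG.grp BEG.fin

variable {ℓ n : ℕ}

/-- A group homomorphism is a morphism of bilinearly enhanced groups if it pushes `ω` to `ω`
and `ψ` to `ψ`. -/
def IsMorphism (X Y : BEG ℓ n) (f : X.G →+ Y.G) : Prop :=
  TensorProduct.map f.toIntLinearMap f.toIntLinearMap X.ω = Y.ω ∧
    ∀ α : Y.G →+ ZMod (ℓ ^ n), f (X.ψ (α.comp f)) = Y.ψ α

theorem IsMorphism.id (X : BEG ℓ n) : IsMorphism X X (AddMonoidHom.id X.G) := by
  refine ⟨?_, fun α => rfl⟩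
  have h : (AddMonoidHom.id X.G).toIntLinearMap = LinearMap.id := rfl
  rw [h, TensorProduct.map_id]
  rfl

theorem IsMorphism.comp {X Y Z : BEG ℓ n} {f : X.G →+ Y.G} {k : Y.G →+ Z.G}
    (hf : IsMorphism X Y f) (hk : IsMorphism Y Z k) : IsMorphism X Z (k.comp f) := by
  refine ⟨?_, fun α => ?_⟩
  · have h : (k.comp f).toIntLinearMap = k.toIntLinearMap ∘ₗ f.toIntLinearMap := rfl
    rw [h, TensorProduct.map_comp, LinearMap.comp_apply, hf.1, hk.1]
  · rw [← hk.2 α, ← hf.2 (α.comp k)]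
    rfl

theorem IsMorphism.symm {X Y : BEG ℓ n} (e : X.G ≃+ Y.G)
    (he : IsMorphism X Y e.toAddMonoidHom) : IsMorphism Y X e.symm.toAddMonoidHom := by
  refine ⟨?_, fun α => ?_⟩
  · rw [← he.1, ← LinearMap.comp_apply, ← TensorProduct.map_comp]
    have h : e.symm.toAddMonoidHom.toIntLinearMap ∘ₗ e.toAddMonoidHom.toIntLinearMap
        = LinearMap.id := by
      ext x
      simp
    rw [h, TensorProduct.map_id]
    rfl
  · rw [← he.2]
    have h : (α.comp e.symm.toAddMonoidHom).comp e.toAddMonoidHom = α := by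
      ext x
      simp
    rw [h]
    simp

/-- Isomorphism of bilinearly enhanced groups. -/
def Iso (X Y : BEG ℓ n) : Prop :=
  ∃ e : X.G ≃+ Y.G, IsMorphism X Y e.toAddMonoidHom

theorem Iso.refl (X : BEG ℓ n) : Iso X X :=
  ⟨AddEquiv.refl X.G, IsMorphism.id X⟩

theorem Iso.symm {X Y : BEG ℓ n} (h : Iso X Y) : Iso Y X := by
  obtain ⟨e, he⟩ := h
  exact ⟨e.symm, IsMorphism.symm e he⟩

theorem Iso.trans {X Y Z : BEG ℓ n} (h : Iso X Y) (h' : Iso Y Z) : Iso X Z := by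
  obtain ⟨e, he⟩ := h
  obtain ⟨e', he'⟩ := h'
  have h1 : IsMorphism X Z (e'.toAddMonoidHom.comp e.toAddMonoidHom) := IsMorphism.comp he he'
  have h2 : (AddEquiv.trans e e').toAddMonoidHom = e'.toAddMonoidHom.comp e.toAddMonoidHom :=
    AddMonoidHom.ext fun _ => rfl
  refine ⟨AddEquiv.trans e e', ?_⟩
  rw [h2]
  exact h1

/-- Isomorphism as an equivalence relation. -/
def isoSetoid (ℓ n : ℕ) : Setoid (BEG ℓ n) :=
  ⟨Iso, Iso.refl, Iso.symm, Iso.trans⟩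

/-- The (countable) set of isomorphism classes of `ℓ^n`-bilinearly enhanced groups. -/
def BEGClass (ℓ n : ℕ) : Type 1 := Quotient (isoSetoid ℓ n)

/-- The isomorphism class of a bilinearly enhanced group. -/
def BEG.toClass (X : BEG ℓ n) : BEGClass ℓ n := Quotient.mk (isoSetoid ℓ n) X

/-- Isomorphism classes form a discrete space: every set of them is measurable. -/
instance : MeasurableSpace (BEGClass ℓ n) := ⊤

/-- `Surj(X, Y)`, the set of surjective morphisms. -/
def SurjSet (X Y : BEG ℓ n) : Set (X.G →+ Y.G) :=
  {f | Function.Surjective f ∧ IsMorphism X Y f}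

theorem card_surjSet_congr {X X' : BEG ℓ n} (h : Iso X X') (Y : BEG ℓ n) :
    Nat.card (SurjSet X Y) = Nat.card (SurjSet X' Y) := by
  obtain ⟨e, he⟩ := h
  refine Nat.card_congr
    { toFun := fun f => ⟨f.1.comp e.symm.toAddMonoidHom,
        f.2.1.comp e.symm.surjective, (IsMorphism.symm e he).comp f.2.2⟩
      invFun := fun f => ⟨f.1.comp e.toAddMonoidHom,
        f.2.1.comp e.surjective, he.comp f.2.2⟩
      left_inv := ?_
      right_inv := ?_ }
  · intro f
    apply Subtype.ext
    ext x
    simp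
  · intro f
    apply Subtype.ext
    ext x
    simp

/-- `#Surj(c, Y)` for an isomorphism class `c`. -/
def surjCount (c : BEGClass ℓ n) (Y : BEG ℓ n) : ℕ :=
  Quotient.lift (s := isoSetoid ℓ n) (fun X => Nat.card (SurjSet X Y))
    (fun _ _ h => card_surjSet_congr h Y) c

/-- The `Y`-th Surj-moment `E_μ #Surj(*, Y)` of a measure on isomorphism classes. -/
def surjMoment (μ : MeasureTheory.Measure (BEGClass ℓ n)) (Y : BEG ℓ n) : ENNReal :=
  ∫⁻ c, (surjCount c Y : ENNReal) ∂μ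

/-- A probability measure on isomorphism classes all of whose Surj-moments are
`1 / |Sym²G[ℓ^n]|`. -/
def HasUniversalMoments (μ : MeasureTheory.Measure (BEGClass ℓ n)) : Prop :=
  MeasureTheory.IsProbabilityMeasure μ ∧
    ∀ Y : BEG ℓ n, surjMoment μ Y = ((symSqTorsionCard Y.G (ℓ ^ n) : ℕ) : ENNReal)⁻¹

/-- Weak convergence of measures on the discrete space of isomorphism classes: the integral of
every bounded (automatically continuous) function converges. -/
def WeaklyConverges (ν : ℕ → MeasureTheory.Measure (BEGClass ℓ n))
    (μ : MeasureTheory.Measure (BEGClass ℓ n)) : Prop :=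
  ∀ φ : BEGClass ℓ n → ℝ, (∃ C : ℝ, ∀ c, |φ c| ≤ C) →
    Filter.Tendsto (fun g => ∫ c, φ c ∂(ν g)) Filter.atTop (nhds (∫ c, φ c ∂μ))

/-! ### The symplectic lattice -/

section Lattice

variable (ℓ : ℕ) [Fact ℓ.Prime] (g : ℕ)

/-- Square matrices of size `2g` over `ℤ_ℓ`; the index `inl i` belongs to the basis vector `e_i`
and `inr i` to `f_i`. -/
abbrev Mat : Type := Matrix (Fin g ⊕ Fin g) (Fin g ⊕ Fin g) ℤ_[ℓ]

/-- The lattice `T = ℤ_ℓ^(2g)`. -/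
abbrev Lat : Type := Fin g ⊕ Fin g → ℤ_[ℓ]

variable {ℓ g}

/-- The standard symplectic pairing on `T`, with `ω(e_i, f_i) = 1`. -/
def symp (x y : Lat ℓ g) : ℤ_[ℓ] :=
  ∑ i : Fin g, (x (Sum.inl i) * y (Sum.inr i) - x (Sum.inr i) * y (Sum.inl i))

/-- The basis vector `e_i`. -/
def vecE (i : Fin g) : Lat ℓ g := Pi.single (Sum.inl i) 1

/-- The basis vector `f_i`. -/
def vecF (i : Fin g) : Lat ℓ g := Pi.single (Sum.inr i) 1

local notation "JJ" => Matrix.J (Fin g) ℤ_[ℓ]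

theorem symp_eq (x y : Lat ℓ g) : symp x y = -(x ⬝ᵥ (JJ *ᵥ y)) := by
  simp only [symp, dotProduct, Matrix.J, Fintype.sum_sum_type, Matrix.fromBlocks_mulVec,
    Sum.elim_inl, Sum.elim_inr, Matrix.zero_mulVec, Matrix.neg_mulVec, Matrix.one_mulVec,
    Function.comp, Pi.add_apply, Pi.neg_apply, Pi.zero_apply]
  rw [← Finset.sum_add_distrib, ← Finset.sum_neg_distrib]
  refine Finset.sum_congr rfl fun i _ => ?_
  ring

theorem symp_swap (x y : Lat ℓ g) : symp x y = -symp y x := by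
  simp only [symp]
  rw [← Finset.sum_neg_distrib]
  refine Finset.sum_congr rfl fun i _ => ?_
  ring

theorem symp_add_left (x y z : Lat ℓ g) : symp (x + y) z = symp x z + symp y z := by
  simp only [symp_eq, add_dotProduct]; ring

theorem symp_smul_left (c : ℤ_[ℓ]) (x z : Lat ℓ g) : symp (c • x) z = c * symp x z := by
  simp only [symp_eq, smul_dotProduct, smul_eq_mul]; ring

theorem symp_add_right (x y z : Lat ℓ g) : symp x (y + z) = symp x y + symp x z := by
  simp only [symp_eq, Matrix.mulVec_add, dotProduct_add]; ring

theorem symp_smul_right (c : ℤ_[ℓ]) (x z : Lat ℓ g) : symp x (c • z) = c * symp x z := by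
  simp only [symp_eq, Matrix.mulVec_smul, dotProduct_smul, smul_eq_mul]; ring

theorem symp_mulVec (A B : Mat ℓ g) (x y : Lat ℓ g) :
    symp (A *ᵥ x) (B *ᵥ y) = -(x ⬝ᵥ ((Aᵀ * JJ * B) *ᵥ y)) := by
  rw [symp_eq, Matrix.dotProduct_mulVec, Matrix.dotProduct_mulVec, Matrix.dotProduct_mulVec,
    Matrix.vecMul_vecMul, ← Matrix.vecMul_transpose, Matrix.vecMul_vecMul]
  simp only [Matrix.mul_assoc]

theorem mat_ext_dot {A B : Mat ℓ g} (h : ∀ x y : Lat ℓ g, x ⬝ᵥ (A *ᵥ y) = x ⬝ᵥ (B *ᵥ y)) :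
    A = B := by
  ext i j
  have := h (Pi.single i 1) (Pi.single j 1)
  simpa using this

/-- The endomorphisms `A` from which a bilinearly enhanced group is built. Both `A = F - 1` with
`F ∈ GSp^(q)` (where `2 ℓ^n u = q - 1`, `ε = 1`) and `A = M + ℓ^n` with `M` skew-symplectic
(where `u = 1`, `ε = 0`) are of this kind. -/
def IsAdmissible (n : ℕ) (A : Mat ℓ g) (u : ℤ_[ℓ]) : Prop :=
  ∃ ε : ℤ_[ℓ],
    Aᵀ * JJ + JJ * A + ε • (Aᵀ * JJ * A) = (2 * (ℓ : ℤ_[ℓ]) ^ n * u) • JJ ∧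
    A * JJ + JJ * Aᵀ + ε • (A * JJ * Aᵀ) = (2 * (ℓ : ℤ_[ℓ]) ^ n * u) • JJ

/-- `ℤ_ℓ`-linearity of reduced homomorphisms. -/
theorem hom_smul {N : ℕ} {G : Type} [AddCommGroup G] [Module ℤ_[ℓ] G]
    (α : G →+ ZMod (ℓ ^ N)) (c : ℤ_[ℓ]) (x : G) :
    α (c • x) = PadicInt.toZModPow N c * α x := by
  obtain ⟨m, hm⟩ : ∃ m : ℕ, (ℓ : ℤ_[ℓ]) ^ N ∣ c - m := by
    refine ⟨(PadicInt.toZModPow N c).val, ?_⟩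
    rw [← Ideal.mem_span_singleton, ← PadicInt.ker_toZModPow, RingHom.mem_ker, map_sub,
      map_natCast, ZMod.natCast_val, ZMod.cast_id', id, sub_self]
  obtain ⟨d, hd⟩ := hm
  have hc : c = m + (ℓ : ℤ_[ℓ]) ^ N * d := by rw [← hd]; ring
  have h0 : ((ℓ : ZMod (ℓ ^ N)) ^ N) = 0 := by
    rw [← Nat.cast_pow, ZMod.natCast_self]
  have h1 : α (((ℓ : ℤ_[ℓ]) ^ N * d) • x) = 0 := by
    rw [mul_smul, ← Nat.cast_pow, Nat.cast_smul_eq_nsmul, map_nsmul, nsmul_eq_mul,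
      Nat.cast_pow, h0, zero_mul]
  rw [hc, add_smul, map_add, h1, Nat.cast_smul_eq_nsmul, map_nsmul, nsmul_eq_mul, map_add,
    map_natCast, map_mul, map_pow, map_natCast, h0]
  ring

theorem toZModPow_eq_zero_iff {N : ℕ} (x : ℤ_[ℓ]) :
    PadicInt.toZModPow N x = 0 ↔ (ℓ : ℤ_[ℓ]) ^ N ∣ x := by
  rw [← RingHom.mem_ker, PadicInt.ker_toZModPow, Ideal.mem_span_singleton]

theorem J_mulVec_J (x : Lat ℓ g) : JJ *ᵥ (JJ *ᵥ x) = -x := by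
  rw [Matrix.mulVec_mulVec, Matrix.J_squared, Matrix.neg_mulVec, Matrix.one_mulVec]

/-- A vector which is divisible by `c` coordinatewise is divisible by `c`. -/
theorem exists_smul_of_dvd {c : ℤ_[ℓ]} {x : Lat ℓ g} (h : ∀ i, c ∣ x i) :
    ∃ y : Lat ℓ g, x = c • y := by
  choose y hy using h
  exact ⟨y, funext hy⟩

theorem dvd_of_symp_dvd {c : ℤ_[ℓ]} {s : Lat ℓ g} (h : ∀ x, c ∣ symp x s) :
    ∃ y : Lat ℓ g, s = c • y := by
  have h1 : ∀ i, c ∣ (JJ *ᵥ s) i := fun i => by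
    have := h (Pi.single i 1)
    rw [symp_eq, single_one_dotProduct] at this
    exact (dvd_neg).1 this
  obtain ⟨y, hy⟩ := exists_smul_of_dvd h1
  refine ⟨-(JJ *ᵥ y), ?_⟩
  rw [smul_neg, ← Matrix.mulVec_smul, ← hy, J_mulVec_J, neg_neg]

/-- Every homomorphism `α : T → G → ℤ/ℓ^N` is `ω(·, s) mod ℓ^N` for some `s`. -/
theorem exists_symp_eq {N : ℕ} {G : Type} [AddCommGroup G] [Module ℤ_[ℓ] G]
    (π : Lat ℓ g →ₗ[ℤ_[ℓ]] G) (α : G →+ ZMod (ℓ ^ N)) :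
    ∃ s : Lat ℓ g, ∀ x, α (π x) = PadicInt.toZModPow N (symp x s) := by
  have hsurj : Function.Surjective (PadicInt.toZModPow (p := ℓ) N) := fun z =>
    ⟨(z.val : ℤ_[ℓ]), by rw [map_natCast, ZMod.natCast_val, ZMod.cast_id', id]⟩
  choose a ha using fun i => hsurj (α (π (Pi.single i 1)))
  refine ⟨JJ *ᵥ a, fun x => ?_⟩
  rw [symp_eq, J_mulVec_J, dotProduct_neg, neg_neg]
  have hx : x = ∑ i, x i • (Pi.single i (1 : ℤ_[ℓ]) : Lat ℓ g) := by
    simpa using pi_eq_sum_univ' x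
  conv_lhs => rw [hx]
  rw [map_sum, map_sum, dotProduct, map_sum]
  refine Finset.sum_congr rfl fun i _ => ?_
  rw [map_smul, hom_smul, map_mul, ha]

/-- If `ω(A x, s)` is always divisible by `ℓ^N`, then `A s = 2 ℓ^n u s mod ℓ^N`. -/
theorem IsAdmissible.mulVec_eq {n : ℕ} {A : Mat ℓ g} {u : ℤ_[ℓ]} (hA : IsAdmissible n A u)
    {c : ℤ_[ℓ]} {s : Lat ℓ g} (hs : ∀ x, c ∣ symp (A *ᵥ x) s) :
    ∃ y : Lat ℓ g, A *ᵥ s = (2 * (ℓ : ℤ_[ℓ]) ^ n * u) • s + c • y := by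
  obtain ⟨ε, -, h2⟩ := hA
  have h1 : ∀ i, c ∣ (Aᵀ *ᵥ (JJ *ᵥ s)) i := fun i => by
    have := hs (Pi.single i 1)
    have e : symp (A *ᵥ (Pi.single i 1)) s = -((Aᵀ *ᵥ (JJ *ᵥ s)) i) := by
      rw [symp_eq, Matrix.mulVec_single_one, Matrix.mulVec]
      rfl
    rw [e] at this
    exact (dvd_neg).1 this
  obtain ⟨y, hy⟩ := exists_smul_of_dvd h1
  have h3 := congrArg (fun B : Mat ℓ g => B *ᵥ (JJ *ᵥ s)) h2
  simp only [Matrix.add_mulVec, Matrix.smul_mulVec, ← Matrix.mulVec_mulVec, J_mulVec_J, hy,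
    Matrix.mulVec_smul, Matrix.mulVec_neg] at h3
  refine ⟨JJ *ᵥ y + ε • (A *ᵥ (JJ *ᵥ y)), ?_⟩
  ext i
  have h4 := congrFun h3 i
  simp only [Pi.add_apply, Pi.smul_apply, Pi.neg_apply, smul_eq_mul] at h4 ⊢
  linear_combination -h4

theorem IsAdmissible.exists_div {n : ℕ} {A : Mat ℓ g} {u : ℤ_[ℓ]} (hA : IsAdmissible n A u)
    {s : Lat ℓ g} (hs : ∀ x, (ℓ : ℤ_[ℓ]) ^ n ∣ symp (A *ᵥ x) s) :
    ∃ t : Lat ℓ g, A *ᵥ s = (ℓ : ℤ_[ℓ]) ^ n • t := by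
  obtain ⟨y, hy⟩ := hA.mulVec_eq hs
  refine ⟨(2 * u) • s + y, ?_⟩
  rw [hy, smul_add, smul_smul]
  congr 2
  ring

theorem IsAdmissible.symp_rel {n : ℕ} {A : Mat ℓ g} {u : ℤ_[ℓ]} (hA : IsAdmissible n A u) :
    ∃ ε : ℤ_[ℓ], ∀ x y : Lat ℓ g, symp (A *ᵥ x) y + symp x (A *ᵥ y)
      + ε * symp (A *ᵥ x) (A *ᵥ y) = 2 * (ℓ : ℤ_[ℓ]) ^ n * u * symp x y := by
  obtain ⟨ε, h1, -⟩ := hA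
  refine ⟨ε, fun x y => ?_⟩
  have e1 := symp_mulVec A 1 x y
  have e2 := symp_mulVec 1 A x y
  have e3 := symp_mulVec A A x y
  simp only [Matrix.one_mulVec, Matrix.mul_one, Matrix.transpose_one, Matrix.one_mul]
    at e1 e2 e3
  have h3 := congrArg (fun B : Mat ℓ g => x ⬝ᵥ (B *ᵥ y)) h1
  simp only [Matrix.add_mulVec, Matrix.smul_mulVec, dotProduct_add, dotProduct_smul,
    smul_eq_mul] at h3
  rw [e1, e2, e3, symp_eq x y]
  linear_combination -h3

/-- The divisibility behind the compatibility of `ψ` and `ω`. -/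
theorem IsAdmissible.compat {n r : ℕ} {A : Mat ℓ g} {u : ℤ_[ℓ]} (hA : IsAdmissible n A u)
    {s t s' t' : Lat ℓ g}
    (ht : ∀ x, (ℓ : ℤ_[ℓ]) ^ (n + r) ∣ symp (A *ᵥ x) t)
    (hs' : A *ᵥ s = (ℓ : ℤ_[ℓ]) ^ n • s') (ht' : A *ᵥ t = (ℓ : ℤ_[ℓ]) ^ n • t') :
    (ℓ : ℤ_[ℓ]) ^ (n + r) ∣ symp s' t - symp t' s - 2 * (u * symp s t) := by
  obtain ⟨ε, hε⟩ := hA.symp_rel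
  have h := hε s t
  obtain ⟨y, hy⟩ := hA.mulVec_eq ht
  obtain ⟨k, hk⟩ := ht s
  have hl : (ℓ : ℤ_[ℓ]) ^ n ≠ 0 := pow_ne_zero _ (by exact_mod_cast (Fact.out : ℓ.Prime).ne_zero)
  rw [hs', symp_smul_left] at hk
  rw [hs', symp_smul_left, symp_smul_left] at h
  have e1 : symp s (A *ᵥ t) = -((ℓ : ℤ_[ℓ]) ^ n * symp t' s) := by
    rw [ht', symp_smul_right, symp_swap s t']; ring
  have e2 : symp s' (A *ᵥ t) = 2 * u * ((ℓ : ℤ_[ℓ]) ^ n * symp s' t)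
      + (ℓ : ℤ_[ℓ]) ^ (n + r) * symp s' y := by
    rw [hy, symp_add_right, symp_smul_right, symp_smul_right]; ring
  rw [hk] at e2
  rw [e1, e2] at h
  refine ⟨-ε * (2 * u * k + symp s' y), mul_left_cancel₀ hl ?_⟩
  linear_combination h

/-! ### The triple attached to an endomorphism -/

section Construction

variable {n : ℕ} {G : Type} [AddCommGroup G] [Module ℤ_[ℓ] G]

/-- The element `u · ∑ e_i ∧ f_i`, pushed forward to `∧²G` along `π`. -/
def omegaOf (π : Lat ℓ g →ₗ[ℤ_[ℓ]] G) (u : ℤ_[ℓ]) : G ⊗[ℤ] G :=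
  ∑ i : Fin g, wedge (π (u • vecE i)) (π (vecF i))

/-- The relation `z = ψ(α)`: if `α = ℓ^(-n) ω(·, s)` on `T`, then `z` is the class
of `ℓ^(-n) A s`. -/
def IsPsi (n : ℕ) (A : Mat ℓ g) (π : Lat ℓ g →ₗ[ℤ_[ℓ]] G) (α : G →+ ZMod (ℓ ^ n)) (z : G) :
    Prop :=
  ∃ s t : Lat ℓ g, (∀ x, α (π x) = PadicInt.toZModPow n (symp x s)) ∧
    A *ᵥ s = (ℓ : ℤ_[ℓ]) ^ n • t ∧ z = π t

variable {A : Mat ℓ g} {u : ℤ_[ℓ]} {π : Lat ℓ g →ₗ[ℤ_[ℓ]] G}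

theorem symp_dvd_of_rep {N : ℕ} (hker : ∀ x, π x = 0 ↔ ∃ y, A *ᵥ y = x)
    {α : G →+ ZMod (ℓ ^ N)} {s : Lat ℓ g}
    (hs : ∀ x, α (π x) = PadicInt.toZModPow N (symp x s)) (x : Lat ℓ g) :
    (ℓ : ℤ_[ℓ]) ^ N ∣ symp (A *ᵥ x) s := by
  rw [← toZModPow_eq_zero_iff, ← hs, (hker _).2 ⟨x, rfl⟩, map_zero]

theorem exists_isPsi (hA : IsAdmissible n A u) (hker : ∀ x, π x = 0 ↔ ∃ y, A *ᵥ y = x)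
    (α : G →+ ZMod (ℓ ^ n)) : ∃ z, IsPsi n A π α z := by
  obtain ⟨s, hs⟩ := exists_symp_eq π α
  obtain ⟨t, ht⟩ := hA.exists_div (symp_dvd_of_rep hker hs)
  exact ⟨π t, s, t, hs, ht, rfl⟩

theorem IsPsi.unique (hker : ∀ x, π x = 0 ↔ ∃ y, A *ᵥ y = x)
    {α : G →+ ZMod (ℓ ^ n)} {z z' : G} (h : IsPsi n A π α z) (h' : IsPsi n A π α z') :
    z = z' := by
  obtain ⟨s, t, hs, ht, rfl⟩ := h
  obtain ⟨s', t', hs', ht', rfl⟩ := h'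
  have hl : (ℓ : ℤ_[ℓ]) ^ n ≠ 0 := pow_ne_zero _ (by exact_mod_cast (Fact.out : ℓ.Prime).ne_zero)
  have h1 : ∀ x, (ℓ : ℤ_[ℓ]) ^ n ∣ symp x (s + (-1 : ℤ_[ℓ]) • s') := fun x => by
    rw [← toZModPow_eq_zero_iff, symp_add_right, symp_smul_right, map_add, map_mul, ← hs,
      ← hs', map_neg, map_one]
    ring
  obtain ⟨w, hw⟩ := dvd_of_symp_dvd h1
  have h2 : t - t' = A *ᵥ w := by
    have : (ℓ : ℤ_[ℓ]) ^ n • (t - t') = (ℓ : ℤ_[ℓ]) ^ n • (A *ᵥ w) := by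
      rw [← Matrix.mulVec_smul, ← hw, smul_sub, ← ht, ← ht', Matrix.mulVec_add,
        Matrix.mulVec_smul]
      simp [sub_eq_add_neg]
    exact smul_right_injective _ hl this
  rw [← sub_eq_zero, ← map_sub, hker]
  exact ⟨w, h2.symm⟩

theorem IsPsi.add {α β : G →+ ZMod (ℓ ^ n)} {z w : G} (h : IsPsi n A π α z)
    (h' : IsPsi n A π β w) : IsPsi n A π (α + β) (z + w) := by
  obtain ⟨s, t, hs, ht, rfl⟩ := h
  obtain ⟨s', t', hs', ht', rfl⟩ := h'
  refine ⟨s + s', t + t', fun x => ?_, ?_, (map_add π t t').symm⟩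
  · rw [AddMonoidHom.add_apply, hs, hs', symp_add_right, map_add]
  · rw [Matrix.mulVec_add, ht, ht', smul_add]

/-- The invariant `ψ`. -/
def psiOf (hA : IsAdmissible n A u) (hker : ∀ x, π x = 0 ↔ ∃ y, A *ᵥ y = x) :
    (G →+ ZMod (ℓ ^ n)) →+ G :=
  AddMonoidHom.mk' (fun α => (exists_isPsi hA hker α).choose) fun α β =>
    IsPsi.unique hker (exists_isPsi hA hker (α + β)).choose_spec
      ((exists_isPsi hA hker α).choose_spec.add (exists_isPsi hA hker β).choose_spec)

theorem psiOf_spec (hA : IsAdmissible n A u) (hker : ∀ x, π x = 0 ↔ ∃ y, A *ᵥ y = x)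
    (α : G →+ ZMod (ℓ ^ n)) : IsPsi n A π α (psiOf hA hker α) :=
  (exists_isPsi hA hker α).choose_spec

theorem exists_pow_smul_eq_zero [Finite G] : ∃ k : ℕ, ∀ x : G, ℓ ^ k • x = 0 := by
  have hN : (Nat.card G : ℤ_[ℓ]) ≠ 0 := by exact_mod_cast Nat.card_pos.ne'
  obtain ⟨k, v, hv⟩ := IsDiscreteValuationRing.eq_unit_mul_pow_irreducible hN
    (PadicInt.irreducible_p (p := ℓ))
  refine ⟨k, fun x => ?_⟩
  have h0 : (Nat.card G : ℤ_[ℓ]) • x = 0 := by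
    rw [Nat.cast_smul_eq_nsmul]
    exact card_nsmul_eq_zero'
  have h1 : ((ℓ : ℤ_[ℓ]) ^ k) • x = 0 := by
    rw [hv, mul_smul] at h0
    have := congrArg (fun z => ((v⁻¹ : ℤ_[ℓ]ˣ) : ℤ_[ℓ]) • z) h0
    simpa [smul_smul] using this
  rw [← Nat.cast_pow, Nat.cast_smul_eq_nsmul] at h1
  exact h1

theorem smul_tmul_padic [Finite G] (c : ℤ_[ℓ]) (x y : G) :
    (c • x) ⊗ₜ[ℤ] y = x ⊗ₜ[ℤ] (c • y) := by
  obtain ⟨k, hk⟩ := exists_pow_smul_eq_zero (ℓ := ℓ) (G := G)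
  obtain ⟨m, d, hd⟩ : ∃ m : ℕ, (ℓ : ℤ_[ℓ]) ^ k ∣ c - m := by
    refine ⟨(PadicInt.toZModPow k c).val, ?_⟩
    rw [← toZModPow_eq_zero_iff, map_sub,
      map_natCast, ZMod.natCast_val, ZMod.cast_id', id, sub_self]
  have h : ∀ z : G, c • z = m • z := fun z => by
    have hc : c = m + (ℓ : ℤ_[ℓ]) ^ k * d := by rw [← hd]; ring
    rw [hc, add_smul, mul_smul, ← Nat.cast_pow, Nat.cast_smul_eq_nsmul,
      Nat.cast_smul_eq_nsmul, hk, add_zero]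
  rw [h, h]
  exact TensorProduct.smul_tmul m x y

/-- The `ℤ_ℓ`-bilinear map `(x, y) ↦ π x ⊗ π y`. -/
def pairOf [Finite G] (π : Lat ℓ g →ₗ[ℤ_[ℓ]] G) :
    Lat ℓ g →ₗ[ℤ_[ℓ]] Lat ℓ g →ₗ[ℤ_[ℓ]] (G ⊗[ℤ] G) :=
  LinearMap.mk₂ ℤ_[ℓ] (fun x y => π x ⊗ₜ[ℤ] π y)
    (fun x x' y => by rw [map_add, TensorProduct.add_tmul])
    (fun c x y => by rw [map_smul, TensorProduct.smul_tmul'])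
    (fun x y y' => by rw [map_add, TensorProduct.tmul_add])
    (fun c x y => by rw [map_smul, ← smul_tmul_padic, TensorProduct.smul_tmul'])

/-- The tensor `∑ B_ij π(b_i) ⊗ π(b_j)` of a matrix `B`. -/
def tensorOf [Finite G] (π : Lat ℓ g →ₗ[ℤ_[ℓ]] G) : Mat ℓ g →ₗ[ℤ_[ℓ]] (G ⊗[ℤ] G) :=
  ∑ i, ∑ j, (LinearMap.toSpanSingleton ℤ_[ℓ] _
    (pairOf π (Pi.single i 1) (Pi.single j 1))).comp (Matrix.entryLinearMap ℤ_[ℓ] ℤ_[ℓ] i j)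

theorem tensorOf_apply [Finite G] (B : Mat ℓ g) :
    tensorOf π B = ∑ i, ∑ j, B i j • pairOf π (Pi.single i 1) (Pi.single j 1) := by
  simp [tensorOf]

theorem sum_smul_single (x : Lat ℓ g) : ∑ i, x i • (Pi.single i (1 : ℤ_[ℓ]) : Lat ℓ g) = x := by
  simpa using (pi_eq_sum_univ' x).symm

theorem tensorOf_mul_left [Finite G] (hker : ∀ x, π x = 0 ↔ ∃ y, A *ᵥ y = x) (B : Mat ℓ g) :
    tensorOf π (A * B) = 0 := by
  rw [tensorOf_apply, Finset.sum_comm]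
  refine Finset.sum_eq_zero fun j _ => ?_
  have h : ∑ i, (A * B) i j • pairOf π (Pi.single i 1) (Pi.single j 1)
      = pairOf π (∑ i, (A *ᵥ (B.col j)) i • (Pi.single i (1 : ℤ_[ℓ]) : Lat ℓ g))
        (Pi.single j 1) := by
    rw [map_sum, LinearMap.sum_apply]
    refine Finset.sum_congr rfl fun i _ => ?_
    rw [map_smul, LinearMap.smul_apply]
    rfl
  rw [h, sum_smul_single]
  change π (A *ᵥ (B.col j)) ⊗ₜ[ℤ] _ = 0
  rw [(hker _).2 ⟨_, rfl⟩, TensorProduct.zero_tmul]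

theorem tensorOf_mul_right [Finite G] (hker : ∀ x, π x = 0 ↔ ∃ y, A *ᵥ y = x) (B : Mat ℓ g) :
    tensorOf π (B * Aᵀ) = 0 := by
  rw [tensorOf_apply]
  refine Finset.sum_eq_zero fun i _ => ?_
  have h : ∑ j, (B * Aᵀ) i j • pairOf π (Pi.single i 1) (Pi.single j 1)
      = pairOf π (Pi.single i 1)
        (∑ j, (A *ᵥ (B.row i)) j • (Pi.single j (1 : ℤ_[ℓ]) : Lat ℓ g)) := by
    rw [map_sum]
    refine Finset.sum_congr rfl fun j _ => ?_
    rw [map_smul]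
    congr 1
    simp only [Matrix.mul_apply, Matrix.mulVec, dotProduct, Matrix.transpose_apply, Matrix.row]
    exact Finset.sum_congr rfl fun k _ => mul_comm _ _
  rw [h, sum_smul_single]
  change _ ⊗ₜ[ℤ] π (A *ᵥ (B.row i)) = 0
  rw [(hker _).2 ⟨_, rfl⟩, TensorProduct.tmul_zero]

theorem omegaOf_eq [Finite G] : omegaOf π u = -(u • tensorOf π JJ) := by
  rw [tensorOf_apply]
  simp only [Fintype.sum_sum_type, Matrix.J, Matrix.fromBlocks_apply₁₁,
    Matrix.fromBlocks_apply₁₂, Matrix.fromBlocks_apply₂₁, Matrix.fromBlocks_apply₂₂,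
    Matrix.zero_apply, zero_smul, Finset.sum_const_zero, zero_add, add_zero,
    Matrix.neg_apply, Matrix.one_apply, neg_smul, ite_smul, one_smul, Finset.sum_neg_distrib,
    Finset.sum_ite_eq, Finset.mem_univ, if_true]
  rw [omegaOf, ← Finset.sum_neg_distrib, ← Finset.sum_add_distrib, Finset.smul_sum,
    ← Finset.sum_neg_distrib]
  refine Finset.sum_congr rfl fun i _ => ?_
  change wedge _ _ = -(u • (-(π (vecE i) ⊗ₜ[ℤ] π (vecF i)) + π (vecF i) ⊗ₜ[ℤ] π (vecE i)))
  rw [wedge, map_smul, ← smul_tmul_padic, smul_add, smul_neg, TensorProduct.smul_tmul',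
    TensorProduct.smul_tmul']
  abel

theorem isUnit_two (h2 : ℓ ≠ 2) : IsUnit (2 : ℤ_[ℓ]) := by
  have : ((2 : ℕ) : ℤ_[ℓ]) = 2 := by norm_num
  rw [← this, PadicInt.isUnit_iff, PadicInt.norm_natCast_eq_one_iff]
  exact (Nat.coprime_primes Fact.out Nat.prime_two).2 h2

theorem omegaOf_torsion [Finite G] (h2 : ℓ ≠ 2) (hA : IsAdmissible n A u)
    (hker : ∀ x, π x = 0 ↔ ∃ y, A *ᵥ y = x) : ℓ ^ n • omegaOf π u = 0 := by
  obtain ⟨ε, -, h⟩ := hA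
  have h1 := congrArg (tensorOf π) h
  rw [map_add, map_add, map_smul, map_smul, tensorOf_mul_left hker, tensorOf_mul_right hker,
    Matrix.mul_assoc, tensorOf_mul_left hker, smul_zero, add_zero, add_zero] at h1
  obtain ⟨v, hv⟩ := isUnit_two h2
  rw [omegaOf_eq, ← Nat.cast_smul_eq_nsmul ℤ_[ℓ], Nat.cast_pow, smul_neg, smul_smul, neg_eq_zero]
  have h3 := congrArg (fun z => ((v⁻¹ : ℤ_[ℓ]ˣ) : ℤ_[ℓ]) • z) h1.symm
  simp only [smul_smul, smul_zero, mul_assoc, ← hv, Units.inv_mul_cancel_left] at h3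
  exact h3

theorem evalPair_omegaOf {N : ℕ} {α β : G →+ ZMod (ℓ ^ N)} {s t : Lat ℓ g}
    (hs : ∀ x, α (π x) = PadicInt.toZModPow N (symp x s))
    (ht : ∀ x, β (π x) = PadicInt.toZModPow N (symp x t)) :
    evalPair α β (omegaOf π u) = PadicInt.toZModPow N (u * symp s t) := by
  have hE : ∀ (i : Fin g) (y : Lat ℓ g), symp (vecE i) y = y (Sum.inr i) := fun i y => by
    simp [symp, vecE, Pi.single_apply]
  have hF : ∀ (i : Fin g) (y : Lat ℓ g), symp (vecF i) y = -y (Sum.inl i) := fun i y => by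
    simp [symp, vecF, Pi.single_apply]
  rw [omegaOf, map_sum, symp, Finset.mul_sum, map_sum]
  refine Finset.sum_congr rfl fun i _ => ?_
  simp only [wedge, evalPair_tmul, map_sub, hs, ht, symp_smul_left, hE, hF, map_mul, map_neg]
  ring

theorem scaleDown_rep {r : ℕ} {α : G →+ ZMod (ℓ ^ (n + r))} {s : Lat ℓ g}
    (hs : ∀ x, α (π x) = PadicInt.toZModPow (n + r) (symp x s)) (x : Lat ℓ g) :
    scaleDown r α (π x) = PadicInt.toZModPow n (symp x s) := by
  change ZMod.castHom (pow_dvd_pow ℓ (Nat.le_add_right n r)) (ZMod (ℓ ^ n)) (α (π x)) = _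
  rw [hs, ZMod.castHom_apply, PadicInt.cast_toZModPow _ _ (Nat.le_add_right n r)]

/-- The bilinearly enhanced group `(G, ω, ψ)` of an endomorphism `A` of `T` with finite cokernel
`π : T → G`: here `ω = u · ∑ π(e_i) ∧ π(f_i)`, and `ψ(ℓ^(-n) ω(·, s)) = ℓ^(-n) A s`. -/
def begOf [Finite G] (h2 : ℓ ≠ 2) (hA : IsAdmissible n A u)
    (hker : ∀ x, π x = 0 ↔ ∃ y, A *ᵥ y = x) : BEG ℓ n where
  G := G
  isPrimary := fun x => (exists_pow_smul_eq_zero (ℓ := ℓ) (G := G)).imp fun _ h => h x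
  ω := omegaOf π u
  ω_mem := Submodule.sum_mem _ fun _ _ => Submodule.subset_span ⟨_, _, rfl⟩
  ω_torsion := omegaOf_torsion h2 hA hker
  ψ := psiOf hA hker
  compat := by
    intro r α β
    obtain ⟨s, hs⟩ := exists_symp_eq π α
    obtain ⟨t, ht⟩ := exists_symp_eq π β
    have hsd := symp_dvd_of_rep hker hs
    have htd := symp_dvd_of_rep hker ht
    have hle : (ℓ : ℤ_[ℓ]) ^ n ∣ (ℓ : ℤ_[ℓ]) ^ (n + r) := pow_dvd_pow _ (Nat.le_add_right n r)
    obtain ⟨s', hs'⟩ := hA.exists_div fun x => hle.trans (hsd x)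
    obtain ⟨t', ht'⟩ := hA.exists_div fun x => hle.trans (htd x)
    have e1 : psiOf hA hker (scaleDown r α) = π s' :=
      (psiOf_spec hA hker _).unique hker ⟨s, s', scaleDown_rep hs, hs', rfl⟩
    have e2 : psiOf hA hker (scaleDown r β) = π t' :=
      (psiOf_spec hA hker _).unique hker ⟨t, t', scaleDown_rep ht, ht', rfl⟩
    have h := hA.compat htd hs' ht'
    rw [← toZModPow_eq_zero_iff, map_sub, map_sub, map_mul, map_ofNat, ← ht, ← hs,
      ← evalPair_omegaOf (u := u) hs ht] at h
    rw [e1, e2]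
    linear_combination h

end Construction

/-! ### The nonlinear model -/

section Nonlinear

variable {n : ℕ} {q : ℤ_[ℓ]}

/-- `ℓ^n ∥ q - 1`. -/
def ExactlyDivides (n : ℕ) (q : ℤ_[ℓ]) : Prop :=
  (ℓ : ℤ_[ℓ]) ^ n ∣ q - 1 ∧ ¬ (ℓ : ℤ_[ℓ]) ^ (n + 1) ∣ q - 1

variable (ℓ g q) in
/-- `GSp_{2g}^(q)(ℤ_ℓ)`: the matrices `F` with `ω(F x, F y) = q ω(x, y)`. -/
abbrev GSp : Type :=
  {F : Mat ℓ g // ∀ x y : Lat ℓ g, symp (F *ᵥ x) (F *ᵥ y) = q * symp x y}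

instance : MeasurableSpace (GSp ℓ g q) := borel _

theorem transpose_J_mul_of_symp {F : Mat ℓ g}
    (h : ∀ x y : Lat ℓ g, symp (F *ᵥ x) (F *ᵥ y) = q * symp x y) : Fᵀ * JJ * F = q • JJ := by
  refine mat_ext_dot fun x y => ?_
  have h1 := h x y
  rw [symp_mulVec, symp_eq] at h1
  rw [Matrix.smul_mulVec, dotProduct_smul, smul_eq_mul]
  linear_combination -h1

theorem ExactlyDivides.isUnit (hn : 1 ≤ n) (hq : ExactlyDivides n q) : IsUnit q := by
  by_contra h
  have h1 : q ∈ IsLocalRing.maximalIdeal ℤ_[ℓ] := (IsLocalRing.mem_maximalIdeal q).2 h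
  have h2 : q - 1 ∈ IsLocalRing.maximalIdeal ℤ_[ℓ] := by
    rw [PadicInt.maximalIdeal_eq_span_p, Ideal.mem_span_singleton]
    exact (dvd_pow_self _ (by omega)).trans hq.1
  have h3 : (1 : ℤ_[ℓ]) ∈ IsLocalRing.maximalIdeal ℤ_[ℓ] := by
    have h4 := Ideal.sub_mem _ h1 h2
    rwa [sub_sub_cancel] at h4
  exact (Ideal.ne_top_iff_one _).1 (IsLocalRing.maximalIdeal.isMaximal ℤ_[ℓ]).ne_top h3

theorem ExactlyDivides.exists_scale (h2 : ℓ ≠ 2) (hq : ExactlyDivides n q) :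
    ∃ u : ℤ_[ℓ], 2 * (ℓ : ℤ_[ℓ]) ^ n * u = q - 1 := by
  obtain ⟨c, hc⟩ := hq.1
  obtain ⟨v, hv⟩ := isUnit_two h2
  refine ⟨((v⁻¹ : ℤ_[ℓ]ˣ) : ℤ_[ℓ]) * c, ?_⟩
  rw [hc, ← hv]
  linear_combination ((ℓ : ℤ_[ℓ]) ^ n * c) * v.mul_inv

/-- The scaling factor `(q - 1) / (2 ℓ^n)`. -/
def scale (h2 : ℓ ≠ 2) (hq : ExactlyDivides n q) : ℤ_[ℓ] := (hq.exists_scale h2).choose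

theorem scale_spec (h2 : ℓ ≠ 2) (hq : ExactlyDivides n q) :
    2 * (ℓ : ℤ_[ℓ]) ^ n * scale h2 hq = q - 1 := (hq.exists_scale h2).choose_spec

theorem GSp.isAdmissible (h2 : ℓ ≠ 2) (hn : 1 ≤ n) (hq : ExactlyDivides n q) (F : GSp ℓ g q) :
    IsAdmissible n (F.1 - 1) (scale h2 hq) := by
  have h := transpose_J_mul_of_symp F.2
  obtain ⟨v, hv⟩ := hq.isUnit hn
  have hinv : (((v⁻¹ : ℤ_[ℓ]ˣ) : ℤ_[ℓ]) • (-(JJ * F.1ᵀ * JJ))) * F.1 = 1 := by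
    have : JJ * F.1ᵀ * JJ * F.1 = JJ * (F.1ᵀ * JJ * F.1) := by simp only [Matrix.mul_assoc]
    rw [Matrix.smul_mul, Matrix.neg_mul, this, h, ← hv, Matrix.mul_smul, Matrix.J_squared,
      smul_neg, smul_neg, smul_neg, neg_neg, smul_smul, Units.inv_mul, one_smul]
  have h' : F.1 * JJ * F.1ᵀ = q • JJ := by
    have e := mul_eq_one_comm.1 hinv
    rw [Matrix.mul_smul, Matrix.mul_neg] at e
    have e1 := congrArg (fun B : Mat ℓ g => q • (B * JJ)) e
    simp only [Matrix.smul_mul, Matrix.neg_mul, Matrix.one_mul, smul_smul, ← hv,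
      Units.mul_inv, one_smul] at e1
    rw [hv] at e1
    rw [← e1]
    have e2 : F.1 * (JJ * F.1ᵀ * JJ) * JJ = F.1 * JJ * F.1ᵀ * (JJ * JJ) := by
      simp only [Matrix.mul_assoc]
    rw [e2, Matrix.J_squared, Matrix.mul_neg, Matrix.mul_one, neg_neg]
  refine ⟨1, ?_, ?_⟩
  · rw [scale_spec, one_smul, sub_smul, one_smul, ← h, Matrix.transpose_sub,
      Matrix.transpose_one]
    noncomm_ring
  · rw [scale_spec, one_smul, sub_smul, one_smul, ← h', Matrix.transpose_sub,
      Matrix.transpose_one]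
    noncomm_ring

/-- `coker(1 - F)`. -/
abbrev GSp.Coker (F : GSp ℓ g q) : Type :=
  Lat ℓ g ⧸ LinearMap.range (Matrix.mulVecLin (1 - F.1))

theorem GSp.mkQ_eq_zero (F : GSp ℓ g q) (x : Lat ℓ g) :
    (LinearMap.range (Matrix.mulVecLin (1 - F.1))).mkQ x = 0 ↔
      ∃ y, (F.1 - 1) *ᵥ y = x := by
  rw [Submodule.mkQ_apply, Submodule.Quotient.mk_eq_zero, LinearMap.mem_range]
  constructor
  · rintro ⟨y, rfl⟩
    refine ⟨-y, ?_⟩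
    rw [Matrix.mulVecLin_apply, Matrix.mulVec_neg, ← Matrix.neg_mulVec, neg_sub]
  · rintro ⟨y, rfl⟩
    refine ⟨-y, ?_⟩
    rw [Matrix.mulVecLin_apply, Matrix.mulVec_neg, ← Matrix.neg_mulVec, neg_sub]

/-- The bilinearly enhanced group `(coker(1 - F), ω, ψ)` of `F ∈ GSp^(q)` for which this cokernel
is finite, where `ω = (q - 1)/(2 ℓ^n) · ∑ e_i ∧ f_i` and
`ψ(ℓ^(-n) ω(·, s)) = ℓ^(-n) (F - 1) s`. -/
def GSp.beg (h2 : ℓ ≠ 2) (hn : 1 ≤ n) (hq : ExactlyDivides n q) (F : GSp ℓ g q)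
    (hF : Finite F.Coker) : BEG ℓ n :=
  begOf h2 (F.isAdmissible h2 hn hq) F.mkQ_eq_zero

variable (ℓ g) in
/-- `Sp_{2g}(ℤ_ℓ)`. -/
abbrev Sp : Type := Matrix.symplecticGroup (Fin g) ℤ_[ℓ]

instance : MeasurableSpace (Sp ℓ g) := borel _

instance : BorelSpace (Sp ℓ g) := ⟨rfl⟩

instance : IsTopologicalGroup (Sp ℓ g) where
  continuous_mul := continuous_mul
  continuous_inv := by
    refine Continuous.subtype_mk ?_ _
    exact (continuous_const.matrix_mul continuous_subtype_val.matrix_transpose).matrix_mul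
      continuous_const

instance : CompactSpace (Mat ℓ g) :=
  inferInstanceAs (CompactSpace (Fin g ⊕ Fin g → Fin g ⊕ Fin g → ℤ_[ℓ]))

instance : CompactSpace (Sp ℓ g) := by
  refine isCompact_iff_compactSpace.1 (IsClosed.isCompact ?_)
  have : ((Matrix.symplecticGroup (Fin g) ℤ_[ℓ] : Submonoid (Mat ℓ g)) : Set (Mat ℓ g))
      = {B : Mat ℓ g | B * JJ * Bᵀ = JJ} := by
    ext B
    exact SymplecticGroup.mem_iff
  change IsClosed ((Matrix.symplecticGroup (Fin g) ℤ_[ℓ] : Submonoid (Mat ℓ g)) : Set (Mat ℓ g))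
  rw [this]
  exact isClosed_eq ((continuous_id.matrix_mul continuous_const).matrix_mul
    continuous_id.matrix_transpose) continuous_const

variable (ℓ g) in
/-- The Haar probability measure of `Sp_{2g}(ℤ_ℓ)`. -/
def spHaar : MeasureTheory.Measure (Sp ℓ g) := MeasureTheory.Measure.haarMeasure ⊤

variable (ℓ g q) in
/-- The similitude `e_i ↦ e_i`, `f_i ↦ q f_i` with factor `q`. -/
def baseSim : Mat ℓ g := Matrix.fromBlocks 1 0 0 (q • 1)

theorem symp_baseSim (x y : Lat ℓ g) :
    symp (baseSim ℓ g q *ᵥ x) (baseSim ℓ g q *ᵥ y) = q * symp x y := by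
  simp only [symp, baseSim, Matrix.fromBlocks_mulVec, Sum.elim_inl, Sum.elim_inr,
    Matrix.zero_mulVec, Matrix.one_mulVec, Matrix.smul_mulVec, add_zero, zero_add,
    Pi.smul_apply, Function.comp, smul_eq_mul, Finset.mul_sum]
  refine Finset.sum_congr rfl fun i _ => ?_
  ring

theorem symp_sp (S : Sp ℓ g) (x y : Lat ℓ g) :
    symp (S.1 *ᵥ x) (S.1 *ᵥ y) = symp x y := by
  rw [symp_mulVec, SymplecticGroup.mem_iff'.1 S.2, symp_eq]

variable (q) in
/-- The bijection of `Sp_{2g}(ℤ_ℓ)` with its coset `GSp^(q)`, translation by `baseSim`. -/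
def GSp.ofSp (S : Sp ℓ g) : GSp ℓ g q :=
  ⟨baseSim ℓ g q * S.1, fun x y => by
    rw [← Matrix.mulVec_mulVec, ← Matrix.mulVec_mulVec, symp_baseSim, symp_sp]⟩

variable (ℓ g q) in
/-- The Haar probability measure of the coset `GSp^(q)` of `Sp_{2g}(ℤ_ℓ)`: the translate of the
Haar measure of `Sp_{2g}(ℤ_ℓ)`. -/
def gspHaar : MeasureTheory.Measure (GSp ℓ g q) := (spHaar ℓ g).map (GSp.ofSp q)

/-- The nonlinear measure: the distribution of the isomorphism class of `(coker(1 - F), ω, ψ)` for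
Haar-random `F ∈ GSp^(q)`, on the set of all `F` for which the cokernel is finite. -/
def nonlinearMeasure (h2 : ℓ ≠ 2) (hn : 1 ≤ n) (hq : ExactlyDivides n q) (g : ℕ) :
    MeasureTheory.Measure (BEGClass ℓ n) :=
  ((gspHaar ℓ g q).comap (Subtype.val : {F : GSp ℓ g q // Finite F.Coker} → GSp ℓ g q)).map
    fun F => (F.1.beg h2 hn hq F.2).toClass

end Nonlinear

/-! ### The linear model -/

section Linear

variable {n : ℕ}

variable (ℓ g) in
/-- The skew-symplectic matrices `M`, those with `ω(M x, y) = -ω(x, M y)`, i.e. the Lie algebra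
of `Sp_{2g}(ℤ_ℓ)`. -/
def skewSymp : AddSubgroup (Mat ℓ g) where
  carrier := {M | ∀ x y : Lat ℓ g, symp (M *ᵥ x) y = -symp x (M *ᵥ y)}
  zero_mem' := fun x y => by simp [symp]
  add_mem' := fun {M N} hM hN x y => by
    rw [Matrix.add_mulVec, Matrix.add_mulVec, symp_add_left, symp_add_right, hM, hN]; ring
  neg_mem' := fun {M} hM x y => by
    have e : ∀ z : Lat ℓ g, (-M) *ᵥ z = (-1 : ℤ_[ℓ]) • (M *ᵥ z) := fun z => by
      simp [Matrix.neg_mulVec]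
    rw [e, e, symp_smul_left, symp_smul_right, hM]; ring

theorem skewSymp_iff {M : Mat ℓ g} : M ∈ skewSymp ℓ g ↔ Mᵀ * JJ + JJ * M = 0 := by
  have e1 := fun x y : Lat ℓ g => symp_mulVec M 1 x y
  have e2 := fun x y : Lat ℓ g => symp_mulVec 1 M x y
  simp only [Matrix.one_mulVec, Matrix.mul_one, Matrix.transpose_one, Matrix.one_mul] at e1 e2
  constructor
  · intro h
    refine mat_ext_dot fun x y => ?_
    have := h x y
    rw [e1, e2] at this
    rw [Matrix.add_mulVec, dotProduct_add, Matrix.zero_mulVec, dotProduct_zero]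
    linear_combination -this
  · intro h x y
    have := congrArg (fun B : Mat ℓ g => x ⬝ᵥ (B *ᵥ y)) h
    simp only [Matrix.add_mulVec, dotProduct_add, Matrix.zero_mulVec, dotProduct_zero] at this
    rw [e1, e2]
    linear_combination -this

instance : MeasurableSpace (skewSymp ℓ g) := borel _

instance : BorelSpace (skewSymp ℓ g) := ⟨rfl⟩

instance : CompactSpace (skewSymp ℓ g) := by
  refine isCompact_iff_compactSpace.1 (IsClosed.isCompact ?_)
  have : ((skewSymp ℓ g : AddSubgroup (Mat ℓ g)) : Set (Mat ℓ g))
      = {M : Mat ℓ g | Mᵀ * JJ + JJ * M = 0} := by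
    ext M
    exact skewSymp_iff
  change IsClosed ((skewSymp ℓ g : AddSubgroup (Mat ℓ g)) : Set (Mat ℓ g))
  rw [this]
  exact isClosed_eq ((continuous_id.matrix_transpose.matrix_mul continuous_const).add
    (continuous_const.matrix_mul continuous_id)) continuous_const

variable (n) in
/-- The endomorphism `M + ℓ^n`. -/
def shifted (M : skewSymp ℓ g) : Mat ℓ g := M.1 + (ℓ : ℤ_[ℓ]) ^ n • 1

theorem shifted_isAdmissible (M : skewSymp ℓ g) : IsAdmissible n (shifted n M) 1 := by
  have h := skewSymp_iff.1 M.2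
  have h' : M.1 * JJ + JJ * M.1ᵀ = 0 := by
    have e := congrArg (fun B : Mat ℓ g => -(JJ * B * JJ)) h
    simp only [Matrix.mul_add, Matrix.add_mul, Matrix.mul_zero, Matrix.zero_mul, neg_zero] at e
    have e1 : JJ * (M.1ᵀ * JJ) * JJ = JJ * M.1ᵀ * (JJ * JJ) := by simp only [Matrix.mul_assoc]
    have e2 : JJ * (JJ * M.1) * JJ = (JJ * JJ) * (M.1 * JJ) := by simp only [Matrix.mul_assoc]
    rw [e1, e2, Matrix.J_squared] at e
    rw [← e]
    noncomm_ring
  have hs : ∀ B : Mat ℓ g, (2 * (ℓ : ℤ_[ℓ]) ^ n * 1) • B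
      = (ℓ : ℤ_[ℓ]) ^ n • B + (ℓ : ℤ_[ℓ]) ^ n • B := fun B => by
    rw [← add_smul]; congr 1; ring
  refine ⟨0, ?_, ?_⟩
  · rw [zero_smul, add_zero, hs, shifted, Matrix.transpose_add, Matrix.transpose_smul,
      Matrix.transpose_one, Matrix.add_mul, Matrix.mul_add, Matrix.smul_mul, Matrix.mul_smul,
      Matrix.one_mul, Matrix.mul_one, add_add_add_comm, h, zero_add]
  · rw [zero_smul, add_zero, hs, shifted, Matrix.transpose_add, Matrix.transpose_smul,
      Matrix.transpose_one, Matrix.add_mul, Matrix.mul_add, Matrix.smul_mul, Matrix.mul_smul,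
      Matrix.one_mul, Matrix.mul_one, add_add_add_comm, h', zero_add]

variable (n) in
/-- `coker(M + ℓ^n)`. -/
abbrev LinCoker (M : skewSymp ℓ g) : Type :=
  Lat ℓ g ⧸ LinearMap.range (Matrix.mulVecLin (shifted n M))

theorem LinCoker.mkQ_eq_zero (M : skewSymp ℓ g) (x : Lat ℓ g) :
    (LinearMap.range (Matrix.mulVecLin (shifted n M))).mkQ x = 0 ↔
      ∃ y, shifted n M *ᵥ y = x := by
  rw [Submodule.mkQ_apply, Submodule.Quotient.mk_eq_zero, LinearMap.mem_range]
  rfl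

/-- The bilinearly enhanced group `(coker(M + ℓ^n), ω, ψ)` of a skew-symplectic `M` for which this
cokernel is finite, where `ω = ∑ e_i ∧ f_i` and `ψ(ℓ^(-n) ω(·, s)) = ℓ^(-n) (M + ℓ^n) s`. -/
def linBeg (h2 : ℓ ≠ 2) (M : skewSymp ℓ g) (hM : Finite (LinCoker n M)) : BEG ℓ n :=
  begOf h2 (shifted_isAdmissible M) (LinCoker.mkQ_eq_zero M)

variable (ℓ g) in
/-- The Haar probability measure of the additive group of skew-symplectic matrices. -/
def skewHaar : MeasureTheory.Measure (skewSymp ℓ g) :=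
  MeasureTheory.Measure.addHaarMeasure ⊤

variable (n) in
/-- The linear measure: the distribution of the isomorphism class of `(coker(M + ℓ^n), ω, ψ)` for
Haar-random skew-symplectic `M`, on the set of all `M` for which the cokernel is finite. -/
def linearMeasure (h2 : ℓ ≠ 2) (g : ℕ) : MeasureTheory.Measure (BEGClass ℓ n) :=
  ((skewHaar ℓ g).comap
    (Subtype.val : {M : skewSymp ℓ g // Finite (LinCoker n M)} → skewSymp ℓ g)).map
    fun M => (linBeg h2 M.1 M.2).toClass

end Linear

end Lattice

end BilinEnh

end

open scoped TensorProduct Matrix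

noncomputable section

namespace BilinEnh

/-! ### Bilinearly enhanced groups presented by an endomorphism -/

/-! Both models attach to a random endomorphism A of T (A = F - 1 or A = M + ℓ^n) its cokernel with
ω and ψ. A surjective morphism from this group to H is the same thing as a surjection f : T → H that
kills A T, pushes the symplectic form to ω_H and satisfies the relation for ψ_H
(`card_surjSet_of_presents`). A moment is therefore a sum, over fixed f, of probabilities.

Nonlinear moments. By Witt's theorem over ℤ_ℓ, Sp acts transitively on the surjections f with a
given pushforward of the form, if g is at least the rank of H (`exists_sp_comp`). Since ℓ^n kills
ω_H and q = 1 + 2ℓ^n u, composing with the base similitude preserves such an orbit, so f∘F = f has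
probability 1/|orbit|. Under this condition the possible ψ form a torsor under the group `Delta` of
homomorphisms with symmetric pairings. The stabiliser of f moves ψ through the whole torsor
(`exists_sp_of_mem_delta`), and |Delta| = |Sym²H[ℓ^n]| (`card_delta`). Summation over the orbit
gives exactly 1/|Sym²H[ℓ^n]| once the orbit is nonempty, which holds for large g.

Linear moments. M ↦ f∘M is equidistributed on the kernel of `crossWedge f`, a homomorphism from
Hom(T, H) onto ∧²H. The moment is the universal one times |orbit|·|∧²H|/|Hom(T, H)|. This factor
tends to 1 because the pushforward of the form is nearly equidistributed on ∧²H
(`tendsto_card_orbit`).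

Finiteness. If det A = 0, the cokernel has at least 2^m surjections to ℤ/ℓ^(m+1). Their expected
number is at most |∧²| = 1 for this cyclic group, so P(det A = 0) ≤ 2^(-m) for all m.

Uniqueness. Counting surjections to Y × (ℤ/ℓ)^i and inverting with q-binomial coefficients isolates
the groups of the same rank as Y (`rank_inversion`). The series converges because the universal
moments, summed over all structures on a group K, give at most |∧²K|, whose growth is beaten by the
inversion coefficients for ℓ ≥ 3. In fixed rank the truncations X/ℓ^m X take finitely many values,
and the moments form a triangular system for their masses (`measure_truncClass_unique`).

Limits. Convergent moments imply tightness, from maps to cyclic groups, and uniform integrability,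
from second moments. Hence every ultrafilter limit has the universal moments. Uniqueness identifies
all these limits, which gives existence of μ and weak convergence. -/

theorem exists_pow_kill {ℓ : ℕ} {H : Type} [AddCommGroup H] [Finite H]
    (hH : ∀ x : H, ∃ k : ℕ, ℓ ^ k • x = 0) :
    ∃ N, ∀ x : H, ℓ ^ N • x = 0 := by
  choose k hk using hH
  obtain ⟨N, hN⟩ := (Set.finite_range k).bddAbove
  refine ⟨N, fun x => ?_⟩
  rw [← Nat.sub_add_cancel (hN ⟨x, rfl⟩), pow_add, mul_smul, hk, smul_zero]

section Presentations

variable {ℓ : ℕ} [Fact ℓ.Prime] {g n : ℕ} {H : Type} [AddCommGroup H]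

theorem padic_pow_ne_zero (N : ℕ) : (ℓ : ℤ_[ℓ]) ^ N ≠ 0 :=
  pow_ne_zero _ (by exact_mod_cast (Fact.out : ℓ.Prime).ne_zero)

/-- The relation `z = ψ(α)` for an additive map `f : T → H`: if `α ∘ f = ℓ^(-n) ω(·, s)`, then
`z = f (ℓ^(-n) A s)`. -/
def PsiRel (n : ℕ) (A : Mat ℓ g) (f : Lat ℓ g →+ H) (α : H →+ ZMod (ℓ ^ n)) (z : H) : Prop :=
  ∃ s t : Lat ℓ g, (∀ x, α (f x) = PadicInt.toZModPow n (symp x s)) ∧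
    A *ᵥ s = (ℓ : ℤ_[ℓ]) ^ n • t ∧ z = f t

/-- The element `u · ∑ e_i ∧ f_i`, pushed forward along an additive map. -/
def omegaAdd (f : Lat ℓ g →+ H) (u : ℤ_[ℓ]) : H ⊗[ℤ] H :=
  ∑ i : Fin g, wedge (f (u • vecE i)) (f (vecF i))

theorem exists_rep {N : ℕ} (α : Lat ℓ g →+ ZMod (ℓ ^ N)) :
    ∃ s : Lat ℓ g, ∀ x, α x = PadicInt.toZModPow N (symp x s) :=
  exists_symp_eq (LinearMap.id : Lat ℓ g →ₗ[ℤ_[ℓ]] Lat ℓ g) α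

variable {A : Mat ℓ g} {u : ℤ_[ℓ]} {f : Lat ℓ g →+ H}

theorem symp_dvd_of_rep' {N : ℕ} (hf : ∀ x, f (A *ᵥ x) = 0)
    {α : H →+ ZMod (ℓ ^ N)} {s : Lat ℓ g}
    (hs : ∀ x, α (f x) = PadicInt.toZModPow N (symp x s)) (x : Lat ℓ g) :
    (ℓ : ℤ_[ℓ]) ^ N ∣ symp (A *ᵥ x) s := by
  rw [← toZModPow_eq_zero_iff, ← hs, hf, map_zero]

theorem exists_psiRel (hA : IsAdmissible n A u) (hf : ∀ x, f (A *ᵥ x) = 0)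
    (α : H →+ ZMod (ℓ ^ n)) : ∃ z, PsiRel n A f α z := by
  obtain ⟨s, hs⟩ := exists_rep (α.comp f)
  obtain ⟨t, ht⟩ := hA.exists_div (symp_dvd_of_rep' hf hs)
  exact ⟨f t, s, t, hs, ht, rfl⟩

/-- Two representatives of the same homomorphism differ by a multiple of `ℓ^N`. -/
theorem rep_unique {N : ℕ} {α : Lat ℓ g →+ ZMod (ℓ ^ N)} {s s' : Lat ℓ g}
    (hs : ∀ x, α x = PadicInt.toZModPow N (symp x s))
    (hs' : ∀ x, α x = PadicInt.toZModPow N (symp x s')) :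
    ∃ w : Lat ℓ g, s - s' = (ℓ : ℤ_[ℓ]) ^ N • w := by
  have h1 : ∀ x, (ℓ : ℤ_[ℓ]) ^ N ∣ symp x (s + (-1 : ℤ_[ℓ]) • s') := fun x => by
    rw [← toZModPow_eq_zero_iff, symp_add_right, symp_smul_right, map_add, map_mul, ← hs,
      ← hs', map_neg, map_one]
    ring
  obtain ⟨w, hw⟩ := dvd_of_symp_dvd h1
  exact ⟨w, by rw [← hw, neg_one_smul, sub_eq_add_neg]⟩

/-- Two choices of s differ by ℓ^n w, so the corresponding t differ by A w, which f kills. This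
makes ψ well defined. -/
theorem PsiRel.unique (hf : ∀ x, f (A *ᵥ x) = 0)
    {α : H →+ ZMod (ℓ ^ n)} {z z' : H} (h : PsiRel n A f α z) (h' : PsiRel n A f α z') :
    z = z' := by
  obtain ⟨s, t, hs, ht, rfl⟩ := h
  obtain ⟨s', t', hs', ht', rfl⟩ := h'
  obtain ⟨w, hw⟩ := rep_unique (α := α.comp f) hs hs'
  have h2 : t - t' = A *ᵥ w := by
    have : (ℓ : ℤ_[ℓ]) ^ n • (t - t') = (ℓ : ℤ_[ℓ]) ^ n • (A *ᵥ w) := by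
      rw [← Matrix.mulVec_smul, ← hw, smul_sub, ← ht, ← ht', Matrix.mulVec_sub]
    exact smul_right_injective _ (padic_pow_ne_zero n) this
  rw [← sub_eq_zero, ← map_sub, h2, hf]

theorem PsiRel.add {α β : H →+ ZMod (ℓ ^ n)} {z w : H} (h : PsiRel n A f α z)
    (h' : PsiRel n A f β w) : PsiRel n A f (α + β) (z + w) := by
  obtain ⟨s, t, hs, ht, rfl⟩ := h
  obtain ⟨s', t', hs', ht', rfl⟩ := h'
  refine ⟨s + s', t + t', fun x => ?_, ?_, (map_add f t t').symm⟩
  · rw [AddMonoidHom.add_apply, hs, hs', symp_add_right, map_add]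
  · rw [Matrix.mulVec_add, ht, ht', smul_add]

/-- The homomorphism `ψ` attached to an admissible endomorphism whose image is killed by `f`. -/
def psiHom (hA : IsAdmissible n A u) (hf : ∀ x, f (A *ᵥ x) = 0) :
    (H →+ ZMod (ℓ ^ n)) →+ H :=
  AddMonoidHom.mk' (fun α => (exists_psiRel hA hf α).choose) fun α β =>
    PsiRel.unique hf (exists_psiRel hA hf (α + β)).choose_spec
      ((exists_psiRel hA hf α).choose_spec.add (exists_psiRel hA hf β).choose_spec)

theorem psiHom_spec (hA : IsAdmissible n A u) (hf : ∀ x, f (A *ᵥ x) = 0)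
    (α : H →+ ZMod (ℓ ^ n)) : PsiRel n A f α (psiHom hA hf α) :=
  (exists_psiRel hA hf α).choose_spec

theorem symp_vecE (i : Fin g) (y : Lat ℓ g) : symp (vecE i) y = y (Sum.inr i) := by
  simp [symp, vecE, Pi.single_apply]

theorem symp_vecF (i : Fin g) (y : Lat ℓ g) : symp (vecF i) y = -y (Sum.inl i) := by
  simp [symp, vecF, Pi.single_apply]

theorem evalPair_omegaAdd {N : ℕ} {α β : H →+ ZMod (ℓ ^ N)} {s t : Lat ℓ g}
    (hs : ∀ x, α (f x) = PadicInt.toZModPow N (symp x s))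
    (ht : ∀ x, β (f x) = PadicInt.toZModPow N (symp x t)) :
    evalPair α β (omegaAdd f u) = PadicInt.toZModPow N (u * symp s t) := by
  rw [omegaAdd, map_sum, symp, Finset.mul_sum, map_sum]
  refine Finset.sum_congr rfl fun i _ => ?_
  simp only [wedge, evalPair_tmul, map_sub, hs, ht, symp_smul_left, symp_vecE, symp_vecF, map_mul,
    map_neg]
  ring

theorem scaleDown_rep' {r : ℕ} {α : H →+ ZMod (ℓ ^ (n + r))} {s : Lat ℓ g}
    (hs : ∀ x, α (f x) = PadicInt.toZModPow (n + r) (symp x s)) (x : Lat ℓ g) :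
    scaleDown r α (f x) = PadicInt.toZModPow n (symp x s) := by
  change ZMod.castHom (pow_dvd_pow ℓ (Nat.le_add_right n r)) (ZMod (ℓ ^ n)) (α (f x)) = _
  rw [hs, ZMod.castHom_apply, PadicInt.cast_toZModPow _ _ (Nat.le_add_right n r)]

/-- One lift modulo ℓ^(n+r) also represents the reduction modulo ℓ^n, and `IsAdmissible.compat` is
then the required congruence. Only f(A T) = 0 is needed, not that the kernel of f equals A T, so
every quotient of the cokernel inherits a structure. -/
theorem psiHom_compat (hA : IsAdmissible n A u) (hf : ∀ x, f (A *ᵥ x) = 0)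
    (r : ℕ) (α β : H →+ ZMod (ℓ ^ (n + r))) :
    β (psiHom hA hf (scaleDown r α)) = α (psiHom hA hf (scaleDown r β))
      + 2 * evalPair α β (omegaAdd f u) := by
  obtain ⟨s, hs⟩ := exists_rep (α.comp f)
  obtain ⟨t, ht⟩ := exists_rep (β.comp f)
  have hsd := symp_dvd_of_rep' hf hs
  have htd := symp_dvd_of_rep' hf ht
  have hle : (ℓ : ℤ_[ℓ]) ^ n ∣ (ℓ : ℤ_[ℓ]) ^ (n + r) := pow_dvd_pow _ (Nat.le_add_right n r)
  obtain ⟨s', hs'⟩ := hA.exists_div fun x => hle.trans (hsd x)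
  obtain ⟨t', ht'⟩ := hA.exists_div fun x => hle.trans (htd x)
  have e1 : psiHom hA hf (scaleDown r α) = f s' :=
    (psiHom_spec hA hf _).unique hf ⟨s, s', scaleDown_rep' hs, hs', rfl⟩
  have e2 : psiHom hA hf (scaleDown r β) = f t' :=
    (psiHom_spec hA hf _).unique hf ⟨t, t', scaleDown_rep' ht, ht', rfl⟩
  have h := hA.compat htd hs' ht'
  rw [← toZModPow_eq_zero_iff, map_sub, map_sub, map_mul, map_ofNat] at h
  have ht1 : β (f s') = PadicInt.toZModPow (n + r) (symp s' t) := ht s'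
  have hs1 : α (f t') = PadicInt.toZModPow (n + r) (symp t' s) := hs t'
  rw [← ht1, ← hs1, ← evalPair_omegaAdd (u := u) hs ht] at h
  rw [e1, e2]
  linear_combination h

/-- `f` is a surjection from `T` which exhibits `(H, ω, ψ)` as a quotient of the bilinearly enhanced
group of `A`. -/
def SurjData (A : Mat ℓ g) (u : ℤ_[ℓ]) (ω : H ⊗[ℤ] H) (ψ : (H →+ ZMod (ℓ ^ n)) →+ H)
    (f : Lat ℓ g →+ H) : Prop :=
  Function.Surjective f ∧ (∀ x, f (A *ᵥ x) = 0) ∧ omegaAdd f u = ω ∧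
    ∀ α, PsiRel n A f α (ψ α)

/-- `X` is the bilinearly enhanced group of `A`. -/
def Presents (X : BEG ℓ n) (A : Mat ℓ g) (u : ℤ_[ℓ]) : Prop :=
  ∃ π : Lat ℓ g →+ X.G, SurjData A u X.ω X.ψ π ∧ ∀ x, π x = 0 → ∃ y, A *ᵥ y = x

theorem map_omegaAdd {H' : Type} [AddCommGroup H'] (h : H →+ H') (f : Lat ℓ g →+ H) :
    TensorProduct.map h.toIntLinearMap h.toIntLinearMap (omegaAdd f u)
      = omegaAdd (h.comp f) u := by
  simp only [omegaAdd, map_sum, wedge, map_sub, TensorProduct.map_tmul]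
  rfl

theorem PsiRel.comp {H' : Type} [AddCommGroup H'] (h : H →+ H') {α : H' →+ ZMod (ℓ ^ n)} {z : H}
    (hz : PsiRel n A f (α.comp h) z) : PsiRel n A (h.comp f) α (h z) := by
  obtain ⟨s, t, hs, ht, rfl⟩ := hz
  exact ⟨s, t, hs, ht, rfl⟩

theorem SurjData.comp {X Y : BEG ℓ n} {π : Lat ℓ g →+ X.G} (hπ : SurjData A u X.ω X.ψ π)
    {h : X.G →+ Y.G} (hh : h ∈ SurjSet X Y) : SurjData A u Y.ω Y.ψ (h.comp π) := by
  obtain ⟨h1, h2, h3, h4⟩ := hπ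
  obtain ⟨k1, k2, k3⟩ := hh
  refine ⟨k1.comp h1, fun x => ?_, ?_, fun α => ?_⟩
  · rw [AddMonoidHom.comp_apply, h2, map_zero]
  · rw [← map_omegaAdd, h3, k2]
  · rw [← k3]
    exact (h4 _).comp h

/-- The kernel of π is A T, which f kills, so f descends. The morphism conditions follow by pushing
ω and ψ along the quotient map and using uniqueness of ψ. -/
theorem SurjData.exists_factor {X Y : BEG ℓ n} {π : Lat ℓ g →+ X.G}
    (hπ : SurjData A u X.ω X.ψ π) (hker : ∀ x, π x = 0 → ∃ y, A *ᵥ y = x)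
    {f : Lat ℓ g →+ Y.G} (hf : SurjData A u Y.ω Y.ψ f) :
    ∃ h : X.G →+ Y.G, h ∈ SurjSet X Y ∧ h.comp π = f := by
  obtain ⟨h1, h2, h3, h4⟩ := hπ
  obtain ⟨k1, k2, k3, k4⟩ := hf
  have hle : π.ker ≤ f.ker := fun x hx => by
    obtain ⟨y, rfl⟩ := hker x hx
    exact k2 y
  let h : X.G →+ Y.G := π.liftOfSurjective h1 ⟨f, hle⟩
  have hh : h.comp π = f := AddMonoidHom.liftOfRightInverse_comp π _ _ ⟨f, hle⟩
  refine ⟨h, ⟨?_, ?_, fun α => ?_⟩, hh⟩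
  · have : Function.Surjective (h.comp π) := hh ▸ k1
    exact Function.Surjective.of_comp this
  · rw [← h3, map_omegaAdd, hh, k3]
  · have := (h4 (α.comp h)).comp h
    rw [hh] at this
    exact this.unique k2 (k4 α)

/-- Replaces the random source X by the fixed lattice: only the condition on f still depends on A,
so expectations become sums of probabilities. -/
theorem card_surjSet_of_presents {X : BEG ℓ n} (hX : Presents X A u) (Y : BEG ℓ n) :
    Nat.card (SurjSet X Y) = Nat.card {f : Lat ℓ g →+ Y.G // SurjData A u Y.ω Y.ψ f} := by
  obtain ⟨π, hπ, hker⟩ := hX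
  refine Nat.card_congr (Equiv.ofBijective
    (fun h => ⟨h.1.comp π, hπ.comp h.2⟩) ⟨fun h h' e => ?_, fun f => ?_⟩)
  · have e1 := congrArg Subtype.val e
    refine Subtype.ext (AddMonoidHom.ext fun x => ?_)
    obtain ⟨y, rfl⟩ := hπ.1 x
    exact DFunLike.congr_fun e1 y
  · obtain ⟨h, hh, e⟩ := hπ.exists_factor hker f.2
    exact ⟨⟨h, hh⟩, Subtype.ext e⟩

/-- Both projections have kernel A T, so the induced surjection is injective. Used to see that the
isomorphism class is a locally constant function of A. -/
theorem Presents.iso {X Y : BEG ℓ n} (hX : Presents X A u) (hY : Presents Y A u) : Iso X Y := by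
  obtain ⟨π, hπ, hker⟩ := hX
  obtain ⟨f, hf, hker'⟩ := hY
  obtain ⟨h, hh, e⟩ := hπ.exists_factor hker hf
  refine ⟨AddEquiv.ofBijective h ⟨?_, hh.1⟩, hh.2⟩
  rw [injective_iff_map_eq_zero]
  intro x hx
  obtain ⟨y, rfl⟩ := hπ.1 x
  have : f y = 0 := by rw [← e]; exact hx
  obtain ⟨z, rfl⟩ := hker' y this
  exact hπ.2.1 z

theorem map_pow_smul {N : ℕ} (hN : ∀ x : H, ℓ ^ N • x = 0) (f : Lat ℓ g →+ H) (x : Lat ℓ g) :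
    f ((ℓ : ℤ_[ℓ]) ^ N • x) = 0 := by
  rw [← Nat.cast_pow, Nat.cast_smul_eq_nsmul, map_nsmul, hN]

/-- Of the power ℓ^(n+N), the factor ℓ^n is used up by the division in the definition of t, and the
remaining ℓ^N kills H. -/
theorem PsiRel.congr_mod {N : ℕ} (hN : ∀ x : H, ℓ ^ N • x = 0) {α : H →+ ZMod (ℓ ^ n)} {z : H}
    (h : PsiRel n A f α z) (B : Mat ℓ g) : PsiRel n (A + (ℓ : ℤ_[ℓ]) ^ (n + N) • B) f α z := by
  obtain ⟨s, t, hs, ht, rfl⟩ := h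
  refine ⟨s, t + (ℓ : ℤ_[ℓ]) ^ N • (B *ᵥ s), hs, ?_, ?_⟩
  · rw [Matrix.add_mulVec, ht, smul_add, smul_smul, Matrix.smul_mulVec, pow_add]
  · rw [map_add, map_pow_smul hN, add_zero]

theorem SurjData.congr_mod {N : ℕ} (hN : ∀ x : H, ℓ ^ N • x = 0) {ω : H ⊗[ℤ] H}
    {ψ : (H →+ ZMod (ℓ ^ n)) →+ H}
    (h : SurjData A u ω ψ f) (B : Mat ℓ g) :
    SurjData (A + (ℓ : ℤ_[ℓ]) ^ (n + N) • B) u ω ψ f := by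
  obtain ⟨h1, h2, h3, h4⟩ := h
  refine ⟨h1, fun x => ?_, h3, fun α => (h4 α).congr_mod hN B⟩
  rw [Matrix.add_mulVec, map_add, h2, zero_add, Matrix.smul_mulVec, pow_add, mul_comm, mul_smul,
    map_pow_smul hN]

/-- The determinant reduces to 1 in the residue field. -/
theorem exists_inverse_one_add {ι : Type*} [Fintype ι] [DecidableEq ι] (B : Matrix ι ι ℤ_[ℓ]) :
    ∃ C : Matrix ι ι ℤ_[ℓ], (1 + (ℓ : ℤ_[ℓ]) • B) * C = 1 := by
  have h : IsUnit (1 + (ℓ : ℤ_[ℓ]) • B).det := by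
    by_contra hn
    rw [← mem_nonunits_iff, ← IsLocalRing.mem_maximalIdeal, ← IsLocalRing.residue_eq_zero_iff,
      RingHom.map_det] at hn
    have e : (IsLocalRing.residue ℤ_[ℓ]) (ℓ : ℤ_[ℓ]) = 0 := by
      rw [IsLocalRing.residue_eq_zero_iff, PadicInt.maximalIdeal_eq_span_p]
      exact Ideal.mem_span_singleton_self _
    have e2 : (IsLocalRing.residue ℤ_[ℓ]).mapMatrix (1 + (ℓ : ℤ_[ℓ]) • B) = 1 := by
      rw [map_add, map_one]
      ext i j
      simp [e]
    rw [e2, Matrix.det_one] at hn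
    exact one_ne_zero hn
  exact ⟨(1 + (ℓ : ℤ_[ℓ]) • B)⁻¹, Matrix.mul_nonsing_inv _ h⟩

/-- A bilinearly enhanced group presented by `A` is also presented by all `A'` close to `A`. -/
theorem Presents.exists_congr_mod {X : BEG ℓ n} (hX : Presents X A u) :
    ∃ N, ∀ B : Mat ℓ g, Presents X (A + (ℓ : ℤ_[ℓ]) ^ N • B) u := by
  obtain ⟨N, hN⟩ := exists_pow_kill (H := X.G) X.isPrimary
  obtain ⟨π, hπ, hker⟩ := hX
  -- The n digits are lost in the division defining ψ, N digits kill X, and one more makes the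
  -- correction factor 1 + ℓ(…) invertible.
  refine ⟨n + (N + 1), fun B => ⟨π, hπ.congr_mod (fun x => ?_) B, fun x hx => ?_⟩⟩
  · rw [pow_succ', mul_smul, hN, smul_zero]
  -- ℓ^N T lies in A T, which yields a matrix C with A C = ℓ^N.
  have hdiv : ∀ x : Lat ℓ g, ∃ y, A *ᵥ y = (ℓ : ℤ_[ℓ]) ^ N • x :=
    fun x => hker _ (map_pow_smul hN π x)
  choose c hc using fun j => hdiv (Pi.single j 1)
  have hC : A * (Matrix.of fun i j => c j i) = (ℓ : ℤ_[ℓ]) ^ N • (1 : Mat ℓ g) := by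
    ext i j
    have := congrFun (hc j) i
    simpa [Matrix.mulVec, dotProduct, Matrix.mul_apply, Matrix.one_apply, Pi.single_apply] using this
  set C : Mat ℓ g := Matrix.of fun i j => c j i
  obtain ⟨D, hD⟩ := exists_inverse_one_add ((ℓ : ℤ_[ℓ]) ^ n • (C * B))
  obtain ⟨y, rfl⟩ := hker x hx
  refine ⟨D *ᵥ y, ?_⟩
  -- Substituting ℓ^N = A C, the perturbed matrix becomes A times an invertible matrix; hence it has
  -- the same image as A.
  have : (A + (ℓ : ℤ_[ℓ]) ^ (n + (N + 1)) • B) * D = A := by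
    have e : A + (ℓ : ℤ_[ℓ]) ^ (n + (N + 1)) • B
        = A * (1 + (ℓ : ℤ_[ℓ]) • (ℓ : ℤ_[ℓ]) ^ n • (C * B)) := by
      rw [Matrix.mul_add, Matrix.mul_one, Matrix.mul_smul, Matrix.mul_smul, ← Matrix.mul_assoc, hC,
        Matrix.smul_mul, Matrix.one_mul, smul_smul, smul_smul]
      congr 2
      ring
    rw [e, Matrix.mul_assoc, hD, Matrix.mul_one]
  rw [Matrix.mulVec_mulVec, this]

theorem presents_begOf {G : Type} [AddCommGroup G] [Module ℤ_[ℓ] G] [Finite G] (h2 : ℓ ≠ 2)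
    {π : Lat ℓ g →ₗ[ℤ_[ℓ]] G} (hπ : Function.Surjective π) (hA : IsAdmissible n A u)
    (hker : ∀ x, π x = 0 ↔ ∃ y, A *ᵥ y = x) : Presents (begOf h2 hA hker) A u :=
  ⟨π.toAddMonoidHom, ⟨hπ, fun x => (hker _).2 ⟨x, rfl⟩, rfl, fun α => psiOf_spec hA hker α⟩,
    fun x => (hker x).1⟩

theorem exists_nat_dvd_sub (N : ℕ) (c : ℤ_[ℓ]) : ∃ m : ℕ, (ℓ : ℤ_[ℓ]) ^ N ∣ c - m :=
  ⟨(PadicInt.toZModPow N c).val, by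
    rw [← toZModPow_eq_zero_iff, map_sub, map_natCast, ZMod.natCast_val, ZMod.cast_id', id,
      sub_self]⟩

/-- The integers m_i are the coordinates of x truncated modulo a power of ℓ that kills H, so one
choice serves all f. Additive maps to H are thereby determined by the basis, although no
ℤ_ℓ-linearity is assumed. -/
theorem exists_map_eq_sum [Finite H] (hH : ∀ x : H, ∃ k : ℕ, ℓ ^ k • x = 0) (x : Lat ℓ g) :
    ∃ m : Fin g ⊕ Fin g → ℕ, ∀ f : Lat ℓ g →+ H, f x = ∑ i, m i • f (Pi.single i 1) := by
  obtain ⟨N, hN⟩ := exists_pow_kill hH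
  choose m d hd using fun i => exists_nat_dvd_sub N (x i)
  have hx : x = ∑ i, m i • (Pi.single i (1 : ℤ_[ℓ]) : Lat ℓ g) + (ℓ : ℤ_[ℓ]) ^ N • d := by
    conv_lhs => rw [← sum_smul_single x]
    conv_rhs => rw [← sum_smul_single d]
    rw [Finset.smul_sum, ← Finset.sum_add_distrib]
    refine Finset.sum_congr rfl fun i _ => ?_
    rw [← Nat.cast_smul_eq_nsmul ℤ_[ℓ], smul_smul, ← add_smul, ← hd, add_sub_cancel]
  refine ⟨m, fun f => ?_⟩
  conv_lhs => rw [hx, map_add, map_pow_smul hN, map_sum, add_zero]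
  exact Finset.sum_congr rfl fun i _ => map_nsmul f _ _

theorem lat_hom_ext [Finite H] (hH : ∀ x : H, ∃ k : ℕ, ℓ ^ k • x = 0) {f f' : Lat ℓ g →+ H}
    (h : ∀ i, f (Pi.single i 1) = f' (Pi.single i 1)) : f = f' := by
  refine AddMonoidHom.ext fun x => ?_
  obtain ⟨m, hm⟩ := exists_map_eq_sum hH x
  simp only [hm, h]

theorem finite_lat_hom [Finite H] (hH : ∀ x : H, ∃ k : ℕ, ℓ ^ k • x = 0) :
    Finite (Lat ℓ g →+ H) :=
  Finite.of_injective (fun f i => f (Pi.single i 1) : _ → (Fin g ⊕ Fin g → H)) fun _ _ h =>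
    lat_hom_ext hH (congrFun h)

end Presentations

/-! ### Witt's theorem for symplectic lattices -/

section Witt

variable {ℓ : ℕ} [Fact ℓ.Prime] {g : ℕ}

theorem mem_symplecticGroup_of_symp {S : Mat ℓ g}
    (h : ∀ x y : Lat ℓ g, symp (S *ᵥ x) (S *ᵥ y) = symp x y) :
    S ∈ Matrix.symplecticGroup (Fin g) ℤ_[ℓ] := by
  rw [SymplecticGroup.mem_iff']
  have := transpose_J_mul_of_symp (q := 1) (F := S) fun x y => by rw [h, one_mul]
  rwa [one_smul] at this

theorem exists_sp_of_linear (φ : Lat ℓ g →ₗ[ℤ_[ℓ]] Lat ℓ g)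
    (h : ∀ x y, symp (φ x) (φ y) = symp x y) : ∃ S : Sp ℓ g, ∀ x, S.1 *ᵥ x = φ x :=
  ⟨⟨LinearMap.toMatrix' φ, mem_symplecticGroup_of_symp fun x y => by
    rw [LinearMap.toMatrix'_mulVec, LinearMap.toMatrix'_mulVec, h]⟩,
    fun x => LinearMap.toMatrix'_mulVec φ x⟩

/-- The symplectic pairing as a bilinear map. -/
def sympBilin : Lat ℓ g →ₗ[ℤ_[ℓ]] Lat ℓ g →ₗ[ℤ_[ℓ]] ℤ_[ℓ] :=
  LinearMap.mk₂ ℤ_[ℓ] symp symp_add_left symp_smul_left symp_add_right symp_smul_right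

@[simp] theorem sympBilin_apply (x y : Lat ℓ g) : sympBilin x y = symp x y := rfl

theorem symp_sum_left {ι : Type*} (t : Finset ι) (x : ι → Lat ℓ g) (y : Lat ℓ g) :
    symp (∑ i ∈ t, x i) y = ∑ i ∈ t, symp (x i) y := by
  simp only [← sympBilin_apply, map_sum, LinearMap.sum_apply]

theorem symp_sum_right {ι : Type*} (t : Finset ι) (x : ι → Lat ℓ g) (y : Lat ℓ g) :
    symp y (∑ i ∈ t, x i) = ∑ i ∈ t, symp y (x i) := by
  simp only [← sympBilin_apply, map_sum]

theorem symp_sub_left (x y z : Lat ℓ g) : symp (x - y) z = symp x z - symp y z := by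
  simp only [← sympBilin_apply, map_sub, LinearMap.sub_apply]

theorem symp_sub_right (x y z : Lat ℓ g) : symp z (x - y) = symp z x - symp z y := by
  simp only [← sympBilin_apply, map_sub]

theorem symp_self (x : Lat ℓ g) : symp x x = 0 := by
  simp only [symp]
  exact Finset.sum_eq_zero fun i _ => by ring

theorem exists_transvection (v : Lat ℓ g) (c : ℤ_[ℓ]) :
    ∃ S : Sp ℓ g, ∀ x, S.1 *ᵥ x = x + (c * symp x v) • v := by
  refine exists_sp_of_linear (LinearMap.id + (c • (sympBilin.flip v)).smulRight v) fun x y => ?_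
  change symp (x + (c * symp x v) • v) (y + (c * symp y v) • v) = _
  simp only [symp_add_left, symp_add_right, symp_smul_left, symp_smul_right, symp_self]
  rw [symp_swap v y]
  ring

/-- If `ω(x, y)` is a unit, then a transvection along `x - y` maps `x` to `y`. -/
theorem exists_transvection_map {x y : Lat ℓ g} (h : IsUnit (symp x y)) :
    ∃ S : Sp ℓ g, S.1 *ᵥ x = y ∧ ∀ z, symp z x = symp z y → S.1 *ᵥ z = z := by
  obtain ⟨v, hv⟩ := h
  obtain ⟨S, hS⟩ := exists_transvection (x - y) ((v⁻¹ : ℤ_[ℓ]ˣ) : ℤ_[ℓ])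
  refine ⟨S, ?_, fun z hz => ?_⟩
  · rw [hS, symp_sub_right, symp_self, ← hv, zero_sub, mul_neg, Units.inv_mul, neg_one_smul]
    abel
  · rw [hS, symp_sub_right, hz, sub_self, mul_zero, zero_smul, add_zero]

/-- Vectors on which the values of a linear form `ω(·, x)` can be prescribed. -/
def Unimod {k : ℕ} (s : Fin k → Lat ℓ g) : Prop :=
  ∀ b : Fin k → ℤ_[ℓ], ∃ x, ∀ i, symp (s i) x = b i

theorem Unimod.init {k : ℕ} {s : Fin (k + 1) → Lat ℓ g} (h : Unimod s) :
    Unimod fun i : Fin k => s i.castSucc := fun b => by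
  obtain ⟨x, hx⟩ := h (Fin.snoc b 0)
  exact ⟨x, fun i => by rw [hx, Fin.snoc_castSucc]⟩

theorem Unimod.sp {k : ℕ} {s : Fin k → Lat ℓ g} (h : Unimod s) (S : Sp ℓ g) :
    Unimod fun i => S.1 *ᵥ s i := fun b => by
  obtain ⟨x, hx⟩ := h b
  exact ⟨S.1 *ᵥ x, fun i => by rw [symp_sp, hx]⟩

theorem isUnit_one_add_of_not {x : ℤ_[ℓ]} (h : ¬ IsUnit x) : IsUnit (1 + x) := by
  have := IsLocalRing.isUnit_one_sub_self_of_mem_nonunits (-x) (by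
    rwa [mem_nonunits_iff, IsUnit.neg_iff])
  rwa [sub_neg_eq_add] at this

/-- Over a local ring two unit conditions can be met together: if neither of the two dual vectors
satisfies both, their sum does, being unit plus non-unit in each. It supplies the detour in Witt's
theorem. -/
theorem Unimod.exists_orthogonal {k : ℕ} {s s' : Fin (k + 1) → Lat ℓ g} (hs : Unimod s)
    (hs' : Unimod s') (h : ∀ i : Fin k, s i.castSucc = s' i.castSucc) :
    ∃ w, (∀ i : Fin k, symp (s i.castSucc) w = 0) ∧ IsUnit (symp (s (Fin.last k)) w) ∧
      IsUnit (symp (s' (Fin.last k)) w) := by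
  obtain ⟨w, hw⟩ := hs (Fin.snoc 0 1)
  obtain ⟨w', hw'⟩ := hs' (Fin.snoc 0 1)
  have e1 : ∀ i : Fin k, symp (s i.castSucc) w = 0 := fun i => by simp [hw]
  have e2 : symp (s (Fin.last k)) w = 1 := by simp [hw]
  have e1' : ∀ i : Fin k, symp (s i.castSucc) w' = 0 := fun i => by rw [h]; simp [hw']
  have e2' : symp (s' (Fin.last k)) w' = 1 := by simp [hw']
  by_cases c1 : IsUnit (symp (s' (Fin.last k)) w)
  · exact ⟨w, e1, e2 ▸ isUnit_one, c1⟩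
  by_cases c2 : IsUnit (symp (s (Fin.last k)) w')
  · exact ⟨w', e1', c2, e2' ▸ isUnit_one⟩
  refine ⟨w + w', fun i => by rw [symp_add_right, e1, e1', add_zero], ?_, ?_⟩
  · rw [symp_add_right, e2]
    exact isUnit_one_add_of_not c2
  · rw [symp_add_right, e2', add_comm]
    exact isUnit_one_add_of_not c1

/-- Witt's theorem: unimodular tuples with the same Gram matrix are conjugate. -/
theorem Unimod.exists_sp {k : ℕ} {s s' : Fin k → Lat ℓ g} (hs : Unimod s) (hs' : Unimod s')
    (h : ∀ i j, symp (s i) (s j) = symp (s' i) (s' j)) : ∃ S : Sp ℓ g, ∀ i, S.1 *ᵥ s i = s' i := by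
  induction k with
  | zero => exact ⟨1, fun i => i.elim0⟩
  | succ k ih =>
    obtain ⟨S, hS⟩ := ih hs.init hs'.init fun i j => h _ _
    -- By induction the first k vectors already agree; what remains is to move the last one while
    -- fixing those.
    suffices H : ∃ S' : Sp ℓ g, S'.1 *ᵥ (S.1 *ᵥ s (Fin.last k)) = s' (Fin.last k) ∧
        ∀ i : Fin k, S'.1 *ᵥ (s' i.castSucc) = s' i.castSucc by
      obtain ⟨S', h1, h2⟩ := H
      refine ⟨S' * S, fun i => ?_⟩
      change (S'.1 * S.1) *ᵥ s i = s' i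
      rw [← Matrix.mulVec_mulVec]
      induction i using Fin.lastCases with
      | last => exact h1
      | cast i => rw [hS, h2]
    have hSs := hs.sp S
    set x := S.1 *ᵥ s (Fin.last k) with hx
    set y := s' (Fin.last k)
    have hxy : ∀ i : Fin k, symp (s' i.castSucc) x = symp (s' i.castSucc) y := fun i => by
      rw [← hS, hx, symp_sp, h, hS]
    by_cases hu : IsUnit (symp x y)
    · obtain ⟨T, hT, hT'⟩ := exists_transvection_map hu
      exact ⟨T, hT, fun i => hT' _ (hxy i)⟩
    -- If ω(x, y) is not a unit, go through x + w: ω(x, x + w) = ω(x, w) is a unit, and so is ω(x +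
    -- w, y), a non-unit plus a unit. As w is orthogonal to the first k vectors, both transvections
    -- fix them.
    obtain ⟨w, hw, hwx, hwy⟩ := hSs.exists_orthogonal hs' hS
    have hz : ∀ i : Fin k, symp (s' i.castSucc) (x + w) = symp (s' i.castSucc) x := fun i => by
      rw [symp_add_right, ← hS, hw, add_zero]
    have u1 : IsUnit (symp x (x + w)) := by
      rw [symp_add_right, symp_self, zero_add]
      exact hwx
    have u2 : IsUnit (symp (x + w) y) := by
      rw [symp_add_left]
      obtain ⟨v, hv⟩ := hwy
      by_contra hcon
      have e1 : symp w y ∈ IsLocalRing.maximalIdeal ℤ_[ℓ] := by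
        have := Ideal.sub_mem _ ((IsLocalRing.mem_maximalIdeal _).2 hcon)
          ((IsLocalRing.mem_maximalIdeal _).2 hu)
        rwa [add_sub_cancel_left] at this
      refine (IsLocalRing.mem_maximalIdeal _).1 e1 ?_
      rw [symp_swap]
      exact IsUnit.neg ⟨v, hv⟩
    obtain ⟨T, hT, hT'⟩ := exists_transvection_map u1
    obtain ⟨T', hT1, hT1'⟩ := exists_transvection_map u2
    refine ⟨T' * T, ?_, fun i => ?_⟩
    · change (T'.1 * T.1) *ᵥ x = y
      rw [← Matrix.mulVec_mulVec, hT, hT1]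
    · change (T'.1 * T.1) *ᵥ _ = _
      rw [← Matrix.mulVec_mulVec, hT' _ (hz i).symm, hT1' _ ((hz i).trans (hxy i))]

/-- `t` is an isotropic family dual to `s`. -/
def IsIsoDual {k : ℕ} (s t : Fin k → Lat ℓ g) : Prop :=
  (∀ i j, symp (s i) (t j) = if i = j then 1 else 0) ∧ ∀ i j, symp (t i) (t j) = 0

theorem IsIsoDual.unimod {k : ℕ} {s t : Fin k → Lat ℓ g} (h : IsIsoDual s t) : Unimod s :=
  fun b => ⟨∑ j, b j • t j, fun i => by
    simp [symp_sum_right, symp_smul_right, h.1]⟩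

theorem IsIsoDual.symp_left {k : ℕ} {s t : Fin k → Lat ℓ g} (h : IsIsoDual s t) (i j : Fin k) :
    symp (t i) (s j) = if i = j then -1 else 0 := by
  rw [symp_swap, h.1]
  simp only [eq_comm (a := j)]
  split_ifs <;> simp

theorem symp_vecE_vecE (i j : Fin g) : symp (vecE i : Lat ℓ g) (vecE j) = 0 := by
  rw [symp_vecE]; simp [vecE]

theorem symp_vecF_vecF (i j : Fin g) : symp (vecF i : Lat ℓ g) (vecF j) = 0 := by
  rw [symp_vecF]; simp [vecF]

theorem symp_vecE_vecF (i j : Fin g) :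
    symp (vecE i : Lat ℓ g) (vecF j) = if i = j then 1 else 0 := by
  rw [symp_vecE]; simp [vecF, Pi.single_apply]

theorem symp_vecF_vecE (i j : Fin g) :
    symp (vecF i : Lat ℓ g) (vecE j) = if i = j then -1 else 0 := by
  rw [symp_vecF]; simp only [vecE, Pi.single_apply, Sum.inl.injEq]; split_ifs <;> simp

/-- Every alternating matrix is the Gram matrix of a tuple with an isotropic dual family. -/
theorem exists_gram {k : ℕ} (hk : k ≤ g) (G : Fin k → Fin k → ℤ_[ℓ])
    (hG : ∀ i j, G i j = -G j i) (hG0 : ∀ i, G i i = 0) :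
    ∃ s t : Fin k → Lat ℓ g, IsIsoDual s t ∧ ∀ i j, symp (s i) (s j) = G i j := by
  let c : Fin k → Fin g := Fin.castLE hk
  have hc : ∀ i j, c i = c j ↔ i = j := fun i j => (Fin.castLE_injective hk).eq_iff
  -- Half of the alternating matrix determines it, so s_i = e_i minus the sum of G_ij f_j over j < i
  -- suffices, with dual family t_i = f_i.
  refine ⟨fun i => vecE (c i) + ∑ j, (if j < i then -G i j else 0) • vecF (c j), fun i => vecF (c i),
    ⟨fun i j => ?_, fun i j => symp_vecF_vecF _ _⟩, fun i j => ?_⟩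
  · simp only [symp_add_left, symp_sum_left, symp_smul_left, symp_vecE_vecF, symp_vecF_vecF, hc,
      mul_zero, Finset.sum_const_zero, add_zero]
  · simp only [symp_add_left, symp_add_right, symp_sum_left, symp_sum_right, symp_smul_left,
      symp_smul_right, symp_vecE_vecF, symp_vecF_vecF, symp_vecE_vecE, symp_vecF_vecE, hc,
      mul_ite, mul_one, mul_zero, Finset.sum_ite_eq, Finset.sum_ite_eq', Finset.mem_univ, if_true,
      zero_add, add_zero, Finset.sum_const_zero, mul_neg]
    rcases lt_trichotomy i j with h | h | h
    · simp [h, h.not_gt, hG i j]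
    · simp [h, hG0]
    · simp [h, h.not_gt]

/-- The model tuple with the same Gram matrix has an isotropic dual, and Witt's theorem transports
it to s. The bound k ≤ g comes from the model. -/
theorem Unimod.exists_isoDual {k : ℕ} (hk : k ≤ g) {s : Fin k → Lat ℓ g} (hs : Unimod s) :
    ∃ t, IsIsoDual s t := by
  obtain ⟨s', t', h1, h2⟩ := exists_gram hk (fun i j => symp (s i) (s j))
    (fun i j => symp_swap _ _) fun i => symp_self _
  obtain ⟨S, hS⟩ := h1.unimod.exists_sp hs h2
  refine ⟨fun i => S.1 *ᵥ t' i, fun i j => ?_, fun i j => ?_⟩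
  · rw [← hS, symp_sp, h1.1]
  · rw [symp_sp, h1.2]

end Witt

/-! ### Standard finite abelian `ℓ`-groups -/

/-- The product of the cyclic groups `ℤ/ℓ^(a i)`. -/
abbrev Std (ℓ : ℕ) {k : ℕ} (a : Fin k → ℕ) : Type := ∀ i, ZMod (ℓ ^ a i)

/-- The exponents are required to be positive so that k is the rank of G; unimodularity of lifts and
the count of characters depend on this. -/
theorem exists_addEquiv_std {ℓ : ℕ} [hℓ : Fact ℓ.Prime] (G : Type) [AddCommGroup G] [Finite G]
    (hG : ∀ x : G, ∃ k : ℕ, ℓ ^ k • x = 0) :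
    ∃ (k : ℕ) (a : Fin k → ℕ), (∀ i, 1 ≤ a i) ∧ Nonempty (G ≃+ Std ℓ a) := by
  obtain ⟨N, hN⟩ := exists_pow_kill hG
  obtain ⟨ι, _, m, hm, ⟨e⟩⟩ := AddCommGroup.equiv_directSum_zmod_of_finite' G
  classical
  let e1 : G ≃+ ∀ i, ZMod (m i) := e.trans (DirectSum.addEquivProd fun i => ZMod (m i))
  have h1 : ∀ i, ∃ b, m i = ℓ ^ b := fun i => by
    have : ((ℓ ^ N : ℕ) : ZMod (m i)) = 0 := by
      have h2 : ℓ ^ N • (Pi.single i 1 : ∀ i, ZMod (m i)) = 0 := by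
        obtain ⟨x, hx⟩ := e1.surjective (Pi.single i 1)
        rw [← hx, ← map_nsmul, hN, map_zero]
      simpa using congrFun h2 i
    rw [ZMod.natCast_eq_zero_iff, Nat.dvd_prime_pow hℓ.out] at this
    exact ⟨this.choose, this.choose_spec.2⟩
  choose b hb using h1
  let r := (Fintype.equivFin ι).symm
  refine ⟨Fintype.card ι, fun i => b (r i), fun i => ?_, ⟨e1.trans ?_⟩⟩
  · by_contra h0
    have h3 := hm (r i)
    have h4 : ¬ 1 ≤ b (r i) := h0
    rw [hb, show b (r i) = 0 by omega, pow_zero] at h3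
    exact lt_irrefl _ h3
  · obtain rfl : m = fun i => ℓ ^ b i := funext hb
    exact { Equiv.piCongrLeft' (fun i => ZMod (ℓ ^ b i)) r.symm with map_add' := fun _ _ => rfl }

section Padic

variable {ℓ : ℕ} [Fact ℓ.Prime]

theorem toZModPow_surjective (N : ℕ) : Function.Surjective (PadicInt.toZModPow (p := ℓ) N) :=
  fun z => ⟨(z.val : ℤ_[ℓ]), by rw [map_natCast, ZMod.natCast_val, ZMod.cast_id', id]⟩

theorem toZModPow_eq_iff {N : ℕ} (x y : ℤ_[ℓ]) :
    PadicInt.toZModPow N x = PadicInt.toZModPow N y ↔ (ℓ : ℤ_[ℓ]) ^ N ∣ x - y := by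
  rw [← sub_eq_zero, ← map_sub, toZModPow_eq_zero_iff]

theorem pow_dvd_pow_mul_iff {M N : ℕ} (x : ℤ_[ℓ]) :
    (ℓ : ℤ_[ℓ]) ^ M ∣ (ℓ : ℤ_[ℓ]) ^ N * x ↔ (ℓ : ℤ_[ℓ]) ^ (M - N) ∣ x := by
  rcases le_total N M with h | h
  · obtain ⟨d, rfl⟩ := Nat.exists_eq_add_of_le h
    rw [pow_add, mul_dvd_mul_iff_left (padic_pow_ne_zero N), Nat.add_sub_cancel_left]
  · rw [Nat.sub_eq_zero_of_le h, pow_zero]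
    exact ⟨fun _ => one_dvd _, fun _ => (pow_dvd_pow _ h).mul_right _⟩

variable (ℓ) in
/-- The homomorphism `ℤ/ℓ^m → ℤ/ℓ^N` given by multiplication with `ℓ^(N - m)`. -/
def cycHom (m N : ℕ) : ZMod (ℓ ^ m) →+ ZMod (ℓ ^ N) :=
  (PadicInt.toZModPow (p := ℓ) m).toAddMonoidHom.liftOfSurjective (toZModPow_surjective m)
    ⟨(PadicInt.toZModPow (p := ℓ) N).toAddMonoidHom.comp
      (AddMonoidHom.mulLeft ((ℓ : ℤ_[ℓ]) ^ (N - m))), fun x hx => by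
        have hx' : (ℓ : ℤ_[ℓ]) ^ m ∣ x := (toZModPow_eq_zero_iff x).1 hx
        change PadicInt.toZModPow N ((ℓ : ℤ_[ℓ]) ^ (N - m) * x) = 0
        rw [toZModPow_eq_zero_iff, pow_dvd_pow_mul_iff]
        exact (pow_dvd_pow _ (by omega)).trans hx'⟩

theorem cycHom_apply (m N : ℕ) (c : ℤ_[ℓ]) :
    cycHom ℓ m N (PadicInt.toZModPow m c) = PadicInt.toZModPow N ((ℓ : ℤ_[ℓ]) ^ (N - m) * c) :=
  AddMonoidHom.liftOfRightInverse_comp_apply (PadicInt.toZModPow (p := ℓ) m).toAddMonoidHom _ _ _ c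

variable {k : ℕ} {a : Fin k → ℕ}

/-- The homomorphism `x ↦ ℓ^(N - a i) x_i`. -/
def gen (N : ℕ) (a : Fin k → ℕ) (i : Fin k) : Std ℓ a →+ ZMod (ℓ ^ N) :=
  (cycHom ℓ (a i) N).comp (Pi.evalAddMonoidHom _ i)

theorem gen_apply {N : ℕ} {i : Fin k} {x : Std ℓ a} {c : ℤ_[ℓ]}
    (h : x i = PadicInt.toZModPow (a i) c) :
    gen N a i x = PadicInt.toZModPow N ((ℓ : ℤ_[ℓ]) ^ (N - a i) * c) := by
  rw [← cycHom_apply, ← h]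
  rfl

theorem std_eq_sum (x : Std ℓ a) : x = ∑ i, (x i).val • (Pi.single i 1 : Std ℓ a) := by
  ext j
  rw [Finset.sum_apply, Finset.sum_eq_single j]
  · simp
  · intro i _ h
    simp [h.symm]
  · simp

theorem std_hom_ext {B : Type*} [AddCommGroup B] {α β : Std ℓ a →+ B}
    (h : ∀ i, α (Pi.single i 1) = β (Pi.single i 1)) : α = β := by
  refine AddMonoidHom.ext fun x => ?_
  rw [std_eq_sum x, map_sum, map_sum]
  exact Finset.sum_congr rfl fun i _ => by rw [map_nsmul, map_nsmul, h]

theorem gen_single {N : ℕ} (i j : Fin k) :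
    gen N a i (Pi.single j 1) = if i = j then PadicInt.toZModPow N ((ℓ : ℤ_[ℓ]) ^ (N - a i)) else 0 := by
  split_ifs with h
  · subst h
    rw [gen_apply (c := 1) (by simp), mul_one]
  · rw [gen_apply (c := 0) (by simp [h]), mul_zero, map_zero]

/-- The value of α at the i-th generator is killed by ℓ^(a i), hence is a multiple of ℓ^(N - a i),
which is the value of `gen N a i` there. -/
theorem exists_eq_sum_gen {N : ℕ} (α : Std ℓ a →+ ZMod (ℓ ^ N)) :
    ∃ m : Fin k → ℕ, α = ∑ i, m i • gen N a i := by
  have h : ∀ i, ∃ m : ℕ, α (Pi.single i 1) = m • PadicInt.toZModPow N ((ℓ : ℤ_[ℓ]) ^ (N - a i)) := by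
    intro i
    obtain ⟨w, hw⟩ := toZModPow_surjective N (α (Pi.single i 1))
    have h1 : (ℓ ^ a i) • α (Pi.single i 1) = 0 := by
      rw [← map_nsmul, ← Pi.single_smul, nsmul_one, ZMod.natCast_self, Pi.single_zero, map_zero]
    rw [← hw, ← map_nsmul, toZModPow_eq_zero_iff, nsmul_eq_mul, Nat.cast_pow,
      pow_dvd_pow_mul_iff] at h1
    obtain ⟨d, rfl⟩ := h1
    obtain ⟨m, c, hm⟩ := exists_nat_dvd_sub N d
    refine ⟨m, ?_⟩
    rw [← hw, ← map_nsmul, toZModPow_eq_iff]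
    refine ⟨(ℓ : ℤ_[ℓ]) ^ (N - a i) * c, ?_⟩
    rw [nsmul_eq_mul]
    linear_combination (ℓ : ℤ_[ℓ]) ^ (N - a i) * hm
  choose m hm using h
  refine ⟨m, std_hom_ext fun j => ?_⟩
  rw [AddMonoidHom.finsetSum_apply, Finset.sum_eq_single j]
  · rw [AddMonoidHom.nsmul_apply, gen_single, if_pos rfl, hm]
  · intro i _ hij
    rw [AddMonoidHom.nsmul_apply, gen_single, if_neg hij, nsmul_zero]
  · simp

/-- The truncated differences cover three cases: the exponent is r for a i ≤ n, it is 0 for a i ≥ n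
+ r, and n + r - a i in between. -/
theorem scaleDown_gen {n r : ℕ} (i : Fin k) :
    scaleDown r (gen (ℓ := ℓ) (n + r) a i) = ℓ ^ ((n + r - a i) - (n - a i)) • gen n a i := by
  refine AddMonoidHom.ext fun x => ?_
  obtain ⟨c, hc⟩ := toZModPow_surjective (a i) (x i)
  rw [AddMonoidHom.nsmul_apply, gen_apply hc.symm]
  change ZMod.castHom (pow_dvd_pow ℓ (Nat.le_add_right n r)) (ZMod (ℓ ^ n)) (gen (n + r) a i x) = _
  rw [gen_apply hc.symm, ZMod.castHom_apply, PadicInt.cast_toZModPow _ _ (Nat.le_add_right n r),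
    ← map_nsmul, nsmul_eq_mul, Nat.cast_pow, ← mul_assoc, ← pow_add]
  congr 3
  omega

theorem pow_smul_gen {n : ℕ} (i : Fin k) : ℓ ^ (min (a i) n) • gen (ℓ := ℓ) n a i = 0 := by
  refine AddMonoidHom.ext fun x => ?_
  obtain ⟨c, hc⟩ := toZModPow_surjective (a i) (x i)
  rw [AddMonoidHom.nsmul_apply, gen_apply hc.symm, ← map_nsmul, nsmul_eq_mul, Nat.cast_pow,
    ← mul_assoc, ← pow_add, AddMonoidHom.zero_apply, toZModPow_eq_zero_iff]
  exact (pow_dvd_pow _ (by omega)).mul_right _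

end Padic

/-! ### Differences of `ψ`-invariants -/

/-- The group of homomorphisms `δ : H^∨[ℓ^n] → H` with `⟨ℓ^r α, β⟩ = ⟨ℓ^r β, α⟩`. -/
def Delta (ℓ n : ℕ) (H : Type) [AddCommGroup H] : AddSubgroup ((H →+ ZMod (ℓ ^ n)) →+ H) where
  carrier := {δ | ∀ (r : ℕ) (α β : H →+ ZMod (ℓ ^ (n + r))),
    β (δ (scaleDown r α)) = α (δ (scaleDown r β))}
  zero_mem' := fun r α β => by simp
  add_mem' := fun {δ δ'} h h' r α β => by
    rw [AddMonoidHom.add_apply, AddMonoidHom.add_apply, map_add, map_add, h, h']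
  neg_mem' := fun {δ} h r α β => by
    rw [AddMonoidHom.neg_apply, AddMonoidHom.neg_apply, map_neg, map_neg, h]

section DeltaStd

variable {ℓ : ℕ} [Fact ℓ.Prime] {n k : ℕ} {a : Fin k → ℕ}

/-- The i-th generator is killed by ℓ^(min (a i) n), so the j-th coordinate of its image is
divisible by ℓ^((a i - n) + (a j - a i)). Symmetry of the pairing then forces the same parameter y
on the transposed entry. The sign anticipates `IsLift.psiRel_symmMap`. -/
theorem exists_pair_of_mem_delta {δ : (Std ℓ a →+ ZMod (ℓ ^ n)) →+ Std ℓ a}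
    (hδ : δ ∈ Delta ℓ n (Std ℓ a)) {i j : Fin k} (hij : a i ≤ a j) :
    ∃ y : ℤ_[ℓ], δ (gen n a j) i = PadicInt.toZModPow (a i) (-((ℓ : ℤ_[ℓ]) ^ (a j - n) * y)) ∧
      δ (gen n a i) j =
        PadicInt.toZModPow (a j) (-((ℓ : ℤ_[ℓ]) ^ ((a i - n) + (a j - a i)) * y)) := by
  obtain ⟨D, hD⟩ := toZModPow_surjective (a j) (δ (gen n a i) j)
  obtain ⟨D', hD'⟩ := toZModPow_surjective (a i) (δ (gen n a j) i)
  have h1 : (ℓ : ℤ_[ℓ]) ^ ((a i - n) + (a j - a i)) ∣ D := by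
    have h := congrFun (congrArg δ (pow_smul_gen (ℓ := ℓ) (a := a) (n := n) i)) j
    rw [map_nsmul, map_zero, Pi.smul_apply, ← hD, ← map_nsmul, Pi.zero_apply,
      toZModPow_eq_zero_iff, nsmul_eq_mul, Nat.cast_pow, pow_dvd_pow_mul_iff] at h
    exact (pow_dvd_pow _ (by omega)).trans h
  obtain ⟨E, rfl⟩ := h1
  refine ⟨-E, ?_, by rw [← hD]; ring_nf⟩
  -- With r = a j - n the modulus exponent n + r is max n (a j), large enough for both cyclic
  -- factors to embed.
  have h := hδ (a j - n) (gen _ a i) (gen _ a j)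
  rw [scaleDown_gen, scaleDown_gen, map_nsmul, map_nsmul, map_nsmul, map_nsmul, gen_apply hD.symm,
    gen_apply hD'.symm, ← map_nsmul, ← map_nsmul, toZModPow_eq_iff, nsmul_eq_mul, nsmul_eq_mul,
    Nat.cast_pow, Nat.cast_pow] at h
  rw [← hD', toZModPow_eq_iff]
  have e : (ℓ : ℤ_[ℓ]) ^ (n + (a j - n) - a i - (n - a i)) * ((ℓ : ℤ_[ℓ]) ^ (n + (a j - n) - a j)
        * ((ℓ : ℤ_[ℓ]) ^ ((a i - n) + (a j - a i)) * E))
      - (ℓ : ℤ_[ℓ]) ^ (n + (a j - n) - a j - (n - a j)) * ((ℓ : ℤ_[ℓ]) ^ (n + (a j - n) - a i) * D')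
      = (ℓ : ℤ_[ℓ]) ^ (n + (a j - n) - a i) * ((ℓ : ℤ_[ℓ]) ^ (a j - n) * E - D') := by
    rw [show n + (a j - n) - a j - (n - a j) = 0 by omega, pow_zero, one_mul, mul_sub,
      ← mul_assoc, ← mul_assoc, ← mul_assoc, ← pow_add, ← pow_add, ← pow_add]
    congr 3
    omega
  rw [e, pow_dvd_pow_mul_iff, show n + (a j - n) - (n + (a j - n) - a i) = a i by omega] at h
  rw [← dvd_neg]
  convert h using 1
  ring

theorem exists_of_mem_delta {δ : (Std ℓ a →+ ZMod (ℓ ^ n)) →+ Std ℓ a}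
    (hδ : δ ∈ Delta ℓ n (Std ℓ a)) :
    ∃ y : Fin k → Fin k → ℤ_[ℓ], (∀ i j, y i j = y j i) ∧ ∀ i j, δ (gen n a i) j =
        PadicInt.toZModPow (a j) (-((ℓ : ℤ_[ℓ]) ^ ((a i - n) + (a j - a i)) * y i j)) := by
  choose y h1 h2 using fun (i j : Fin k) (hij : a i ≤ a j) => exists_pair_of_mem_delta hδ hij
  -- Ties between equal exponents are broken by the index, so that each unordered pair receives one
  -- parameter and y is symmetric.
  let P : Fin k → Fin k → Prop := fun i j => a i < a j ∨ (a i = a j ∧ i ≤ j)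
  have hP : ∀ i j, P i j → a i ≤ a j := fun i j h => h.elim le_of_lt fun h => h.1.le
  have hP' : ∀ i j, ¬ P i j → P j i := fun i j h => by
    simp only [P] at h ⊢
    omega
  classical
  refine ⟨fun i j => if h : P i j then y i j (hP _ _ h) else y j i (hP _ _ (hP' _ _ h)),
    fun i j => ?_, fun i j => ?_⟩
  · by_cases h : P i j
    · by_cases h' : P j i
      · obtain rfl : i = j := by
          simp only [P] at h h'
          omega
        rfl
      · simp only [dif_pos h, dif_neg h']
    · simp only [dif_neg h, dif_pos (hP' _ _ h)]
  · by_cases h : P i j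
    · simp only [dif_pos h]
      exact h2 _ _ _
    · simp only [dif_neg h]
      rw [Nat.sub_eq_zero_of_le (hP _ _ (hP' _ _ h)), add_zero]
      exact h1 _ _ _

theorem hom_gen_ext {B : Type*} [AddCommGroup B] {δ δ' : (Std ℓ a →+ ZMod (ℓ ^ n)) →+ B}
    (h : ∀ i, δ (gen n a i) = δ' (gen n a i)) : δ = δ' := by
  refine AddMonoidHom.ext fun α => ?_
  obtain ⟨m, rfl⟩ := exists_eq_sum_gen α
  simp only [map_sum, map_nsmul, h]

end DeltaStd

/-! ### Surjections from the symplectic lattice to a standard group -/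

section Lifts

variable {ℓ : ℕ} [Fact ℓ.Prime] {g n k : ℕ} {a : Fin k → ℕ}

/-- The vectors `s i` represent the coordinates of `f`. -/
def IsLift (f : Lat ℓ g →+ Std ℓ a) (s : Fin k → Lat ℓ g) : Prop :=
  ∀ x i, f x i = PadicInt.toZModPow (a i) (symp x (s i))

theorem exists_isLift (f : Lat ℓ g →+ Std ℓ a) : ∃ s, IsLift f s := by
  choose s hs using fun i => exists_rep ((Pi.evalAddMonoidHom _ i).comp f)
  exact ⟨s, fun x i => hs i x⟩

/-- Preimages x_j of the generators satisfy -ω(s_i, x_j) ≡ δ_ij mod ℓ, because a i ≥ 1, and a matrix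
congruent to 1 mod ℓ is invertible. -/
theorem IsLift.unimod {f : Lat ℓ g →+ Std ℓ a} {s : Fin k → Lat ℓ g} (hs : IsLift f s)
    (hf : Function.Surjective f) (ha : ∀ i, 1 ≤ a i) : Unimod s := by
  choose x hx using fun j => hf (Pi.single j 1)
  have h : ∀ i j, ∃ b, -symp (s i) (x j) = (1 : Matrix (Fin k) (Fin k) ℤ_[ℓ]) i j + ℓ * b := by
    intro i j
    have h1 := hs (x j) i
    have h2 : (Pi.single j 1 : Std ℓ a) i = PadicInt.toZModPow (a i)
        ((1 : Matrix (Fin k) (Fin k) ℤ_[ℓ]) i j) := by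
      rw [Matrix.one_apply]
      split_ifs with hij
      · subst hij; simp
      · simp [hij]
    rw [hx, h2, eq_comm, toZModPow_eq_iff] at h1
    obtain ⟨b, hb⟩ := (dvd_pow_self (ℓ : ℤ_[ℓ]) (Nat.one_le_iff_ne_zero.1 (ha i))).trans h1
    exact ⟨b, by rw [← hb, symp_swap (s i)]; ring⟩
  choose b hb using h
  obtain ⟨C, hC⟩ := exists_inverse_one_add (Matrix.of b)
  intro v
  refine ⟨∑ j, (-(C *ᵥ v) j) • x j, fun i => ?_⟩
  have e : ∀ j, symp (s i) (x j) = -(1 + (ℓ : ℤ_[ℓ]) • Matrix.of b) i j := fun j => by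
    rw [← neg_eq_iff_eq_neg, hb]
    simp
  have e2 := congrFun (congrArg (fun M => M *ᵥ v) hC) i
  simp only [← Matrix.mulVec_mulVec, Matrix.one_mulVec] at e2
  rw [symp_sum_right, ← e2]
  simp only [symp_smul_right, e]
  rw [Matrix.mulVec, dotProduct]
  exact Finset.sum_congr rfl fun j _ => by ring

/-- The homomorphism with given lifts. -/
def ofLift (a : Fin k → ℕ) (s : Fin k → Lat ℓ g) : Lat ℓ g →+ Std ℓ a :=
  AddMonoidHom.mk' (fun x i => PadicInt.toZModPow (a i) (symp x (s i))) fun x y => by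
    ext i
    rw [symp_add_left, map_add]
    rfl

theorem isLift_ofLift (s : Fin k → Lat ℓ g) : IsLift (ofLift a s) s := fun _ _ => rfl

/-- The Gram matrix of a lift, modulo `ℓ^(min (a i) (a j))`, only depends on the pushforward of
the symplectic form. -/
theorem IsLift.gram {f f' : Lat ℓ g →+ Std ℓ a} {s s' : Fin k → Lat ℓ g} (hs : IsLift f s)
    (hs' : IsLift f' s') (h : omegaAdd f 1 = omegaAdd f' 1) {i j : Fin k} (hij : a i ≤ a j) :
    (ℓ : ℤ_[ℓ]) ^ a i ∣ symp (s i) (s j) - symp (s' i) (s' j) := by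
  let α : Std ℓ a →+ ZMod (ℓ ^ a i) := gen (a i) a i
  let β : Std ℓ a →+ ZMod (ℓ ^ a i) := gen (a i) a j
  have h1 : ∀ {f : Lat ℓ g →+ Std ℓ a} {s : Fin k → Lat ℓ g}, IsLift f s →
      evalPair α β (omegaAdd f 1) = PadicInt.toZModPow (a i) (symp (s i) (s j)) := by
    intro f s hs
    have e1 : ∀ x, α (f x) = PadicInt.toZModPow (a i) (symp x (s i)) := fun x => by
      rw [gen_apply (hs x i), Nat.sub_self, pow_zero, one_mul]
    have e2 : ∀ x, β (f x) = PadicInt.toZModPow (a i) (symp x (s j)) := fun x => by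
      rw [gen_apply (hs x j), Nat.sub_eq_zero_of_le hij, pow_zero, one_mul]
    rw [evalPair_omegaAdd e1 e2, one_mul]
  rw [← toZModPow_eq_iff, ← h1 hs, ← h1 hs', h]

/-- Adding ℓ^(a i)-multiples of the isotropic family t to s_i changes the Gram matrix linearly,
without quadratic terms. The congruences allow the Gram matrix of s' to be matched exactly, and then
Witt's theorem applies. -/
theorem IsIsoDual.exists_sp_of_congr {s t s' : Fin k → Lat ℓ g} (h : IsIsoDual s t)
    (hs' : Unimod s') (hg : ∀ i j, a i ≤ a j →
      (ℓ : ℤ_[ℓ]) ^ a i ∣ symp (s' i) (s' j) - symp (s i) (s j)) :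
    ∃ (S : Sp ℓ g) (x : Fin k → Lat ℓ g), ∀ i, S.1 *ᵥ s' i = s i + (ℓ : ℤ_[ℓ]) ^ a i • x i := by
  let P : Fin k → Fin k → Prop := fun i j => a i < a j ∨ (a i = a j ∧ i < j)
  have hP : ∀ i j, P i j → a i ≤ a j := fun i j h => h.elim le_of_lt fun h => h.1.le
  choose E hE using hg
  classical
  -- The error at (i, j) is divisible by the smaller of the two powers, so it is absorbed entirely
  -- by the vector with the smaller exponent.
  let X : Fin k → Fin k → ℤ_[ℓ] := fun i j => if h : P i j then -E i j (hP _ _ h) else 0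
  have hX : ∀ i j, (ℓ : ℤ_[ℓ]) ^ a j * X j i - (ℓ : ℤ_[ℓ]) ^ a i * X i j
      = symp (s' i) (s' j) - symp (s i) (s j) := by
    intro i j
    by_cases h1 : P i j
    · have h2 : ¬ P j i := by
        simp only [P] at h1 ⊢
        omega
      simp only [X, dif_pos h1, dif_neg h2]
      rw [hE i j (hP _ _ h1)]
      ring
    · by_cases h2 : P j i
      · simp only [X, dif_pos h2, dif_neg h1]
        rw [mul_neg, ← hE j i (hP _ _ h2), symp_swap (s' j), symp_swap (s j)]
        ring
      · obtain rfl : i = j := by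
          simp only [P] at h1 h2
          omega
        simp only [X, dif_neg h1, symp_self]
        ring
  let s'' : Fin k → Lat ℓ g := fun i => s i + (ℓ : ℤ_[ℓ]) ^ a i • ∑ j, X i j • t j
  have h2 : IsIsoDual s'' t := ⟨fun i j => by
    simp [s'', symp_add_left, symp_smul_left, symp_sum_left, h.2, h.1], h.2⟩
  obtain ⟨S, hS⟩ := hs'.exists_sp h2.unimod fun i j => by
    simp only [s'', symp_add_left, symp_add_right, symp_smul_left, symp_smul_right, symp_sum_left,
      symp_sum_right, h.1, h.2, h.symp_left, mul_ite, mul_one, mul_zero, mul_neg,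
      Finset.sum_ite_eq, Finset.sum_ite_eq', Finset.mem_univ, if_true, Finset.sum_const_zero,
      add_zero]
    linear_combination -hX i j
  exact ⟨S, _, hS⟩

/-- The symplectic group acts transitively on surjections to `Std ℓ a` with given pushforward of
the symplectic form. -/
theorem exists_sp_comp {f f' : Lat ℓ g →+ Std ℓ a} (hk : k ≤ g) (ha : ∀ i, 1 ≤ a i)
    (hf : Function.Surjective f) (hf' : Function.Surjective f')
    (h : omegaAdd f 1 = omegaAdd f' 1) : ∃ S : Sp ℓ g, ∀ x, f (S.1 *ᵥ x) = f' x := by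
  obtain ⟨s, hs⟩ := exists_isLift f
  obtain ⟨s', hs'⟩ := exists_isLift f'
  obtain ⟨t, ht⟩ := (hs.unimod hf ha).exists_isoDual hk
  obtain ⟨S, x, hS⟩ := ht.exists_sp_of_congr (a := a) (hs'.unimod hf' ha)
    fun i j hij => hs'.gram hs h.symm hij
  refine ⟨S, fun z => funext fun i => ?_⟩
  rw [hs, hs', toZModPow_eq_iff]
  refine ⟨-symp (S.1 *ᵥ z) (x i), ?_⟩
  rw [← symp_sp S z (s' i), hS, symp_add_right, symp_smul_right]
  ring

/-- The linear map `x ↦ ∑ c i j ω(x, t i) t j`. -/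
def symmMap (c : Fin k → Fin k → ℤ_[ℓ]) (t : Fin k → Lat ℓ g) : Lat ℓ g →ₗ[ℤ_[ℓ]] Lat ℓ g :=
  ∑ i, ∑ j, (c i j • sympBilin.flip (t i)).smulRight (t j)

theorem symmMap_apply (c : Fin k → Fin k → ℤ_[ℓ]) (t : Fin k → Lat ℓ g) (x : Lat ℓ g) :
    symmMap c t x = ∑ i, ∑ j, (c i j * symp x (t i)) • t j := by
  simp [symmMap, LinearMap.sum_apply]

theorem symp_symmMap {c : Fin k → Fin k → ℤ_[ℓ]} (hc : ∀ i j, c i j = c j i)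
    (t : Fin k → Lat ℓ g) (x y : Lat ℓ g) :
    symp (symmMap c t x) y = -symp x (symmMap c t y) := by
  simp only [symmMap_apply, symp_sum_left, symp_sum_right, symp_smul_left, symp_smul_right]
  rw [Finset.sum_comm, ← Finset.sum_neg_distrib]
  refine Finset.sum_congr rfl fun i _ => ?_
  rw [← Finset.sum_neg_distrib]
  refine Finset.sum_congr rfl fun j _ => ?_
  rw [hc, symp_swap (t i) y]
  ring

/-- Isotropy of t removes the second-order term, so that `id + symmMap c t` is exactly symplectic
for symmetric c. -/
theorem symp_symmMap_symmMap {c : Fin k → Fin k → ℤ_[ℓ]} {t : Fin k → Lat ℓ g}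
    (ht : ∀ i j, symp (t i) (t j) = 0) (x y : Lat ℓ g) :
    symp (symmMap c t x) (symmMap c t y) = 0 := by
  simp only [symmMap_apply, symp_sum_left, symp_sum_right, symp_smul_left, symp_smul_right, ht,
    mul_zero, Finset.sum_const_zero]

theorem symmMap_dual {c : Fin k → Fin k → ℤ_[ℓ]} {s t : Fin k → Lat ℓ g} (h : IsIsoDual s t)
    (i : Fin k) : symmMap c t (s i) = ∑ j, c i j • t j := by
  rw [symmMap_apply, Finset.sum_eq_single i]
  · simp [h.1]
  · intro j _ hj
    simp [h.1, hj.symm]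
  · simp

theorem exists_skew_of_linear (φ : Lat ℓ g →ₗ[ℤ_[ℓ]] Lat ℓ g)
    (h : ∀ x y, symp (φ x) y = -symp x (φ y)) : ∃ M : skewSymp ℓ g, ∀ x, M.1 *ᵥ x = φ x :=
  ⟨⟨LinearMap.toMatrix' φ, fun x y => by
    rw [LinearMap.toMatrix'_mulVec, LinearMap.toMatrix'_mulVec, h]⟩,
    fun x => LinearMap.toMatrix'_mulVec φ x⟩

theorem isAdmissible_sp (S : Sp ℓ g) : IsAdmissible n (S.1 - 1) 0 := by
  have h1 := SymplecticGroup.mem_iff.1 S.2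
  have h2 := SymplecticGroup.mem_iff'.1 S.2
  refine ⟨1, ?_, ?_⟩
  · rw [mul_zero, zero_smul, one_smul, Matrix.transpose_sub, Matrix.transpose_one]
    rw [← sub_eq_zero] at h2
    rw [← h2]
    noncomm_ring
  · rw [mul_zero, zero_smul, one_smul, Matrix.transpose_sub, Matrix.transpose_one]
    rw [← sub_eq_zero] at h1
    rw [← h1]
    noncomm_ring

theorem skewSymp_mul_J (M : skewSymp ℓ g) :
    M.1 * Matrix.J (Fin g) ℤ_[ℓ] + Matrix.J (Fin g) ℤ_[ℓ] * M.1ᵀ = 0 := by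
  have e := congrArg (fun B : Mat ℓ g =>
    -(Matrix.J (Fin g) ℤ_[ℓ] * B * Matrix.J (Fin g) ℤ_[ℓ])) (skewSymp_iff.1 M.2)
  simp only [Matrix.mul_add, Matrix.add_mul, Matrix.mul_zero, Matrix.zero_mul, neg_zero] at e
  rw [← Matrix.mul_assoc, ← Matrix.mul_assoc, Matrix.mul_assoc _ _ (Matrix.J (Fin g) ℤ_[ℓ]),
    Matrix.J_squared] at e
  rw [← e, Matrix.mul_neg, Matrix.mul_one, Matrix.neg_mul, Matrix.neg_mul, Matrix.one_mul]
  abel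

theorem isAdmissible_skew (M : skewSymp ℓ g) : IsAdmissible n M.1 0 := by
  refine ⟨0, ?_, ?_⟩
  · rw [mul_zero, zero_smul, zero_smul, add_zero, skewSymp_iff.1 M.2]
  · rw [mul_zero, zero_smul, zero_smul, add_zero, skewSymp_mul_J M]

/-- For u = 0 the ω-term of the compatibility vanishes and the symmetric relation is left. -/
theorem psiHom_mem_delta {H : Type} [AddCommGroup H] {A : Mat ℓ g} {f : Lat ℓ g →+ H}
    (hA : IsAdmissible n A 0) (hf : ∀ x, f (A *ᵥ x) = 0) : psiHom hA hf ∈ Delta ℓ n H := by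
  intro r α β
  rw [psiHom_compat hA hf]
  simp [omegaAdd, wedge]

/-- The symmetric coefficients attached to the parameters `y` of an element of `Delta`. -/
def deltaCoeff (a : Fin k → ℕ) (y : Fin k → Fin k → ℤ_[ℓ]) (i j : Fin k) : ℤ_[ℓ] :=
  (ℓ : ℤ_[ℓ]) ^ (a i + (a j - a i)) * y i j

theorem deltaCoeff_symm {y : Fin k → Fin k → ℤ_[ℓ]} (hy : ∀ i j, y i j = y j i) (i j : Fin k) :
    deltaCoeff a y i j = deltaCoeff a y j i := by
  rw [deltaCoeff, deltaCoeff, hy]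
  congr 2
  omega

/-- The coefficient at (i, j) carries ℓ^(max (a i) (a j)), hence vanishes in the coordinate
concerned. -/
theorem IsLift.map_symmMap {f : Lat ℓ g →+ Std ℓ a} {s t : Fin k → Lat ℓ g} (hs : IsLift f s)
    (ht : IsIsoDual s t) (y : Fin k → Fin k → ℤ_[ℓ]) (hy : ∀ i j, y i j = y j i) (x : Lat ℓ g) :
    f (symmMap (deltaCoeff a y) t x) = 0 := by
  ext i
  rw [hs, symp_symmMap (deltaCoeff_symm hy), symmMap_dual ht, symp_sum_right, Pi.zero_apply, toZModPow_eq_zero_iff, dvd_neg]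
  refine Finset.dvd_sum fun j _ => ?_
  rw [symp_smul_right, deltaCoeff, pow_add, mul_assoc, mul_assoc]
  exact dvd_mul_right _ _

/-- The i-th generator is represented by ℓ^(n - a i) s_i, whose image is the sum of ℓ^(n - a i) c_ij
t_j. Dividing by ℓ^n leaves the stated exponents, and ω(t_j, s_j) = -1 gives the sign. -/
theorem IsLift.psiRel_symmMap {f : Lat ℓ g →+ Std ℓ a} {s t : Fin k → Lat ℓ g} (hs : IsLift f s)
    (ht : IsIsoDual s t) (y : Fin k → Fin k → ℤ_[ℓ]) {A : Mat ℓ g}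
    (hA : ∀ x, A *ᵥ x = symmMap (deltaCoeff a y) t x) (i : Fin k) {z : Std ℓ a}
    (hz : ∀ j, z j = PadicInt.toZModPow (a j)
      (-((ℓ : ℤ_[ℓ]) ^ ((a i - n) + (a j - a i)) * y i j))) : PsiRel n A f (gen n a i) z := by
  refine ⟨(ℓ : ℤ_[ℓ]) ^ (n - a i) • s i,
    ∑ j, ((ℓ : ℤ_[ℓ]) ^ ((a i - n) + (a j - a i)) * y i j) • t j, fun x => ?_, ?_, ?_⟩
  · rw [gen_apply (hs x i), symp_smul_right]
  · rw [hA, map_smul, symmMap_dual ht, Finset.smul_sum, Finset.smul_sum]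
    refine Finset.sum_congr rfl fun j _ => ?_
    rw [smul_smul, smul_smul, deltaCoeff, ← mul_assoc, ← mul_assoc, ← pow_add, ← pow_add]
    congr 3
    omega
  · ext j
    rw [hs, hz, symp_sum_left]
    congr 1
    simp [symp_smul_left, ht.symp_left]

theorem psiRel_of_gen {A : Mat ℓ g} {u : ℤ_[ℓ]} (hA : IsAdmissible n A u) {f : Lat ℓ g →+ Std ℓ a}
    (hf : ∀ x, f (A *ᵥ x) = 0) {δ : (Std ℓ a →+ ZMod (ℓ ^ n)) →+ Std ℓ a}
    (h : ∀ i, PsiRel n A f (gen n a i) (δ (gen n a i))) (α : Std ℓ a →+ ZMod (ℓ ^ n)) :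
    PsiRel n A f α (δ α) := by
  rw [← hom_gen_ext (δ := psiHom hA hf) (δ' := δ) fun i => (psiHom_spec hA hf _).unique hf (h i)]
  exact psiHom_spec hA hf α

/-- The witness is id plus the symmetric map whose coefficients are read off from δ. Multiplication
by these stabilisers of f shifts ψ arbitrarily within `Delta`, which is the source of the factor
1/|Delta|. -/
theorem exists_sp_of_mem_delta (hk : k ≤ g) (ha : ∀ i, 1 ≤ a i) {f : Lat ℓ g →+ Std ℓ a}
    (hf : Function.Surjective f) {δ : (Std ℓ a →+ ZMod (ℓ ^ n)) →+ Std ℓ a}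
    (hδ : δ ∈ Delta ℓ n (Std ℓ a)) :
    ∃ S : Sp ℓ g, (∀ x, f (S.1 *ᵥ x) = f x) ∧ ∀ α, PsiRel n (S.1 - 1) f α (δ α) := by
  obtain ⟨s, hs⟩ := exists_isLift f
  obtain ⟨t, ht⟩ := (hs.unimod hf ha).exists_isoDual hk
  obtain ⟨y, hy, hδ⟩ := exists_of_mem_delta hδ
  obtain ⟨S, hS⟩ := exists_sp_of_linear (LinearMap.id + symmMap (deltaCoeff a y) t) fun x y => by
    simp only [LinearMap.add_apply, LinearMap.id_apply, symp_add_left, symp_add_right,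
      symp_symmMap_symmMap ht.2, symp_symmMap (deltaCoeff_symm hy)]
    ring
  have hS' : ∀ x, (S.1 - 1) *ᵥ x = symmMap (deltaCoeff a y) t x := fun x => by
    rw [Matrix.sub_mulVec, hS, Matrix.one_mulVec]
    simp
  have hf0 : ∀ x, f ((S.1 - 1) *ᵥ x) = 0 := fun x => by rw [hS', hs.map_symmMap ht y hy]
  refine ⟨S, fun x => ?_, psiRel_of_gen (isAdmissible_sp S) hf0 fun i =>
    hs.psiRel_symmMap ht y hS' i (hδ i)⟩
  have := hf0 x
  rwa [Matrix.sub_mulVec, Matrix.one_mulVec, map_sub, sub_eq_zero] at this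

/-- The additive analogue: the symmetric map itself, without the identity, is a skew-symplectic
endomorphism. -/
theorem exists_skew_of_mem_delta (hk : k ≤ g) (ha : ∀ i, 1 ≤ a i) {f : Lat ℓ g →+ Std ℓ a}
    (hf : Function.Surjective f) {δ : (Std ℓ a →+ ZMod (ℓ ^ n)) →+ Std ℓ a}
    (hδ : δ ∈ Delta ℓ n (Std ℓ a)) :
    ∃ M : skewSymp ℓ g, (∀ x, f (M.1 *ᵥ x) = 0) ∧ ∀ α, PsiRel n M.1 f α (δ α) := by
  obtain ⟨s, hs⟩ := exists_isLift f
  obtain ⟨t, ht⟩ := (hs.unimod hf ha).exists_isoDual hk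
  obtain ⟨y, hy, hδ⟩ := exists_of_mem_delta hδ
  obtain ⟨M, hM⟩ := exists_skew_of_linear (symmMap (deltaCoeff a y) t)
    (symp_symmMap (deltaCoeff_symm hy) t)
  have hf0 : ∀ x, f (M.1 *ᵥ x) = 0 := fun x => by rw [hM, hs.map_symmMap ht y hy]
  exact ⟨M, hf0, psiRel_of_gen (isAdmissible_skew M) hf0 fun i =>
    hs.psiRel_symmMap ht y hM i (hδ i)⟩

/-- Every symmetric family of parameters defines an element of `Delta`. -/
theorem exists_delta_of_symm (y : Fin k → Fin k → ℤ_[ℓ]) (hy : ∀ i j, y i j = y j i) :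
    ∃ δ ∈ Delta ℓ n (Std ℓ a), ∀ i j, δ (gen n a i) j =
        PadicInt.toZModPow (a j) (-((ℓ : ℤ_[ℓ]) ^ ((a i - n) + (a j - a i)) * y i j)) := by
  -- The element is realised as the ψ of a skew endomorphism of ℤ_ℓ^(2k), so that membership in
  -- `Delta` needs no separate check.
  obtain ⟨s, t, ht, -⟩ := exists_gram (ℓ := ℓ) (le_refl k) (fun _ _ => 0) (by simp) (by simp)
  have hs := isLift_ofLift (a := a) s
  obtain ⟨M, hM⟩ := exists_skew_of_linear (symmMap (deltaCoeff a y) t)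
    (symp_symmMap (deltaCoeff_symm hy) t)
  have hf0 : ∀ x, ofLift a s (M.1 *ᵥ x) = 0 := fun x => by rw [hM, hs.map_symmMap ht y hy]
  refine ⟨psiHom (isAdmissible_skew M) hf0, psiHom_mem_delta _ _, fun i j => ?_⟩
  have := (psiHom_spec (isAdmissible_skew (n := n) M) hf0 (gen n a i)).unique hf0
    (hs.psiRel_symmMap ht y hM i (z := fun j => PadicInt.toZModPow (a j)
      (-((ℓ : ℤ_[ℓ]) ^ ((a i - n) + (a j - a i)) * y i j))) fun j => rfl)
  rw [this]

end Lifts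

/-! ### The order of `Sym²H[ℓ^n]` -/

section SymCount

set_option linter.unusedSectionVars false

variable {ℓ : ℕ} [Fact ℓ.Prime] {n k : ℕ}

/-- Index pairs `i ≤ j`. -/
abbrev PairIdx (k : ℕ) : Type := {p : Fin k × Fin k // p.1 ≤ p.2}

theorem card_torsion_zmod (m : ℕ) :
    Nat.card {z : ZMod (ℓ ^ m) // ℓ ^ n • z = 0} = ℓ ^ min m n := by
  rw [← Nat.card_zmod (ℓ ^ min m n)]
  symm
  refine Nat.card_congr (Equiv.ofBijective (fun z => ⟨cycHom ℓ (min m n) m z, ?_⟩) ⟨?_, ?_⟩)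
  · obtain ⟨c, rfl⟩ := toZModPow_surjective _ z
    rw [cycHom_apply, ← map_nsmul, toZModPow_eq_zero_iff, nsmul_eq_mul, Nat.cast_pow, ← mul_assoc,
      ← pow_add]
    exact (pow_dvd_pow _ (by omega)).mul_right _
  · intro z z' h
    have h := congrArg Subtype.val h
    obtain ⟨c, rfl⟩ := toZModPow_surjective _ z
    obtain ⟨c', rfl⟩ := toZModPow_surjective _ z'
    simp only [cycHom_apply] at h
    rw [toZModPow_eq_iff, ← mul_sub, pow_dvd_pow_mul_iff] at h
    rw [toZModPow_eq_iff]
    exact (pow_dvd_pow _ (by omega)).trans h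
  · rintro ⟨z, hz⟩
    obtain ⟨c, rfl⟩ := toZModPow_surjective _ z
    rw [← map_nsmul, toZModPow_eq_zero_iff, nsmul_eq_mul, Nat.cast_pow, pow_dvd_pow_mul_iff] at hz
    obtain ⟨d, rfl⟩ := hz
    refine ⟨PadicInt.toZModPow _ d, Subtype.ext ?_⟩
    change cycHom ℓ _ _ _ = _
    rw [cycHom_apply]
    congr 3
    omega

variable (ℓ) in
/-- Reduction of the `i`-th coordinate modulo a smaller power of `ℓ`. -/
def coordRed (a : Fin k → ℕ) (i : Fin k) (m : ℕ) (h : m ≤ a i) : Std ℓ a →ₗ[ℤ] ZMod (ℓ ^ m) :=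
  ((ZMod.castHom (pow_dvd_pow ℓ h) (ZMod (ℓ ^ m))).toAddMonoidHom.comp
    (Pi.evalAddMonoidHom _ i)).toIntLinearMap

theorem coordRed_single (a : Fin k → ℕ) (i j : Fin k) (m : ℕ) (h : m ≤ a i) :
    coordRed ℓ a i m h (Pi.single j 1) = if i = j then 1 else 0 := by
  change ZMod.castHom (pow_dvd_pow ℓ h) (ZMod (ℓ ^ m)) ((Pi.single j 1 : Std ℓ a) i) = _
  split_ifs with hij
  · subst hij
    rw [Pi.single_eq_same, map_one]
  · rw [Pi.single_eq_of_ne hij, map_zero]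

variable (ℓ) in
/-- The coordinates of a symmetric tensor. -/
def symCoordTensor (a : Fin k → ℕ) (p : PairIdx k) :
    Std ℓ a ⊗[ℤ] Std ℓ a →ₗ[ℤ] ZMod (ℓ ^ min (a p.1.1) (a p.1.2)) :=
  LinearMap.mul' ℤ _ ∘ₗ TensorProduct.map (coordRed ℓ a p.1.1 _ (min_le_left _ _))
      (coordRed ℓ a p.1.2 _ (min_le_right _ _)) +
    -- On the diagonal the symmetrised term would double the coordinate, so it is dropped there.
    (if p.1.1 = p.1.2 then (0 : ℤ) else 1) •
      (LinearMap.mul' ℤ _ ∘ₗ TensorProduct.map (coordRed ℓ a p.1.2 _ (min_le_right _ _))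
        (coordRed ℓ a p.1.1 _ (min_le_left _ _)))

theorem symCoordTensor_tmul (a : Fin k → ℕ) (i j : Fin k) (hij : i ≤ j) (x y : Std ℓ a) :
    symCoordTensor ℓ a ⟨(i, j), hij⟩ (x ⊗ₜ y) =
      coordRed ℓ a i (min (a i) (a j)) (min_le_left _ _) x *
        coordRed ℓ a j (min (a i) (a j)) (min_le_right _ _) y +
      (if i = j then (0 : ℤ) else 1) • (coordRed ℓ a j (min (a i) (a j)) (min_le_right _ _) x *
        coordRed ℓ a i (min (a i) (a j)) (min_le_left _ _) y) := rfl

theorem symCoordTensor_comm (a : Fin k → ℕ) (p : PairIdx k) (x y : Std ℓ a) :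
    symCoordTensor ℓ a p (x ⊗ₜ y) = symCoordTensor ℓ a p (y ⊗ₜ x) := by
  obtain ⟨⟨i, j⟩, hij⟩ := p
  rw [symCoordTensor_tmul, symCoordTensor_tmul]
  by_cases h : i = j
  · subst h
    simp only [if_true, zero_smul, add_zero]
    exact mul_comm _ _
  · simp only [if_neg h, one_smul]
    ring

variable (ℓ) in
/-- The coordinates on `Sym²`. -/
def symCoord (a : Fin k → ℕ) :
    SymSq (Std ℓ a) →ₗ[ℤ] ∀ p : PairIdx k, ZMod (ℓ ^ min (a p.1.1) (a p.1.2)) :=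
  (wedgeSq (Std ℓ a)).liftQ (LinearMap.pi (symCoordTensor ℓ a)) <| by
    rw [wedgeSq, Submodule.span_le]
    rintro _ ⟨x, y, rfl⟩
    ext p
    rw [LinearMap.pi_apply, wedge, map_sub, symCoordTensor_comm, sub_self]
    rfl

/-- The class of `x ⊗ y` in `Sym²`. -/
def symMk {G : Type*} [AddCommGroup G] (x y : G) : SymSq G := (wedgeSq G).mkQ (x ⊗ₜ[ℤ] y)

theorem symMk_comm {G : Type*} [AddCommGroup G] (x y : G) : symMk x y = symMk y x := by
  rw [← sub_eq_zero, symMk, symMk, ← map_sub, Submodule.mkQ_apply, Submodule.Quotient.mk_eq_zero]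
  exact Submodule.subset_span ⟨x, y, rfl⟩

theorem symCoord_single (a : Fin k → ℕ) (p : PairIdx k) :
    symCoord ℓ a (symMk (Pi.single p.1.1 1) (Pi.single p.1.2 1)) = Pi.single p 1 := by
  ext q
  change symCoordTensor ℓ a q (_ ⊗ₜ _) = _
  obtain ⟨⟨i, j⟩, hij⟩ := p
  obtain ⟨⟨i', j'⟩, hij'⟩ := q
  simp only at hij hij'
  have e1 : (Pi.single (⟨(i, j), hij⟩ : PairIdx k) 1 :
      ∀ p : PairIdx k, ZMod (ℓ ^ min (a p.1.1) (a p.1.2))) ⟨(i', j'), hij'⟩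
      = if i' = i ∧ j' = j then 1 else 0 := by
    split_ifs with h
    · obtain ⟨rfl, rfl⟩ := h
      simp
    · rw [Pi.single_eq_of_ne]
      simpa using h
  rw [e1]
  rw [symCoordTensor_tmul]
  simp only [coordRed_single]
  by_cases h1 : i' = i <;> by_cases h2 : j' = j
  · subst h1 h2
    by_cases h3 : i' = j'
    · simp [h3]
    · simp [h3, Ne.symm h3]
  · by_cases h3 : j' = i
    · have h4 : i' = j' := h1.trans h3.symm
      simp [h2, h4]
    · simp [h2, h3]
  · by_cases h3 : i' = j
    · have h4 : i' = j' := h3.trans h2.symm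
      have h5 : ¬ j' = i := h4 ▸ h1
      simp [h4, h5]
    · simp [h1, h3]
  · by_cases h3 : j' = i
    · by_cases h4 : i' = j
      · exfalso
        subst h3 h4
        exact h1 (le_antisymm hij' hij)
      · simp [h1, h4]
    · simp [h1, h3]

theorem pow_smul_symMk (a : Fin k → ℕ) (i j : Fin k) :
    (ℓ ^ min (a i) (a j)) • symMk (Pi.single i 1 : Std ℓ a) (Pi.single j 1) = 0 := by
  have h : ∀ i, (ℓ ^ a i) • (Pi.single i 1 : Std ℓ a) = 0 := fun i => by
    rw [← Pi.single_smul, nsmul_one, ZMod.natCast_self, Pi.single_zero]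
  rcases le_total (a i) (a j) with hij | hij
  · rw [min_eq_left hij, symMk, ← map_nsmul, TensorProduct.smul_tmul', h, TensorProduct.zero_tmul,
      map_zero]
  · rw [min_eq_right hij, symMk, ← map_nsmul, ← TensorProduct.tmul_smul, h,
      TensorProduct.tmul_zero, map_zero]

variable (ℓ) in
/-- The inverse of `symCoord`. -/
def symCoordInv (a : Fin k → ℕ) :
    (∀ p : PairIdx k, ZMod (ℓ ^ min (a p.1.1) (a p.1.2))) →+ SymSq (Std ℓ a) :=
  ∑ p : PairIdx k, (ZMod.lift (ℓ ^ min (a p.1.1) (a p.1.2))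
    ⟨zmultiplesHom _ (symMk (Pi.single p.1.1 1 : Std ℓ a) (Pi.single p.1.2 1)), by
      rw [zmultiplesHom_apply, natCast_zsmul, pow_smul_symMk]⟩).comp (Pi.evalAddMonoidHom _ p)

theorem symCoordInv_single (a : Fin k → ℕ) (p : PairIdx k) :
    symCoordInv ℓ a (Pi.single p 1) = symMk (Pi.single p.1.1 1) (Pi.single p.1.2 1) := by
  rw [symCoordInv, AddMonoidHom.finsetSum_apply, Finset.sum_eq_single p]
  · rw [AddMonoidHom.comp_apply, Pi.evalAddMonoidHom_apply, Pi.single_eq_same]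
    have := ZMod.lift_coe (ℓ ^ min (a p.1.1) (a p.1.2))
      ⟨zmultiplesHom _ (symMk (Pi.single p.1.1 1 : Std ℓ a) (Pi.single p.1.2 1)), by
      rw [zmultiplesHom_apply, natCast_zsmul, pow_smul_symMk]⟩ 1
    rw [Int.cast_one] at this
    rw [this, zmultiplesHom_apply, one_smul]
  · intro q _ hq
    rw [AddMonoidHom.comp_apply, Pi.evalAddMonoidHom_apply, Pi.single_eq_of_ne hq, map_zero]
  · simp

theorem pi_zmod_hom_ext {ι : Type*} [Fintype ι] [DecidableEq ι] {m : ι → ℕ} [∀ i, NeZero (m i)]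
    {B : Type*} [AddCommGroup B] {α β : (∀ i, ZMod (m i)) →+ B}
    (h : ∀ i, α (Pi.single i 1) = β (Pi.single i 1)) : α = β := by
  refine AddMonoidHom.ext fun x => ?_
  have hx : x = ∑ i, (x i).val • (Pi.single i 1 : ∀ i, ZMod (m i)) := by
    ext j
    rw [Finset.sum_apply, Finset.sum_eq_single j]
    · simp
    · intro i _ h
      simp [h.symm]
    · simp
  rw [hx, map_sum, map_sum]
  exact Finset.sum_congr rfl fun i _ => by rw [map_nsmul, map_nsmul, h]

variable (ℓ) in
/-- `Sym²` of a standard group. -/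
def symCoordEquiv (a : Fin k → ℕ) :
    SymSq (Std ℓ a) ≃+ ∀ p : PairIdx k, ZMod (ℓ ^ min (a p.1.1) (a p.1.2)) :=
  AddMonoidHom.toAddEquiv (symCoord ℓ a).toAddMonoidHom (symCoordInv ℓ a)
    (by
      have h : ((symCoordInv ℓ a).comp (symCoord ℓ a).toAddMonoidHom).toIntLinearMap
          = LinearMap.id := by
        refine Submodule.linearMap_qext _ (TensorProduct.ext' fun x y => ?_)
        change symCoordInv ℓ a (symCoord ℓ a (symMk x y)) = symMk x y
        have hB : ∀ i j, symCoordInv ℓ a (symCoord ℓ a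
            (symMk (Pi.single i 1) (Pi.single j 1))) = symMk (Pi.single i 1) (Pi.single j 1) := by
          intro i j
          rcases le_total i j with hij | hij
          · rw [symCoord_single a ⟨(i, j), hij⟩, symCoordInv_single]
          · rw [symMk_comm, symCoord_single a ⟨(j, i), hij⟩, symCoordInv_single]
        rw [std_eq_sum x, std_eq_sum y]
        simp only [symMk, TensorProduct.sum_tmul, TensorProduct.tmul_sum, map_sum,
          TensorProduct.tmul_smul, ← TensorProduct.smul_tmul', map_nsmul]
        refine Finset.sum_congr rfl fun i _ => ?_
        congr 1
        refine Finset.sum_congr rfl fun j _ => ?_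
        congr 1
        exact hB _ _
      exact AddMonoidHom.ext fun x => LinearMap.congr_fun h x)
    (by
      refine pi_zmod_hom_ext fun p => ?_
      change symCoord ℓ a (symCoordInv ℓ a _) = _
      rw [symCoordInv_single, symCoord_single]
      rfl)

theorem symSqTorsionCard_std (a : Fin k → ℕ) :
    symSqTorsionCard (Std ℓ a) (ℓ ^ n) = ∏ p : PairIdx k, ℓ ^ min (min (a p.1.1) (a p.1.2)) n := by
  rw [symSqTorsionCard, ← Finset.prod_congr rfl fun p _ => card_torsion_zmod (ℓ := ℓ) (n := n)
    (min (a p.1.1) (a p.1.2)), ← Nat.card_pi]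
  refine Nat.card_congr (((symCoordEquiv ℓ a).toEquiv.subtypeEquiv
    (q := fun z => ∀ p, ℓ ^ n • z p = 0) fun z => ?_).trans
      (Equiv.subtypePiEquivPi (p := fun (p : PairIdx k)
        (z : ZMod (ℓ ^ min (a p.1.1) (a p.1.2))) => ℓ ^ n • z = 0)))
  change _ ↔ ∀ p, (ℓ ^ n • symCoordEquiv ℓ a z) p = 0
  rw [← map_nsmul, ← EmbeddingLike.map_eq_zero_iff (f := symCoordEquiv ℓ a), funext_iff]
  rfl

/-- The parameter y_ij of δ matters exactly modulo ℓ^(min (a i) (a j) n) and is otherwise free for i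
≤ j. These are also the orders of the torsion in the cyclic factors of Sym². -/
theorem card_delta_std (a : Fin k → ℕ) :
    Nat.card (Delta ℓ n (Std ℓ a)) = symSqTorsionCard (Std ℓ a) (ℓ ^ n) := by
  rw [symSqTorsionCard_std, ← Finset.prod_congr rfl fun p _ => Nat.card_zmod
    (ℓ ^ min (min (a p.1.1) (a p.1.2)) n), ← Nat.card_pi]
  choose y hy hδ using fun δ : Delta ℓ n (Std ℓ a) => exists_of_mem_delta δ.2
  refine Nat.card_congr (Equiv.ofBijective
    (fun δ p => PadicInt.toZModPow (min (min (a p.1.1) (a p.1.2)) n) (y δ p.1.1 p.1.2)) ⟨?_, ?_⟩)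
  · intro δ δ' h
    refine Subtype.ext (hom_gen_ext fun i => funext fun j => ?_)
    have h1 : (ℓ : ℤ_[ℓ]) ^ (min (min (a i) (a j)) n) ∣ y δ i j - y δ' i j := by
      rcases le_total i j with hij | hij
      · exact (toZModPow_eq_iff _ _).1 (congrFun h ⟨(i, j), hij⟩)
      · rw [hy δ i j, hy δ' i j, min_comm (a i)]
        exact (toZModPow_eq_iff _ _).1 (congrFun h ⟨(j, i), hij⟩)
    rw [hδ, hδ, toZModPow_eq_iff, neg_sub_neg, ← mul_sub, pow_dvd_pow_mul_iff]
    refine (pow_dvd_pow _ ?_).trans ((dvd_neg.2 h1).trans (by rw [neg_sub]))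
    omega
  · intro z
    choose c hc using fun p => toZModPow_surjective _ (z p)
    let y0 : Fin k → Fin k → ℤ_[ℓ] := fun i j =>
      if h : i ≤ j then c ⟨(i, j), h⟩ else c ⟨(j, i), le_of_not_ge h⟩
    obtain ⟨δ, hδ1, hδ2⟩ := exists_delta_of_symm (n := n) (a := a) y0 fun i j => by
      rcases lt_trichotomy i j with h | rfl | h
      · simp [y0, h.le, h.not_ge]
      · rfl
      · simp [y0, h.le, h.not_ge]
    refine ⟨⟨δ, hδ1⟩, funext fun p => ?_⟩
    obtain ⟨⟨i, j⟩, hij⟩ := p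
    have hij : i ≤ j := hij
    rw [← hc, toZModPow_eq_iff]
    have e : c ⟨(i, j), hij⟩ = y0 i j := by simp [y0, hij]
    have e' : y0 j i = y0 i j := by
      rcases hij.lt_or_eq with h | rfl
      · simp [y0, h.le, h.not_ge]
      · rfl
    rw [e]
    rcases le_total (a i) (a j) with h | h
    · have := (hδ ⟨δ, hδ1⟩ i j).symm.trans (hδ2 i j)
      rw [toZModPow_eq_iff, neg_sub_neg, ← mul_sub, pow_dvd_pow_mul_iff, ← dvd_neg,
        neg_sub] at this
      exact (pow_dvd_pow _ (by simp only; omega)).trans this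
    · have := (hδ ⟨δ, hδ1⟩ j i).symm.trans (hδ2 j i)
      rw [toZModPow_eq_iff, neg_sub_neg, ← mul_sub, pow_dvd_pow_mul_iff, ← dvd_neg,
        neg_sub, e', hy] at this
      exact (pow_dvd_pow _ (by simp only; omega)).trans this

end SymCount

/-! ### Structures on a fixed group, pushforward, countability -/

section BEGOn

variable {ℓ n : ℕ}

instance finite_tensor (H : Type*) [AddCommGroup H] [Finite H] : Finite (H ⊗[ℤ] H) := by
  have h0 : Module.Finite ℤ H := inferInstance
  have : Module.Finite ℤ (H ⊗[ℤ] H) := by exact Module.Finite.tensorProduct ℤ H H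
  refine Module.finite_of_fg_torsion _ fun x => ?_
  refine ⟨⟨(Nat.card H : ℤ), mem_nonZeroDivisors_of_ne_zero (by exact_mod_cast Nat.card_pos.ne')⟩, ?_⟩
  change (Nat.card H : ℤ) • x = 0
  induction x with
  | zero => simp
  | add x y hx hy => rw [smul_add, hx, hy, add_zero]
  | tmul x y => rw [TensorProduct.smul_tmul', natCast_zsmul, card_nsmul_eq_zero', TensorProduct.zero_tmul]

variable (ℓ n) in
/-- The structures of a bilinearly enhanced group on the group `H`. -/
def BEGOn (H : Type) [AddCommGroup H] : Type :=
  {p : (H ⊗[ℤ] H) × ((H →+ ZMod (ℓ ^ n)) →+ H) // p.1 ∈ wedgeSq H ∧ ℓ ^ n • p.1 = 0 ∧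
    ∀ (r : ℕ) (α β : H →+ ZMod (ℓ ^ (n + r))),
      β (p.2 (scaleDown r α)) = α (p.2 (scaleDown r β)) + 2 * evalPair α β p.1}

instance [NeZero ℓ] (H : Type) [AddCommGroup H] [Finite H] : Finite (BEGOn ℓ n H) := by
  have : Finite (H →+ ZMod (ℓ ^ n)) := DFunLike.finite _
  have : Finite ((H →+ ZMod (ℓ ^ n)) →+ H) := DFunLike.finite _
  exact Subtype.finite

/-- A group with a structure, as a bilinearly enhanced group. -/
def BEGOn.toBEG {H : Type} [AddCommGroup H] [Finite H] (s : BEGOn ℓ n H)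
    (hH : ∀ x : H, ∃ k : ℕ, ℓ ^ k • x = 0) : BEG ℓ n where
  G := H
  isPrimary := hH
  ω := s.1.1
  ω_mem := s.2.1
  ω_torsion := s.2.2.1
  ψ := s.1.2
  compat := s.2.2.2

theorem map_wedge {G H : Type*} [AddCommGroup G] [AddCommGroup H] (f : G →+ H) (x y : G) :
    TensorProduct.map f.toIntLinearMap f.toIntLinearMap (wedge x y) = wedge (f x) (f y) := by
  rw [wedge, map_sub]
  rfl

theorem map_mem_wedgeSq {G H : Type*} [AddCommGroup G] [AddCommGroup H] (f : G →+ H)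
    {w : G ⊗[ℤ] G} (hw : w ∈ wedgeSq G) :
    TensorProduct.map f.toIntLinearMap f.toIntLinearMap w ∈ wedgeSq H := by
  induction hw using Submodule.span_induction with
  | mem w hw =>
    obtain ⟨x, y, rfl⟩ := hw
    rw [map_wedge]
    exact Submodule.subset_span ⟨f x, f y, rfl⟩
  | zero => rw [map_zero]; exact Submodule.zero_mem _
  | add w w' _ _ h h' => rw [map_add]; exact Submodule.add_mem _ h h'
  | smul m w _ h => rw [map_zsmul]; exact Submodule.smul_mem _ m h

theorem evalPair_map {G H : Type*} [AddCommGroup G] [AddCommGroup H] (f : G →+ H) {N : ℕ}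
    (α β : H →+ ZMod N) (w : G ⊗[ℤ] G) :
    evalPair α β (TensorProduct.map f.toIntLinearMap f.toIntLinearMap w)
      = evalPair (α.comp f) (β.comp f) w := by
  induction w with
  | zero => simp only [map_zero]
  | tmul x y => rfl
  | add w w' h h' => simp only [map_add, h, h']

/-- The pushforward of the structure of `X` along a homomorphism. -/
def BEG.push (X : BEG ℓ n) {H : Type} [AddCommGroup H] (f : X.G →+ H) : BEGOn ℓ n H :=
  ⟨(TensorProduct.map f.toIntLinearMap f.toIntLinearMap X.ω,
    (f.comp X.ψ).comp (AddMonoidHom.compHom.flip f)),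
    map_mem_wedgeSq f X.ω_mem, by rw [← map_nsmul, X.ω_torsion, map_zero], fun r α β => by
      rw [evalPair_map]
      exact X.compat r (α.comp f) (β.comp f)⟩

theorem primary_of_surjective {G H : Type*} [AddCommGroup G] [AddCommGroup H]
    (hG : ∀ x : G, ∃ k : ℕ, ℓ ^ k • x = 0) {f : G →+ H} (hf : Function.Surjective f) (x : H) :
    ∃ k : ℕ, ℓ ^ k • x = 0 := by
  obtain ⟨y, rfl⟩ := hf x
  obtain ⟨k, hk⟩ := hG y
  exact ⟨k, by rw [← map_nsmul, hk, map_zero]⟩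

theorem isMorphism_toBEG_iff (X : BEG ℓ n) {H : Type} [AddCommGroup H] [Finite H]
    (hH : ∀ x : H, ∃ k : ℕ, ℓ ^ k • x = 0) (f : X.G →+ H) (s : BEGOn ℓ n H) :
    IsMorphism X (s.toBEG hH) f ↔ X.push f = s := by
  constructor
  · rintro ⟨h1, h2⟩
    exact Subtype.ext (Prod.ext h1 (AddMonoidHom.ext h2))
  · rintro rfl
    exact ⟨rfl, fun α => rfl⟩

theorem isMorphism_push (X : BEG ℓ n) {H : Type} [AddCommGroup H] [Finite H]
    (hH : ∀ x : H, ∃ k : ℕ, ℓ ^ k • x = 0) (f : X.G →+ H) :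
    IsMorphism X ((X.push f).toBEG hH) f := (isMorphism_toBEG_iff X hH f _).2 rfl

theorem IsMorphism.of_comp {X Y Z : BEG ℓ n} {f : X.G →+ Y.G} {h : Y.G →+ Z.G}
    (hf : IsMorphism X Y f) (hh : IsMorphism X Z (h.comp f)) : IsMorphism Y Z h := by
  refine ⟨?_, fun α => ?_⟩
  · rw [← hf.1, ← hh.1, ← LinearMap.comp_apply, ← TensorProduct.map_comp]
    rfl
  · rw [← hh.2, ← hf.2]
    rfl

theorem iso_push (X : BEG ℓ n) {H : Type} [AddCommGroup H] [Finite H]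
    (hH : ∀ x : H, ∃ k : ℕ, ℓ ^ k • x = 0) (e : X.G ≃+ H) :
    Iso X ((X.push e.toAddMonoidHom).toBEG hH) :=
  ⟨e, isMorphism_push X hH e.toAddMonoidHom⟩

theorem exists_primary_pow [NeZero ℓ] {k : ℕ} (a : Fin k → ℕ) (x : Std ℓ a) :
    ∃ m : ℕ, ℓ ^ m • x = 0 := by
  refine ⟨∑ i, a i, funext fun i => ?_⟩
  rw [Pi.smul_apply, nsmul_eq_mul, Pi.zero_apply, ← Finset.sum_erase_add _ _ (Finset.mem_univ i),
    pow_add, Nat.cast_mul, ZMod.natCast_self, mul_zero, zero_mul]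

theorem exists_iso_std [Fact ℓ.Prime] (X : BEG ℓ n) :
    ∃ (k : ℕ) (a : Fin k → ℕ) (s : BEGOn ℓ n (Std ℓ a)), (∀ i, 1 ≤ a i) ∧
      Iso X (s.toBEG (exists_primary_pow a)) := by
  obtain ⟨k, a, ha, ⟨e⟩⟩ := exists_addEquiv_std X.G X.isPrimary
  exact ⟨k, a, _, ha, iso_push X _ e⟩

instance countable_BEGClass [Fact ℓ.Prime] : Countable (BEGClass ℓ n) := by
  let F : (Σ k : ℕ, Σ a : Fin k → ℕ, BEGOn ℓ n (Std ℓ a)) → BEGClass ℓ n :=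
    fun p => (p.2.2.toBEG (exists_primary_pow p.2.1)).toClass
  refine Function.Surjective.countable (f := F) fun c => ?_
  obtain ⟨X, rfl⟩ := Quotient.exists_rep c
  obtain ⟨k, a, s, -, h⟩ := exists_iso_std X
  exact ⟨⟨k, a, s⟩, (Quotient.sound h).symm⟩

theorem exists_rep_std [Fact ℓ.Prime] (c : BEGClass ℓ n) :
    ∃ (k : ℕ) (a : Fin k → ℕ) (s : BEGOn ℓ n (Std ℓ a)), (∀ i, 1 ≤ a i) ∧
      c = (s.toBEG (exists_primary_pow a)).toClass := by
  obtain ⟨X, rfl⟩ := Quotient.exists_rep c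
  obtain ⟨k, a, s, ha, h⟩ := exists_iso_std X
  exact ⟨k, a, s, ha, Quotient.sound h⟩

/-- A representative of an isomorphism class. -/
abbrev rep (c : BEGClass ℓ n) : BEG ℓ n := Quotient.out c

theorem toClass_rep (c : BEGClass ℓ n) : (rep c).toClass = c := Quotient.out_eq c

theorem iso_rep (X : BEG ℓ n) : Iso (rep X.toClass) X := Quotient.exact (toClass_rep X.toClass)

theorem toClass_eq_iff {X Y : BEG ℓ n} : X.toClass = Y.toClass ↔ Iso X Y := Quotient.eq

theorem surjCount_toClass (X Y : BEG ℓ n) : surjCount X.toClass Y = Nat.card (SurjSet X Y) := rfl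

theorem surjCount_eq (c : BEGClass ℓ n) (Y : BEG ℓ n) :
    surjCount c Y = Nat.card (SurjSet (rep c) Y) := by
  conv_lhs => rw [← toClass_rep c]
  rfl

instance finite_hom {G H : Type*} [AddCommGroup G] [AddCommGroup H] [Finite G] [Finite H] :
    Finite (G →+ H) := DFunLike.finite _

theorem symSqTorsionCard_congr {G H : Type*} [AddCommGroup G] [AddCommGroup H] (e : G ≃+ H)
    (N : ℕ) : symSqTorsionCard G N = symSqTorsionCard H N := by
  let e1 : G ⊗[ℤ] G ≃ₗ[ℤ] H ⊗[ℤ] H := TensorProduct.congr e.toIntLinearEquiv e.toIntLinearEquiv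
  have h1 : (wedgeSq G).map e1.toLinearMap = wedgeSq H := by
    rw [wedgeSq, wedgeSq, Submodule.map_span]
    congr 1
    ext z
    constructor
    · rintro ⟨_, ⟨x, y, rfl⟩, rfl⟩
      exact ⟨e x, e y, map_wedge e.toAddMonoidHom x y⟩
    · rintro ⟨x, y, rfl⟩
      refine ⟨_, ⟨e.symm x, e.symm y, rfl⟩, (map_wedge e.toAddMonoidHom _ _).trans ?_⟩
      simp
  let e2 : SymSq G ≃ₗ[ℤ] SymSq H := Submodule.Quotient.equiv _ _ e1 h1
  refine Nat.card_congr (e2.toEquiv.subtypeEquiv fun z => ?_)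
  change _ ↔ N • e2 z = 0
  rw [← map_nsmul, EmbeddingLike.map_eq_zero_iff]

/-- `Delta` only depends on the group up to isomorphism. -/
theorem card_delta_congr {G H : Type} [AddCommGroup G] [AddCommGroup H] (e : G ≃+ H) :
    Nat.card (Delta ℓ n G) = Nat.card (Delta ℓ n H) := by
  have key : ∀ {G H : Type} [AddCommGroup G] [AddCommGroup H] (e : G ≃+ H) {δ}
      (_ : δ ∈ Delta ℓ n G),
      (e.toAddMonoidHom.comp δ).comp (AddMonoidHom.compHom.flip e.toAddMonoidHom)
        ∈ Delta ℓ n H := fun e δ hδ r α β =>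
    hδ r (α.comp e.toAddMonoidHom) (β.comp e.toAddMonoidHom)
  refine Nat.card_congr
    { toFun := fun δ => ⟨_, key e δ.2⟩
      invFun := fun δ => ⟨_, key e.symm δ.2⟩
      left_inv := ?_
      right_inv := ?_ }
  · rintro ⟨δ, hδ⟩
    refine Subtype.ext (AddMonoidHom.ext fun α => ?_)
    change e.symm (e (δ ((α.comp e.symm.toAddMonoidHom).comp e.toAddMonoidHom))) = δ α
    rw [e.symm_apply_apply]
    congr 1
    ext x
    simp
  · rintro ⟨δ, hδ⟩
    refine Subtype.ext (AddMonoidHom.ext fun α => ?_)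
    change e (e.symm (δ ((α.comp e.toAddMonoidHom).comp e.symm.toAddMonoidHom))) = δ α
    rw [e.apply_symm_apply]
    congr 1
    ext x
    simp

theorem card_delta [Fact ℓ.Prime] {H : Type} [AddCommGroup H] [Finite H]
    (hH : ∀ x : H, ∃ k : ℕ, ℓ ^ k • x = 0) :
    Nat.card (Delta ℓ n H) = symSqTorsionCard H (ℓ ^ n) := by
  obtain ⟨k, a, -, ⟨e⟩⟩ := exists_addEquiv_std H hH
  rw [card_delta_congr e, card_delta_std, symSqTorsionCard_congr e]

theorem BEGOn.sub_mem_delta {H : Type} [AddCommGroup H] {s s' : BEGOn ℓ n H}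
    (h : s.1.1 = s'.1.1) : s.1.2 - s'.1.2 ∈ Delta ℓ n H := fun r α β => by
  rw [AddMonoidHom.sub_apply, AddMonoidHom.sub_apply, map_sub, map_sub, s.2.2.2, s'.2.2.2, h]
  ring

/-- For fixed ω the admissible ψ are either absent or form a torsor under `Delta`, whose order is
|Sym²H[ℓ^n]|. -/
theorem card_BEGOn_le [Fact ℓ.Prime] {H : Type} [AddCommGroup H] [Finite H]
    (hH : ∀ x : H, ∃ k : ℕ, ℓ ^ k • x = 0) :
    Nat.card (BEGOn ℓ n H) ≤ Nat.card (wedgeSq H) * symSqTorsionCard H (ℓ ^ n) := by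
  classical
  rw [← card_delta hH, ← Nat.card_prod]
  let b : wedgeSq H → Option (BEGOn ℓ n H) := fun w =>
    if h : ∃ s : BEGOn ℓ n H, s.1.1 = w.1 then some h.choose else none
  refine Nat.card_le_card_of_injective (fun s => (⟨s.1.1, s.2.1⟩,
    ⟨s.1.2 - (Exists.choose (⟨s, rfl⟩ : ∃ s' : BEGOn ℓ n H, s'.1.1 = s.1.1)).1.2,
      BEGOn.sub_mem_delta (Exists.choose_spec
        (⟨s, rfl⟩ : ∃ s' : BEGOn ℓ n H, s'.1.1 = s.1.1)).symm⟩)) fun s s' h => ?_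
  have h1 : s.1.1 = s'.1.1 := congrArg Subtype.val (congrArg Prod.fst h)
  have h2 := congrArg Subtype.val (congrArg Prod.snd h)
  refine Subtype.ext (Prod.ext h1 ?_)
  -- The chosen base point depends on ω alone, so it cancels once the two ω agree.
  simp only [h1] at h2
  exact sub_left_injective h2

/-- The number of surjective homomorphisms. -/
def homSurjCount (c : BEGClass ℓ n) (H : Type) [AddCommGroup H] : ℕ :=
  Nat.card {f : (rep c).G →+ H // Function.Surjective f}

/-- A surjection of groups is a morphism for exactly one structure on H, the pushforward. -/
theorem homSurjCount_eq_sum [NeZero ℓ] (c : BEGClass ℓ n) {H : Type} [AddCommGroup H] [Finite H]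
    (hH : ∀ x : H, ∃ k : ℕ, ℓ ^ k • x = 0) :
    (homSurjCount c H : ENNReal) = ∑' s : BEGOn ℓ n H, (surjCount c (s.toBEG hH) : ENNReal) := by
  have := Fintype.ofFinite (BEGOn ℓ n H)
  rw [tsum_fintype, ← Nat.cast_sum]
  congr 1
  have h : ∀ s : BEGOn ℓ n H, surjCount c (s.toBEG hH)
      = Nat.card {f : (rep c).G →+ H // Function.Surjective f ∧ (rep c).push f = s} := fun s => by
    rw [surjCount_eq]
    exact Nat.card_congr (Equiv.subtypeEquivRight fun f =>
      and_congr_right fun _ => isMorphism_toBEG_iff _ hH f s)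
  simp only [h]
  rw [homSurjCount, ← Nat.card_sigma]
  exact Nat.card_congr
    { toFun := fun f => ⟨(rep c).push f.1, f.1, f.2, rfl⟩
      invFun := fun p => ⟨p.2.1, p.2.2.1⟩
      left_inv := fun f => rfl
      right_inv := by
        rintro ⟨s, f, hf, rfl⟩
        rfl }

theorem lintegral_homSurjCount [NeZero ℓ] (μ : MeasureTheory.Measure (BEGClass ℓ n)) {H : Type}
    [AddCommGroup H] [Finite H] (hH : ∀ x : H, ∃ k : ℕ, ℓ ^ k • x = 0) :
    ∫⁻ c, (homSurjCount c H : ENNReal) ∂μ = ∑' s : BEGOn ℓ n H, surjMoment μ (s.toBEG hH) := by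
  simp only [homSurjCount_eq_sum _ hH, surjMoment]
  have : Countable (BEGOn ℓ n H) := Finite.to_countable
  exact MeasureTheory.lintegral_tsum fun s => Measurable.aemeasurable fun _ _ => trivial

/-- For a measure with universal moments this bounds the expected number of plain group surjections
to H by |∧²H|. Finiteness of cokernels, tightness and convergence of the inversion series all rest
on it. -/
theorem tsum_begOn_const_le [Fact ℓ.Prime] {H : Type} [AddCommGroup H] [Finite H]
    (hH : ∀ x : H, ∃ k : ℕ, ℓ ^ k • x = 0) :
    ∑' _ : BEGOn ℓ n H, ((symSqTorsionCard H (ℓ ^ n) : ℕ) : ENNReal)⁻¹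
      ≤ (Nat.card (wedgeSq H) : ENNReal) := by
  have := Fintype.ofFinite (BEGOn ℓ n H)
  rw [tsum_fintype, Finset.sum_const, Finset.card_univ, ← Nat.card_eq_fintype_card, nsmul_eq_mul,
    ← div_eq_mul_inv]
  refine ENNReal.div_le_of_le_mul ?_
  exact_mod_cast card_BEGOn_le hH

end BEGOn

/-! ### Bounds for exterior squares -/

section Wedge

theorem card_wedgeSq_congr {G H : Type*} [AddCommGroup G] [AddCommGroup H] [Finite G] [Finite H]
    (e : G ≃+ H) : Nat.card (wedgeSq G) ≤ Nat.card (wedgeSq H) := by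
  refine Nat.card_le_card_of_injective
    (fun w => ⟨_, map_mem_wedgeSq e.toAddMonoidHom w.2⟩) fun w w' h => Subtype.ext ?_
  exact (TensorProduct.congr e.toIntLinearEquiv e.toIntLinearEquiv).injective
    (congrArg Subtype.val h)

/-- `H` is generated by `k` elements. -/
def GenBy (H : Type*) [AddCommGroup H] (k : ℕ) : Prop :=
  ∃ h : Fin k → H, ∀ x, ∃ m : Fin k → ℤ, x = ∑ i, m i • h i

theorem wedge_add_left {H : Type*} [AddCommGroup H] (x y z : H) :
    wedge (x + y) z = wedge x z + wedge y z := by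
  simp only [wedge, TensorProduct.add_tmul, TensorProduct.tmul_add]; abel

theorem wedge_add_right {H : Type*} [AddCommGroup H] (x y z : H) :
    wedge x (y + z) = wedge x y + wedge x z := by
  simp only [wedge, TensorProduct.add_tmul, TensorProduct.tmul_add]; abel

theorem wedge_swap {H : Type*} [AddCommGroup H] (x y : H) : wedge x y = -wedge y x := by
  simp only [wedge, neg_sub]

theorem wedge_self {H : Type*} [AddCommGroup H] (x : H) : wedge x x = 0 := sub_self _

/-- `wedge` as a bilinear map. -/
def wedgeHom (H : Type*) [AddCommGroup H] : H →+ H →+ H ⊗[ℤ] H :=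
  AddMonoidHom.mk' (fun x => AddMonoidHom.mk' (wedge x) (wedge_add_right x)) fun x y =>
    AddMonoidHom.ext fun z => wedge_add_left x y z

theorem wedgeHom_apply {H : Type*} [AddCommGroup H] (x y : H) : wedgeHom H x y = wedge x y := rfl

theorem wedge_mem {H : Type*} [AddCommGroup H] (x y : H) : wedge x y ∈ wedgeSq H :=
  Submodule.subset_span ⟨x, y, rfl⟩

theorem GenBy.prod_zmod {H : Type*} [AddCommGroup H] {k : ℕ} (h : GenBy H k) (ℓ : ℕ) :
    GenBy (H × ZMod ℓ) (k + 1) := by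
  obtain ⟨b, hb⟩ := h
  refine ⟨Fin.snoc (fun i => (b i, 0)) (0, 1), fun x => ?_⟩
  obtain ⟨m, hm⟩ := hb x.1
  refine ⟨Fin.snoc m (x.2.cast : ℤ), ?_⟩
  rw [Fin.sum_univ_castSucc]
  simp only [Fin.snoc_castSucc, Fin.snoc_last, Prod.smul_mk, smul_zero]
  refine Prod.ext ?_ ?_
  · simp [hm, Prod.fst_sum]
  · simp [Prod.snd_sum]

/-- Passing to H × ℤ/ℓ adds to ∧²H only the elements x ∧ e, where e generates the new factor. They
are killed by ℓ and depend linearly on x, so they form an image of (ℤ/ℓ)^k. -/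
theorem card_wedgeSq_prod_le {H : Type*} [AddCommGroup H] [Finite H] {k : ℕ} (h : GenBy H k) {ℓ : ℕ}
    [NeZero ℓ] : Nat.card (wedgeSq (H × ZMod ℓ)) ≤ Nat.card (wedgeSq H) * ℓ ^ k := by
  obtain ⟨b, hb⟩ := h
  let ι : H →+ H × ZMod ℓ := AddMonoidHom.inl H (ZMod ℓ)
  let e : H × ZMod ℓ := (0, 1)
  have he : ∀ x, ℓ • wedge (ι x) e = 0 := fun x => by
    have h0 : ℓ • e = 0 := Prod.ext (by simp [e]) (by simp [e])
    rw [← wedgeHom_apply, ← map_nsmul, h0, map_zero]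
  let L : (Fin k → ZMod ℓ) →+ (H × ZMod ℓ) ⊗[ℤ] (H × ZMod ℓ) :=
    ∑ i, (ZMod.lift ℓ ⟨zmultiplesHom _ (wedge (ι (b i)) e), by
      rw [zmultiplesHom_apply, natCast_zsmul, he]⟩).comp (Pi.evalAddMonoidHom _ i)
  have hL : ∀ m : Fin k → ℤ, L (fun i => (m i : ZMod ℓ)) = wedge (ι (∑ i, m i • b i)) e := by
    intro m
    rw [AddMonoidHom.finsetSum_apply, map_sum, ← wedgeHom_apply, map_sum, AddMonoidHom.finsetSum_apply]
    refine Finset.sum_congr rfl fun i _ => ?_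
    rw [AddMonoidHom.comp_apply, Pi.evalAddMonoidHom_apply, ZMod.lift_coe, zmultiplesHom_apply,
      map_zsmul, map_zsmul, AddMonoidHom.zsmul_apply, wedgeHom_apply]
  let F : wedgeSq H × (Fin k → ZMod ℓ) → (H × ZMod ℓ) ⊗[ℤ] (H × ZMod ℓ) := fun p =>
    TensorProduct.map ι.toIntLinearMap ι.toIntLinearMap p.1.1 + L p.2
  have hF : ∀ w ∈ wedgeSq (H × ZMod ℓ), ∃ p, F p = w := by
    intro w hw
    induction hw using Submodule.span_induction with
    | mem w hw =>
      obtain ⟨⟨x, c⟩, ⟨y, d⟩, rfl⟩ := hw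
      -- (x + c e) ∧ (y + d e) = x ∧ y + (d x - c y) ∧ e.
      obtain ⟨m, hm⟩ := hb ((d.cast : ℤ) • x - (c.cast : ℤ) • y)
      refine ⟨(⟨wedge x y, wedge_mem x y⟩, fun i => (m i : ZMod ℓ)), ?_⟩
      have e1 : ((x, c) : H × ZMod ℓ) = ι x + (c.cast : ℤ) • e := by simp [ι, e]
      have e2 : ((y, d) : H × ZMod ℓ) = ι y + (d.cast : ℤ) • e := by simp [ι, e]
      simp only [F]
      rw [hL, ← hm, e1, e2]
      simp only [← wedgeHom_apply, map_add, map_sub, map_zsmul, AddMonoidHom.add_apply,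
        AddMonoidHom.sub_apply, AddMonoidHom.zsmul_apply]
      simp only [wedgeHom_apply, wedge_self, smul_zero, add_zero, wedge_swap e (ι y)]
      have e3 : TensorProduct.map ι.toIntLinearMap ι.toIntLinearMap (wedge x y)
        = wedge (ι x) (ι y) := by simp [wedge]
      rw [e3, smul_neg]
      abel
    | zero => exact ⟨0, by simp [F]⟩
    | add w w' _ _ h h' =>
      obtain ⟨p, rfl⟩ := h
      obtain ⟨p', rfl⟩ := h'
      refine ⟨p + p', ?_⟩
      simp only [F, Prod.fst_add, Prod.snd_add, Submodule.coe_add, map_add]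
      abel
    | smul m w _ h =>
      obtain ⟨p, rfl⟩ := h
      exact ⟨m • p, by simp only [F, Prod.smul_fst, Prod.smul_snd, Submodule.coe_smul, map_zsmul,
        smul_add]⟩
  choose r hr using fun w : wedgeSq (H × ZMod ℓ) => hF w.1 w.2
  calc Nat.card (wedgeSq (H × ZMod ℓ))
      ≤ Nat.card (wedgeSq H × (Fin k → ZMod ℓ)) :=
        Nat.card_le_card_of_injective r fun w w' h => Subtype.ext (by rw [← hr, h, hr])
    _ = Nat.card (wedgeSq H) * ℓ ^ k := by
        rw [Nat.card_prod, Nat.card_fun, Nat.card_zmod, Nat.card_fin]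

theorem GenBy.congr {G H : Type*} [AddCommGroup G] [AddCommGroup H] (e : G ≃+ H) {k : ℕ}
    (h : GenBy G k) : GenBy H k := by
  obtain ⟨b, hb⟩ := h
  refine ⟨fun i => e (b i), fun x => ?_⟩
  obtain ⟨m, hm⟩ := hb (e.symm x)
  refine ⟨m, ?_⟩
  rw [← e.apply_symm_apply x, hm, map_sum]
  simp only [map_zsmul]

/-- Splitting off the last coordinate. -/
def prodPowSucc (H : Type*) [AddCommGroup H] (ℓ e : ℕ) :
    (H × (Fin e → ZMod ℓ)) × ZMod ℓ ≃+ H × (Fin (e + 1) → ZMod ℓ) where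
  toFun x := (x.1.1, Fin.snoc x.1.2 x.2)
  invFun x := ((x.1, fun i => x.2 i.castSucc), x.2 (Fin.last e))
  left_inv x := by simp
  right_inv x := by
    refine Prod.ext rfl ?_
    exact Fin.snoc_init_self _
  map_add' x y := by
    refine Prod.ext rfl (funext fun i => ?_)
    induction i using Fin.lastCases <;> simp

theorem GenBy.prod_pow {H : Type*} [AddCommGroup H] {k : ℕ} (h : GenBy H k) (ℓ e : ℕ) :
    GenBy (H × (Fin e → ZMod ℓ)) (k + e) := by
  induction e with
  | zero =>
    exact h.congr (AddEquiv.prodUnique (M := H) (N := Fin 0 → ZMod ℓ)).symm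
  | succ e ih => exact (ih.prod_zmod ℓ).congr (prodPowSucc H ℓ e)

/-- The successive groups have k, k + 1, …, k + e - 1 generators, and these numbers add up to k e +
e.choose 2. -/
theorem card_wedgeSq_prod_pow_le {H : Type*} [AddCommGroup H] [Finite H] {k : ℕ} (h : GenBy H k)
    {ℓ : ℕ} [NeZero ℓ] (e : ℕ) :
    Nat.card (wedgeSq (H × (Fin e → ZMod ℓ))) ≤ Nat.card (wedgeSq H) * ℓ ^ (k * e + e.choose 2) := by
  induction e with
  | zero =>
    simpa using card_wedgeSq_congr (AddEquiv.prodUnique (M := H) (N := Fin 0 → ZMod ℓ))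
  | succ e ih =>
    calc _ ≤ _ := card_wedgeSq_congr (prodPowSucc H ℓ e).symm
      _ ≤ _ := card_wedgeSq_prod_le (h.prod_pow ℓ e)
      _ ≤ _ := Nat.mul_le_mul_right _ ih
      _ = _ := by
        rw [mul_assoc, ← pow_add]
        congr 2
        rw [Nat.choose_succ_succ' e 1, Nat.choose_one_right]
        ring

theorem card_wedgeSq_cyclic (m : ℕ) : Nat.card (wedgeSq (ZMod m)) = 1 := by
  have : wedgeSq (ZMod m) = ⊥ := by
    rw [wedgeSq, Submodule.span_eq_bot]
    rintro _ ⟨x, y, rfl⟩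
    obtain ⟨x, rfl⟩ := ZMod.intCast_surjective x
    obtain ⟨y, rfl⟩ := ZMod.intCast_surjective y
    have h : ∀ z : ℤ, (z : ZMod m) = z • (1 : ZMod m) := fun z => by simp
    rw [h x, h y, ← wedgeHom_apply, map_zsmul, map_zsmul, AddMonoidHom.zsmul_apply, wedgeHom_apply,
      wedge_self, smul_zero, smul_zero]
  rw [this, Nat.card_unique]

theorem genBy_std {ℓ : ℕ} [NeZero ℓ] {k : ℕ} (a : Fin k → ℕ) : GenBy (Std ℓ a) k := by
  refine ⟨fun i => Pi.single i 1, fun x => ⟨fun i => (x i).val, ?_⟩⟩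
  simp only [natCast_zsmul]
  ext j
  rw [Finset.sum_apply, Finset.sum_eq_single j]
  · simp
  · intro i _ h
    simp [h.symm]
  · simp

end Wedge

/-! ### Inversion coefficients -/

section Coefficients

/-- The coefficients `1 / ∏_{k = 1}^i (ℓ^k - 1)`. -/
def invCoeff (ℓ i : ℕ) : ℝ := ∏ k ∈ Finset.range i, ((ℓ : ℝ) ^ (k + 1) - 1)⁻¹

theorem pow_succ_sub_one_pos {ℓ : ℕ} (hℓ : 2 ≤ ℓ) (k : ℕ) : 0 < (ℓ : ℝ) ^ (k + 1) - 1 := by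
  have h1 : (1 : ℝ) < ℓ := by exact_mod_cast hℓ
  exact sub_pos.2 (one_lt_pow₀ h1 (Nat.succ_ne_zero k))

theorem invCoeff_nonneg {ℓ : ℕ} (hℓ : 2 ≤ ℓ) (i : ℕ) : 0 ≤ invCoeff ℓ i :=
  Finset.prod_nonneg fun k _ => inv_nonneg.2 (pow_succ_sub_one_pos hℓ k).le

/-- A q-binomial identity whose partial sums collapse to a product, with z kept as an indeterminate
to make the induction work. -/
theorem sum_invCoeff {ℓ : ℕ} (hℓ : 2 ≤ ℓ) (z : ℝ) (m : ℕ) :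
    ∑ i ∈ Finset.range (m + 1), (-1) ^ i * invCoeff ℓ i * ∏ k ∈ Finset.range i, (z - (ℓ : ℝ) ^ k)
      = (-1) ^ m * invCoeff ℓ m * ∏ k ∈ Finset.range m, (z - (ℓ : ℝ) ^ (k + 1)) := by
  induction m with
  | zero => simp
  | succ m ih =>
    rw [Finset.sum_range_succ, ih, Finset.prod_range_succ' (fun k => z - (ℓ : ℝ) ^ k),
      Finset.prod_range_succ (fun k => z - (ℓ : ℝ) ^ (k + 1)), invCoeff, invCoeff,
      Finset.prod_range_succ]
    have h := (pow_succ_sub_one_pos hℓ m).ne'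
    set p := ∏ k ∈ Finset.range m, ((ℓ : ℝ) ^ (k + 1) - 1)⁻¹
    set P := ∏ k ∈ Finset.range m, (z - (ℓ : ℝ) ^ (k + 1))
    field_simp
    ring

/-- The number of linearly independent `i`-tuples in a space of dimension `d`. -/
def frameCount (ℓ d i : ℕ) : ℕ := ∏ k ∈ Finset.range i, (ℓ ^ d - ℓ ^ k)

theorem frameCount_eq_zero {ℓ d i : ℕ} (h : d < i) : frameCount ℓ d i = 0 :=
  Finset.prod_eq_zero (Finset.mem_range.2 h) (Nat.sub_self _)

theorem cast_frameCount {ℓ : ℕ} (hℓ : 2 ≤ ℓ) (d i : ℕ) :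
    (frameCount ℓ d i : ℝ) = ∏ k ∈ Finset.range i, ((ℓ : ℝ) ^ d - (ℓ : ℝ) ^ k) := by
  rcases lt_or_ge d i with h | h
  · rw [frameCount_eq_zero h, Nat.cast_zero]
    exact (Finset.prod_eq_zero (Finset.mem_range.2 h) (sub_self _)).symm
  · rw [frameCount, Nat.cast_prod]
    refine Finset.prod_congr rfl fun k hk => ?_
    rw [Nat.cast_sub (Nat.pow_le_pow_right (by omega) ((Finset.mem_range.1 hk).le.trans h)),
      Nat.cast_pow, Nat.cast_pow]

/-- At z = ℓ^d with 1 ≤ d ≤ m the closed product contains the factor ℓ^d - ℓ^d; for d = 0 it cancels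
the coefficient up to the sign (-1)^m. -/
theorem sum_invCoeff_frameCount {ℓ : ℕ} (hℓ : 2 ≤ ℓ) (d m : ℕ) (h : d ≤ m) :
    ∑ i ∈ Finset.range (m + 1), (-1) ^ i * (invCoeff ℓ i * frameCount ℓ d i)
      = if d = 0 then 1 else 0 := by
  simp only [← mul_assoc, cast_frameCount hℓ, sum_invCoeff hℓ]
  split_ifs with hd
  · subst hd
    have : ∀ k ∈ Finset.range m, ((ℓ : ℝ) ^ (k + 1) - 1)⁻¹ * ((ℓ : ℝ) ^ 0 - (ℓ : ℝ) ^ (k + 1)) = -1 :=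
      fun k _ => by
        have h := (pow_succ_sub_one_pos hℓ k).ne'
        field_simp
        ring
    rw [mul_assoc, invCoeff, ← Finset.prod_mul_distrib, Finset.prod_congr rfl this]
    simp [← mul_pow]
  · rw [Finset.prod_eq_zero (Finset.mem_range.2 (show d - 1 < m by omega)), mul_zero]
    rw [Nat.sub_add_cancel (by omega), sub_self]

/-- Positive and negative terms stand on different sides, so the inversion can be used in [0, ∞]
without subtraction. -/
theorem tsum_even_invCoeff {ℓ : ℕ} (hℓ : 2 ≤ ℓ) (d : ℕ) :
    ∑' i, ENNReal.ofReal (invCoeff ℓ (2 * i)) * frameCount ℓ d (2 * i)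
      = (if d = 0 then 1 else 0)
        + ∑' i, ENNReal.ofReal (invCoeff ℓ (2 * i + 1)) * frameCount ℓ d (2 * i + 1) := by
  have h1 : ∀ i, ENNReal.ofReal (invCoeff ℓ i) * frameCount ℓ d i
      = ENNReal.ofReal (invCoeff ℓ i * frameCount ℓ d i) := fun i => by
    rw [ENNReal.ofReal_mul (invCoeff_nonneg hℓ i), ENNReal.ofReal_natCast]
  have h0 : ∀ i, 0 ≤ invCoeff ℓ i * frameCount ℓ d i := fun i =>
    mul_nonneg (invCoeff_nonneg hℓ i) (Nat.cast_nonneg _)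
  have hz : ∀ i, d < i → invCoeff ℓ i * frameCount ℓ d i = 0 := fun i hi => by
    rw [frameCount_eq_zero hi, Nat.cast_zero, mul_zero]
  simp only [h1]
  rw [tsum_eq_sum (s := Finset.range (d + 1)) fun i hi => by
      rw [hz _ (by rw [Finset.mem_range] at hi; omega), ENNReal.ofReal_zero],
    tsum_eq_sum (s := Finset.range (d + 1)) fun i hi => by
      rw [hz _ (by rw [Finset.mem_range] at hi; omega), ENNReal.ofReal_zero],
    ← ENNReal.ofReal_sum_of_nonneg fun i _ => h0 _, ← ENNReal.ofReal_sum_of_nonneg fun i _ => h0 _]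
  have h3 : (if d = 0 then 1 else 0 : ENNReal) = ENNReal.ofReal (if d = 0 then 1 else 0) := by
    split_ifs <;> simp
  rw [h3, ← ENNReal.ofReal_add (by split_ifs <;> norm_num) (Finset.sum_nonneg fun i _ => h0 _)]
  congr 1
  -- The cut-off 2d + 1 gives 2(d + 1) terms, which split into d + 1 even and d + 1 odd ones.
  rw [← sum_invCoeff_frameCount hℓ d (2 * d + 1) (by omega)]
  have key : ∀ (f : ℕ → ℝ) (m : ℕ), ∑ i ∈ Finset.range (2 * m), (-1) ^ i * f i
      = ∑ i ∈ Finset.range m, f (2 * i) - ∑ i ∈ Finset.range m, f (2 * i + 1) := by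
    intro f m
    induction m with
    | zero => simp
    | succ m ih =>
      rw [mul_add, mul_one, Finset.sum_range_succ, Finset.sum_range_succ, ih,
        Finset.sum_range_succ, Finset.sum_range_succ, pow_succ, pow_mul]
      simp
      ring
  rw [show 2 * d + 1 + 1 = 2 * (d + 1) by ring, key]
  ring

/-- Each new factor is ℓ^i / (ℓ^(i+1) - 1), at most 1/2 as soon as ℓ ≥ 3. The power of ℓ is the
growth of ∧² of an elementary group, which the coefficients have to beat. -/
theorem invCoeff_mul_pow_le {ℓ : ℕ} (hℓ : 3 ≤ ℓ) (i : ℕ) :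
    invCoeff ℓ i * (ℓ : ℝ) ^ (i.choose 2) ≤ (1 / 2) ^ i := by
  induction i with
  | zero => simp [invCoeff]
  | succ i ih =>
    have h3 : (3 : ℝ) ≤ ℓ := by exact_mod_cast hℓ
    have hp := pow_succ_sub_one_pos (by omega : 2 ≤ ℓ) i
    have h1 : (1 : ℝ) ≤ (ℓ : ℝ) ^ i := one_le_pow₀ (by linarith)
    have h2 : ((ℓ : ℝ) ^ (i + 1) - 1)⁻¹ * (ℓ : ℝ) ^ i ≤ 1 / 2 := by
      rw [inv_mul_le_iff₀ hp, pow_succ]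
      nlinarith
    have e : invCoeff ℓ (i + 1) * (ℓ : ℝ) ^ ((i + 1).choose 2)
        = (invCoeff ℓ i * (ℓ : ℝ) ^ (i.choose 2)) * (((ℓ : ℝ) ^ (i + 1) - 1)⁻¹ * (ℓ : ℝ) ^ i) := by
      rw [invCoeff, Finset.prod_range_succ, ← invCoeff, Nat.choose_succ_succ' i 1,
        Nat.choose_one_right, pow_add]
      ring
    rw [e, pow_succ (1 / 2 : ℝ) i]
    exact mul_le_mul ih h2 (mul_nonneg (inv_nonneg.2 hp.le) (by linarith)) (by positivity)

end Coefficients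

/-! ### Counting extensions of a surjection by homomorphisms to an elementary group -/

section Frames

variable {ℓ : ℕ} [Fact ℓ.Prime]

theorem card_frames (V : Type*) [AddCommGroup V] [Module (ZMod ℓ) V] [Finite V] (i : ℕ) :
    Nat.card {s : Fin i → V // LinearIndependent (ZMod ℓ) s}
      = frameCount ℓ (Module.finrank (ZMod ℓ) V) i := by
  have : Module.Finite (ZMod ℓ) V := Module.Finite.of_finite
  have := Fintype.ofFinite V
  rcases lt_or_ge (Module.finrank (ZMod ℓ) V) i with h | h
  · rw [frameCount_eq_zero h, Nat.card_eq_zero]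
    left
    refine ⟨fun s => ?_⟩
    have := s.2.fintype_card_le_finrank
    rw [Fintype.card_fin] at this
    omega
  · rw [card_linearIndependent h, frameCount, Finset.prod_range, ZMod.card]

/-- Each frame of the quotient lifts in |W|^i ways, and any lift is allowed. -/
theorem card_frames_mod {V : Type*} [AddCommGroup V] [Module (ZMod ℓ) V] [Finite V]
    (W : Submodule (ZMod ℓ) V) (i : ℕ) :
    Nat.card {s : Fin i → V // LinearIndependent (ZMod ℓ) (W.mkQ ∘ s)}
      = frameCount ℓ (Module.finrank (ZMod ℓ) (V ⧸ W)) i * Nat.card W ^ i := by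
  have : Finite (V ⧸ W) := Finite.of_surjective _ W.mkQ_surjective
  have h1 : ∀ q : V ⧸ W, W.mkQ q.out = q := fun q => Quotient.out_eq q
  rw [← card_frames, ← Nat.card_fin i, ← Nat.card_fun, ← Nat.card_prod, Nat.card_fin]
  have h2 : ∀ (w : W), W.mkQ w = 0 := fun w => by
    rw [← LinearMap.mem_ker, Submodule.ker_mkQ]
    exact w.2
  have h3 : ∀ (t : Fin i → V ⧸ W) (w : Fin i → W), W.mkQ ∘ (fun j => (t j).out + (w j : V)) = t :=
    fun t w => funext fun j => by rw [Function.comp_apply, map_add, h1, h2, add_zero]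
  refine Nat.card_congr
    { toFun := fun s => (⟨W.mkQ ∘ s.1, s.2⟩, fun j => ⟨s.1 j - (W.mkQ (s.1 j)).out,
        (Submodule.Quotient.mk_eq_zero W).1 (by
          change W.mkQ _ = 0
          rw [map_sub, h1, sub_self])⟩)
      invFun := fun p => ⟨fun j => (p.1.1 j).out + p.2 j, by
        rw [h3]
        exact p.1.2⟩
      left_inv := fun s => by
        apply Subtype.ext
        funext j
        simp
      right_inv := fun p => by
        refine Prod.ext (Subtype.ext (h3 _ _)) (funext fun j => Subtype.ext ?_)
        change (p.1.1 j).out + p.2 j - (W.mkQ ((p.1.1 j).out + p.2 j)).out = p.2 j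
        rw [map_add, h1, h2, add_zero]
        abel }

variable {X G : Type*} [AddCommGroup X] [AddCommGroup G]

/-- Pulling back homomorphisms to `ℤ/ℓ`. -/
def pullHom (ℓ : ℕ) [Fact ℓ.Prime] (φ : X →+ G) : (G →+ ZMod ℓ) →ₗ[ZMod ℓ] (X →+ ZMod ℓ) where
  toFun χ := χ.comp φ
  map_add' _ _ := rfl
  map_smul' _ _ := rfl

theorem pullHom_injective {φ : X →+ G} (hφ : Function.Surjective φ) :
    Function.Injective (pullHom ℓ φ) := fun χ χ' h => by
  ext y
  obtain ⟨x, rfl⟩ := hφ y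
  exact DFunLike.congr_fun h x

/-- Given that φ is onto, (φ, κ) is onto exactly when κ maps ker φ onto (ℤ/ℓ)^i. An obstruction is a
nonzero combination of the κ_j vanishing on ker φ, that is, one that factors through φ. -/
theorem surjective_prod_iff {φ : X →+ G} (hφ : Function.Surjective φ) {i : ℕ}
    (κ : Fin i → (X →+ ZMod ℓ)) :
    Function.Surjective (φ.prod (AddMonoidHom.pi κ)) ↔
      LinearIndependent (ZMod ℓ) ((LinearMap.range (pullHom ℓ φ)).mkQ ∘ κ) := by
  rw [Fintype.linearIndependent_iff]
  constructor
  · intro h c hc j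
    have hc' : ∑ k, c k • κ k ∈ LinearMap.range (pullHom ℓ φ) := by
      rw [← Submodule.ker_mkQ (LinearMap.range (pullHom ℓ φ)), LinearMap.mem_ker, map_sum]
      simpa using hc
    obtain ⟨χ, hχ⟩ := hc'
    obtain ⟨x, hx⟩ := h (0, Pi.single j 1)
    have h1 : φ x = 0 := congrArg Prod.fst hx
    have h2 : ∀ k, κ k x = (Pi.single j 1 : Fin i → ZMod ℓ) k := fun k =>
      congrFun (congrArg Prod.snd hx) k
    have h3 := DFunLike.congr_fun hχ x
    change χ (φ x) = _ at h3
    rw [h1, map_zero, AddMonoidHom.finsetSum_apply] at h3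
    have h4 : ∀ k, (c k • κ k) x = c k * (Pi.single j 1 : Fin i → ZMod ℓ) k := fun k => by
      rw [← h2 k]; rfl
    simp only [h4, Pi.single_apply, mul_ite, mul_one, mul_zero, Finset.sum_ite_eq',
      Finset.mem_univ, if_true] at h3
    exact h3.symm
  · intro h
    let U : AddSubgroup (Fin i → ZMod ℓ) := φ.ker.map (AddMonoidHom.pi κ)
    have hU : U = ⊤ := by
      by_contra hne
      have hlt : AddSubgroup.toZModSubmodule ℓ U < ⊤ := lt_top_iff_ne_top.2 fun e => hne
        (by rw [← (AddSubgroup.toZModSubmodule ℓ).injective.eq_iff, e]; exact (OrderIso.map_top _).symm)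
      -- A functional f vanishing on the proper subspace κ(ker φ) makes f∘κ descend to G, which is a
      -- linear relation modulo the pulled-back characters.
      obtain ⟨f, hf0, hf⟩ := Submodule.exists_le_ker_of_lt_top _ hlt
      have hfs : ∀ v, f v = ∑ k, f (Pi.single k 1) * v k := fun v => by
        conv_lhs => rw [pi_eq_sum_univ' v]
        rw [map_sum]
        refine Finset.sum_congr rfl fun k _ => ?_
        rw [map_smul, smul_eq_mul, mul_comm]
      have hker : φ.ker ≤ (f.toAddMonoidHom.comp (AddMonoidHom.pi κ)).ker := fun x hx =>
        hf (show AddMonoidHom.pi κ x ∈ U from ⟨x, hx, rfl⟩)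
      let χ := φ.liftOfSurjective hφ ⟨_, hker⟩
      have hχ : ∀ x, χ (φ x) = f (AddMonoidHom.pi κ x) := fun x =>
        AddMonoidHom.liftOfRightInverse_comp_apply _ _ _ _ x
      refine hf0 (LinearMap.ext fun v => ?_)
      have hc : ∑ k, f (Pi.single k 1) • ((LinearMap.range (pullHom ℓ φ)).mkQ ∘ κ) k = 0 := by
        have : ∑ k, f (Pi.single k 1) • κ k ∈ LinearMap.range (pullHom ℓ φ) := by
          refine ⟨χ, ?_⟩
          ext x
          change χ (φ x) = _
          rw [hχ, hfs, AddMonoidHom.finsetSum_apply]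
          rfl
        rw [← Submodule.ker_mkQ (LinearMap.range (pullHom ℓ φ)), LinearMap.mem_ker, map_sum] at this
        simpa using this
      rw [hfs]
      exact Finset.sum_eq_zero fun k _ => by rw [h _ hc k, zero_mul]
    rintro ⟨y, v⟩
    obtain ⟨x, rfl⟩ := hφ y
    have hv : v - AddMonoidHom.pi κ x ∈ U := by rw [hU]; trivial
    obtain ⟨z, hz, hz'⟩ := hv
    refine ⟨x + z, Prod.ext ?_ ?_⟩
    · change φ (x + z) = φ x
      rw [map_add, (AddMonoidHom.mem_ker).1 hz, add_zero]
    · change AddMonoidHom.pi κ (x + z) = v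
      rw [map_add, hz']
      abel

/-- The defect of a surjection `X → G`: the difference of the ranks of `X` and `G`. -/
def rankDefect (ℓ : ℕ) [Fact ℓ.Prime] (φ : X →+ G) : ℕ :=
  Module.finrank (ZMod ℓ) ((X →+ ZMod ℓ) ⧸ LinearMap.range (pullHom ℓ φ))

variable [Finite X]

theorem finite_homZMod : Finite (X →+ ZMod ℓ) := DFunLike.finite _

omit [Finite X] in
theorem card_range_pullHom {φ : X →+ G} (hφ : Function.Surjective φ) :
    Nat.card (LinearMap.range (pullHom ℓ φ)) = Nat.card (G →+ ZMod ℓ) :=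
  (Nat.card_congr (LinearEquiv.ofInjective _ (pullHom_injective hφ)).toEquiv).symm

theorem card_surjective_prod {φ : X →+ G} (hφ : Function.Surjective φ) (i : ℕ) :
    Nat.card {κ : Fin i → (X →+ ZMod ℓ) // Function.Surjective (φ.prod (AddMonoidHom.pi κ))}
      = frameCount ℓ (rankDefect ℓ φ) i * Nat.card (G →+ ZMod ℓ) ^ i := by
  have : Finite (X →+ ZMod ℓ) := finite_homZMod
  rw [← card_range_pullHom hφ, rankDefect, ← card_frames_mod]
  exact Nat.card_congr (Equiv.subtypeEquivRight fun κ => surjective_prod_iff hφ κ)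

theorem rankDefect_eq_zero_iff {φ : X →+ G} (hφ : Function.Surjective φ) :
    rankDefect ℓ φ = 0 ↔ Nat.card (X →+ ZMod ℓ) = Nat.card (G →+ ZMod ℓ) := by
  have : Finite (X →+ ZMod ℓ) := finite_homZMod
  have h1 := Submodule.card_eq_card_quotient_mul_card (LinearMap.range (pullHom ℓ φ))
  rw [card_range_pullHom hφ, Module.natCard_eq_pow_finrank (K := ZMod ℓ)
    (V := (X →+ ZMod ℓ) ⧸ LinearMap.range (pullHom ℓ φ)), Nat.card_zmod, ← rankDefect] at h1
  have h2 : 0 < Nat.card (G →+ ZMod ℓ) := by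
    rw [← card_range_pullHom hφ]
    exact Nat.card_pos
  rw [h1]
  constructor
  · intro h; rw [h]; simp
  · intro h
    by_contra hne
    have h3 : 1 < ℓ ^ rankDefect ℓ φ := Nat.one_lt_pow hne (Fact.out : ℓ.Prime).one_lt
    nlinarith

end Frames

/-! ### Moments restricted to groups of a fixed rank -/

section RankMoments

open MeasureTheory

variable {ℓ n : ℕ} [Fact ℓ.Prime]

theorem primary_prod {H : Type*} [AddCommGroup H] (hH : ∀ x : H, ∃ k : ℕ, ℓ ^ k • x = 0) (i : ℕ)
    (x : H × (Fin i → ZMod ℓ)) : ∃ k : ℕ, ℓ ^ k • x = 0 := by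
  obtain ⟨k, hk⟩ := hH x.1
  refine ⟨k + 1, Prod.ext ?_ ?_⟩
  · change ℓ ^ (k + 1) • x.1 = 0
    rw [pow_succ, mul_comm, mul_smul, hk, smul_zero]
  · change ℓ ^ (k + 1) • x.2 = 0
    ext j
    simp

/-- The structures on `Y × (ℤ/ℓ)^i` over the one of `Y`. -/
def LiftOn (Y : BEG ℓ n) (i : ℕ) : Type :=
  {s : BEGOn ℓ n (Y.G × (Fin i → ZMod ℓ)) //
    IsMorphism (s.toBEG (primary_prod Y.isPrimary i)) Y (AddMonoidHom.fst _ _)}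

instance (Y : BEG ℓ n) (i : ℕ) : Finite (LiftOn Y i) :=
  have : NeZero ℓ := ⟨(Fact.out : ℓ.Prime).ne_zero⟩
  Subtype.finite

/-- A structure over the one of `Y`, as a bilinearly enhanced group. -/
def LiftOn.toBEG {Y : BEG ℓ n} {i : ℕ} (s : LiftOn Y i) : BEG ℓ n :=
  s.1.toBEG (primary_prod Y.isPrimary i)

/-- A surjective morphism to some lift of Y amounts to a surjective morphism φ to Y with i
characters that keep the product onto; the structure on the product is then forced to be the
pushforward. -/
theorem tsum_surjCount_liftOn (c : BEGClass ℓ n) (Y : BEG ℓ n) (i : ℕ) :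
    ∑' s : LiftOn Y i, (surjCount c s.toBEG : ENNReal)
      = ∑' φ : SurjSet (rep c) Y,
        (frameCount ℓ (rankDefect ℓ φ.1) i * Nat.card (Y.G →+ ZMod ℓ) ^ i : ENNReal) := by
  have := Fintype.ofFinite (LiftOn Y i)
  have := Fintype.ofFinite (SurjSet (rep c) Y)
  rw [tsum_fintype, tsum_fintype]
  have h : ∀ φ : SurjSet (rep c) Y,
      (frameCount ℓ (rankDefect ℓ φ.1) i * Nat.card (Y.G →+ ZMod ℓ) ^ i : ENNReal)
        = (Nat.card {κ : Fin i → ((rep c).G →+ ZMod ℓ) //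
            Function.Surjective (φ.1.prod (AddMonoidHom.pi κ))} : ENNReal) := fun φ => by
    rw [card_surjective_prod φ.2.1]
    push_cast
    rfl
  have hf : Finite ((rep c).G →+ ZMod ℓ) := finite_homZMod
  simp only [h, surjCount_eq]
  rw [← Nat.cast_sum, ← Nat.cast_sum, ← Nat.card_sigma, ← Nat.card_sigma]
  congr 1
  refine Nat.card_congr
    { toFun := fun p => ⟨⟨(AddMonoidHom.fst _ _).comp p.2.1,
          Prod.fst_surjective.comp p.2.2.1, p.2.2.2.comp p.1.2⟩,
        fun j => (Pi.evalAddMonoidHom _ j).comp ((AddMonoidHom.snd _ _).comp p.2.1), p.2.2.1⟩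
      invFun := fun p => ⟨⟨(rep c).push (p.1.1.prod (AddMonoidHom.pi p.2.1)),
          IsMorphism.of_comp (isMorphism_push _ _ _) p.1.2.2⟩,
        p.1.1.prod (AddMonoidHom.pi p.2.1), p.2.2, isMorphism_push _ _ _⟩
      left_inv := ?_
      right_inv := fun p => rfl }
  rintro ⟨⟨s, hs⟩, f, hf, hm⟩
  change (rep c).G →+ Y.G × (Fin i → ZMod ℓ) at f
  have h1 := (isMorphism_toBEG_iff _ _ f s).1 hm
  subst h1
  rfl

/-- The moment of the indicator of groups of the same rank as `Y`. -/
def rankMoment (μ : Measure (BEGClass ℓ n)) (Y : BEG ℓ n) : ENNReal :=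
  ∫⁻ c, (if Nat.card ((rep c).G →+ ZMod ℓ) = Nat.card (Y.G →+ ZMod ℓ) then
    (surjCount c Y : ENNReal) else 0) ∂μ

omit [Fact ℓ.Prime] in
theorem measurable_class {β : Type*} [MeasurableSpace β] (f : BEGClass ℓ n → β) : Measurable f :=
  fun _ _ => trivial

/-- After division by |Hom(Y, ℤ/ℓ)|^i each φ contributes the number of i-frames in dimension
`rankDefect ℓ φ`. The alternating sum keeps only the φ of defect zero, which are those whose source
has the rank of Y. -/
theorem rank_inversion (c : BEGClass ℓ n) (Y : BEG ℓ n) :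
    ∑' i, ENNReal.ofReal (invCoeff ℓ (2 * i)) * ((Nat.card (Y.G →+ ZMod ℓ) : ENNReal)⁻¹ ^ (2 * i)
        * ∑' s : LiftOn Y (2 * i), (surjCount c s.toBEG : ENNReal))
      = (if Nat.card ((rep c).G →+ ZMod ℓ) = Nat.card (Y.G →+ ZMod ℓ) then
          (surjCount c Y : ENNReal) else 0)
        + ∑' i, ENNReal.ofReal (invCoeff ℓ (2 * i + 1)) *
          ((Nat.card (Y.G →+ ZMod ℓ) : ENNReal)⁻¹ ^ (2 * i + 1)
            * ∑' s : LiftOn Y (2 * i + 1), (surjCount c s.toBEG : ENNReal)) := by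
  have hf : Finite (Y.G →+ ZMod ℓ) := finite_homZMod
  have h1 : ∀ i, (Nat.card (Y.G →+ ZMod ℓ) : ENNReal)⁻¹ ^ i
      * ∑' s : LiftOn Y i, (surjCount c s.toBEG : ENNReal)
      = ∑' φ : SurjSet (rep c) Y, (frameCount ℓ (rankDefect ℓ φ.1) i : ENNReal) := fun i => by
    rw [tsum_surjCount_liftOn, ← ENNReal.tsum_mul_left]
    refine tsum_congr fun φ => ?_
    rw [mul_comm, mul_assoc, ← mul_pow, ENNReal.mul_inv_cancel, one_pow, mul_one]
    · exact_mod_cast Nat.card_pos.ne'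
    · exact ENNReal.natCast_ne_top _
  simp only [h1, ← ENNReal.tsum_mul_left]
  rw [ENNReal.tsum_comm, ENNReal.tsum_comm (f := fun i (φ : SurjSet (rep c) Y) => 
      ENNReal.ofReal (invCoeff ℓ (2 * i + 1)) * (frameCount ℓ (rankDefect ℓ φ.1) (2 * i + 1) : ENNReal))]
  simp only [tsum_even_invCoeff (Fact.out : ℓ.Prime).two_le]
  rw [ENNReal.tsum_add]
  congr 1
  have := Fintype.ofFinite (SurjSet (rep c) Y)
  have h2 : ∀ φ : SurjSet (rep c) Y, (if rankDefect ℓ φ.1 = 0 then (1 : ENNReal) else 0)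
      = if Nat.card ((rep c).G →+ ZMod ℓ) = Nat.card (Y.G →+ ZMod ℓ) then 1 else 0 := fun φ => by
    simp only [rankDefect_eq_zero_iff φ.2.1]
  simp only [h2, tsum_fintype, Finset.sum_const, Finset.card_univ, ← Nat.card_eq_fintype_card,
    ← surjCount_eq]
  split_ifs <;> simp

/-- The contribution of the `i`-th term of the inversion formula to a moment. -/
def inversionTerm (M : BEG ℓ n → ENNReal) (Y : BEG ℓ n) (i : ℕ) : ENNReal :=
  ENNReal.ofReal (invCoeff ℓ i) * ((Nat.card (Y.G →+ ZMod ℓ) : ENNReal)⁻¹ ^ i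
    * ∑' s : LiftOn Y i, M s.toBEG)

theorem integral_rank_inversion (μ : Measure (BEGClass ℓ n)) (Y : BEG ℓ n) :
    ∑' i, inversionTerm (surjMoment μ) Y (2 * i)
      = rankMoment μ Y + ∑' i, inversionTerm (surjMoment μ) Y (2 * i + 1) := by
  have h1 : ∀ i, inversionTerm (surjMoment μ) Y i = ∫⁻ c, inversionTerm (fun Z => surjCount c Z) Y i ∂μ := by
    intro i
    have : Countable (LiftOn Y i) := Finite.to_countable
    simp only [inversionTerm, surjMoment]
    rw [lintegral_const_mul _ (measurable_class _), lintegral_const_mul _ (measurable_class _),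
      lintegral_tsum fun s => (measurable_class _).aemeasurable]
  simp only [h1]
  rw [← lintegral_tsum fun s => (measurable_class _).aemeasurable,
    ← lintegral_tsum fun s => (measurable_class _).aemeasurable, rankMoment,
    ← lintegral_add_left (measurable_class _)]
  exact lintegral_congr fun c => rank_inversion c Y

theorem card_hom_std {k : ℕ} (a : Fin k → ℕ) (ha : ∀ i, 1 ≤ a i) :
    Nat.card (Std ℓ a →+ ZMod ℓ) = ℓ ^ k := by
  classical
  have hd : ∀ i, ℓ ∣ ℓ ^ a i := fun i => dvd_pow_self _ (by have := ha i; omega)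
  have h : Nat.card (Fin k → ZMod ℓ) = ℓ ^ k := by
    rw [Nat.card_fun, Nat.card_zmod, Nat.card_fin]
  rw [← h]
  refine Nat.card_congr
    { toFun := fun χ i => χ (Pi.single i 1)
      invFun := fun c => ∑ i, (AddMonoidHom.mulLeft (c i)).comp
        ((ZMod.castHom (hd i) (ZMod ℓ)).toAddMonoidHom.comp (Pi.evalAddMonoidHom _ i))
      left_inv := fun χ => ?_
      right_inv := fun c => ?_ }
  · refine std_hom_ext fun j => ?_
    rw [AddMonoidHom.finsetSum_apply, Finset.sum_eq_single j]
    · have h1 : ZMod.castHom (hd j) (ZMod ℓ) 1 = 1 := map_one _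
      simp [-ZMod.castHom_apply, h1]
    · intro i _ h
      simp [Pi.single_eq_of_ne h]
    · simp
  · funext j
    change (∑ i, _ : Std ℓ a →+ ZMod ℓ) (Pi.single j 1) = c j
    rw [AddMonoidHom.finsetSum_apply, Finset.sum_eq_single j]
    · have h1 : ZMod.castHom (hd j) (ZMod ℓ) 1 = 1 := map_one _
      simp [-ZMod.castHom_apply, h1]
    · intro i _ h
      simp [Pi.single_eq_of_ne h]
    · simp

/-- The moments of the universal measure. -/
def univMoment (Y : BEG ℓ n) : ENNReal := ((symSqTorsionCard Y.G (ℓ ^ n) : ℕ) : ENNReal)⁻¹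

/-- The sum over lifts is at most |∧²(Y × (ℤ/ℓ)^i)|. Normalising by |Hom(Y, ℤ/ℓ)|^i = ℓ^(k i)
removes one part of the exponent, and the inversion coefficient removes i.choose 2 with a factor
2^(-i) to spare. -/
theorem inversionTerm_univ_le (hℓ : ℓ ≠ 2) (Y : BEG ℓ n) (i : ℕ) :
    inversionTerm univMoment Y i ≤ Nat.card (wedgeSq Y.G) * ENNReal.ofReal (1 / 2) ^ i := by
  have h3 : 3 ≤ ℓ := by
    have := (Fact.out : ℓ.Prime).two_le
    omega
  have : NeZero ℓ := ⟨by omega⟩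
  obtain ⟨k, a, ha, ⟨e⟩⟩ := exists_addEquiv_std Y.G Y.isPrimary
  have hk : Nat.card (Y.G →+ ZMod ℓ) = ℓ ^ k := by
    rw [← card_hom_std a ha]
    exact Nat.card_congr (e.addMonoidHomCongrLeft (N := ZMod ℓ)).toEquiv
  have h1 : ∑' s : LiftOn Y i, univMoment s.toBEG
      ≤ (Nat.card (wedgeSq Y.G) * ℓ ^ (k * i + i.choose 2) : ℕ) := by
    calc ∑' s : LiftOn Y i, univMoment s.toBEG
        ≤ ∑' _ : BEGOn ℓ n (Y.G × (Fin i → ZMod ℓ)),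
          ((symSqTorsionCard (Y.G × (Fin i → ZMod ℓ)) (ℓ ^ n) : ℕ) : ENNReal)⁻¹ :=
          ENNReal.tsum_comp_le_tsum_of_injective Subtype.val_injective _
      _ ≤ _ := tsum_begOn_const_le (primary_prod Y.isPrimary i)
      _ ≤ _ := Nat.cast_le.2 (card_wedgeSq_prod_pow_le ((genBy_std a).congr e.symm) i)
  have hℓ0 : (ℓ : ENNReal) ^ (k * i) ≠ 0 := pow_ne_zero _ (by exact_mod_cast (by omega : ℓ ≠ 0))
  have hℓt : (ℓ : ENNReal) ^ (k * i) ≠ ⊤ := ENNReal.pow_ne_top (ENNReal.natCast_ne_top _)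
  calc inversionTerm univMoment Y i
      ≤ ENNReal.ofReal (invCoeff ℓ i) * ((Nat.card (Y.G →+ ZMod ℓ) : ENNReal)⁻¹ ^ i
        * (Nat.card (wedgeSq Y.G) * ℓ ^ (k * i + i.choose 2) : ℕ)) := by
        unfold inversionTerm
        gcongr
    _ = Nat.card (wedgeSq Y.G) * (ENNReal.ofReal (invCoeff ℓ i) * (ℓ : ENNReal) ^ (i.choose 2)) *
        (((ℓ : ENNReal) ^ (k * i))⁻¹ * (ℓ : ENNReal) ^ (k * i)) := by
        rw [hk]
        push_cast
        rw [← ENNReal.inv_pow, ← pow_mul, pow_add]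
        ring
    _ ≤ _ := by
        rw [ENNReal.inv_mul_cancel hℓ0 hℓt, mul_one]
        gcongr
        rw [← ENNReal.ofReal_natCast, ← ENNReal.ofReal_pow (Nat.cast_nonneg _),
          ← ENNReal.ofReal_mul (invCoeff_nonneg (by omega) i), ← ENNReal.ofReal_pow (by norm_num)]
        exact ENNReal.ofReal_le_ofReal (invCoeff_mul_pow_le h3 i)

theorem tsum_inversionTerm_univ_ne_top (hℓ : ℓ ≠ 2) (Y : BEG ℓ n) :
    ∑' i, inversionTerm univMoment Y i ≠ ⊤ := by
  refine ne_top_of_le_ne_top ?_ (ENNReal.tsum_le_tsum (inversionTerm_univ_le hℓ Y))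
  rw [ENNReal.tsum_mul_left, ENNReal.tsum_geometric]
  refine ENNReal.mul_ne_top (ENNReal.natCast_ne_top _) (ENNReal.inv_ne_top.2 ?_)
  rw [← ENNReal.ofReal_one, ← ENNReal.ofReal_sub _ (by norm_num)]
  norm_num

/-- Both sides of the inversion are determined by the moments, and the odd part is finite, so it can
be cancelled. -/
theorem rankMoment_unique (hℓ : ℓ ≠ 2) {μ μ' : Measure (BEGClass ℓ n)}
    (h : ∀ Y, surjMoment μ Y = univMoment Y) (h' : ∀ Y, surjMoment μ' Y = univMoment Y)
    (Y : BEG ℓ n) : rankMoment μ Y = rankMoment μ' Y := by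
  have e : surjMoment μ = univMoment := funext h
  have e' : surjMoment μ' = univMoment := funext h'
  have h1 := integral_rank_inversion μ Y
  have h2 := integral_rank_inversion μ' Y
  rw [e] at h1
  rw [e', h1] at h2
  refine (ENNReal.add_left_inj ?_).1 h2
  exact ne_top_of_le_ne_top (tsum_inversionTerm_univ_ne_top hℓ Y)
    (ENNReal.tsum_comp_le_tsum_of_injective (f := fun i => 2 * i + 1)
      (fun i j hij => by simpa using hij) _)

end RankMoments

/-! ### Uniqueness of the universal measure -/

section Unique

open MeasureTheory

variable {ℓ n : ℕ} [Fact ℓ.Prime]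

theorem Iso.card_hom {X Y : BEG ℓ n} (h : Iso X Y) :
    Nat.card (X.G →+ ZMod ℓ) = Nat.card (Y.G →+ ZMod ℓ) := by
  obtain ⟨e, -⟩ := h
  exact Nat.card_congr (e.addMonoidHomCongrLeft (N := ZMod ℓ)).toEquiv

omit [Fact ℓ.Prime] in
theorem Iso.kills {X Y : BEG ℓ n} (h : Iso X Y) {N : ℕ} (hX : ∀ x : X.G, N • x = 0) (y : Y.G) :
    N • y = 0 := by
  obtain ⟨e, -⟩ := h
  obtain ⟨x, rfl⟩ := e.surjective y
  rw [← map_nsmul, hX, map_zero]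

/-- There are finitely many classes of bounded rank and exponent. -/
theorem finite_classes (B m : ℕ) :
    {c : BEGClass ℓ n | Nat.card ((rep c).G →+ ZMod ℓ) ≤ B ∧
      ∀ x : (rep c).G, ℓ ^ m • x = 0}.Finite := by
  have hp : 1 < ℓ := (Fact.out : ℓ.Prime).one_lt
  have : NeZero ℓ := ⟨by omega⟩
  let F : (Σ k : Fin (B + 1), Σ a : Fin k → Fin (m + 1), BEGOn ℓ n (Std ℓ fun i => (a i : ℕ))) →
      BEGClass ℓ n := fun p => (p.2.2.toBEG (exists_primary_pow fun i => (p.2.1 i : ℕ))).toClass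
  refine (Set.finite_range F).subset ?_
  rintro c ⟨h1, h2⟩
  obtain ⟨k, a, s, ha, hc⟩ := exists_rep_std c
  have hi : Iso (rep c) (s.toBEG (exists_primary_pow a)) := toClass_eq_iff.1 (by rw [toClass_rep, hc])
  have hk : k < B + 1 := by
    rw [hi.card_hom] at h1
    have e : Nat.card (Std ℓ a →+ ZMod ℓ) ≤ B := h1
    rw [card_hom_std a ha] at e
    -- The rank k is less than ℓ^k, the number of characters.
    exact Nat.lt_succ_of_le ((Nat.lt_pow_self hp).le.trans e)
  have hm : ∀ i, a i < m + 1 := fun i => by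
    have e : ℓ ^ m • (Pi.single i 1 : Std ℓ a) = 0 := hi.kills h2 _
    have e1 := congrFun e i
    rw [Pi.smul_apply, Pi.single_eq_same, nsmul_eq_mul, mul_one, Pi.zero_apply,
      ZMod.natCast_eq_zero_iff, Nat.pow_dvd_pow_iff_le_right hp] at e1
    omega
  exact ⟨⟨⟨k, hk⟩, fun i => ⟨a i, hm i⟩, s⟩, hc.symm⟩

/-- The quotient `X / ℓ^m X`. -/
def trunc (X : BEG ℓ n) (m : ℕ) : BEG ℓ n :=
  (X.push (QuotientAddGroup.mk' (nsmulAddMonoidHom (α := X.G) (ℓ ^ m)).range)).toBEG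
    (primary_of_surjective X.isPrimary (QuotientAddGroup.mk'_surjective _))

/-- The projection `X → X / ℓ^m X`. -/
def truncMap (X : BEG ℓ n) (m : ℕ) : X.G →+ (trunc X m).G :=
  QuotientAddGroup.mk' (nsmulAddMonoidHom (α := X.G) (ℓ ^ m)).range

omit [Fact ℓ.Prime] in
theorem truncMap_surjective (X : BEG ℓ n) (m : ℕ) : Function.Surjective (truncMap X m) :=
  QuotientAddGroup.mk'_surjective _

omit [Fact ℓ.Prime] in
theorem isMorphism_truncMap (X : BEG ℓ n) (m : ℕ) : IsMorphism X (trunc X m) (truncMap X m) :=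
  isMorphism_push _ _ _

omit [Fact ℓ.Prime] in
theorem truncMap_eq_zero_iff (X : BEG ℓ n) (m : ℕ) (x : X.G) :
    truncMap X m x = 0 ↔ ∃ y : X.G, ℓ ^ m • y = x :=
  (QuotientAddGroup.eq_zero_iff (N := (nsmulAddMonoidHom (α := X.G) (ℓ ^ m)).range) x)

omit [Fact (ℓ.Prime)] in
theorem ker_truncMap_le (X : BEG ℓ n) (m : ℕ) {H : Type*} [AddCommGroup H] (f : X.G →+ H)
    (hf : ∀ y : H, ℓ ^ m • y = 0) : (truncMap X m).ker ≤ f.ker := by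
  intro x hx
  obtain ⟨y, rfl⟩ := (truncMap_eq_zero_iff X m x).1 hx
  rw [AddMonoidHom.mem_ker, map_nsmul, hf]

omit [Fact ℓ.Prime] in
theorem exists_factor_trunc (X : BEG ℓ n) (m : ℕ) {H : Type*} [AddCommGroup H] (f : X.G →+ H)
    (hf : ∀ y : H, ℓ ^ m • y = 0) : ∃ h : (trunc X m).G →+ H, h.comp (truncMap X m) = f :=
  ⟨(truncMap X m).liftOfSurjective (truncMap_surjective X m) ⟨f, ker_truncMap_le X m f hf⟩,
    AddMonoidHom.liftOfRightInverse_comp _ _ _ _⟩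

omit [Fact (ℓ.Prime)] in
theorem trunc_kills (X : BEG ℓ n) (m : ℕ) (y : (trunc X m).G) : ℓ ^ m • y = 0 := by
  obtain ⟨x, rfl⟩ := truncMap_surjective X m y
  rw [← map_nsmul, truncMap_eq_zero_iff]
  exact ⟨x, rfl⟩

omit [Fact ℓ.Prime] in
theorem card_surjSet_trunc (X Z : BEG ℓ n) (m : ℕ) (hZ : ∀ y : Z.G, ℓ ^ m • y = 0) :
    Nat.card (SurjSet (trunc X m) Z) = Nat.card (SurjSet X Z) := by
  refine Nat.card_eq_of_bijective (fun f => ⟨f.1.comp (truncMap X m),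
    f.2.1.comp (truncMap_surjective X m), (isMorphism_truncMap X m).comp f.2.2⟩) ⟨?_, ?_⟩
  · intro f f' h
    refine Subtype.ext (AddMonoidHom.ext fun y => ?_)
    obtain ⟨x, rfl⟩ := truncMap_surjective X m y
    exact DFunLike.congr_fun (congrArg Subtype.val h) x
  · rintro ⟨f, hf, hm⟩
    obtain ⟨h, rfl⟩ := exists_factor_trunc X m f hZ
    exact ⟨⟨h, fun z => (hf z).imp' (truncMap X m) fun x hx => hx,
      IsMorphism.of_comp (isMorphism_truncMap X m) hm⟩, rfl⟩

theorem card_hom_trunc (X : BEG ℓ n) (m : ℕ) (hm : 1 ≤ m) :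
    Nat.card ((trunc X m).G →+ ZMod ℓ) = Nat.card (X.G →+ ZMod ℓ) := by
  refine Nat.card_eq_of_bijective (fun f => f.comp (truncMap X m)) ⟨?_, ?_⟩
  · intro f f' h
    refine AddMonoidHom.ext fun y => ?_
    obtain ⟨x, rfl⟩ := truncMap_surjective X m y
    exact DFunLike.congr_fun h x
  · intro f
    refine exists_factor_trunc X m f fun y => ?_
    obtain ⟨k, rfl⟩ := Nat.exists_eq_add_of_le hm
    rw [pow_add, pow_one, mul_smul, nsmul_eq_mul, ZMod.natCast_self, zero_mul]

omit [Fact (ℓ.Prime)] in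
/-- If `X / ℓ^(m+1) X` is killed by `ℓ^m` then `X` is. -/
theorem iso_trunc_of_kills (X : BEG ℓ n) (m : ℕ) (h : ∀ y : (trunc X (m + 1)).G, ℓ ^ m • y = 0) :
    Iso X (trunc X (m + 1)) := by
  have h1 : ∀ x : X.G, ∃ y : X.G, ℓ ^ m • x = ℓ • ℓ ^ m • y := fun x => by
    have e := h (truncMap X (m + 1) x)
    rw [← map_nsmul, truncMap_eq_zero_iff] at e
    obtain ⟨y, hy⟩ := e
    refine ⟨y, ?_⟩
    rw [← hy, pow_succ', mul_smul]
  -- Iterating ℓ^m X = ℓ·ℓ^m X makes ℓ^m X divisible by every power of ℓ, hence zero in a finite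
  -- ℓ-group.
  have h2 : ∀ (j : ℕ) (x : X.G), ∃ y : X.G, ℓ ^ m • x = ℓ ^ j • ℓ ^ m • y := by
    intro j
    induction j with
    | zero => exact fun x => ⟨x, by simp⟩
    | succ j ih =>
      intro x
      obtain ⟨y, hy⟩ := ih x
      obtain ⟨z, hz⟩ := h1 y
      exact ⟨z, by rw [hy, hz, pow_succ, mul_smul]⟩
  obtain ⟨K, hK⟩ := exists_pow_kill X.isPrimary
  have h3 : ∀ x : X.G, ℓ ^ m • x = 0 := fun x => by
    obtain ⟨y, hy⟩ := h2 K x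
    rw [hy, hK]
  have hinj : Function.Injective (truncMap X (m + 1)) := by
    rw [← AddMonoidHom.ker_eq_bot_iff, eq_bot_iff]
    intro x hx
    obtain ⟨y, rfl⟩ := (truncMap_eq_zero_iff X _ x).1 hx
    rw [pow_succ', mul_smul, h3, smul_zero]
    exact AddSubgroup.zero_mem _
  refine ⟨AddEquiv.ofBijective (truncMap X (m + 1)) ⟨hinj, truncMap_surjective _ _⟩, ?_⟩
  exact isMorphism_truncMap X (m + 1)

omit [Fact ℓ.Prime] in
theorem surjCount_self_ne_zero (c : BEGClass ℓ n) : surjCount c (rep c) ≠ 0 := by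
  rw [surjCount_eq]
  have : Nonempty (SurjSet (rep c) (rep c)) :=
    ⟨⟨AddMonoidHom.id _, Function.surjective_id, IsMorphism.id _⟩⟩
  exact Nat.card_pos.ne'

omit [Fact ℓ.Prime] in
-- This is the triangularity of the moment matrix: off the diagonal, surjections only go from larger
-- groups to smaller ones.
theorem eq_of_surjCount_ne_zero {c d : BEGClass ℓ n} (h : surjCount c (rep d) ≠ 0)
    (hc : Nat.card (rep c).G ≤ Nat.card (rep d).G) : c = d := by
  rw [surjCount_eq] at h
  obtain ⟨⟨f, hf, hm⟩⟩ := (Nat.card_ne_zero.1 h).1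
  have hb : Function.Bijective f := by
    have hle := Nat.card_le_card_of_surjective f hf
    exact (Nat.bijective_iff_surjective_and_card f).2 ⟨hf, le_antisymm hc hle⟩
  rw [← toClass_rep c, ← toClass_rep d, toClass_eq_iff]
  exact ⟨AddEquiv.ofBijective f hb, hm⟩

/-- The class of `X / ℓ^m X`. -/
def truncClass (m : ℕ) (c : BEGClass ℓ n) : BEGClass ℓ n := (trunc (rep c) m).toClass

/-- As ℓ^m kills Z and m ≥ 1, both the count of surjections and the rank depend on X/ℓ^m X only.
Fixing the rank leaves finitely many such truncations, so the integral is a finite sum. -/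
theorem rankMoment_eq_sum (μ : Measure (BEGClass ℓ n)) {m : ℕ} (hm : 1 ≤ m) (Z : BEG ℓ n)
    (hZ : ∀ y : Z.G, ℓ ^ m • y = 0) (C : Finset (BEGClass ℓ n))
    (hC : ∀ c, c ∈ C ↔ Nat.card ((rep c).G →+ ZMod ℓ) = Nat.card (Z.G →+ ZMod ℓ) ∧
      ∀ x : (rep c).G, ℓ ^ m • x = 0) :
    rankMoment μ Z = ∑ c ∈ C, surjCount c Z * μ (truncClass m ⁻¹' {c}) := by
  have h1 : ∀ c, (if Nat.card ((rep c).G →+ ZMod ℓ) = Nat.card (Z.G →+ ZMod ℓ) then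
      (surjCount c Z : ENNReal) else 0)
      = ∑ d ∈ C, (surjCount d Z : ENNReal) * (truncClass m ⁻¹' {d}).indicator 1 c := by
    classical
    intro c
    have h2 : surjCount c Z = surjCount (truncClass m c) Z := by
      rw [surjCount_eq, ← card_surjSet_trunc _ _ m hZ]
      rfl
    have h3 : truncClass m c ∈ C
        ↔ Nat.card ((rep c).G →+ ZMod ℓ) = Nat.card (Z.G →+ ZMod ℓ) := by
      have hi : Iso (rep (truncClass m c)) (trunc (rep c) m) := iso_rep _
      rw [hC, hi.card_hom, card_hom_trunc _ _ hm]
      exact and_iff_left fun x => hi.symm.kills (trunc_kills _ _) x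
    simp only [Set.indicator_apply, Set.mem_preimage, Set.mem_singleton_iff, Pi.one_apply,
      mul_ite, mul_one, mul_zero, Finset.sum_ite_eq, h3, h2]
  rw [rankMoment, lintegral_congr h1, lintegral_finsetSum _ fun _ _ => measurable_class _]
  refine Finset.sum_congr rfl fun c _ => ?_
  rw [lintegral_const_mul _ (measurable_class _), lintegral_indicator_one (show MeasurableSet[⊤] _ from trivial)]

/-- A finite triangular system with nonzero diagonal, since the identity is a surjective morphism.
All terms are finite because the measures are. -/
theorem measure_truncClass_unique {μ μ' : Measure (BEGClass ℓ n)} [IsProbabilityMeasure μ]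
    [IsProbabilityMeasure μ'] (h : ∀ Y, rankMoment μ Y = rankMoment μ' Y) {m : ℕ} (hm : 1 ≤ m) (w : ℕ)
    (d : BEGClass ℓ n) (hd : Nat.card ((rep d).G →+ ZMod ℓ) = w)
    (hd' : ∀ x : (rep d).G, ℓ ^ m • x = 0) :
    μ (truncClass m ⁻¹' {d}) = μ' (truncClass m ⁻¹' {d}) := by
  classical
  have hfin : {c : BEGClass ℓ n | Nat.card ((rep c).G →+ ZMod ℓ) = w ∧
      ∀ x : (rep c).G, ℓ ^ m • x = 0}.Finite :=
    (finite_classes w m).subset fun c hc => ⟨hc.1.le, hc.2⟩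
  set C := hfin.toFinset with hC
  have hmem : ∀ c, c ∈ C ↔ Nat.card ((rep c).G →+ ZMod ℓ) = w ∧
      ∀ x : (rep c).G, ℓ ^ m • x = 0 := fun c => hfin.mem_toFinset
  obtain ⟨B, hB⟩ : ∃ B, ∀ c ∈ C, Nat.card (rep c).G ≤ B :=
    ⟨C.sup fun c => Nat.card (rep c).G, fun c hc => Finset.le_sup (f := fun c => Nat.card (rep c).G) hc⟩
  -- The induction runs downwards on the order of the group: the equation for d involves only
  -- strictly larger groups besides d.
  have key : ∀ (j : ℕ) (d : BEGClass ℓ n), d ∈ C → B - Nat.card (rep d).G = j →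
      μ (truncClass m ⁻¹' {d}) = μ' (truncClass m ⁻¹' {d}) := by
    intro j
    induction j using Nat.strong_induction_on with
    | _ j ih =>
      intro d hd hj
      obtain ⟨hd1, hd2⟩ := (hmem d).1 hd
      have e := h (rep d)
      rw [rankMoment_eq_sum μ hm (rep d) hd2 C (by rw [hd1]; exact hmem),
        rankMoment_eq_sum μ' hm (rep d) hd2 C (by rw [hd1]; exact hmem),
        ← Finset.add_sum_erase C _ hd, ← Finset.add_sum_erase C _ hd] at e
      have e2 : ∑ c ∈ C.erase d, (surjCount c (rep d) : ENNReal) * μ (truncClass m ⁻¹' {c})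
          = ∑ c ∈ C.erase d, (surjCount c (rep d) : ENNReal) * μ' (truncClass m ⁻¹' {c}) := by
        refine Finset.sum_congr rfl fun c hc => ?_
        obtain ⟨hcd, hcC⟩ := Finset.mem_erase.1 hc
        by_cases h0 : surjCount c (rep d) = 0
        · rw [h0, Nat.cast_zero, zero_mul, zero_mul]
        · have hlt : Nat.card (rep d).G < Nat.card (rep c).G := by
            by_contra hle
            exact hcd (eq_of_surjCount_ne_zero h0 (not_lt.1 hle))
          have hb := hB c hcC
          rw [ih (B - Nat.card (rep c).G) (by omega) c hcC rfl]
      rw [e2] at e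
      have e3 := (ENNReal.add_left_inj (ENNReal.sum_ne_top.2 fun c _ =>
        ENNReal.mul_ne_top (ENNReal.natCast_ne_top _) (measure_ne_top _ _))).1 e
      exact (ENNReal.mul_right_inj (by exact_mod_cast surjCount_self_ne_zero d)
        (ENNReal.natCast_ne_top _)).1 e3
  exact key _ d ((hmem d).2 ⟨hd, hd'⟩) rfl

theorem hasUniversalMoments_unique (hℓ : ℓ ≠ 2) {μ μ' : Measure (BEGClass ℓ n)}
    (h : HasUniversalMoments μ) (h' : HasUniversalMoments μ') : μ = μ' := by
  have : Countable (BEGClass ℓ n) := countable_BEGClass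
  have := h.1
  have := h'.1
  refine Measure.ext_of_singleton fun c => ?_
  obtain ⟨m, hm⟩ := exists_pow_kill (rep c).isPrimary
  -- Truncation at m + 1 rather than m isolates c: if X/ℓ^(m+1) X is killed by ℓ^m, then X has no
  -- further torsion to lose and equals its truncation.
  have hpre : truncClass (m + 1) ⁻¹' {c} = {c} := by
    ext d
    have key : ∀ d : BEGClass ℓ n, (∀ y : (trunc (rep d) (m + 1)).G, ℓ ^ m • y = 0) →
        truncClass (m + 1) d = d := fun d hd => by
      conv_rhs => rw [← toClass_rep d]
      exact (toClass_eq_iff.2 (iso_trunc_of_kills _ _ hd)).symm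
    constructor
    · intro hd
      have hd' : truncClass (m + 1) d = c := hd
      have hi : Iso (rep c) (trunc (rep d) (m + 1)) := by
        rw [← hd']
        exact iso_rep _
      rw [Set.mem_singleton_iff, ← hd', key d (hi.kills hm)]
    · rintro rfl
      refine key d fun y => ?_
      obtain ⟨x, rfl⟩ := truncMap_surjective _ _ y
      rw [← map_nsmul, hm, map_zero]
  rw [← hpre]
  exact measure_truncClass_unique (rankMoment_unique hℓ h.2 h'.2) (by omega) _ c rfl
    fun x => by rw [pow_succ, mul_comm, mul_smul, hm, smul_zero]

end Unique

/-! ### Convergence of measures from convergence of moments -/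

section Limit

open MeasureTheory Filter Topology

variable {ℓ n : ℕ} [Fact ℓ.Prime]

/-- Convergence of all Surj-moments to the universal ones. -/
def MomentsConverge (ν : ℕ → Measure (BEGClass ℓ n)) : Prop :=
  ∀ Y : BEG ℓ n, Tendsto (fun g => surjMoment (ν g) Y) atTop (𝓝 (univMoment Y))

/-- There are finitely many structures on H, so the sum of their moments converges to at most |∧²H|;
the added 1 makes the bound strict and thus valid eventually. -/
theorem MomentsConverge.homSurj_le {ν : ℕ → Measure (BEGClass ℓ n)} (h : MomentsConverge ν)
    {H : Type} [AddCommGroup H] [Finite H] (hH : ∀ x : H, ∃ k : ℕ, ℓ ^ k • x = 0) :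
    ∀ᶠ g in atTop, ∫⁻ c, (homSurjCount c H : ENNReal) ∂(ν g) ≤ Nat.card (wedgeSq H) + 1 := by
  have : NeZero ℓ := ⟨(Fact.out : ℓ.Prime).ne_zero⟩
  have := Fintype.ofFinite (BEGOn ℓ n H)
  simp only [lintegral_homSurjCount _ hH]
  have h1 : Tendsto (fun g => ∑' s : BEGOn ℓ n H, surjMoment (ν g) (s.toBEG hH)) atTop
      (𝓝 (∑' s : BEGOn ℓ n H, univMoment (s.toBEG hH))) := by
    simp only [tsum_fintype]
    exact tendsto_finsetSum _ fun s _ => h _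
  have h2 : ∑' s : BEGOn ℓ n H, univMoment (s.toBEG hH) < Nat.card (wedgeSq H) + 1 :=
    (tsum_begOn_const_le (n := n) hH).trans_lt
      (ENNReal.lt_add_right (ENNReal.natCast_ne_top _) one_ne_zero)
  exact (h1.eventually_lt_const h2).mono fun g hg => hg.le

omit [Fact ℓ.Prime] in
theorem primary_zmod (m : ℕ) (x : ZMod (ℓ ^ m)) : ∃ k : ℕ, ℓ ^ k • x = 0 :=
  ⟨m, by rw [nsmul_eq_mul, ZMod.natCast_self, zero_mul]⟩

theorem pred_card_hom_le (c : BEGClass ℓ n) :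
    Nat.card ((rep c).G →+ ZMod ℓ) ≤ homSurjCount c (ZMod (ℓ ^ 1)) + 1 := by
  classical
  have : Finite ((rep c).G →+ ZMod ℓ) := finite_homZMod
  have : NeZero (ℓ ^ 1) := ⟨pow_ne_zero _ (Fact.out : ℓ.Prime).ne_zero⟩
  rw [pow_one] at *
  have h1 : ∀ f : (rep c).G →+ ZMod ℓ, f ≠ 0 → Function.Surjective f := by
    intro f hf y
    obtain ⟨x, hx⟩ : ∃ x, f x ≠ 0 := by
      by_contra h
      push Not at h
      exact hf (AddMonoidHom.ext h)
    refine ⟨(y * (f x)⁻¹).val • x, ?_⟩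
    rw [map_nsmul, nsmul_eq_mul, ZMod.natCast_val, ZMod.cast_id', id, mul_assoc, inv_mul_cancel₀ hx,
      mul_one]
  rw [homSurjCount, ← Finite.card_option]
  refine Nat.card_le_card_of_injective
    (fun f => if h : f = 0 then none else some ⟨f, h1 f h⟩) fun f f' h => ?_
  dsimp only at h
  split_ifs at h with h2 h3 h3
  · rw [h2, h3]
  · exact congrArg Subtype.val (Option.some_injective _ h)

/-- A group not killed by ℓ^m surjects onto ℤ/ℓ^(m+1), and composing with the units gives ℓ^m (ℓ -
1) surjections. -/
theorem pow_le_homSurjCount (hℓ : ℓ ≠ 2) (c : BEGClass ℓ n) (m : ℕ)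
    (h : ¬ ∀ x : (rep c).G, ℓ ^ m • x = 0) : 2 ^ m ≤ homSurjCount c (ZMod (ℓ ^ (m + 1))) := by
  classical
  have hp : ℓ.Prime := Fact.out
  have h3 : 3 ≤ ℓ := by
    have := hp.two_le
    omega
  have : NeZero (ℓ ^ (m + 1)) := ⟨pow_ne_zero _ hp.ne_zero⟩
  obtain ⟨k, a, ha, ⟨e⟩⟩ := exists_addEquiv_std (rep c).G (rep c).isPrimary
  obtain ⟨i, hi⟩ : ∃ i, m + 1 ≤ a i := by
    by_contra! hlt
    refine h fun x => e.injective (funext fun i => ?_)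
    have hd : ℓ ^ a i ∣ ℓ ^ m := pow_dvd_pow _ (Nat.lt_succ_iff.1 (hlt i))
    rw [map_nsmul, map_zero, Pi.smul_apply, Pi.zero_apply, nsmul_eq_mul,
      (ZMod.natCast_eq_zero_iff _ _).2 hd, zero_mul]
  let f : (rep c).G →+ ZMod (ℓ ^ (m + 1)) := ((ZMod.castHom (pow_dvd_pow ℓ hi) _).toAddMonoidHom.comp
    (Pi.evalAddMonoidHom (fun i => ZMod (ℓ ^ a i)) i)).comp e.toAddMonoidHom
  have hf : Function.Surjective f :=
    ((ZMod.castHom_surjective (pow_dvd_pow ℓ hi)).comp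
      (Function.surjective_eval i)).comp e.surjective
  obtain ⟨x, hx⟩ := hf 1
  calc 2 ^ m ≤ ℓ ^ m * (ℓ - 1) := by
        calc 2 ^ m ≤ ℓ ^ m := Nat.pow_le_pow_left (by omega) m
          _ ≤ _ := Nat.le_mul_of_pos_right _ (by omega)
    _ = Nat.card (ZMod (ℓ ^ (m + 1)))ˣ := by
        rw [Nat.card_eq_fintype_card, ZMod.card_units_eq_totient, Nat.totient_prime_pow_succ hp]
    _ ≤ _ := by
        refine Nat.card_le_card_of_injective (fun u => ⟨(AddMonoidHom.mulLeft (u : ZMod (ℓ ^ (m + 1)))).comp f,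
          fun y => ?_⟩) fun u v huv => ?_
        · obtain ⟨z, hz⟩ := hf (↑u⁻¹ * y)
          exact ⟨z, by simp [hz]⟩
        · have := DFunLike.congr_fun (congrArg Subtype.val huv) x
          refine Units.ext ?_
          simpa [hx] using this

omit [Fact (ℓ.Prime)] in
theorem measure_le_of_le {ν : Measure (BEGClass ℓ n)} {S : Set (BEGClass ℓ n)}
    {f : BEGClass ℓ n → ENNReal} {K C : ENNReal} (hK : K ≠ 0) (hK' : K ≠ ⊤) (h : ∀ c ∈ S, K ≤ f c)
    (hf : ∫⁻ c, f c ∂ν ≤ C) : ν S ≤ C / K :=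
  (measure_mono h).trans ((meas_ge_le_lintegral_div (measurable_class f).aemeasurable hK hK').trans
    (by gcongr))

theorem exists_nat_div_le {C ε : ENNReal} (hC : C ≠ ⊤) (hε : ε ≠ 0) :
    ∃ K : ℕ, 1 ≤ K ∧ C / K ≤ ε := by
  obtain ⟨K, hK⟩ := ENNReal.exists_nat_gt (ENNReal.div_ne_top hC hε)
  have hK0 : K ≠ 0 := by
    rintro rfl
    simp at hK
  refine ⟨K, by omega, ENNReal.div_le_of_le_mul ?_⟩
  rw [mul_comm]
  exact (ENNReal.div_le_iff_le_mul (Or.inl hε) (Or.inr (by exact_mod_cast hK0))).1 hK.le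

/-- Large rank or large exponent forces many surjections to a cyclic group. Their expected number is
eventually at most |∧²| + 1 = 2, so Markov's inequality bounds both events. -/
theorem MomentsConverge.tight (hℓ : ℓ ≠ 2) {ν : ℕ → Measure (BEGClass ℓ n)} (h : MomentsConverge ν)
    {ε : ENNReal} (hε : ε ≠ 0) :
    ∃ S : Finset (BEGClass ℓ n), ∀ᶠ g in atTop, ν g (S : Set (BEGClass ℓ n))ᶜ ≤ ε := by
  have : NeZero ℓ := ⟨(Fact.out : ℓ.Prime).ne_zero⟩
  have : ∀ m, NeZero (ℓ ^ m) := fun m => ⟨pow_ne_zero _ (Fact.out : ℓ.Prime).ne_zero⟩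
  -- The same B limits the number of characters and the exponent ℓ^B; for the latter B < 2^B is
  -- used.
  obtain ⟨B, hB, hB'⟩ := exists_nat_div_le (C := 2) (by norm_num) (ENNReal.half_pos hε).ne'
  have hfin := finite_classes (ℓ := ℓ) (n := n) B B
  refine ⟨hfin.toFinset, ?_⟩
  have hE : ∀ m : ℕ, ∀ᶠ g in atTop, ∫⁻ c, (homSurjCount c (ZMod (ℓ ^ m)) : ENNReal) ∂(ν g) ≤ 2 := by
    intro m
    refine (h.homSurj_le (H := ZMod (ℓ ^ m)) (primary_zmod m)).mono fun g hg => hg.trans ?_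
    rw [card_wedgeSq_cyclic]
    norm_num
  filter_upwards [hE 1, hE (B + 1)] with g h1 h2
  have hB0 : (B : ENNReal) ≠ 0 := by exact_mod_cast (by omega : B ≠ 0)
  have e1 : ν g {c | (B : ENNReal) ≤ homSurjCount c (ZMod (ℓ ^ 1))} ≤ ε / 2 :=
    (measure_le_of_le hB0 (ENNReal.natCast_ne_top _) (fun c hc => hc) h1).trans hB'
  have e2 : ν g {c | (B : ENNReal) ≤ homSurjCount c (ZMod (ℓ ^ (B + 1)))} ≤ ε / 2 :=
    (measure_le_of_le hB0 (ENNReal.natCast_ne_top _) (fun c hc => hc) h2).trans hB'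
  calc ν g (hfin.toFinset : Set (BEGClass ℓ n))ᶜ
      ≤ ν g ({c | (B : ENNReal) ≤ homSurjCount c (ZMod (ℓ ^ 1))} ∪
          {c | (B : ENNReal) ≤ homSurjCount c (ZMod (ℓ ^ (B + 1)))}) := by
        refine measure_mono fun c hc => ?_
        rw [Set.Finite.coe_toFinset, Set.mem_compl_iff, Set.mem_ofPred_eq, not_and_or] at hc
        rcases hc with hc | hc
        · left
          have := pred_card_hom_le c
          exact Nat.cast_le (α := ENNReal) |>.2 (by omega)
        · right
          exact Nat.cast_le (α := ENNReal) |>.2 ((Nat.lt_two_pow_self (n := B)).le.trans (pow_le_homSurjCount hℓ c B hc))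
    _ ≤ ε / 2 + ε / 2 := (measure_union_le _ _).trans (add_le_add e1 e2)
    _ = ε := ENNReal.add_halves ε

-- A pair of surjections to Y is a surjection to its image in Y × Y. Second moments are thus bounded
-- by first moments for subgroups of Y × Y.
omit [Fact ℓ.Prime] in
theorem sq_surjCount_le (c : BEGClass ℓ n) (Y : BEG ℓ n) :
    (surjCount c Y : ENNReal) ^ 2
      ≤ ∑' B : AddSubgroup (Y.G × Y.G), (homSurjCount c B : ENNReal) := by
  have := Fintype.ofFinite (AddSubgroup (Y.G × Y.G))
  rw [tsum_fintype, ← Nat.cast_pow, ← Nat.cast_sum]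
  refine Nat.cast_le.2 ?_
  rw [surjCount_eq, sq, ← Nat.card_prod]
  unfold homSurjCount
  rw [← Nat.card_sigma]
  refine Nat.card_le_card_of_injective
    (fun p => ⟨(p.1.1.prod p.2.1).range, (p.1.1.prod p.2.1).rangeRestrict,
      AddMonoidHom.rangeRestrict_surjective _⟩) fun p p' h => ?_
  have key : ∀ (q q' : Σ B : AddSubgroup (Y.G × Y.G), {f : (rep c).G →+ B // Function.Surjective f}),
      q = q' → ∀ x, (q.2.1 x : Y.G × Y.G) = q'.2.1 x := by
    rintro q _ rfl x
    rfl
  have h2 := key _ _ h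
  refine Prod.ext (Subtype.ext (AddMonoidHom.ext fun x => ?_))
    (Subtype.ext (AddMonoidHom.ext fun x => ?_))
  · exact congrArg Prod.fst (h2 x)
  · exact congrArg Prod.snd (h2 x)

theorem MomentsConverge.sq_bounded {ν : ℕ → Measure (BEGClass ℓ n)} (h : MomentsConverge ν)
    (Y : BEG ℓ n) : ∃ C : ENNReal, C ≠ ⊤ ∧
      ∀ᶠ g in atTop, ∫⁻ c, (surjCount c Y : ENNReal) ^ 2 ∂(ν g) ≤ C := by
  have := Fintype.ofFinite (AddSubgroup (Y.G × Y.G))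
  have hp : ∀ (B : AddSubgroup (Y.G × Y.G)) (x : B), ∃ k : ℕ, ℓ ^ k • x = 0 := by
    intro B x
    obtain ⟨k, hk⟩ := exists_pow_kill Y.isPrimary
    exact ⟨k, Subtype.ext (Prod.ext (hk x.1.1) (hk x.1.2))⟩
  refine ⟨∑ B : AddSubgroup (Y.G × Y.G), (Nat.card (wedgeSq B) + 1 : ENNReal),
    ENNReal.sum_ne_top.2 fun B _ => by finiteness, ?_⟩
  filter_upwards [eventually_all.2 fun B => h.homSurj_le (hp B)] with g hg
  calc ∫⁻ c, (surjCount c Y : ENNReal) ^ 2 ∂(ν g)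
      ≤ ∫⁻ c, ∑ B : AddSubgroup (Y.G × Y.G), (homSurjCount c B : ENNReal) ∂(ν g) :=
        lintegral_mono fun c => (sq_surjCount_le c Y).trans (tsum_fintype _).le
    _ = ∑ B : AddSubgroup (Y.G × Y.G), ∫⁻ c, (homSurjCount c B : ENNReal) ∂(ν g) :=
        lintegral_finsetSum _ fun _ _ => measurable_class _
    _ ≤ _ := Finset.sum_le_sum fun B _ => hg B

/-- Use x ≤ x²/K + K: the first part is small by the second moment bound for large K, the second by
tightness with tail mass ε/(2K). -/
theorem MomentsConverge.uniformlyIntegrable (hℓ : ℓ ≠ 2) {ν : ℕ → Measure (BEGClass ℓ n)}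
    (h : MomentsConverge ν) (Y : BEG ℓ n) {ε : ENNReal} (hε : ε ≠ 0) :
    ∃ S : Finset (BEGClass ℓ n), ∀ᶠ g in atTop,
      ∫⁻ c in (S : Set (BEGClass ℓ n))ᶜ, (surjCount c Y : ENNReal) ∂(ν g) ≤ ε := by
  obtain ⟨C, hC, hC'⟩ := h.sq_bounded Y
  have hε2 : ε / 2 ≠ 0 := (ENNReal.half_pos hε).ne'
  obtain ⟨K, hK, hK'⟩ := exists_nat_div_le hC hε2
  have hK0 : (K : ENNReal) ≠ 0 := by exact_mod_cast (by omega : K ≠ 0)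
  have hKt : (K : ENNReal) ≠ ⊤ := ENNReal.natCast_ne_top _
  obtain ⟨S, hS⟩ := h.tight hℓ (ENNReal.div_pos hε2 hKt).ne'
  refine ⟨S, ?_⟩
  filter_upwards [hC', hS] with g h1 h2
  have hle : ∀ c, (surjCount c Y : ENNReal) ≤ (surjCount c Y : ENNReal) ^ 2 * (K : ENNReal)⁻¹ + K := by
    intro c
    rcases le_total (surjCount c Y) K with hc | hc
    · exact (Nat.cast_le.2 hc).trans le_add_self
    · refine le_trans ?_ le_self_add
      calc (surjCount c Y : ENNReal) = surjCount c Y * (K * (K : ENNReal)⁻¹) := by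
            rw [ENNReal.mul_inv_cancel hK0 hKt, mul_one]
        _ ≤ surjCount c Y * (surjCount c Y * (K : ENNReal)⁻¹) := by gcongr
        _ = _ := by ring
  calc ∫⁻ c in (S : Set (BEGClass ℓ n))ᶜ, (surjCount c Y : ENNReal) ∂(ν g)
      ≤ ∫⁻ c in (S : Set (BEGClass ℓ n))ᶜ, ((surjCount c Y : ENNReal) ^ 2 * (K : ENNReal)⁻¹ + K) ∂(ν g) :=
        lintegral_mono hle
    _ = (∫⁻ c in (S : Set (BEGClass ℓ n))ᶜ, (surjCount c Y : ENNReal) ^ 2 ∂(ν g)) * (K : ENNReal)⁻¹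
          + K * ν g (S : Set (BEGClass ℓ n))ᶜ := by
        rw [lintegral_add_left (measurable_class _), lintegral_mul_const _ (measurable_class _),
          lintegral_const, Measure.restrict_apply MeasurableSet.univ, Set.univ_inter]
    _ ≤ C * (K : ENNReal)⁻¹ + K * (ε / 2 / K) := by
        gcongr
        exact (setLIntegral_le_lintegral _ _).trans h1
    _ ≤ ε / 2 + ε / 2 := by
        rw [ENNReal.mul_div_cancel hK0 hKt, ← div_eq_mul_inv]
        gcongr
    _ = ε := ENNReal.add_halves ε

/-- The trivial bilinearly enhanced group. -/
def trivialBEG (ℓ n : ℕ) : BEG ℓ n where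
  G := PUnit
  isPrimary x := ⟨0, Subsingleton.elim _ _⟩
  ω := 0
  ω_mem := Submodule.zero_mem _
  ω_torsion := smul_zero _
  ψ := 0
  compat r α β := by
    have h : ∀ γ : PUnit.{1} →+ ZMod (ℓ ^ (n + r)), γ = 0 := fun γ => AddMonoidHom.ext fun x => map_zero γ
    simp only [h α, h β, AddMonoidHom.zero_apply, map_zero, mul_zero, add_zero]

instance subsingleton_trivialBEG : Subsingleton (trivialBEG ℓ n).G :=
  inferInstanceAs (Subsingleton PUnit)

omit [Fact ℓ.Prime] in
theorem surjCount_trivial (c : BEGClass ℓ n) : surjCount c (trivialBEG ℓ n) = 1 := by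
  rw [surjCount_eq, Nat.card_eq_one_iff_unique]
  have hT : ∀ z : (trivialBEG ℓ n).G ⊗[ℤ] (trivialBEG ℓ n).G, z = 0 := fun z => by
    induction z with
    | zero => rfl
    | tmul x y => rw [Subsingleton.elim x 0, TensorProduct.zero_tmul]
    | add x y hx hy => rw [hx, hy, add_zero]
  refine ⟨⟨fun f f' => Subtype.ext (AddMonoidHom.ext fun x => Subsingleton.elim _ _)⟩,
    ⟨⟨0, fun y => ⟨0, Subsingleton.elim _ _⟩, ?_, fun α => Subsingleton.elim _ _⟩⟩⟩
  rw [hT (trivialBEG ℓ n).ω]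
  exact hT _

omit [Fact ℓ.Prime] in
theorem univMoment_trivial : univMoment (trivialBEG ℓ n) = 1 := by
  have : symSqTorsionCard (trivialBEG ℓ n).G (ℓ ^ n) = 1 := by
    rw [symSqTorsionCard, Nat.card_eq_one_iff_unique]
    have hT : ∀ z : (trivialBEG ℓ n).G ⊗[ℤ] (trivialBEG ℓ n).G, z = 0 := fun z => by
      induction z with
      | zero => rfl
      | tmul x y => rw [Subsingleton.elim x 0, TensorProduct.zero_tmul]
      | add x y hx hy => rw [hx, hy, add_zero]
    refine ⟨⟨fun z z' => Subtype.ext ?_⟩, ⟨⟨0, smul_zero _⟩⟩⟩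
    obtain ⟨w, hw⟩ := Submodule.mkQ_surjective (wedgeSq (trivialBEG ℓ n).G) z.1
    obtain ⟨w', hw'⟩ := Submodule.mkQ_surjective (wedgeSq (trivialBEG ℓ n).G) z'.1
    rw [← hw, ← hw', hT w, hT w']
  rw [univMoment, this]
  simp

-- The total mass is the moment of the trivial group, so being a probability measure is automatic.
omit [Fact (ℓ.Prime)] in
theorem hasUniversalMoments_iff {μ : Measure (BEGClass ℓ n)} :
    HasUniversalMoments μ ↔ ∀ Y, surjMoment μ Y = univMoment Y := by
  refine ⟨fun h => h.2, fun h => ⟨⟨?_⟩, h⟩⟩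
  have h1 := h (trivialBEG ℓ n)
  simpa [surjMoment, surjCount_trivial, univMoment_trivial] using h1

theorem setLIntegral_finset_class (ν : Measure (BEGClass ℓ n)) (f : BEGClass ℓ n → ENNReal)
    (S : Finset (BEGClass ℓ n)) :
    ∫⁻ c in (S : Set (BEGClass ℓ n)), f c ∂ν = ∑ c ∈ S, f c * ν {c} := by
  rw [lintegral_finset]

/-- Along an ultrafilter, measures with converging moments converge to a universal measure. -/
theorem MomentsConverge.exists_limit (hℓ : ℓ ≠ 2) {ν : ℕ → Measure (BEGClass ℓ n)}
    (h : MomentsConverge ν) (U : Ultrafilter ℕ) (hU : (U : Filter ℕ) ≤ atTop) :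
    ∃ μ : Measure (BEGClass ℓ n), HasUniversalMoments μ ∧
      ∀ c, Tendsto (fun g => ν g {c}) U (𝓝 (μ {c})) := by
  have hlim : ∀ c, ∃ p : ENNReal, Tendsto (fun g => ν g {c}) U (𝓝 p) := fun c => by
    obtain ⟨p, -, hp⟩ := isCompact_univ.ultrafilter_le_nhds (U.map fun g => ν g {c})
      (by simp)
    exact ⟨p, hp⟩
  choose p hp using hlim
  have : Countable (BEGClass ℓ n) := countable_BEGClass
  -- The masses of points converge along U by compactness of [0, ∞]; they define μ, which could a
  -- priori lose mass.
  let μ : Measure (BEGClass ℓ n) := Measure.sum fun c => p c • Measure.dirac c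
  have hμ : ∀ f : BEGClass ℓ n → ENNReal, ∫⁻ c, f c ∂μ = ∑' c, f c * p c := fun f => by
    rw [lintegral_sum_measure]
    refine tsum_congr fun c => ?_
    rw [lintegral_smul_measure, lintegral_dirac' _ (measurable_class f), smul_eq_mul, mul_comm]
  have hS : ∀ (Y : BEG ℓ n) (S : Finset (BEGClass ℓ n)),
      Tendsto (fun g => ∫⁻ c in (S : Set (BEGClass ℓ n)), (surjCount c Y : ENNReal) ∂(ν g)) U
        (𝓝 (∑ c ∈ S, surjCount c Y * p c)) := fun Y S => by
    simp only [setLIntegral_finset_class]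
    exact tendsto_finsetSum _ fun c _ =>
      ENNReal.Tendsto.const_mul (hp c) (Or.inr (ENNReal.natCast_ne_top _))
  refine ⟨μ, hasUniversalMoments_iff.2 fun Y => ?_, fun c => ?_⟩
  · rw [surjMoment, hμ]
    have hY := (h Y).mono_left hU
    -- One inequality is Fatou's lemma on finite sets; uniform integrability shows that nothing
    -- escapes to infinity, which gives the other.
    refine le_antisymm ?_ (ENNReal.le_of_forall_pos_le_add fun ε hε _ => ?_)
    · rw [ENNReal.tsum_eq_iSup_sum]
      exact iSup_le fun S => le_of_tendsto_of_tendsto (hS Y S) hY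
        (Eventually.of_forall fun g => setLIntegral_le_lintegral _ _)
    · obtain ⟨S, hS'⟩ := h.uniformlyIntegrable hℓ Y (ε := ε) (by exact_mod_cast hε.ne')
      calc univMoment Y ≤ ∑ c ∈ S, surjCount c Y * p c + ε := by
            refine le_of_tendsto_of_tendsto hY ((hS Y S).add_const _) ?_
            filter_upwards [hU hS'] with g hg
            calc surjMoment (ν g) Y = _ := (lintegral_add_compl _
                  (show MeasurableSet (S : Set (BEGClass ℓ n)) from trivial)).symm
              _ ≤ _ := by gcongr
        _ ≤ _ := by
            gcongr
            exact ENNReal.sum_le_tsum S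
  · have e : μ {c} = p c := by
      have h1 := hμ (Set.indicator {c} 1)
      rw [lintegral_indicator_one (show MeasurableSet ({c} : Set (BEGClass ℓ n)) from trivial)] at h1
      rw [h1, tsum_eq_single c]
      · simp
      · intro d hd
        simp [hd]
    rw [e]
    exact hp c

theorem MomentsConverge.exists_universal (hℓ : ℓ ≠ 2) {ν : ℕ → Measure (BEGClass ℓ n)}
    (h : MomentsConverge ν) : ∃ μ : Measure (BEGClass ℓ n), HasUniversalMoments μ := by
  obtain ⟨μ, hμ, -⟩ := h.exists_limit hℓ (Filter.hyperfilter ℕ)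
    (Filter.hyperfilter_le_cofinite.trans Nat.cofinite_eq_atTop.le)
  exact ⟨μ, hμ⟩

/-- All ultrafilter limits have the universal moments, hence coincide with μ by uniqueness. -/
theorem MomentsConverge.tendsto_singleton (hℓ : ℓ ≠ 2) {ν : ℕ → Measure (BEGClass ℓ n)}
    (h : MomentsConverge ν) {μ : Measure (BEGClass ℓ n)} (hμ : HasUniversalMoments μ)
    (c : BEGClass ℓ n) : Tendsto (fun g => ν g {c}) atTop (𝓝 (μ {c})) := by
  rw [tendsto_iff_ultrafilter]
  intro U hU
  obtain ⟨μ', hμ', hc⟩ := h.exists_limit hℓ U hU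
  rw [hasUniversalMoments_unique hℓ hμ hμ']
  exact hc c

theorem MomentsConverge.weaklyConverges (hℓ : ℓ ≠ 2) {ν : ℕ → Measure (BEGClass ℓ n)}
    (hν : ∀ g, IsProbabilityMeasure (ν g)) (h : MomentsConverge ν) {μ : Measure (BEGClass ℓ n)}
    (hμ : HasUniversalMoments μ) : WeaklyConverges ν μ := by
  rintro φ ⟨C, hC⟩
  have := hμ.1
  have hC0 : ∀ c, ‖φ c‖ ≤ |C| + 1 := fun c =>
    (hC c).trans ((le_abs_self C).trans (by linarith))
  have hint : ∀ (m : Measure (BEGClass ℓ n)) [IsProbabilityMeasure m], Integrable φ m := fun m _ =>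
    Integrable.of_bound (measurable_class φ).aestronglyMeasurable _ (Eventually.of_forall hC0)
  rw [Metric.tendsto_nhds]
  intro ε hε
  -- Chosen so that the integral of φ over a set of mass δ is at most ε/4; |C| + 1 is used to stay
  -- positive.
  set δ : ℝ := ε / (4 * (|C| + 1)) with hδ
  have hCp : 0 < |C| + 1 := by positivity
  have hδ0 : 0 < δ := by positivity
  obtain ⟨S, hS⟩ := h.tight hℓ (ε := ENNReal.ofReal δ) (by simpa using hδ0)
  have hm : ∀ T : Set (BEGClass ℓ n), MeasurableSet T := fun _ => trivial
  have hsum : ∀ m : Measure (BEGClass ℓ n), m (S : Set (BEGClass ℓ n)) = ∑ c ∈ S, m {c} := fun m => by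
    rw [sum_measure_singleton]
  have hSt : Tendsto (fun g => ν g (S : Set (BEGClass ℓ n))) atTop (𝓝 (μ (S : Set (BEGClass ℓ n)))) := by
    simp only [hsum]
    exact tendsto_finsetSum _ fun c _ => h.tendsto_singleton hℓ hμ c
  have hSμ : μ (S : Set (BEGClass ℓ n))ᶜ ≤ ENNReal.ofReal δ := by
    have h1 : Tendsto (fun g => ν g (S : Set (BEGClass ℓ n))ᶜ) atTop
        (𝓝 (μ (S : Set (BEGClass ℓ n))ᶜ)) := by
      simp only [prob_compl_eq_one_sub (hm _)]
      exact ENNReal.Tendsto.sub tendsto_const_nhds hSt (Or.inl ENNReal.one_ne_top)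
    exact le_of_tendsto h1 hS
  have htail : ∀ (m : Measure (BEGClass ℓ n)) [IsProbabilityMeasure m],
      m (S : Set (BEGClass ℓ n))ᶜ ≤ ENNReal.ofReal δ →
        |∫ c in (S : Set (BEGClass ℓ n))ᶜ, φ c ∂m| ≤ ε / 4 := fun m _ hmS => by
    have h1 := norm_setIntegral_le_of_norm_le_const (μ := m) (s := (S : Set (BEGClass ℓ n))ᶜ)
      (measure_lt_top _ _) (fun c _ => hC0 c)
    have h2 : m.real (S : Set (BEGClass ℓ n))ᶜ ≤ δ := ENNReal.toReal_le_of_le_ofReal hδ0.le hmS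
    calc _ ≤ (|C| + 1) * m.real (S : Set (BEGClass ℓ n))ᶜ := h1
      _ ≤ (|C| + 1) * δ := by gcongr
      _ = ε / 4 := by rw [hδ]; field_simp
  have hfin : ∀ (m : Measure (BEGClass ℓ n)) [IsProbabilityMeasure m],
      ∫ c in (S : Set (BEGClass ℓ n)), φ c ∂m = ∑ c ∈ S, m.real {c} * φ c := fun m _ => by
    rw [setIntegral_finset S (hint m).integrableOn]
    rfl
  have hmain : Tendsto (fun g => ∑ c ∈ S, (ν g).real {c} * φ c) atTop
      (𝓝 (∑ c ∈ S, μ.real {c} * φ c)) :=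
    tendsto_finsetSum _ fun c _ => ((ENNReal.tendsto_toReal (measure_ne_top _ _)).comp
      (h.tendsto_singleton hℓ hμ c)).mul_const _
  filter_upwards [hS, (Metric.tendsto_nhds.1 hmain) (ε / 4) (by positivity)] with g h1 h2
  have := hν g
  rw [Real.dist_eq] at h2 ⊢
  rw [← integral_add_compl (hm S) (hint (ν g)), ← integral_add_compl (hm S) (hint μ), hfin, hfin]
  have h3 := htail (ν g) h1
  have h4 := htail μ hSμ
  rw [abs_le] at h3 h4
  rw [abs_lt] at h2 ⊢
  constructor <;> linarith [h2.1, h2.2, h3.1, h3.2, h4.1, h4.2]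

end Limit

/-! ### The distribution of a random bilinearly enhanced group -/

section Model

open MeasureTheory Topology

variable {ℓ : ℕ} [Fact ℓ.Prime] {g n : ℕ}

theorem eventually_dvd_sub (N : ℕ) (c : ℤ_[ℓ]) : ∀ᶠ x in 𝓝 c, (ℓ : ℤ_[ℓ]) ^ N ∣ x - c := by
  have hp : (0 : ℝ) < (ℓ : ℝ) ^ (-(N : ℤ)) := by
    have : (0 : ℝ) < ℓ := by exact_mod_cast (Fact.out : ℓ.Prime).pos
    positivity
  filter_upwards [Metric.ball_mem_nhds c hp] with x hx
  rw [Metric.mem_ball, dist_eq_norm] at hx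
  rw [← Ideal.mem_span_singleton]
  exact (PadicInt.norm_le_pow_iff_mem_span_pow _ _).1 hx.le

theorem eventually_congr_mod (N : ℕ) (M : Mat ℓ g) :
    ∀ᶠ M' in 𝓝 M, ∃ B : Mat ℓ g, M' = M + (ℓ : ℤ_[ℓ]) ^ N • B := by
  have h : ∀ᶠ M' in 𝓝 M, ∀ i j, (ℓ : ℤ_[ℓ]) ^ N ∣ M' i j - M i j :=
    Filter.eventually_all.2 fun i => Filter.eventually_all.2 fun j =>
      ((continuous_id.matrix_elem i j).tendsto M).eventually (eventually_dvd_sub N (M i j))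
  filter_upwards [h] with M' h'
  choose B hB using h'
  refine ⟨Matrix.of B, ?_⟩
  ext i j
  simp [← hB]

variable {Ω : Type*} [TopologicalSpace Ω] {A : Ω → Mat ℓ g} {u : ℤ_[ℓ]}

/-- The condition on f is unchanged when A is changed modulo ℓ^(n+N), where ℓ^N kills Y. -/
theorem isOpen_surjData (hA : Continuous A) (Y : BEG ℓ n) (f : Lat ℓ g →+ Y.G) :
    IsOpen {w | SurjData (A w) u Y.ω Y.ψ f} := by
  obtain ⟨N, hN⟩ := exists_pow_kill Y.isPrimary
  rw [isOpen_iff_mem_nhds]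
  intro w hw
  filter_upwards [hA.continuousAt.eventually (eventually_congr_mod (n + N) (A w))] with w' h'
  obtain ⟨B, hB⟩ := h'
  rw [hB]
  exact SurjData.congr_mod hN hw B

variable [MeasurableSpace Ω]

/-- The expected number of homomorphisms from the lattice which exhibit `Y` as a quotient of the
bilinearly enhanced group of a random endomorphism. -/
def rawMoment (P : Measure Ω) (A : Ω → Mat ℓ g) (u : ℤ_[ℓ]) (Y : BEG ℓ n) : ENNReal :=
  ∑' f : Lat ℓ g →+ Y.G, P {w | SurjData (A w) u Y.ω Y.ψ f}

/-- The distribution of the class of a random bilinearly enhanced group. -/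
def classLaw (P : Measure Ω) {fin : Ω → Prop} (b : {w // fin w} → BEG ℓ n) :
    Measure (BEGClass ℓ n) :=
  (P.comap (Subtype.val : {w // fin w} → Ω)).map fun w => (b w).toClass

variable [BorelSpace Ω] {P : Measure Ω} {fin : Ω → Prop} {b : {w // fin w} → BEG ℓ n}

-- Endomorphisms near A w present the same group, and the hypothesis on `fin` turns a presentation
-- back into finiteness.
omit [MeasurableSpace Ω] [BorelSpace Ω] in
theorem isOpen_fin (hA : Continuous A) (hb : ∀ w, Presents (b w) (A w.1) u)
    (hfin : ∀ w (X : BEG ℓ n), Presents X (A w) u → fin w) : IsOpen {w | fin w} := by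
  rw [isOpen_iff_mem_nhds]
  intro w hw
  obtain ⟨N, hN⟩ := (hb ⟨w, hw⟩).exists_congr_mod
  filter_upwards [hA.continuousAt.eventually (eventually_congr_mod N (A w))] with w' h'
  obtain ⟨B, hB⟩ := h'
  exact hfin w' _ (hB ▸ hN B)

/-- The class is locally constant, since nearby endomorphisms present isomorphic groups. -/
theorem measurable_toClass (hA : Continuous A) (hb : ∀ w, Presents (b w) (A w.1) u) :
    Measurable fun w => (b w).toClass := by
  intro s _
  refine IsOpen.measurableSet ?_
  rw [isOpen_iff_mem_nhds]
  intro w hw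
  obtain ⟨N, hN⟩ := (hb w).exists_congr_mod
  filter_upwards [(hA.comp continuous_subtype_val).continuousAt.eventually
    (eventually_congr_mod N (A w.1))] with w' h'
  obtain ⟨B, hB⟩ := h'
  have h1 : Presents (b w) (A w'.1) u := (show A w'.1 = _ from hB) ▸ hN B
  change (b w').toClass ∈ s
  rw [toClass_eq_iff.2 ((hb w').iso h1)]
  exact hw

theorem isProbabilityMeasure_classLaw [IsProbabilityMeasure P] (hA : Continuous A)
    (hb : ∀ w, Presents (b w) (A w.1) u)
    (hfin : ∀ w (X : BEG ℓ n), Presents X (A w) u → fin w) (h0 : P {w | ¬ fin w} = 0) :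
    IsProbabilityMeasure (classLaw P b) := by
  have hm : MeasurableSet {w | fin w} := (isOpen_fin hA hb hfin).measurableSet
  have he : MeasurableEmbedding (Subtype.val : {w // fin w} → Ω) := MeasurableEmbedding.subtype_coe hm
  refine ⟨?_⟩
  rw [classLaw, Measure.map_apply (measurable_toClass hA hb) MeasurableSet.univ, Set.preimage_univ,
    he.comap_apply, Set.image_univ, show Set.range (Subtype.val : {w // fin w} → Ω) = {w | fin w} from
      Subtype.range_coe]
  exact (prob_compl_eq_zero_iff hm).1 h0

/-- Off a null set the surjections are counted on the lattice, where the finite index set of f is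
the same for all w; the sum and the expectation are then interchanged. -/
theorem surjMoment_classLaw (hA : Continuous A) (hb : ∀ w, Presents (b w) (A w.1) u)
    (hfin : ∀ w (X : BEG ℓ n), Presents X (A w) u → fin w) (h0 : P {w | ¬ fin w} = 0)
    (Y : BEG ℓ n) : surjMoment (classLaw P b) Y = rawMoment P A u Y := by
  have hm : MeasurableSet {w | fin w} := (isOpen_fin hA hb hfin).measurableSet
  have := finite_lat_hom (g := g) Y.isPrimary
  have : Countable (Lat ℓ g →+ Y.G) := Finite.to_countable
  have hS : ∀ f : Lat ℓ g →+ Y.G, MeasurableSet {w | SurjData (A w) u Y.ω Y.ψ f} := fun f =>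
    (isOpen_surjData hA Y f).measurableSet
  have h1 : ∀ w : {w // fin w}, (surjCount (b w).toClass Y : ENNReal)
      = ∑' f : Lat ℓ g →+ Y.G, {w | SurjData (A w) u Y.ω Y.ψ f}.indicator 1 w.1 := fun w => by
    classical
    have := Fintype.ofFinite (Lat ℓ g →+ Y.G)
    rw [surjCount_toClass, card_surjSet_of_presents (hb w), tsum_fintype,
      Nat.card_eq_fintype_card, Fintype.card_subtype, Finset.card_filter, Nat.cast_sum]
    refine Finset.sum_congr rfl fun f _ => ?_
    rw [Set.indicator_apply]
    push_cast
    rfl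
  have he : MeasurableEmbedding (Subtype.val : {w // fin w} → Ω) := MeasurableEmbedding.subtype_coe hm
  rw [surjMoment, classLaw, lintegral_map (measurable_class _) (measurable_toClass hA hb),
    lintegral_congr h1]
  have h2 : ∀ F : Ω → ENNReal, ∫⁻ w : {w // fin w}, F w.1 ∂(P.comap Subtype.val) = ∫⁻ w, F w ∂P :=
    fun F => by
    rw [← he.lintegral_map, he.map_comap,
      show Set.range (Subtype.val : {w // fin w} → Ω) = {w | fin w} from Subtype.range_coe,
      Measure.restrict_eq_self_of_ae_mem (s := {w | fin w}) h0]
  rw [h2 fun w => ∑' f : Lat ℓ g →+ Y.G, {w | SurjData (A w) u Y.ω Y.ψ f}.indicator 1 w,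
    lintegral_tsum fun f => (measurable_one.indicator (hS f)).aemeasurable]
  exact tsum_congr fun f => lintegral_indicator_one (hS f)

end Model

/-! ### Finiteness of the cokernel -/

section Finiteness

variable {ℓ : ℕ} [Fact ℓ.Prime] {g n : ℕ}

/-- By the adjugate, det A multiplies T into A T, so the cokernel is a quotient of T/ℓ^N T. -/
theorem finite_coker_of_det_ne_zero {A : Mat ℓ g} (h : A.det ≠ 0) :
    Finite (Lat ℓ g ⧸ LinearMap.range (Matrix.mulVecLin A)) := by
  obtain ⟨N, v, hv⟩ := IsDiscreteValuationRing.eq_unit_mul_pow_irreducible h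
    (PadicInt.irreducible_p (p := ℓ))
  have hr : ∀ x : Lat ℓ g, (ℓ : ℤ_[ℓ]) ^ N • x ∈ LinearMap.range (Matrix.mulVecLin A) := fun x => by
    refine ⟨((v⁻¹ : ℤ_[ℓ]ˣ) : ℤ_[ℓ]) • (A.adjugate *ᵥ x), ?_⟩
    rw [Matrix.mulVecLin_apply, Matrix.mulVec_smul, Matrix.mulVec_mulVec, Matrix.mul_adjugate, hv,
      Matrix.smul_mulVec, Matrix.one_mulVec, smul_smul, ← mul_assoc, Units.inv_mul, one_mul]
  have : NeZero (ℓ ^ N) := ⟨pow_ne_zero _ (Fact.out : ℓ.Prime).ne_zero⟩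
  refine Finite.of_injective (fun q i => PadicInt.toZModPow N (q.out i) :
    _ → (Fin g ⊕ Fin g → ZMod (ℓ ^ N))) fun q q' e => ?_
  have hd : ∀ i, (ℓ : ℤ_[ℓ]) ^ N ∣ (q.out - q'.out) i := fun i => by
    rw [← toZModPow_eq_zero_iff, Pi.sub_apply, map_sub, sub_eq_zero]
    exact congrFun e i
  obtain ⟨y, hy⟩ := exists_smul_of_dvd hd
  rw [← Quotient.out_eq q, ← Quotient.out_eq q']
  refine (Submodule.Quotient.eq _).2 ?_
  rw [hy]
  exact hr y

theorem exists_primitive {v : Lat ℓ g} (hv : v ≠ 0) :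
    ∃ (N : ℕ) (w : Lat ℓ g), v = (ℓ : ℤ_[ℓ]) ^ N • w ∧ ∃ i, IsUnit (w i) := by
  classical
  obtain ⟨i₀, hi₀⟩ := Function.ne_iff.1 hv
  obtain ⟨K, e, he⟩ := IsDiscreteValuationRing.eq_unit_mul_pow_irreducible hi₀
    (PadicInt.irreducible_p (p := ℓ))
  let Q : ℕ → Prop := fun N => ∀ i, (ℓ : ℤ_[ℓ]) ^ N ∣ v i
  have hK : ∀ N, Q N → N ≤ K := fun N hN => by
    have h := hN i₀
    rw [he, mul_comm] at h
    have h1 := (Units.dvd_mul_right).1 h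
    exact (pow_dvd_pow_iff (PadicInt.irreducible_p (p := ℓ)).ne_zero
      (PadicInt.irreducible_p (p := ℓ)).not_isUnit).1 h1
  have h0 : Q 0 := fun i => by simp
  have hspec := Nat.findGreatest_spec (P := Q) (Nat.zero_le K) h0
  set N := Nat.findGreatest Q K
  obtain ⟨w, hw⟩ := exists_smul_of_dvd hspec
  refine ⟨N, w, hw, ?_⟩
  by_contra! hnu
  have h1 : Q (N + 1) := fun i => by
    have : (ℓ : ℤ_[ℓ]) ∣ w i := by
      rw [← Ideal.mem_span_singleton, ← PadicInt.maximalIdeal_eq_span_p]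
      exact (IsLocalRing.mem_maximalIdeal _).2 (hnu i)
    rw [hw, Pi.smul_apply, smul_eq_mul, pow_succ]
    exact mul_dvd_mul_left _ this
  exact absurd (hK _ h1) (not_le.2 (Nat.findGreatest_is_greatest (P := Q) (Nat.lt_succ_self N) |>
    fun h => by
      by_contra hle
      exact h (not_lt.1 hle) h1))

theorem wedge_zmod_eq_zero (m : ℕ) (x y : ZMod m) : wedge x y = 0 := by
  have h := Nat.card_eq_one_iff_unique.1 (card_wedgeSq_cyclic m)
  have := h.1
  exact congrArg Subtype.val (Subsingleton.elim (⟨wedge x y, wedge_mem x y⟩ : wedgeSq (ZMod m)) 0)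

/-- ∧² of a cyclic group is zero, so ω imposes no condition, and ψ is the one induced by A. Every
surjection killing A T is thus counted in the raw moment of some structure. -/
theorem exists_surjData_zmod {A : Mat ℓ g} {u : ℤ_[ℓ]} (hA : IsAdmissible n A u) {m : ℕ}
    [NeZero (ℓ ^ m)]
    {f : Lat ℓ g →+ ZMod (ℓ ^ m)} (hf : Function.Surjective f) (hfA : ∀ x, f (A *ᵥ x) = 0) :
    ∃ s : BEGOn ℓ n (ZMod (ℓ ^ m)),
      SurjData A u (s.toBEG (primary_zmod m)).ω (s.toBEG (primary_zmod m)).ψ f := by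
  have h0 : omegaAdd f u = 0 := Finset.sum_eq_zero fun i _ => wedge_zmod_eq_zero _ _ _
  exact ⟨⟨(omegaAdd f u, psiHom hA hfA), by rw [h0]; exact Submodule.zero_mem _,
    by rw [h0, smul_zero], psiHom_compat hA hfA⟩, hf, hfA, rfl, psiHom_spec hA hfA⟩

/-- A primitive vector w in the left kernel of A gives the surjection x ↦ w·x, which kills A T; its
unit multiples number ℓ^m (ℓ - 1). -/
theorem two_pow_le_card_hom_of_det_eq_zero (hℓ : ℓ ≠ 2) {A : Mat ℓ g} (h : A.det = 0) (m : ℕ) :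
    2 ^ m ≤ Nat.card {f : Lat ℓ g →+ ZMod (ℓ ^ (m + 1)) // Function.Surjective f ∧
      ∀ x, f (A *ᵥ x) = 0} := by
  classical
  have hp : ℓ.Prime := Fact.out
  have h3 : 3 ≤ ℓ := by
    have := hp.two_le
    omega
  have : NeZero (ℓ ^ (m + 1)) := ⟨pow_ne_zero _ hp.ne_zero⟩
  obtain ⟨v, hv, hvA⟩ := Matrix.exists_vecMul_eq_zero_iff.2 h
  obtain ⟨N, w, hw, i, hi⟩ := exists_primitive hv
  have hwA : w ᵥ* A = 0 := by
    refine smul_right_injective _ (padic_pow_ne_zero (ℓ := ℓ) N) ?_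
    dsimp only
    rw [← Matrix.smul_vecMul, ← hw, hvA, smul_zero]
  let f : Lat ℓ g →+ ZMod (ℓ ^ (m + 1)) :=
    AddMonoidHom.mk' (fun x => PadicInt.toZModPow (m + 1) (w ⬝ᵥ x)) fun x y => by
      rw [dotProduct_add, map_add]
  have hfA : ∀ x, f (A *ᵥ x) = 0 := fun x => by
    change PadicInt.toZModPow (m + 1) (w ⬝ᵥ (A *ᵥ x)) = 0
    rw [Matrix.dotProduct_mulVec, hwA, zero_dotProduct, map_zero]
  have hf : Function.Surjective f := fun z => by
    obtain ⟨c, rfl⟩ := toZModPow_surjective (m + 1) z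
    obtain ⟨e, he⟩ := hi
    refine ⟨Pi.single i (((e⁻¹ : ℤ_[ℓ]ˣ) : ℤ_[ℓ]) * c), ?_⟩
    change PadicInt.toZModPow (m + 1) (w ⬝ᵥ _) = _
    rw [dotProduct_single, ← he, ← mul_assoc, Units.mul_inv, one_mul]
  obtain ⟨x, hx⟩ := hf 1
  have hfinite := finite_lat_hom (g := g) (H := ZMod (ℓ ^ (m + 1))) (primary_zmod (m + 1))
  calc 2 ^ m ≤ ℓ ^ m * (ℓ - 1) := by
        calc 2 ^ m ≤ ℓ ^ m := Nat.pow_le_pow_left (by omega) m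
          _ ≤ _ := Nat.le_mul_of_pos_right _ (by omega)
    _ = Nat.card (ZMod (ℓ ^ (m + 1)))ˣ := by
        rw [Nat.card_eq_fintype_card, ZMod.card_units_eq_totient, Nat.totient_prime_pow_succ hp]
    _ ≤ _ := by
        refine Nat.card_le_card_of_injective (fun c =>
          ⟨(AddMonoidHom.mulLeft (c : ZMod (ℓ ^ (m + 1)))).comp f,
          fun y => ?_, fun y => ?_⟩) fun c d hcd => ?_
        · obtain ⟨z, hz⟩ := hf (↑c⁻¹ * y)
          exact ⟨z, by simp [hz]⟩
        · simp [hfA]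
        · have := DFunLike.congr_fun (congrArg Subtype.val hcd) x
          refine Units.ext ?_
          simpa [hx] using this

open MeasureTheory

variable {Ω : Type*} [TopologicalSpace Ω] [MeasurableSpace Ω] [BorelSpace Ω] {P : Measure Ω}
  {A : Ω → Mat ℓ g} {u : ℤ_[ℓ]}

/-- The cokernel is almost surely finite if the moments of cyclic groups are bounded by the
universal ones. -/
theorem measure_det_eq_zero (hℓ : ℓ ≠ 2) (hA : Continuous A) (hadm : ∀ w, IsAdmissible n (A w) u)
    (hraw : ∀ (m : ℕ) [NeZero (ℓ ^ (m + 1))] (s : BEGOn ℓ n (ZMod (ℓ ^ (m + 1)))),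
      rawMoment P A u (s.toBEG (primary_zmod _)) ≤ univMoment (s.toBEG (primary_zmod _))) :
    P {w | (A w).det = 0} = 0 := by
  classical
  have hp : ℓ.Prime := Fact.out
  have hS : MeasurableSet {w | (A w).det = 0} :=
    (isClosed_eq hA.matrix_det continuous_const).measurableSet
  -- On the event det = 0 at least 2^m surjections occur, while the expected number of all
  -- surjections is at most the sum of the universal moments, hence at most 1.
  have key : ∀ m : ℕ, (2 : ENNReal) ^ m * P {w | (A w).det = 0} ≤ 1 := fun m => by
    have : NeZero (ℓ ^ (m + 1)) := ⟨pow_ne_zero _ hp.ne_zero⟩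
    have : NeZero ℓ := ⟨hp.ne_zero⟩
    have hfinite := finite_lat_hom (g := g) (H := ZMod (ℓ ^ (m + 1))) (primary_zmod (m + 1))
    have : Countable (Lat ℓ g →+ ZMod (ℓ ^ (m + 1))) := Finite.to_countable
    have : Countable (BEGOn ℓ n (ZMod (ℓ ^ (m + 1)))) := Finite.to_countable
    have := Fintype.ofFinite (Lat ℓ g →+ ZMod (ℓ ^ (m + 1)))
    let E : BEGOn ℓ n (ZMod (ℓ ^ (m + 1))) → (Lat ℓ g →+ ZMod (ℓ ^ (m + 1))) → Set Ω := fun s f =>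
      {w | SurjData (A w) u (s.toBEG (primary_zmod _)).ω (s.toBEG (primary_zmod _)).ψ f}
    have hE : ∀ s f, MeasurableSet (E s f) := fun s f =>
      (isOpen_surjData hA (s.toBEG (primary_zmod _)) f).measurableSet
    calc (2 : ENNReal) ^ m * P {w | (A w).det = 0}
        = ∫⁻ w, {w | (A w).det = 0}.indicator (fun _ => (2 : ENNReal) ^ m) w ∂P := by
          rw [lintegral_indicator_const hS]
      _ ≤ ∫⁻ w, ∑' s, ∑' f, (E s f).indicator 1 w ∂P := by
          refine lintegral_mono fun w => ?_
          rw [Set.indicator_apply]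
          split_ifs with hw
          · rw [ENNReal.tsum_comm]
            have h1 := two_pow_le_card_hom_of_det_eq_zero (ℓ := ℓ) hℓ hw m
            calc (2 : ENNReal) ^ m ≤ Nat.card {f : Lat ℓ g →+ ZMod (ℓ ^ (m + 1)) //
                  Function.Surjective f ∧ ∀ x, f (A w *ᵥ x) = 0} := by exact_mod_cast h1
              _ = ∑ f : Lat ℓ g →+ ZMod (ℓ ^ (m + 1)),
                  if Function.Surjective f ∧ ∀ x, f (A w *ᵥ x) = 0 then 1 else 0 := by
                  rw [Nat.card_eq_fintype_card, Fintype.card_subtype, Finset.card_filter,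
                    Nat.cast_sum]
                  push_cast
                  rfl
              _ ≤ _ := by
                  rw [tsum_fintype]
                  refine Finset.sum_le_sum fun f _ => ?_
                  split_ifs with hf
                  · obtain ⟨s, hs⟩ := exists_surjData_zmod (hadm w) hf.1 hf.2
                    refine le_trans ?_ (ENNReal.le_tsum s)
                    rw [Set.indicator_of_mem (show w ∈ E s f from hs), Pi.one_apply]
                  · exact zero_le
          · exact zero_le
      _ = ∑' s, ∑' f, P (E s f) := by
          rw [lintegral_tsum fun s => (Measurable.tsum fun f =>
            measurable_one.indicator (hE s f)).aemeasurable]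
          refine tsum_congr fun s => ?_
          rw [lintegral_tsum fun f => (measurable_one.indicator (hE s f)).aemeasurable]
          exact tsum_congr fun f => lintegral_indicator_one (hE s f)
      _ ≤ ∑' s : BEGOn ℓ n (ZMod (ℓ ^ (m + 1))), univMoment (s.toBEG (primary_zmod _)) :=
          ENNReal.tsum_le_tsum fun s => hraw m s
      _ ≤ Nat.card (wedgeSq (ZMod (ℓ ^ (m + 1)))) := tsum_begOn_const_le (primary_zmod _)
      _ = 1 := by rw [card_wedgeSq_cyclic, Nat.cast_one]
  by_contra hne
  obtain ⟨m, hm⟩ := ENNReal.exists_nat_gt (ENNReal.inv_ne_top.2 hne)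
  have h1 : (m : ENNReal) < 2 ^ m := by exact_mod_cast Nat.lt_two_pow_self
  have h2 := key m
  have h3 : (P {w | (A w).det = 0})⁻¹ < 2 ^ m := hm.trans h1
  have htop : P {w | (A w).det = 0} ≠ ⊤ := by
    have := key 0
    rw [pow_zero, one_mul] at this
    exact ne_top_of_le_ne_top ENNReal.one_ne_top this
  have h4 : (1 : ENNReal) < 2 ^ m * P {w | (A w).det = 0} := by
    have := ENNReal.mul_lt_mul_left hne htop h3
    rwa [ENNReal.inv_mul_cancel hne htop] at this
  exact absurd h2 (not_le.2 h4)

end Finiteness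

/-! ### Finiteness and moments from the standard groups -/

section Reduction

open MeasureTheory

variable {ℓ : ℕ} [Fact ℓ.Prime] {g n : ℕ}

theorem Presents.finite_coker {X : BEG ℓ n} {A : Mat ℓ g} {u : ℤ_[ℓ]} (hX : Presents X A u)
    {W : Submodule ℤ_[ℓ] (Lat ℓ g)} (hW : ∀ y, A *ᵥ y ∈ W) : Finite (Lat ℓ g ⧸ W) := by
  obtain ⟨π, -, hker⟩ := hX
  refine Finite.of_injective (fun q => π q.out) fun q q' e => ?_
  obtain ⟨y, hy⟩ := hker (q.out - q'.out) (by rw [map_sub, sub_eq_zero]; exact e)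
  rw [← Quotient.out_eq q, ← Quotient.out_eq q']
  refine (Submodule.Quotient.eq _).2 ?_
  rw [← hy]
  exact hW y

omit [Fact ℓ.Prime] in
theorem univMoment_congr {X Y : BEG ℓ n} (h : Iso X Y) : univMoment X = univMoment Y := by
  obtain ⟨e, -⟩ := h
  rw [univMoment, univMoment, symSqTorsionCard_congr e]

variable {Ω : Type*} [TopologicalSpace Ω] [MeasurableSpace Ω] [BorelSpace Ω] {P : Measure Ω}
  {A : Ω → Mat ℓ g} {u : ℤ_[ℓ]}

omit [TopologicalSpace Ω] [BorelSpace Ω] in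
theorem rawMoment_congr {X Y : BEG ℓ n} (h : Iso X Y) : rawMoment P A u X = rawMoment P A u Y := by
  obtain ⟨e, he⟩ := h
  let E : (Lat ℓ g →+ X.G) ≃ (Lat ℓ g →+ Y.G) :=
    { toFun := fun f => e.toAddMonoidHom.comp f
      invFun := fun f => e.symm.toAddMonoidHom.comp f
      left_inv := fun f => by ext; simp
      right_inv := fun f => by ext; simp }
  rw [rawMoment, rawMoment, ← E.tsum_eq]
  refine tsum_congr fun f => ?_
  congr 1
  ext w
  refine ⟨fun h => SurjData.comp h ⟨e.surjective, he⟩, fun h => ?_⟩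
  have h1 := SurjData.comp h (X := Y) (Y := X) ⟨e.symm.surjective, IsMorphism.symm e he⟩
  have h2 : e.symm.toAddMonoidHom.comp (E f) = f := E.left_inv f
  rwa [h2] at h1

/-- The cokernel is almost surely finite if the moments of all cyclic groups are bounded by the
universal ones. -/
theorem measure_det_eq_zero' (hℓ : ℓ ≠ 2) (hA : Continuous A) (hadm : ∀ w, IsAdmissible n (A w) u)
    [NeZero ℓ]
    (hraw : ∀ (a : Fin 1 → ℕ), (∀ i, 1 ≤ a i) → ∀ s : BEGOn ℓ n (Std ℓ a),
      rawMoment P A u (s.toBEG (exists_primary_pow a))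
        ≤ univMoment (s.toBEG (exists_primary_pow a))) :
    P {w | (A w).det = 0} = 0 := by
  refine measure_det_eq_zero hℓ hA hadm fun m _ s => ?_
  let e : ZMod (ℓ ^ (m + 1)) ≃+ Std ℓ (fun _ : Fin 1 => m + 1) :=
    (AddEquiv.piUnique (fun _ : Fin 1 => ZMod (ℓ ^ (m + 1)))).symm
  have h := iso_push (s.toBEG (primary_zmod _)) (exists_primary_pow fun _ : Fin 1 => m + 1) e
  rw [rawMoment_congr h, univMoment_congr h]
  exact hraw _ (fun _ => by omega) _

end Reduction

/-! ### Homomorphisms from the lattice -/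

section LatHom

variable {ℓ : ℕ} [Fact ℓ.Prime] {g : ℕ} {H : Type} [AddCommGroup H]

theorem map_smul_of_dvd_sub {N m : ℕ} {c : ℤ_[ℓ]} (hN : ∀ x : H, ℓ ^ N • x = 0)
    (hc : (ℓ : ℤ_[ℓ]) ^ N ∣ c - m) (f : Lat ℓ g →+ H) (x : Lat ℓ g) : f (c • x) = m • f x := by
  obtain ⟨d, hd⟩ := hc
  have : c = m + (ℓ : ℤ_[ℓ]) ^ N * d := by rw [← hd]; ring
  rw [this, add_smul, mul_smul, map_add, map_pow_smul hN, Nat.cast_smul_eq_nsmul, map_nsmul,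
    add_zero]

theorem omegaAdd_eq_nsmul {N m : ℕ} {u : ℤ_[ℓ]} (hN : ∀ x : H, ℓ ^ N • x = 0)
    (hu : (ℓ : ℤ_[ℓ]) ^ N ∣ u - m) (f : Lat ℓ g →+ H) : omegaAdd f u = m • omegaAdd f 1 := by
  rw [omegaAdd, omegaAdd, Finset.smul_sum]
  refine Finset.sum_congr rfl fun i _ => ?_
  rw [map_smul_of_dvd_sub hN hu, one_smul, ← wedgeHom_apply, map_nsmul]
  rfl

theorem omegaAdd_inj {N : ℕ} {u : ℤ_[ℓ]} (hN : ∀ x : H, ℓ ^ N • x = 0) (hu : IsUnit u)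
    {f f' : Lat ℓ g →+ H} (h : omegaAdd f u = omegaAdd f' u) : omegaAdd f 1 = omegaAdd f' 1 := by
  obtain ⟨v, rfl⟩ := hu
  obtain ⟨m, hm⟩ := exists_nat_dvd_sub N (v : ℤ_[ℓ])
  obtain ⟨m', hm'⟩ := exists_nat_dvd_sub N ((v⁻¹ : ℤ_[ℓ]ˣ) : ℤ_[ℓ])
  have key : ∀ f : Lat ℓ g →+ H, omegaAdd f 1 = m' • omegaAdd f v := fun f => by
    rw [omegaAdd_eq_nsmul hN hm, smul_smul, ← Nat.cast_one]
    have h1 : (ℓ : ℤ_[ℓ]) ^ N ∣ 1 - ((m' * m : ℕ) : ℤ_[ℓ]) := by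
      have e : 1 - ((m' * m : ℕ) : ℤ_[ℓ]) = (((v⁻¹ : ℤ_[ℓ]ˣ) : ℤ_[ℓ]) - m') * v + m' * (v - m) := by
        push_cast
        linear_combination -v.inv_mul
      rw [e]
      exact dvd_add (hm'.mul_right _) (hm.mul_left _)
    have := omegaAdd_eq_nsmul hN h1 f
    simpa using this
  rw [key, key, h]

/-- Composition of a homomorphism from the lattice with an endomorphism. -/
def compMat (f : Lat ℓ g →+ H) (M : Mat ℓ g) : Lat ℓ g →+ H :=
  f.comp (Matrix.mulVecLin M).toAddMonoidHom

theorem compMat_apply (f : Lat ℓ g →+ H) (M : Mat ℓ g) (x : Lat ℓ g) :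
    compMat f M x = f (M *ᵥ x) := rfl

theorem compMat_mul (f : Lat ℓ g →+ H) (M M' : Mat ℓ g) :
    compMat f (M * M') = compMat (compMat f M) M' := by
  refine AddMonoidHom.ext fun x => ?_
  simp only [compMat_apply, Matrix.mulVec_mulVec]

theorem compMat_one (f : Lat ℓ g →+ H) : compMat f 1 = f := by
  refine AddMonoidHom.ext fun x => ?_
  simp only [compMat_apply, Matrix.one_mulVec]

theorem tensorOf_comp {G : Type} [AddCommGroup G] [Module ℤ_[ℓ] G] [Finite G]
    (π : Lat ℓ g →ₗ[ℤ_[ℓ]] G) (M B : Mat ℓ g) :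
    tensorOf (π ∘ₗ Matrix.mulVecLin M) B = tensorOf π (M * B * Mᵀ) := by
  have h1 : ∀ i, M *ᵥ (Pi.single i 1) = ∑ k, M k i • (Pi.single k (1 : ℤ_[ℓ]) : Lat ℓ g) := fun i => by
    rw [Matrix.mulVec_single_one]
    exact (sum_smul_single (M.col i)).symm
  have h2 : ∀ i j, pairOf (π ∘ₗ Matrix.mulVecLin M) (Pi.single i 1) (Pi.single j 1)
      = ∑ k, ∑ l, (M k i * M l j) • pairOf π (Pi.single k 1) (Pi.single l 1) := fun i j => by
    change pairOf π (M *ᵥ Pi.single i 1) (M *ᵥ Pi.single j 1) = _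
    rw [h1 i, map_sum (pairOf π), LinearMap.sum_apply]
    refine Finset.sum_congr rfl fun k _ => ?_
    rw [h1 j, map_sum]
    refine Finset.sum_congr rfl fun l _ => ?_
    rw [map_smul, LinearMap.map_smul₂, smul_smul, mul_comm]
  rw [tensorOf_apply, tensorOf_apply]
  simp only [h2, Finset.smul_sum, smul_smul, Matrix.mul_apply, Matrix.transpose_apply,
    Finset.sum_mul, Finset.sum_smul]
  calc _ = ∑ i, ∑ k, ∑ j, ∑ l, (B i j * (M k i * M l j)) •
          pairOf π (Pi.single k 1) (Pi.single l 1) :=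
        Finset.sum_congr rfl fun i _ => Finset.sum_comm
    _ = ∑ k, ∑ i, ∑ l, ∑ j, (B i j * (M k i * M l j)) •
          pairOf π (Pi.single k 1) (Pi.single l 1) := by
        rw [Finset.sum_comm]
        exact Finset.sum_congr rfl fun k _ => Finset.sum_congr rfl fun i _ => Finset.sum_comm
    _ = ∑ k, ∑ l, ∑ i, ∑ j, (B i j * (M k i * M l j)) •
          pairOf π (Pi.single k 1) (Pi.single l 1) :=
        Finset.sum_congr rfl fun k _ => Finset.sum_comm
    _ = _ := by
        refine Finset.sum_congr rfl fun k _ => Finset.sum_congr rfl fun l _ => ?_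
        rw [Finset.sum_comm]
        refine Finset.sum_congr rfl fun j _ => Finset.sum_congr rfl fun i _ => ?_
        congr 1
        ring

/-- The pushforward along f∘M depends on M only through M J Mᵀ, and additively so. Invariance under
Sp and the vanishing of the derivative along skew-symplectic M both follow from this. -/
theorem exists_omegaAdd_comp [Finite H] (hH : ∀ x : H, ∃ k : ℕ, ℓ ^ k • x = 0)
    (f : Lat ℓ g →+ H) : ∃ τ : Mat ℓ g →+ H ⊗[ℤ] H,
      ∀ M, omegaAdd (compMat f M) 1 = τ (M * Matrix.J (Fin g) ℤ_[ℓ] * Mᵀ) := by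
  obtain ⟨N, hN⟩ := exists_pow_kill hH
  -- H is made a ℤ_ℓ-module through ℤ/ℓ^N, so that f becomes linear and the matrix formula for ω
  -- applies.
  let _ : Module (ZMod (ℓ ^ N)) H := AddCommGroup.zmodModule hN
  let _ : Module ℤ_[ℓ] H := Module.compHom H (PadicInt.toZModPow N)
  have hs : ∀ (c : ℤ_[ℓ]) (m : ℕ) (x : H), (ℓ : ℤ_[ℓ]) ^ N ∣ c - m → c • x = m • x := by
    intro c m x hc
    change PadicInt.toZModPow N c • x = m • x
    rw [← toZModPow_eq_zero_iff, map_sub, sub_eq_zero, map_natCast] at hc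
    rw [hc, Nat.cast_smul_eq_nsmul]
  let π : Lat ℓ g →ₗ[ℤ_[ℓ]] H :=
    { toFun := f
      map_add' := map_add f
      map_smul' := fun c x => by
        obtain ⟨m, hm⟩ := exists_nat_dvd_sub N c
        rw [map_smul_of_dvd_sub hN hm, RingHom.id_apply, hs c m _ hm] }
  refine ⟨-(tensorOf π).toAddMonoidHom, fun M => ?_⟩
  have e1 : omegaAdd (compMat f M) 1 = omegaOf (π ∘ₗ Matrix.mulVecLin M) 1 := rfl
  rw [e1, omegaOf_eq, tensorOf_comp]
  simp

theorem omegaAdd_comp_sp [Finite H] (hH : ∀ x : H, ∃ k : ℕ, ℓ ^ k • x = 0) (f : Lat ℓ g →+ H)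
    (S : Sp ℓ g) : omegaAdd (compMat f S.1) 1 = omegaAdd f 1 := by
  obtain ⟨τ, hτ⟩ := exists_omegaAdd_comp hH f
  have h := hτ 1
  rw [compMat_one, Matrix.one_mul, Matrix.transpose_one, Matrix.mul_one] at h
  rw [hτ, SymplecticGroup.mem_iff.1 S.2, h]

theorem surjective_compMat {f : Lat ℓ g →+ H} (hf : Function.Surjective f) {M M' : Mat ℓ g}
    (h : M * M' = 1) : Function.Surjective (compMat f M) := fun y => by
  obtain ⟨x, rfl⟩ := hf y
  exact ⟨M' *ᵥ x, by rw [compMat_apply, Matrix.mulVec_mulVec, h, Matrix.one_mulVec]⟩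

end LatHom

/-! ### Moments of the nonlinear model -/

section NonlinearMoments

open MeasureTheory

variable {ℓ : ℕ} [Fact ℓ.Prime] {g n : ℕ} {q : ℤ_[ℓ]}

instance : IsProbabilityMeasure (spHaar ℓ g) :=
  ⟨Measure.haarMeasure_self⟩

instance : (spHaar ℓ g).IsHaarMeasure :=
  inferInstanceAs (Measure.IsHaarMeasure (Measure.haarMeasure ⊤))

theorem sp_mul_inv (S : Sp ℓ g) : S.1 * (S⁻¹).1 = 1 := by
  have := congrArg Subtype.val (mul_inv_cancel S)
  exact this

/-- The homomorphisms from the lattice to `H` with finite target are locally constant. -/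
theorem isOpen_comp_eq {Ω : Type*} [TopologicalSpace Ω] {A : Ω → Mat ℓ g} (hA : Continuous A)
    {H : Type} [AddCommGroup H] [Finite H] (hH : ∀ x : H, ∃ k : ℕ, ℓ ^ k • x = 0)
    (f f' : Lat ℓ g →+ H) : IsOpen {w | compMat f (A w) = f'} := by
  obtain ⟨N, hN⟩ := exists_pow_kill hH
  rw [isOpen_iff_mem_nhds]
  intro w hw
  filter_upwards [hA.continuousAt.eventually (eventually_congr_mod N (A w))] with w' h'
  obtain ⟨B, hB⟩ := h'
  rw [← show compMat f (A w) = f' from hw, hB]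
  refine AddMonoidHom.ext fun x => ?_
  rw [compMat_apply, Matrix.add_mulVec, map_add, Matrix.smul_mulVec, map_pow_smul hN, add_zero]
  rfl

/-- A measure on finitely many disjoint measurable sets of the same measure. -/
theorem measure_eq_div_of_partition {Ω ι : Type*} [MeasurableSpace Ω] {P : Measure Ω} [Finite ι]
    [Nonempty ι] {E : ι → Set Ω} {F : Set Ω} (hE : ∀ i, MeasurableSet (E i))
    (hd : Pairwise (Function.onFun Disjoint E)) (hF : F = ⋃ i, E i)
    (h : ∀ i j, P (E i) = P (E j)) (i : ι) : P (E i) = P F / Nat.card ι := by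
  have := Fintype.ofFinite ι
  have : Countable ι := Finite.to_countable
  rw [hF, measure_iUnion hd hE, tsum_congr fun j => h j i, tsum_fintype, Finset.sum_const,
    Finset.card_univ, ← Nat.card_eq_fintype_card, nsmul_eq_mul]
  rw [mul_comm, ENNReal.mul_div_cancel_right]
  · exact_mod_cast Nat.card_pos.ne'
  · exact ENNReal.natCast_ne_top _

variable {k : ℕ} {a : Fin k → ℕ}

/-- The surjections from the lattice with given image of the symplectic form. -/
def Orbit (g : ℕ) (w : Std ℓ a ⊗[ℤ] Std ℓ a) : Type :=
  {f : Lat ℓ g →+ Std ℓ a // Function.Surjective f ∧ omegaAdd f 1 = w}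

instance [NeZero ℓ] (w : Std ℓ a ⊗[ℤ] Std ℓ a) : Finite (Orbit g w) :=
  have := finite_lat_hom (g := g) (H := Std ℓ a) (exists_primary_pow a)
  Subtype.finite

theorem compMat_sp_mem [NeZero ℓ] {w : Std ℓ a ⊗[ℤ] Std ℓ a} (f : Orbit g w) (S : Sp ℓ g) :
    Function.Surjective (compMat f.1 S.1) ∧ omegaAdd (compMat f.1 S.1) 1 = w :=
  ⟨surjective_compMat f.2.1 (sp_mul_inv S),
    (omegaAdd_comp_sp (exists_primary_pow a) f.1 S).trans f.2.2⟩

/-- The events for varying h and fixed f partition Sp. They are left translates of each other, since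
h∘(L S) = (h∘L)∘S and Sp is transitive on the orbit. -/
theorem measure_comp_eq [NeZero ℓ] (hk : k ≤ g) (ha : ∀ i, 1 ≤ a i) {w : Std ℓ a ⊗[ℤ] Std ℓ a}
    (h f : Orbit g w) : spHaar ℓ g {S | compMat h.1 S.1 = f.1} = (Nat.card (Orbit g w) : ENNReal)⁻¹ := by
  have : Nonempty (Orbit g w) := ⟨f⟩
  have hm : ∀ h : Orbit g w, MeasurableSet {S : Sp ℓ g | compMat h.1 S.1 = f.1} := fun h =>
    (isOpen_comp_eq continuous_subtype_val (exists_primary_pow a) h.1 f.1).measurableSet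
  have key := measure_eq_div_of_partition (P := spHaar ℓ g) (F := Set.univ)
    (E := fun h : Orbit g w => {S : Sp ℓ g | compMat h.1 S.1 = f.1}) hm ?_ ?_ ?_ h
  · rw [key, measure_univ, one_div]
  · intro h h' hne
    refine Set.disjoint_left.2 fun S hS hS' => hne (Subtype.ext ?_)
    have e : compMat h.1 S.1 = compMat h'.1 S.1 := hS.trans (Eq.symm hS')
    rw [← compMat_one h.1, ← compMat_one h'.1, ← sp_mul_inv S, compMat_mul, e, ← compMat_mul]
  · refine (Set.eq_univ_of_forall fun S => Set.mem_iUnion.2 ?_).symm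
    refine ⟨⟨compMat f.1 (S⁻¹).1, compMat_sp_mem f _⟩, ?_⟩
    change compMat (compMat f.1 (S⁻¹).1) S.1 = f.1
    rw [← compMat_mul]
    have := sp_mul_inv S⁻¹
    rw [inv_inv] at this
    rw [this, compMat_one]
  · intro h h'
    obtain ⟨L, hL⟩ := exists_sp_comp (f := h.1) (f' := h'.1) hk ha h.2.1 h'.2.1
      (h.2.2.trans h'.2.2.symm)
    have hL' : compMat h.1 L.1 = h'.1 := AddMonoidHom.ext hL
    have e : {S : Sp ℓ g | compMat h'.1 S.1 = f.1}
        = (fun S => L * S) ⁻¹' {S : Sp ℓ g | compMat h.1 S.1 = f.1} := by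
      ext S
      change compMat h'.1 S.1 = f.1 ↔ compMat h.1 (L.1 * S.1) = f.1
      rw [compMat_mul, hL']
    rw [e, measure_preimage_mul]

end NonlinearMoments

/-! ### The joint law of the condition f∘F = f and of ψ on the coset GSp^(q). -/

section NonlinearMoments

open MeasureTheory

variable {ℓ : ℕ} [Fact ℓ.Prime] {g n : ℕ} {q u : ℤ_[ℓ]}

theorem baseSim_mul (c d : ℤ_[ℓ]) : baseSim ℓ g c * baseSim ℓ g d = baseSim ℓ g (c * d) := by
  simp [baseSim, Matrix.fromBlocks_multiply, smul_smul, mul_comm]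

theorem baseSim_one : baseSim ℓ g 1 = 1 := by
  simp [baseSim]

/-- Conjugation of a symplectic matrix by `baseSim`. -/
theorem exists_conj_sp (hq : IsUnit q) (S : Sp ℓ g) :
    ∃ S' : Sp ℓ g, baseSim ℓ g q * S'.1 = S.1 * baseSim ℓ g q := by
  obtain ⟨v, rfl⟩ := hq
  let S' : Mat ℓ g := baseSim ℓ g ((v⁻¹ : ℤ_[ℓ]ˣ) : ℤ_[ℓ]) * (S.1 * baseSim ℓ g v)
  have h : baseSim ℓ g (v : ℤ_[ℓ]) * S' = S.1 * baseSim ℓ g v := by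
    rw [← Matrix.mul_assoc, baseSim_mul, Units.mul_inv, baseSim_one, Matrix.one_mul]
  refine ⟨⟨S', mem_symplecticGroup_of_symp fun x y => ?_⟩, h⟩
  refine mul_left_cancel₀ v.ne_zero ?_
  rw [← symp_baseSim, Matrix.mulVec_mulVec, Matrix.mulVec_mulVec, h, ← Matrix.mulVec_mulVec,
    ← Matrix.mulVec_mulVec, symp_sp, symp_baseSim]

variable {H : Type} [AddCommGroup H]

/-- S F - 1 = (S - 1)(F - 1) + (F - 1) + (S - 1), and f kills the image of S - 1, so the mixed term
disappears and the values of ψ add. -/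
theorem PsiRel.sp_mul {f : Lat ℓ g →+ H} {S F : Mat ℓ g} {α : H →+ ZMod (ℓ ^ n)} {z z' : H}
    (hS : ∀ x, f (S *ᵥ x) = f x) (h : PsiRel n (S - 1) f α z') (h' : PsiRel n (F - 1) f α z) :
    PsiRel n (S * F - 1) f α (z + z') := by
  obtain ⟨s, t, hs, ht, rfl⟩ := h'
  obtain ⟨s', t', hs', ht', rfl⟩ := h
  obtain ⟨w, hw⟩ := rep_unique (α := α.comp f) hs' hs
  have e1 : (S - 1) *ᵥ s = (ℓ : ℤ_[ℓ]) ^ n • (t' - (S - 1) *ᵥ w) := by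
    have : s = s' - (ℓ : ℤ_[ℓ]) ^ n • w := by rw [← hw]; abel
    rw [this, Matrix.mulVec_sub, ht', Matrix.mulVec_smul, smul_sub]
  have hS' : ∀ x, f ((S - 1) *ᵥ x) = 0 := fun x => by
    rw [Matrix.sub_mulVec, Matrix.one_mulVec, map_sub, hS, sub_self]
  refine ⟨s, t + (t' - (S - 1) *ᵥ w) + (S - 1) *ᵥ t, hs, ?_, ?_⟩
  · have e2 : S * F - 1 = (S - 1) * (F - 1) + (F - 1) + (S - 1) := by noncomm_ring
    rw [e2, Matrix.add_mulVec, Matrix.add_mulVec, ← Matrix.mulVec_mulVec, ht, e1,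
      Matrix.mulVec_smul, smul_add, smul_add]
    abel
  · rw [map_add, map_add, map_sub, hS', hS', sub_zero, add_zero]

/-- The similitude multiplies the pushed-forward form by q = 1 + 2ℓ^n u, and ℓ^n kills that form. -/
theorem omegaAdd_baseSim {f : Lat ℓ g →+ H} {N : ℕ} (hN : ∀ x : H, ℓ ^ N • x = 0)
    (hu : 2 * (ℓ : ℤ_[ℓ]) ^ n * u = q - 1) (h0 : ℓ ^ n • omegaAdd f 1 = 0) :
    omegaAdd (compMat f (baseSim ℓ g q)) 1 = omegaAdd f 1 := by
  obtain ⟨m, hm⟩ := exists_nat_dvd_sub N u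
  have hE : ∀ i : Fin g, baseSim ℓ g q *ᵥ vecE i = vecE i := fun i => by
    ext j
    rcases j with j | j <;>
      simp [baseSim, vecE, Matrix.one_apply, Pi.single_apply]
  have hF : ∀ i : Fin g, baseSim ℓ g q *ᵥ vecF i = q • vecF i := fun i => by
    ext j
    rcases j with j | j <;>
      simp [baseSim, vecF, Matrix.one_apply, Pi.single_apply]
  have hq : (ℓ : ℤ_[ℓ]) ^ N ∣ q - ((1 + 2 * ℓ ^ n * m : ℕ) : ℤ_[ℓ]) := by
    have e : q - ((1 + 2 * ℓ ^ n * m : ℕ) : ℤ_[ℓ]) = 2 * (ℓ : ℤ_[ℓ]) ^ n * (u - m) := by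
      push_cast
      linear_combination -hu
    rw [e]
    exact hm.mul_left _
  have h1 : omegaAdd (compMat f (baseSim ℓ g q)) 1 = (1 + 2 * ℓ ^ n * m) • omegaAdd f 1 := by
    rw [omegaAdd, omegaAdd, Finset.smul_sum]
    refine Finset.sum_congr rfl fun i _ => ?_
    rw [one_smul, compMat_apply, compMat_apply, hE, hF, map_smul_of_dvd_sub hN hq, ← wedgeHom_apply,
      map_nsmul, wedgeHom_apply]
  rw [h1, add_smul, one_smul, mul_assoc, mul_comm (ℓ ^ n), ← mul_assoc, mul_smul, h0, smul_zero,
    add_zero]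

theorem omegaAdd_torsion {f : Lat ℓ g →+ H} {N : ℕ} (hN : ∀ x : H, ℓ ^ N • x = 0) (hu : IsUnit u)
    {m : ℕ} (h : m • omegaAdd f u = 0) : m • omegaAdd f 1 = 0 := by
  obtain ⟨v, rfl⟩ := hu
  obtain ⟨c, hc⟩ := exists_nat_dvd_sub N (v : ℤ_[ℓ])
  obtain ⟨c', hc'⟩ := exists_nat_dvd_sub N ((v⁻¹ : ℤ_[ℓ]ˣ) : ℤ_[ℓ])
  have h1 : (ℓ : ℤ_[ℓ]) ^ N ∣ 1 - ((c' * c : ℕ) : ℤ_[ℓ]) := by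
    have e : 1 - ((c' * c : ℕ) : ℤ_[ℓ]) = (((v⁻¹ : ℤ_[ℓ]ˣ) : ℤ_[ℓ]) - c') * v + c' * (v - c) := by
      push_cast
      linear_combination -v.inv_mul
    rw [e]
    exact dvd_add (hc'.mul_right _) (hc.mul_left _)
  rw [omegaAdd_eq_nsmul hN h1, mul_smul, ← omegaAdd_eq_nsmul hN hc, smul_comm, h, smul_zero]

variable {k : ℕ} {a : Fin k → ℕ} [NeZero ℓ]

omit [NeZero ℓ] in
/-- The difference of two homomorphisms with the compatibility for the same `ω`. -/
theorem sub_mem_delta_of_psiRel {A : Mat ℓ g} (hA : IsAdmissible n A u) {f : Lat ℓ g →+ H}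
    (hf : ∀ x, f (A *ᵥ x) = 0) (s : BEGOn ℓ n H) (hω : omegaAdd f u = s.1.1) :
    psiHom hA hf - s.1.2 ∈ Delta ℓ n H := fun r α β => by
  rw [AddMonoidHom.sub_apply, AddMonoidHom.sub_apply, map_sub, map_sub, psiHom_compat hA hf,
    s.2.2.2, hω]
  ring

instance (H : Type) [AddCommGroup H] [Finite H] : Finite (Delta ℓ n H) :=
  have : Finite (H →+ ZMod (ℓ ^ n)) := DFunLike.finite _
  have : Finite ((H →+ ZMod (ℓ ^ n)) →+ H) := DFunLike.finite _
  Subtype.finite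

omit [NeZero ℓ] in
theorem continuous_baseSim_mul : Continuous fun S : Sp ℓ g => baseSim ℓ g q * S.1 :=
  continuous_const.matrix_mul continuous_subtype_val

omit [NeZero ℓ] in
theorem continuous_baseSim_mul_sub : Continuous fun S : Sp ℓ g => baseSim ℓ g q * S.1 - 1 :=
  continuous_baseSim_mul.sub continuous_const

/-- The first factor is the probability that f∘F = f. On this event the difference of ψ from its
prescribed value lies in `Delta`, and translation by the stabiliser of f makes all differences
equally likely. -/
theorem measure_surjData_sp (hk : k ≤ g) (ha : ∀ i, 1 ≤ a i) (hq : IsUnit q) (hu : IsUnit u)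
    (hqu : 2 * (ℓ : ℤ_[ℓ]) ^ n * u = q - 1)
    (hadm : ∀ S : Sp ℓ g, IsAdmissible n (baseSim ℓ g q * S.1 - 1) u)
    (s : BEGOn ℓ n (Std ℓ a)) (f : Lat ℓ g →+ Std ℓ a) (hf : Function.Surjective f)
    (hω : omegaAdd f u = s.1.1) :
    spHaar ℓ g {S | SurjData (baseSim ℓ g q * S.1 - 1) u s.1.1 s.1.2 f}
      = (Nat.card (Orbit g (omegaAdd f 1)) : ENNReal)⁻¹ * univMoment (s.toBEG (exists_primary_pow a)) := by
  obtain ⟨N, hN⟩ := exists_pow_kill (H := Std ℓ a) (exists_primary_pow a)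
  obtain ⟨v, hv⟩ := hq
  have h0 : ℓ ^ n • omegaAdd f 1 = 0 := omegaAdd_torsion hN hu (by rw [hω, s.2.2.1])
  let f₀ : Orbit g (omegaAdd f 1) := ⟨f, hf, rfl⟩
  -- Writing F as the base similitude times S, the condition f∘F = f says that S moves h₀ to f
  -- inside one orbit.
  let h₀ : Orbit g (omegaAdd f 1) := ⟨compMat f (baseSim ℓ g q),
    surjective_compMat hf (M' := baseSim ℓ g ((v⁻¹ : ℤ_[ℓ]ˣ) : ℤ_[ℓ]))
      (by rw [baseSim_mul, ← hv, Units.mul_inv, baseSim_one]),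
    omegaAdd_baseSim hN hqu h0⟩
  have hB : ∀ S : Sp ℓ g, (compMat h₀.1 S.1 = f ↔ ∀ x, f ((baseSim ℓ g q * S.1 - 1) *ᵥ x) = 0) := by
    intro S
    constructor
    · intro h x
      have := DFunLike.congr_fun h x
      rw [compMat_apply, compMat_apply, Matrix.mulVec_mulVec] at this
      rw [Matrix.sub_mulVec, map_sub, this, Matrix.one_mulVec, sub_self]
    · intro h
      refine AddMonoidHom.ext fun x => ?_
      have := h x
      rw [Matrix.sub_mulVec, map_sub, sub_eq_zero, Matrix.one_mulVec] at this
      rw [compMat_apply, compMat_apply, Matrix.mulVec_mulVec, this]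
  let E : Delta ℓ n (Std ℓ a) → Set (Sp ℓ g) := fun δ => {S | compMat h₀.1 S.1 = f ∧
    ∀ α, PsiRel n (baseSim ℓ g q * S.1 - 1) f α (s.1.2 α + δ.1 α)}
  have hE : ∀ δ, E δ = {S | SurjData (baseSim ℓ g q * S.1 - 1) u s.1.1 (s.1.2 + δ.1) f} := fun δ => by
    ext S
    change _ ∧ _ ↔ _ ∧ _ ∧ _ ∧ _
    rw [hB]
    exact ⟨fun h => ⟨hf, h.1, hω, h.2⟩, fun h => ⟨h.2.1, h.2.2.2⟩⟩
  have hEm : ∀ δ, MeasurableSet (E δ) := fun δ => by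
    rw [hE]
    have h1 : ∀ (r : ℕ) (α β : Std ℓ a →+ ZMod (ℓ ^ (n + r))), β ((s.1.2 + δ.1) (scaleDown r α))
        = α ((s.1.2 + δ.1) (scaleDown r β)) + 2 * evalPair α β s.1.1 := fun r α β => by
      rw [AddMonoidHom.add_apply, AddMonoidHom.add_apply, map_add, map_add, s.2.2.2, δ.2 r α β]
      ring
    let s' : BEGOn ℓ n (Std ℓ a) := ⟨(s.1.1, s.1.2 + δ.1), s.2.1, s.2.2.1, h1⟩
    exact (isOpen_surjData continuous_baseSim_mul_sub (s'.toBEG (exists_primary_pow a)) f).measurableSet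
  have key := measure_eq_div_of_partition (P := spHaar ℓ g) (F := {S | compMat h₀.1 S.1 = f}) hEm
    ?_ ?_ ?_ 0
  · have h1 : {S : Sp ℓ g | SurjData (baseSim ℓ g q * S.1 - 1) u s.1.1 s.1.2 f} = E 0 := by
      rw [hE, ZeroMemClass.coe_zero, add_zero]
    rw [h1, key, measure_comp_eq hk ha h₀ f₀, card_delta (exists_primary_pow a), div_eq_mul_inv]
    rfl
  · intro δ δ' hne
    refine Set.disjoint_left.2 fun S hS hS' => hne (Subtype.ext (AddMonoidHom.ext fun α => ?_))
    exact add_left_cancel ((hS.2 α).unique ((hB S).1 hS.1) (hS'.2 α))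
  · ext S
    constructor
    · intro hS
      have hS' := (hB S).1 hS
      refine Set.mem_iUnion.2 ⟨⟨_, sub_mem_delta_of_psiRel (hadm S) hS' s hω⟩, hS, fun α => ?_⟩
      rw [AddMonoidHom.sub_apply, add_sub_cancel]
      exact psiHom_spec _ _ α
    · intro hS
      obtain ⟨δ, hδ⟩ := Set.mem_iUnion.1 hS
      exact hδ.1
  · have h1 : ∀ δ δ' : Delta ℓ n (Std ℓ a), spHaar ℓ g (E δ) ≤ spHaar ℓ g (E δ') := by
      intro δ δ'
      -- S₁ fixes f and shifts ψ by δ' - δ. Its conjugate S₂ realises left multiplication of F by S₁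
      -- as a left translation of S; exchanging δ and δ' gives the reverse inequality.
      obtain ⟨S₁, hS₁, hδ⟩ := exists_sp_of_mem_delta hk ha hf (δ' - δ).2
      obtain ⟨S₂, hS₂⟩ := exists_conj_sp ⟨v, hv⟩ S₁
      rw [← measure_preimage_mul (spHaar ℓ g) S₂ (E δ')]
      refine measure_mono fun S hS => ?_
      have e : baseSim ℓ g q * (S₂ * S).1 = S₁.1 * (baseSim ℓ g q * S.1) := by
        change baseSim ℓ g q * (S₂.1 * S.1) = _
        rw [← Matrix.mul_assoc, hS₂, Matrix.mul_assoc]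
      refine ⟨AddMonoidHom.ext fun x => ?_, fun α => ?_⟩
      · rw [compMat_apply, compMat_apply, Matrix.mulVec_mulVec, e, ← Matrix.mulVec_mulVec, hS₁,
          ← Matrix.mulVec_mulVec]
        exact DFunLike.congr_fun hS.1 x
      · change PsiRel n (baseSim ℓ g q * (S₂ * S).1 - 1) f α _
        rw [e]
        have := PsiRel.sp_mul hS₁ (hδ α) (hS.2 α)
        convert this using 1
        rw [AddSubgroup.coe_sub, AddMonoidHom.sub_apply]
        abel
    exact fun δ δ' => le_antisymm (h1 δ δ') (h1 δ' δ)

-- Every f in the orbit contributes equally, so the size of the orbit cancels. The moment takes the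
-- universal value if ω is attained by a surjection and is zero otherwise.
open scoped Classical in
theorem tsum_spHaar_surjData (hk : k ≤ g) (ha : ∀ i, 1 ≤ a i) (hq : IsUnit q) (hu : IsUnit u)
    (hqu : 2 * (ℓ : ℤ_[ℓ]) ^ n * u = q - 1)
    (hadm : ∀ S : Sp ℓ g, IsAdmissible n (baseSim ℓ g q * S.1 - 1) u)
    (s : BEGOn ℓ n (Std ℓ a)) :
    ∑' f : Lat ℓ g →+ Std ℓ a, spHaar ℓ g {S | SurjData (baseSim ℓ g q * S.1 - 1) u s.1.1 s.1.2 f}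
      = if ∃ f : Lat ℓ g →+ Std ℓ a, Function.Surjective f ∧ omegaAdd f u = s.1.1
        then univMoment (s.toBEG (exists_primary_pow a)) else 0 := by
  have hfin := finite_lat_hom (g := g) (H := Std ℓ a) (exists_primary_pow a)
  have := Fintype.ofFinite (Lat ℓ g →+ Std ℓ a)
  obtain ⟨N, hN⟩ := exists_pow_kill (H := Std ℓ a) (exists_primary_pow a)
  split_ifs with h
  · obtain ⟨f₀, hf₀, hω₀⟩ := h
    have hiff : ∀ f : Lat ℓ g →+ Std ℓ a, omegaAdd f u = s.1.1 ↔ omegaAdd f 1 = omegaAdd f₀ 1 := by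
      obtain ⟨m, hm⟩ := exists_nat_dvd_sub N u
      refine fun f => ⟨fun h => omegaAdd_inj hN hu (h.trans hω₀.symm), fun h => ?_⟩
      rw [← hω₀, omegaAdd_eq_nsmul hN hm, omegaAdd_eq_nsmul hN hm, h]
    have h1 : ∀ f : Lat ℓ g →+ Std ℓ a,
        spHaar ℓ g {S | SurjData (baseSim ℓ g q * S.1 - 1) u s.1.1 s.1.2 f}
        = if Function.Surjective f ∧ omegaAdd f 1 = omegaAdd f₀ 1 then
          (Nat.card (Orbit g (omegaAdd f₀ 1)) : ENNReal)⁻¹ *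
            univMoment (s.toBEG (exists_primary_pow a)) else 0 := fun f => by
      split_ifs with hf
      · rw [measure_surjData_sp hk ha hq hu hqu hadm s f hf.1 ((hiff f).2 hf.2), hf.2]
      · convert measure_empty (μ := spHaar ℓ g)
        refine Set.eq_empty_of_forall_notMem fun S hS => hf ⟨hS.1, (hiff f).1 hS.2.2.1⟩
    rw [tsum_congr h1, tsum_fintype, ← Finset.sum_filter, Finset.sum_const, nsmul_eq_mul,
      ← Fintype.card_subtype, ← Nat.card_eq_fintype_card, ← mul_assoc]
    have : Nonempty (Orbit g (omegaAdd f₀ 1)) := ⟨⟨f₀, hf₀, rfl⟩⟩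
    have e : (Nat.card {f : Lat ℓ g →+ Std ℓ a // Function.Surjective f ∧
      omegaAdd f 1 = omegaAdd f₀ 1} : ENNReal) = Nat.card (Orbit g (omegaAdd f₀ 1)) := rfl
    rw [e, ENNReal.mul_inv_cancel (by exact_mod_cast Nat.card_pos.ne') (ENNReal.natCast_ne_top _),
      one_mul]
  · refine ENNReal.tsum_eq_zero.2 fun f => ?_
    convert measure_empty (μ := spHaar ℓ g)
    exact Set.eq_empty_of_forall_notMem fun S hS => h ⟨f, hS.1, hS.2.2.1⟩

end NonlinearMoments

/-! ### Finiteness of the cokernel and exact moments for the nonlinear model. -/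

section NonlinearMain

open MeasureTheory

variable {ℓ : ℕ} [Fact ℓ.Prime] {g n : ℕ} {q u : ℤ_[ℓ]}

theorem exists_wedge_sum {H : Type*} [AddCommGroup H] {w : H ⊗[ℤ] H} (hw : w ∈ wedgeSq H) :
    ∃ (r : ℕ) (x y : ℕ → H), w = ∑ i ∈ Finset.range r, wedge (x i) (y i) := by
  induction hw using Submodule.span_induction with
  | mem w hw =>
    obtain ⟨x, y, rfl⟩ := hw
    exact ⟨1, fun _ => x, fun _ => y, by simp⟩
  | zero => exact ⟨0, 0, 0, by simp⟩
  | add w w' _ _ h h' =>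
    obtain ⟨r, x, y, rfl⟩ := h
    obtain ⟨r', x', y', rfl⟩ := h'
    refine ⟨r + r', fun i => if i < r then x i else x' (i - r),
      fun i => if i < r then y i else y' (i - r), ?_⟩
    rw [Finset.sum_range_add]
    congr 1
    · exact Finset.sum_congr rfl fun i hi => by simp [Finset.mem_range.1 hi]
    · exact Finset.sum_congr rfl fun i _ => by simp
  | smul m w _ h =>
    obtain ⟨r, x, y, rfl⟩ := h
    refine ⟨r, fun i => m • x i, y, ?_⟩
    rw [Finset.smul_sum]
    refine Finset.sum_congr rfl fun i _ => ?_
    simp only [← wedgeHom_apply, map_zsmul, AddMonoidHom.zsmul_apply]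

variable {k : ℕ} {a : Fin k → ℕ}

/-- The homomorphism from the lattice with given values on the basis. -/
def homOfValues (v : Fin g ⊕ Fin g → Std ℓ a) : Lat ℓ g →+ Std ℓ a :=
  AddMonoidHom.mk' (fun x j => ∑ i, PadicInt.toZModPow (a j) (x i) * v i j) fun x y => by
    funext j
    simp [add_mul, Finset.sum_add_distrib]

theorem homOfValues_single (v : Fin g ⊕ Fin g → Std ℓ a) (i : Fin g ⊕ Fin g) :
    homOfValues v (Pi.single i 1) = v i := by
  funext j
  change ∑ i', PadicInt.toZModPow (a j) ((Pi.single i 1 : Lat ℓ g) i') * v i' j = v i j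
  rw [Finset.sum_eq_single i]
  · simp
  · intro i' _ h
    simp [h]
  · simp

theorem surjective_of_gen {f : Lat ℓ g →+ Std ℓ a} [NeZero ℓ] (x : Fin k → Lat ℓ g)
    (h : ∀ j, f (x j) = Pi.single j 1) : Function.Surjective f := fun z => by
  refine ⟨∑ j, (z j).val • x j, ?_⟩
  rw [map_sum]
  conv_rhs => rw [← Finset.univ_sum_single z]
  refine Finset.sum_congr rfl fun j _ => ?_
  rw [map_nsmul, h, ← Pi.single_smul]
  congr 1
  rw [nsmul_eq_mul, mul_one, ZMod.natCast_zmod_val]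

/-- The first r hyperbolic pairs produce the r wedges, with the inverse of u inserted on one side.
The next k vectors e_i map to the generators while their partners f_i map to 0, so they do not
affect the form. -/
theorem exists_surjective_omegaAdd [NeZero ℓ] (hu : IsUnit u) {r : ℕ} (x y : ℕ → Std ℓ a)
    (hg : r + k ≤ g) : ∃ f : Lat ℓ g →+ Std ℓ a, Function.Surjective f ∧
      omegaAdd f u = ∑ i ∈ Finset.range r, wedge (x i) (y i) := by
  obtain ⟨N, hN⟩ := exists_pow_kill (H := Std ℓ a) (exists_primary_pow a)
  obtain ⟨c, rfl⟩ := hu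
  obtain ⟨m, hm⟩ := exists_nat_dvd_sub N (c : ℤ_[ℓ])
  obtain ⟨m', hm'⟩ := exists_nat_dvd_sub N ((c⁻¹ : ℤ_[ℓ]ˣ) : ℤ_[ℓ])
  have hmm : ∀ z : Std ℓ a, m • m' • z = z := fun z => by
    have h1 : (ℓ : ℤ_[ℓ]) ^ N ∣ ((m * m' : ℕ) : ℤ_[ℓ]) - (1 : ℕ) := by
      have e : ((m * m' : ℕ) : ℤ_[ℓ]) - (1 : ℕ)
          = -((c - m) * m' + c * (((c⁻¹ : ℤ_[ℓ]ˣ) : ℤ_[ℓ]) - m')) := by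
        push_cast
        linear_combination c.mul_inv
      rw [e, dvd_neg]
      exact dvd_add (hm.mul_right _) (hm'.mul_left _)
    obtain ⟨f, hf⟩ : ∃ f : Lat ℓ 1 →+ Std ℓ a, f (Pi.single (Sum.inl 0) 1) = z :=
      ⟨homOfValues fun _ => z, homOfValues_single _ _⟩
    have h2 := map_smul_of_dvd_sub hN h1 f (Pi.single (Sum.inl 0) 1)
    rw [Nat.cast_smul_eq_nsmul, map_nsmul, hf, one_smul, mul_smul] at h2
    exact h2
  let v : Fin g ⊕ Fin g → Std ℓ a := Sum.elim
    (fun i => if i.1 < r then m' • x i else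
      if h : i.1 - r < k then Pi.single ⟨i.1 - r, h⟩ 1 else 0)
    (fun i => if i.1 < r then y i else 0)
  have hv := homOfValues_single (ℓ := ℓ) v
  refine ⟨homOfValues v, surjective_of_gen
    (fun j => Pi.single (Sum.inl ⟨r + j, by omega⟩) 1) fun j => ?_, ?_⟩
  · have hj : ∀ j' : Fin k, j' = j → (Pi.single j' 1 : Std ℓ a) = Pi.single j 1 := by
      rintro _ rfl
      rfl
    rw [hv]
    simp only [v, Sum.elim_inl, dif_pos (show r + j.1 - r < k by omega),
      if_neg (show ¬ r + j.1 < r by omega)]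
    exact hj _ (Fin.ext (by simp))
  · have h1 : ∀ i : Fin g, wedge (homOfValues v ((c : ℤ_[ℓ]) • vecE i)) (homOfValues v (vecF i))
        = if i.1 < r then wedge (x i) (y i) else 0 := fun i => by
      rw [map_smul_of_dvd_sub hN hm, vecE, vecF, hv, hv]
      simp only [v, Sum.elim_inl, Sum.elim_inr]
      split_ifs with h1 h2
      · rw [hmm]
      · rw [← wedgeHom_apply, map_zero]
      · rw [← wedgeHom_apply, map_zero]
    rw [omegaAdd, Finset.sum_congr rfl fun i _ => h1 i,
      Fin.sum_univ_eq_sum_range (fun i => if i < r then wedge (x i) (y i) else 0) g,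
      ← Finset.sum_filter]
    refine Finset.sum_congr ?_ fun _ _ => rfl
    ext i
    simp only [Finset.mem_filter, Finset.mem_range]
    omega

/-- The exactness ℓ^(n+1) ∤ q - 1 enters here; invertibility of u lets the form be recovered from
its multiple by u. -/
theorem isUnit_scale (h2 : ℓ ≠ 2) (hq : ExactlyDivides n q) : IsUnit (scale h2 hq) := by
  by_contra h
  have h1 : (ℓ : ℤ_[ℓ]) ∣ scale h2 hq := by
    rw [← Ideal.mem_span_singleton, ← PadicInt.maximalIdeal_eq_span_p]
    exact (IsLocalRing.mem_maximalIdeal _).2 h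
  obtain ⟨d, hd⟩ := h1
  refine hq.2 ⟨2 * d, ?_⟩
  rw [← scale_spec h2 hq, hd]
  ring

instance : BorelSpace (GSp ℓ g q) := ⟨rfl⟩

theorem continuous_ofSp : Continuous (GSp.ofSp (ℓ := ℓ) (g := g) q) :=
  Continuous.subtype_mk continuous_baseSim_mul _

instance : IsProbabilityMeasure (gspHaar ℓ g q) :=
  Measure.isProbabilityMeasure_map continuous_ofSp.measurable.aemeasurable

theorem continuous_gsp_sub_one : Continuous fun F : GSp ℓ g q => F.1 - 1 :=
  continuous_subtype_val.sub continuous_const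

theorem GSp.mulVec_mem_range (F : GSp ℓ g q) (y : Lat ℓ g) :
    (F.1 - 1) *ᵥ y ∈ LinearMap.range (Matrix.mulVecLin (1 - F.1)) := by
  exact ⟨-y, by rw [Matrix.mulVecLin_apply, Matrix.mulVec_neg, ← Matrix.neg_mulVec, neg_sub]⟩

theorem GSp.presents_beg (h2 : ℓ ≠ 2) (hn : 1 ≤ n) (hq : ExactlyDivides n q) (F : GSp ℓ g q)
    (hF : Finite F.Coker) : Presents (F.beg h2 hn hq hF) (F.1 - 1) (scale h2 hq) :=
  presents_begOf h2 (Submodule.mkQ_surjective _) _ _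

theorem rawMoment_gsp [NeZero ℓ] (Y : BEG ℓ n) :
    rawMoment (gspHaar ℓ g q) (fun F => F.1 - 1) u Y
      = ∑' f : Lat ℓ g →+ Y.G, spHaar ℓ g {S | SurjData (baseSim ℓ g q * S.1 - 1) u Y.ω Y.ψ f} := by
  refine tsum_congr fun f => ?_
  rw [gspHaar, Measure.map_apply continuous_ofSp.measurable
    (isOpen_surjData continuous_gsp_sub_one Y f).measurableSet]
  rfl

/-- The inequality does not require ω to be attained and so holds from g ≥ k on. With k = 1 it
covers cyclic groups for every positive g. -/
theorem rawMoment_gsp_le [NeZero ℓ] (h2 : ℓ ≠ 2) (hn : 1 ≤ n) (hq : ExactlyDivides n q)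
    (hk : k ≤ g) (ha : ∀ i, 1 ≤ a i) (s : BEGOn ℓ n (Std ℓ a)) :
    rawMoment (gspHaar ℓ g q) (fun F => F.1 - 1) (scale h2 hq) (s.toBEG (exists_primary_pow a))
      ≤ univMoment (s.toBEG (exists_primary_pow a)) := by
  classical
  rw [rawMoment_gsp]
  refine (tsum_spHaar_surjData hk ha (hq.isUnit hn) (isUnit_scale h2 hq) (scale_spec h2 hq)
    (fun S => (GSp.ofSp q S).isAdmissible h2 hn hq) s).trans_le ?_
  split_ifs <;> simp

theorem finite_coker_zero (W : Submodule ℤ_[ℓ] (Lat ℓ 0)) : Finite (Lat ℓ 0 ⧸ W) :=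
  Finite.of_surjective _ W.mkQ_surjective

theorem measure_gsp_infinite_coker (h2 : ℓ ≠ 2) (hn : 1 ≤ n) (hq : ExactlyDivides n q) :
    gspHaar ℓ g q {F | ¬ Finite F.Coker} = 0 := by
  have : NeZero ℓ := ⟨(Fact.out : ℓ.Prime).ne_zero⟩
  -- For g = 0 the lattice is trivial, and the moment bound is not needed.
  rcases Nat.eq_zero_or_pos g with rfl | hg
  · convert measure_empty (μ := gspHaar ℓ 0 q)
    exact Set.eq_empty_of_forall_notMem fun F hF => hF (finite_coker_zero _)
  · refine measure_mono_null (fun F hF => ?_) (measure_det_eq_zero' h2 continuous_gsp_sub_one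
      (fun F => F.isAdmissible h2 hn hq) fun a ha s => rawMoment_gsp_le h2 hn hq hg ha s)
    by_contra hdet
    have h1 := finite_coker_of_det_ne_zero hdet
    refine hF ?_
    have hle : LinearMap.range (Matrix.mulVecLin (F.1 - 1))
        ≤ LinearMap.range (Matrix.mulVecLin (1 - F.1)) := by
      rintro _ ⟨y, rfl⟩
      exact F.mulVec_mem_range y
    exact Finite.of_surjective _ (Submodule.factor_surjective hle)

theorem nonlinearMeasure_eq (h2 : ℓ ≠ 2) (hn : 1 ≤ n) (hq : ExactlyDivides n q) :
    nonlinearMeasure h2 hn hq g = classLaw (gspHaar ℓ g q)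
      (fun F : {F : GSp ℓ g q // Finite F.Coker} => F.1.beg h2 hn hq F.2) := rfl

theorem isProbabilityMeasure_nonlinear (h2 : ℓ ≠ 2) (hn : 1 ≤ n) (hq : ExactlyDivides n q) (g : ℕ) :
    IsProbabilityMeasure (nonlinearMeasure h2 hn hq g) :=
  isProbabilityMeasure_classLaw continuous_gsp_sub_one (fun F => F.1.presents_beg h2 hn hq F.2)
    (fun F _ hX => hX.finite_coker F.mulVec_mem_range) (measure_gsp_infinite_coker h2 hn hq)

/-- The moments of the nonlinear model are eventually equal to the universal ones. -/
theorem surjMoment_nonlinear (h2 : ℓ ≠ 2) (hn : 1 ≤ n) (Y : BEG ℓ n) :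
    ∃ g₀ : ℕ, ∀ (q : ℤ_[ℓ]) (hq : ExactlyDivides n q) (g : ℕ), g₀ ≤ g →
      surjMoment (nonlinearMeasure h2 hn hq g) Y = univMoment Y := by
  classical
  have : NeZero ℓ := ⟨(Fact.out : ℓ.Prime).ne_zero⟩
  obtain ⟨k, a, s, ha, hi⟩ := exists_iso_std Y
  obtain ⟨r, x, y, hw⟩ := exists_wedge_sum s.2.1
  -- r pairs realise ω_H as a sum of r wedges and k more give surjectivity; neither number depends
  -- on q.
  refine ⟨r + k, fun q hq g hg => ?_⟩
  rw [nonlinearMeasure_eq, surjMoment_classLaw continuous_gsp_sub_one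
    (fun F => F.1.presents_beg h2 hn hq F.2)
    (fun F _ hX => hX.finite_coker F.mulVec_mem_range) (measure_gsp_infinite_coker h2 hn hq),
    rawMoment_congr hi, univMoment_congr hi, rawMoment_gsp]
  refine (tsum_spHaar_surjData (by omega) ha (hq.isUnit hn) (isUnit_scale h2 hq) (scale_spec h2 hq)
    (fun S => (GSp.ofSp q S).isAdmissible h2 hn hq) s).trans ?_
  obtain ⟨f, hf, hω⟩ := exists_surjective_omegaAdd (isUnit_scale h2 hq) x y hg
  exact if_pos ⟨f, hf, hω.trans hw.symm⟩

end NonlinearMain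

/-! ### Counting generating tuples -/

section Generating

theorem card_fiber_mul_card {A B : Type*} [AddCommGroup A] [AddCommGroup B] [Finite A]
    {φ : A →+ B} (hφ : Function.Surjective φ) (b : B) :
    Nat.card {x // φ x = b} * Nat.card B = Nat.card A := by
  obtain ⟨x₀, rfl⟩ := hφ b
  have e : {x // φ x = φ x₀} ≃ φ.ker :=
    { toFun := fun x => ⟨x.1 - x₀, by rw [AddMonoidHom.mem_ker, map_sub, x.2, sub_self]⟩
      invFun := fun y => ⟨y.1 + x₀, by rw [map_add, (AddMonoidHom.mem_ker).1 y.2, zero_add]⟩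
      left_inv := fun x => by simp
      right_inv := fun y => by simp }
  rw [Nat.card_congr e, ← Nat.card_congr (QuotientAddGroup.quotientKerEquivOfSurjective φ hφ).toEquiv,
    mul_comm, ← AddSubgroup.card_eq_card_quotient_mul_card_addSubgroup]

variable (H : Type) [AddCommGroup H] [Finite H] (g : ℕ)

/-- A non-generating tuple lies in a proper subgroup, which has index at least 2. -/
theorem two_pow_mul_card_not_generating_le :
    2 ^ g * Nat.card {x : Fin g → H // AddSubgroup.closure (Set.range x) ≠ ⊤}
      ≤ Nat.card (AddSubgroup H) * Nat.card H ^ g := by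
  classical
  have := Fintype.ofFinite {K : AddSubgroup H // K ≠ ⊤}
  let F : {x : Fin g → H // AddSubgroup.closure (Set.range x) ≠ ⊤} →
      Σ K : {K : AddSubgroup H // K ≠ ⊤}, (Fin g → K.1) := fun x =>
    ⟨⟨_, x.2⟩, fun i => ⟨x.1 i, AddSubgroup.subset_closure ⟨i, rfl⟩⟩⟩
  have hF : Function.Injective F := fun x y h => by
    let G : (Σ K : {K : AddSubgroup H // K ≠ ⊤}, (Fin g → K.1)) → Fin g → H := fun z i => z.2 i
    exact Subtype.ext (congrArg G h)
  have h1 : ∀ K : {K : AddSubgroup H // K ≠ ⊤}, 2 ^ g * Nat.card (Fin g → K.1) ≤ Nat.card H ^ g := by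
    intro K
    rw [Nat.card_fun, Nat.card_fin, ← mul_pow]
    refine Nat.pow_le_pow_left ?_ g
    rw [← K.1.index_mul_card]
    refine Nat.mul_le_mul_right _ ?_
    have h0 := K.1.index_ne_zero_of_finite
    have h1 : K.1.index ≠ 1 := fun h => K.2 (AddSubgroup.index_eq_one.1 h)
    omega
  calc _ ≤ 2 ^ g * Nat.card (Σ K : {K : AddSubgroup H // K ≠ ⊤}, (Fin g → K.1)) :=
        Nat.mul_le_mul_left _ (Nat.card_le_card_of_injective F hF)
    _ = ∑ K : {K : AddSubgroup H // K ≠ ⊤}, 2 ^ g * Nat.card (Fin g → K.1) := by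
        rw [Nat.card_sigma, Finset.mul_sum]
    _ ≤ ∑ _K : {K : AddSubgroup H // K ≠ ⊤}, Nat.card H ^ g := Finset.sum_le_sum fun K _ => h1 K
    _ = Nat.card {K : AddSubgroup H // K ≠ ⊤} * Nat.card H ^ g := by
        rw [Finset.sum_const, Finset.card_univ, smul_eq_mul, ← Nat.card_eq_fintype_card]
    _ ≤ _ := Nat.mul_le_mul_right _
        (Nat.card_le_card_of_injective _ Subtype.val_injective)

variable {H g}

omit [Finite H] in
theorem wedge_mem_sum {ι : Type*} [Fintype ι] (x y : ι → H) :
    ∑ i, wedge (x i) (y i) ∈ wedgeSq H :=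
  Submodule.sum_mem _ fun _ _ => Submodule.subset_span ⟨_, _, rfl⟩

/-- The homomorphism `y ↦ ∑ x_i ∧ y_i`. -/
def wedgeSum (x : Fin g → H) : (Fin g → H) →+ wedgeSq H :=
  AddMonoidHom.mk' (fun y => ⟨∑ i, wedge (x i) (y i), wedge_mem_sum x y⟩) fun y y' => by
    refine Subtype.ext ?_
    change ∑ i, wedge (x i) ((y + y') i) = ∑ i, wedge (x i) (y i) + ∑ i, wedge (x i) (y' i)
    rw [← Finset.sum_add_distrib]
    exact Finset.sum_congr rfl fun i _ => wedge_add_right _ _ _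

omit [Finite H] in
theorem surjective_to_wedgeSq {A : Type*} [AddCommGroup A] (φ : A →+ wedgeSq H)
    (h : ∀ x y : H, ∃ z, (φ z : H ⊗[ℤ] H) = wedge x y) : Function.Surjective φ := by
  rintro ⟨w, hw⟩
  suffices H : ∃ z, (φ z : H ⊗[ℤ] H) = w by
    obtain ⟨z, hz⟩ := H
    exact ⟨z, Subtype.ext hz⟩
  induction hw using Submodule.span_induction with
  | mem w hw =>
    obtain ⟨x, y, rfl⟩ := hw
    exact h x y
  | zero => exact ⟨0, by rw [map_zero]; rfl⟩
  | add w w' _ _ h h' =>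
    obtain ⟨z, hz⟩ := h
    obtain ⟨z', hz'⟩ := h'
    exact ⟨z + z', by rw [map_add, ← hz, ← hz']; rfl⟩
  | smul m w _ h =>
    obtain ⟨z, hz⟩ := h
    exact ⟨m • z, by rw [map_zsmul, ← hz]; rfl⟩

omit [Finite H] in
theorem wedgeSum_surjective {x : Fin g → H} (hx : AddSubgroup.closure (Set.range x) = ⊤) :
    Function.Surjective (wedgeSum x) := by
  refine surjective_to_wedgeSq _ fun x' y => ?_
  have h : x' ∈ AddSubgroup.closure (Set.range x) := hx ▸ AddSubgroup.mem_top x'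
  induction h using AddSubgroup.closure_induction with
  | mem x' h =>
    obtain ⟨i, rfl⟩ := h
    refine ⟨Pi.single i y, ?_⟩
    change ∑ j, wedge (x j) ((Pi.single i y : Fin g → H) j) = _
    rw [Finset.sum_eq_single i]
    · rw [Pi.single_eq_same]
    · intro j _ hj
      rw [Pi.single_eq_of_ne hj, ← wedgeHom_apply, map_zero]
    · simp
  | zero => exact ⟨0, by rw [map_zero, ← wedgeHom_apply, map_zero]; rfl⟩
  | add x₁ x₂ _ _ h h' =>
    obtain ⟨z, hz⟩ := h
    obtain ⟨z', hz'⟩ := h'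
    exact ⟨z + z', by rw [map_add, wedge_add_left, ← hz, ← hz']; rfl⟩
  | neg x₁ _ h =>
    obtain ⟨z, hz⟩ := h
    refine ⟨-z, ?_⟩
    rw [map_neg, ← wedgeHom_apply, map_neg, AddMonoidHom.neg_apply, wedgeHom_apply, ← hz]
    rfl

/-- For a generating tuple x the map y ↦ ∑ x_i ∧ y_i is a surjective homomorphism, so all its fibres
have the same size. -/
theorem card_generating_fiber (w : wedgeSq H) :
    Nat.card {p : (Fin g → H) × (Fin g → H) //
        AddSubgroup.closure (Set.range p.1) = ⊤ ∧ wedgeSum p.1 p.2 = w} * Nat.card (wedgeSq H)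
      = Nat.card {x : Fin g → H // AddSubgroup.closure (Set.range x) = ⊤} * Nat.card H ^ g := by
  classical
  have := Fintype.ofFinite {x : Fin g → H // AddSubgroup.closure (Set.range x) = ⊤}
  have e : {p : (Fin g → H) × (Fin g → H) //
        AddSubgroup.closure (Set.range p.1) = ⊤ ∧ wedgeSum p.1 p.2 = w} ≃
      Σ x : {x : Fin g → H // AddSubgroup.closure (Set.range x) = ⊤}, {y // wedgeSum x.1 y = w} :=
    { toFun := fun p => ⟨⟨p.1.1, p.2.1⟩, p.1.2, p.2.2⟩
      invFun := fun z => ⟨(z.1.1, z.2.1), z.1.2, z.2.2⟩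
      left_inv := fun _ => rfl
      right_inv := fun _ => rfl }
  rw [Nat.card_congr e, Nat.card_sigma, Finset.sum_mul]
  rw [Finset.sum_congr rfl fun x _ => card_fiber_mul_card (wedgeSum_surjective x.2) w,
    Finset.sum_const, Finset.card_univ, smul_eq_mul, ← Nat.card_eq_fintype_card, Nat.card_fun,
    Nat.card_fin]

/-- The image of the symplectic form is nearly equidistributed. -/
theorem card_wedgeSum_fiber_bounds (w : wedgeSq H) {Q : (Fin g → H) × (Fin g → H) → Prop}
    (h1 : ∀ p, AddSubgroup.closure (Set.range p.1) = ⊤ → wedgeSum p.1 p.2 = w → Q p)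
    (h2 : ∀ p, Q p → wedgeSum p.1 p.2 = w) :
    2 ^ g * (Nat.card H ^ g * Nat.card H ^ g) ≤ 2 ^ g * (Nat.card {p // Q p} * Nat.card (wedgeSq H))
        + Nat.card (AddSubgroup H) * (Nat.card H ^ g * Nat.card H ^ g) ∧
      2 ^ g * (Nat.card {p // Q p} * Nat.card (wedgeSq H)) ≤ 2 ^ g * (Nat.card H ^ g * Nat.card H ^ g)
        + Nat.card (AddSubgroup H) * Nat.card (wedgeSq H) * (Nat.card H ^ g * Nat.card H ^ g) := by
  classical
  have hA := card_generating_fiber (g := g) w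
  have hN := two_pow_mul_card_not_generating_le H g
  have hsum : Nat.card {x : Fin g → H // AddSubgroup.closure (Set.range x) = ⊤}
      + Nat.card {x : Fin g → H // AddSubgroup.closure (Set.range x) ≠ ⊤} = Nat.card H ^ g := by
    rw [← Nat.card_sum, Nat.card_congr (Equiv.sumCompl _), Nat.card_fun, Nat.card_fin]
  have hle1 : Nat.card {p : (Fin g → H) × (Fin g → H) //
      AddSubgroup.closure (Set.range p.1) = ⊤ ∧ wedgeSum p.1 p.2 = w} ≤ Nat.card {p // Q p} :=
    Nat.card_le_card_of_injective (fun p => ⟨p.1, h1 _ p.2.1 p.2.2⟩) fun p p' h =>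
      Subtype.ext (Subtype.mk.inj h)
  have hle2 : Nat.card {p // Q p} ≤ Nat.card {p : (Fin g → H) × (Fin g → H) //
      AddSubgroup.closure (Set.range p.1) = ⊤ ∧ wedgeSum p.1 p.2 = w}
        + Nat.card {x : Fin g → H // AddSubgroup.closure (Set.range x) ≠ ⊤} * Nat.card H ^ g := by
    have e : Nat.card (Fin g → H) = Nat.card H ^ g := by rw [Nat.card_fun, Nat.card_fin]
    rw [← e, ← Nat.card_prod, ← Nat.card_sum]
    let F : {p // Q p} → {p : (Fin g → H) × (Fin g → H) //
      AddSubgroup.closure (Set.range p.1) = ⊤ ∧ wedgeSum p.1 p.2 = w} ⊕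
        {x : Fin g → H // AddSubgroup.closure (Set.range x) ≠ ⊤} × (Fin g → H) := fun p =>
      if h : AddSubgroup.closure (Set.range p.1.1) = ⊤ then Sum.inl ⟨p.1, h, h2 _ p.2⟩
      else Sum.inr (⟨p.1.1, h⟩, p.1.2)
    let G : {p : (Fin g → H) × (Fin g → H) //
      AddSubgroup.closure (Set.range p.1) = ⊤ ∧ wedgeSum p.1 p.2 = w} ⊕
        {x : Fin g → H // AddSubgroup.closure (Set.range x) ≠ ⊤} × (Fin g → H) →
        (Fin g → H) × (Fin g → H) := Sum.elim (fun p => p.1) fun p => (p.1.1, p.2)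
    have hGF : ∀ p, G (F p) = p.1 := fun p => by
      simp only [F]
      split_ifs <;> rfl
    exact Nat.card_le_card_of_injective F fun p p' h =>
      Subtype.ext (by rw [← hGF, ← hGF, h])
  set A := Nat.card {p : (Fin g → H) × (Fin g → H) //
      AddSubgroup.closure (Set.range p.1) = ⊤ ∧ wedgeSum p.1 p.2 = w}
  set B := Nat.card {x : Fin g → H // AddSubgroup.closure (Set.range x) = ⊤}
  set C := Nat.card {x : Fin g → H // AddSubgroup.closure (Set.range x) ≠ ⊤}
  set h := Nat.card H ^ g
  set W := Nat.card (wedgeSq H)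
  set S := Nat.card (AddSubgroup H)
  set O := Nat.card {p // Q p}
  have hA2 : A * W + C * h = h * h := by rw [hA, ← add_mul, hsum]
  have hN2 : 2 ^ g * (C * h) ≤ S * (h * h) := by
    rw [← mul_assoc, ← mul_assoc]
    exact Nat.mul_le_mul_right _ hN
  constructor
  · calc 2 ^ g * (h * h) = 2 ^ g * (A * W) + 2 ^ g * (C * h) := by rw [← mul_add, hA2]
      _ ≤ _ := add_le_add (Nat.mul_le_mul_left _ (Nat.mul_le_mul_right _ hle1)) hN2
  · calc 2 ^ g * (O * W) ≤ 2 ^ g * ((A + C * h) * W) :=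
          Nat.mul_le_mul_left _ (Nat.mul_le_mul_right _ hle2)
      _ = 2 ^ g * (A * W) + 2 ^ g * (C * h) * W := by ring
      _ ≤ 2 ^ g * (h * h) + S * (h * h) * W := by
          refine add_le_add (Nat.mul_le_mul_left _ ?_) (Nat.mul_le_mul_right _ hN2)
          rw [← hA2]
          exact Nat.le_add_right _ _
      _ = _ := by ring

end Generating

/-! ### Moments of the linear model -/

section LinearMoments

open MeasureTheory

variable {ℓ : ℕ} [Fact ℓ.Prime] {g n : ℕ} {H : Type} [AddCommGroup H]

theorem compMat_add (f : Lat ℓ g →+ H) (M M' : Mat ℓ g) :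
    compMat f (M + M') = compMat f M + compMat f M' := by
  refine AddMonoidHom.ext fun x => ?_
  simp only [compMat_apply, AddMonoidHom.add_apply, Matrix.add_mulVec, map_add]

/-- The polar form of the pushforward of the symplectic form. -/
def crossWedge (f : Lat ℓ g →+ H) : (Lat ℓ g →+ H) →+ wedgeSq H :=
  AddMonoidHom.mk' (fun h => ⟨∑ i, (wedge (f (vecE i)) (h (vecF i)) + wedge (h (vecE i)) (f (vecF i))),
    Submodule.sum_mem _ fun _ _ => Submodule.add_mem _ (Submodule.subset_span ⟨_, _, rfl⟩)
      (Submodule.subset_span ⟨_, _, rfl⟩)⟩) fun h h' => by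
    refine Subtype.ext ?_
    simp only [Submodule.coe_add, ← Finset.sum_add_distrib, AddMonoidHom.add_apply, wedge_add_left,
      wedge_add_right]
    exact Finset.sum_congr rfl fun i _ => by abel

theorem coe_crossWedge (f h : Lat ℓ g →+ H) : (crossWedge f h : H ⊗[ℤ] H)
    = ∑ i, (wedge (f (vecE i)) (h (vecF i)) + wedge (h (vecE i)) (f (vecF i))) := rfl

theorem omegaAdd_add (f h : Lat ℓ g →+ H) :
    omegaAdd (f + h) 1 = omegaAdd f 1 + omegaAdd h 1 + crossWedge f h := by
  simp only [coe_crossWedge, omegaAdd, ← Finset.sum_add_distrib, AddMonoidHom.add_apply,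
    wedge_add_left, wedge_add_right, one_smul]
  exact Finset.sum_congr rfl fun i _ => by abel

theorem crossWedge_self (f : Lat ℓ g →+ H) :
    (crossWedge f f : H ⊗[ℤ] H) = 2 • omegaAdd f 1 := by
  simp only [coe_crossWedge, omegaAdd, Finset.smul_sum, one_smul, two_smul]

/-- (1 + M) J (1 + M)ᵀ has no term linear in M when M is skew-symplectic. Comparison with the
polarisation of the pushforward leaves zero for the cross term. -/
theorem crossWedge_skew [Finite H] (hH : ∀ x : H, ∃ k : ℕ, ℓ ^ k • x = 0) (f : Lat ℓ g →+ H)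
    (M : skewSymp ℓ g) : crossWedge f (compMat f M.1) = 0 := by
  obtain ⟨τ, hτ⟩ := exists_omegaAdd_comp hH f
  have h1 := omegaAdd_add f (compMat f M.1)
  have h2 := hτ 1
  rw [compMat_one, Matrix.one_mul, Matrix.transpose_one, Matrix.mul_one] at h2
  have h3 : (1 + M.1) * Matrix.J (Fin g) ℤ_[ℓ] * (1 + M.1)ᵀ = Matrix.J (Fin g) ℤ_[ℓ]
      + M.1 * Matrix.J (Fin g) ℤ_[ℓ] * M.1ᵀ := by
    rw [Matrix.transpose_add, Matrix.transpose_one]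
    have : (1 + M.1) * Matrix.J (Fin g) ℤ_[ℓ] * (1 + M.1ᵀ) = Matrix.J (Fin g) ℤ_[ℓ]
      + M.1 * Matrix.J (Fin g) ℤ_[ℓ] * M.1ᵀ
      + (M.1 * Matrix.J (Fin g) ℤ_[ℓ] + Matrix.J (Fin g) ℤ_[ℓ] * M.1ᵀ) := by noncomm_ring
    rw [this, skewSymp_mul_J, add_zero]
  have h4 : omegaAdd (f + compMat f M.1) 1 = omegaAdd f 1 + omegaAdd (compMat f M.1) 1 := by
    have e : f + compMat f M.1 = compMat f (1 + M.1) := by rw [compMat_add, compMat_one]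
    rw [e, hτ, h3, map_add, h2, hτ]
  rw [h4] at h1
  exact Subtype.ext (left_eq_add.1 h1)

theorem PsiRel.add_matrix {f : Lat ℓ g →+ H} {A B : Mat ℓ g} {α : H →+ ZMod (ℓ ^ n)} {z z' : H}
    (hB : ∀ x, f (B *ᵥ x) = 0) (h : PsiRel n A f α z) (h' : PsiRel n B f α z') :
    PsiRel n (A + B) f α (z + z') := by
  obtain ⟨s, t, hs, ht, rfl⟩ := h
  obtain ⟨s', t', hs', ht', rfl⟩ := h'
  obtain ⟨w, hw⟩ := rep_unique (α := α.comp f) hs' hs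
  have e1 : B *ᵥ s = (ℓ : ℤ_[ℓ]) ^ n • (t' - B *ᵥ w) := by
    have : s = s' - (ℓ : ℤ_[ℓ]) ^ n • w := by rw [← hw]; abel
    rw [this, Matrix.mulVec_sub, ht', Matrix.mulVec_smul, smul_sub]
  refine ⟨s, t + (t' - B *ᵥ w), hs, ?_, ?_⟩
  · rw [Matrix.add_mulVec, ht, e1, smul_add]
  · rw [map_add, map_sub, hB, sub_zero]

variable {k : ℕ} {a : Fin k → ℕ}

/-- Expanding a preimage of x in the symplectic basis shows which values of h on the dual basis give
x ∧ y. It follows that the kernel has |Hom(T, H)| / |∧²H| elements. -/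
theorem crossWedge_surjective [NeZero ℓ] {f : Lat ℓ g →+ Std ℓ a} (hf : Function.Surjective f) :
    Function.Surjective (crossWedge f) := by
  refine surjective_to_wedgeSq _ fun x y => ?_
  obtain ⟨z, rfl⟩ := hf x
  obtain ⟨m, hm⟩ := exists_map_eq_sum (H := Std ℓ a) (exists_primary_pow a) z
  let v : Fin g ⊕ Fin g → Std ℓ a :=
    Sum.elim (fun i => -(m (Sum.inr i) • y)) fun i => m (Sum.inl i) • y
  have hv := homOfValues_single (ℓ := ℓ) v
  refine ⟨homOfValues v, ?_⟩
  rw [coe_crossWedge, hm, Fintype.sum_sum_type, wedge_add_left, Finset.sum_add_distrib]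
  simp only [vecE, vecF, hv, v, Sum.elim_inl, Sum.elim_inr]
  congr 1
  · rw [← wedgeHom_apply, map_sum, AddMonoidHom.finsetSum_apply]
    refine Finset.sum_congr rfl fun i _ => ?_
    rw [← wedgeHom_apply, map_nsmul, map_nsmul, AddMonoidHom.nsmul_apply]
  · rw [← wedgeHom_apply, map_sum, AddMonoidHom.finsetSum_apply]
    refine Finset.sum_congr rfl fun i _ => ?_
    rw [← wedgeHom_apply, map_neg, AddMonoidHom.neg_apply, wedgeHom_apply, ← wedge_swap,
      ← wedgeHom_apply, map_nsmul, map_nsmul, AddMonoidHom.nsmul_apply]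

theorem IsLift.crossWedge {f h : Lat ℓ g →+ Std ℓ a} {s t : Fin k → Lat ℓ g} (hs : IsLift f s)
    (ht : IsLift h t) (h0 : crossWedge f h = 0) {i j : Fin k} (hij : a i ≤ a j) :
    (ℓ : ℤ_[ℓ]) ^ a i ∣ symp (s i) (t j) + symp (t i) (s j) := by
  have key : ∀ {f : Lat ℓ g →+ Std ℓ a} {s : Fin k → Lat ℓ g}, IsLift f s →
      evalPair (gen (a i) a i) (gen (a i) a j) (omegaAdd f 1)
        = PadicInt.toZModPow (a i) (symp (s i) (s j)) := by
    intro f s hs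
    have e1 : ∀ x, gen (a i) a i (f x) = PadicInt.toZModPow (a i) (symp x (s i)) := fun x => by
      rw [gen_apply (hs x i), Nat.sub_self, pow_zero, one_mul]
    have e2 : ∀ x, gen (a i) a j (f x) = PadicInt.toZModPow (a i) (symp x (s j)) := fun x => by
      rw [gen_apply (hs x j), Nat.sub_eq_zero_of_le hij, pow_zero, one_mul]
    rw [evalPair_omegaAdd e1 e2, one_mul]
  have hst : IsLift (f + h) (fun i => s i + t i) := fun x i => by
    rw [AddMonoidHom.add_apply, Pi.add_apply, hs, ht, symp_add_right, map_add]
  have e := key hst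
  rw [omegaAdd_add, h0, ZeroMemClass.coe_zero, add_zero, map_add, key hs, key ht] at e
  rw [← toZModPow_eq_zero_iff]
  simp only [symp_add_left, symp_add_right, map_add] at e ⊢
  linear_combination -e

/-- A skew-symplectic endomorphism with prescribed values on a family with an isotropic dual. -/
theorem IsIsoDual.exists_skew {s t v : Fin k → Lat ℓ g} (ht : IsIsoDual s t)
    (hv : ∀ i j, symp (s i) (v j) = symp (s j) (v i)) :
    ∃ M : skewSymp ℓ g, ∀ i, M.1 *ᵥ s i = v i := by
  -- The first sum is skew and sends s_i to v_i plus the sum of ω(s_i, v_j) t_j; the symmetric map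
  -- removes that surplus.
  let φ : Lat ℓ g →ₗ[ℤ_[ℓ]] Lat ℓ g := (∑ j, ((sympBilin.flip (t j)).smulRight (v j)
    + (sympBilin.flip (v j)).smulRight (t j))) - symmMap (fun i j => symp (s i) (v j)) t
  have hφ : ∀ x, φ x = ∑ j, (symp x (t j) • v j + symp x (v j) • t j)
      - symmMap (fun i j => symp (s i) (v j)) t x := fun x => by
    simp [φ, LinearMap.sum_apply]
  obtain ⟨M, hM⟩ := exists_skew_of_linear φ fun x y => by
    rw [hφ, hφ, symp_sub_left, symp_sub_right, symp_symmMap hv, symp_sum_left, symp_sum_right]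
    have : ∀ j, symp (symp x (t j) • v j + symp x (v j) • t j) y
        = -symp x (symp y (t j) • v j + symp y (v j) • t j) := fun j => by
      rw [symp_add_left, symp_add_right, symp_smul_left, symp_smul_left, symp_smul_right,
        symp_smul_right, symp_swap (v j) y, symp_swap (t j) y]
      ring
    rw [Finset.sum_congr rfl fun j _ => this j, Finset.sum_neg_distrib]
    ring
  refine ⟨M, fun i => ?_⟩
  rw [hM, hφ, symmMap_dual ht, Finset.sum_add_distrib, add_sub_cancel_right,
    Finset.sum_eq_single i]
  · rw [ht.1, if_pos rfl, one_smul]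
  · intro j _ hj
    rw [ht.1, if_neg (Ne.symm hj), zero_smul]
  · simp

/-- The infinitesimal form of the transitivity of Sp. Vanishing of the cross term makes the pairings
of the lifts of f and h symmetric up to multiples of ℓ^(a i), and these are corrected along the dual
family. -/
theorem exists_skew_comp (hk : k ≤ g) (ha : ∀ i, 1 ≤ a i) {f h : Lat ℓ g →+ Std ℓ a}
    (hf : Function.Surjective f) (h0 : crossWedge f h = 0) :
    ∃ M : skewSymp ℓ g, compMat f M.1 = h := by
  obtain ⟨s, hs⟩ := exists_isLift f
  obtain ⟨t, ht⟩ := exists_isLift h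
  obtain ⟨τ, hτ⟩ := (hs.unimod hf ha).exists_isoDual hk
  let P : Fin k → Fin k → Prop := fun i j => a i < a j ∨ (a i = a j ∧ i < j)
  have hP : ∀ i j, P i j → a i ≤ a j := fun i j h => h.elim le_of_lt fun h => h.1.le
  choose E hE using fun (i j : Fin k) (hij : a i ≤ a j) => hs.crossWedge ht h0 hij
  classical
  let X : Fin k → Fin k → ℤ_[ℓ] := fun i j => if h : P i j then -E i j (hP _ _ h) else 0
  have hX : ∀ i j, (ℓ : ℤ_[ℓ]) ^ a j * X j i - (ℓ : ℤ_[ℓ]) ^ a i * X i j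
      = symp (s i) (t j) + symp (t i) (s j) := by
    intro i j
    by_cases h1 : P i j
    · have h2 : ¬ P j i := by
        simp only [P] at h1 ⊢
        omega
      simp only [X, dif_pos h1, dif_neg h2]
      rw [hE i j (hP _ _ h1)]
      ring
    · by_cases h2 : P j i
      · simp only [X, dif_pos h2, dif_neg h1]
        rw [mul_neg, ← hE j i (hP _ _ h2), symp_swap (s j), symp_swap (t j)]
        ring
      · obtain rfl : i = j := by
          simp only [P] at h1 h2
          omega
        simp only [X, dif_neg h1]
        rw [symp_swap (t i)]
        ring
  -- The minus sign before t_j compensates ω(M x, s_j) = -ω(x, M s_j).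
  let v : Fin k → Lat ℓ g := fun j => (ℓ : ℤ_[ℓ]) ^ a j • (∑ i, X j i • τ i) - t j
  have hv : ∀ i j, symp (s i) (v j) = (ℓ : ℤ_[ℓ]) ^ a j * X j i - symp (s i) (t j) := fun i j => by
    simp [v, symp_sub_right, symp_smul_right, symp_sum_right, hτ.1]
  obtain ⟨M, hM⟩ := hτ.exists_skew (v := v) fun i j => by
    rw [hv, hv, symp_swap (s j)]
    linear_combination hX i j
  refine ⟨M, AddMonoidHom.ext fun x => funext fun j => ?_⟩
  rw [compMat_apply, hs, ht, M.2, hM, toZModPow_eq_iff]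
  refine ⟨-symp x (∑ i, X j i • τ i), ?_⟩
  simp only [v, symp_sub_right, symp_smul_right]
  ring

instance : IsProbabilityMeasure (skewHaar ℓ g) :=
  ⟨Measure.addHaarMeasure_self⟩

instance : (skewHaar ℓ g).IsAddHaarMeasure :=
  inferInstanceAs (Measure.IsAddHaarMeasure (Measure.addHaarMeasure ⊤))

/-- M ↦ f∘M is a homomorphism onto the kernel of `crossWedge f`, so Haar measure is pushed to the
uniform measure. -/
theorem measure_skew_comp_eq [NeZero ℓ] (hk : k ≤ g) (ha : ∀ i, 1 ≤ a i) {f h : Lat ℓ g →+ Std ℓ a}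
    (hf : Function.Surjective f) (h0 : crossWedge f h = 0) :
    skewHaar ℓ g {M | compMat f M.1 = h}
      = (Nat.card {h : Lat ℓ g →+ Std ℓ a // crossWedge f h = 0} : ENNReal)⁻¹ := by
  have : Nonempty {h : Lat ℓ g →+ Std ℓ a // crossWedge f h = 0} := ⟨⟨h, h0⟩⟩
  have := finite_lat_hom (g := g) (H := Std ℓ a) (exists_primary_pow a)
  have key := measure_eq_div_of_partition (P := skewHaar ℓ g) (F := Set.univ)
    (E := fun h : {h : Lat ℓ g →+ Std ℓ a // crossWedge f h = 0} => {M : skewSymp ℓ g | compMat f M.1 = h.1})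
    (fun h => (isOpen_comp_eq continuous_subtype_val (exists_primary_pow a) f h.1).measurableSet)
    ?_ ?_ ?_ ⟨h, h0⟩
  · rw [key, measure_univ, one_div]
  · intro h h' hne
    exact Set.disjoint_left.2 fun M hM hM' => hne (Subtype.ext ((Eq.symm hM).trans hM'))
  · exact (Set.eq_univ_of_forall fun M => Set.mem_iUnion.2
      ⟨⟨compMat f M.1, crossWedge_skew (exists_primary_pow a) f M⟩, rfl⟩).symm
  · intro h h'
    obtain ⟨L, hL⟩ := exists_skew_comp hk ha hf (h := h.1 - h'.1)
      (by rw [map_sub, h.2, h'.2, sub_zero])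
    have e : {M : skewSymp ℓ g | compMat f M.1 = h'.1}
        = (fun M => L + M) ⁻¹' {M : skewSymp ℓ g | compMat f M.1 = h.1} := by
      ext M
      change compMat f M.1 = h'.1 ↔ compMat f (L.1 + M.1) = h.1
      rw [compMat_add, hL]
      constructor
      · intro h
        rw [h, sub_add_cancel]
      · intro h
        exact add_left_cancel (h.trans (sub_add_cancel _ _).symm)
    rw [e, measure_preimage_add]

theorem continuous_shifted : Continuous (shifted n : skewSymp ℓ g → Mat ℓ g) :=
  continuous_subtype_val.add continuous_const

theorem compMat_eq_iff_shifted {f : Lat ℓ g →+ H} (M : skewSymp ℓ g) :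
    compMat f M.1 = -(ℓ ^ n • f) ↔ ∀ x, f (shifted n M *ᵥ x) = 0 := by
  have h : ∀ x, f (shifted n M *ᵥ x) = compMat f M.1 x + (ℓ ^ n • f) x := fun x => by
    rw [shifted, Matrix.add_mulVec, map_add, Matrix.smul_mulVec, Matrix.one_mulVec, compMat_apply,
      AddMonoidHom.nsmul_apply, ← map_nsmul, ← Nat.cast_smul_eq_nsmul ℤ_[ℓ], Nat.cast_pow]
  rw [DFunLike.ext_iff]
  refine forall_congr' fun x => ?_
  rw [h, AddMonoidHom.neg_apply, eq_neg_iff_add_eq_zero]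

theorem measure_surjData_skew [NeZero ℓ] (hk : k ≤ g) (ha : ∀ i, 1 ≤ a i)
    (s : BEGOn ℓ n (Std ℓ a)) (f : Lat ℓ g →+ Std ℓ a) (hf : Function.Surjective f)
    (hω : omegaAdd f 1 = s.1.1) :
    skewHaar ℓ g {M | SurjData (shifted n M) 1 s.1.1 s.1.2 f}
      = (Nat.card {h : Lat ℓ g →+ Std ℓ a // crossWedge f h = 0} : ENNReal)⁻¹
        * univMoment (s.toBEG (exists_primary_pow a)) := by
  -- The cross term of f with itself is twice ω, which ℓ^n kills. Thus f∘M = -ℓ^n f, the condition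
  -- that f kills M + ℓ^n, is attainable.
  have h0 : crossWedge f (-(ℓ ^ n • f)) = 0 := by
    rw [map_neg, map_nsmul, neg_eq_zero]
    refine Subtype.ext ?_
    rw [Submodule.coe_smul_of_tower, crossWedge_self, smul_comm, hω, s.2.2.1, smul_zero]
    rfl
  let E : Delta ℓ n (Std ℓ a) → Set (skewSymp ℓ g) := fun δ => {M | compMat f M.1 = -(ℓ ^ n • f) ∧
    ∀ α, PsiRel n (shifted n M) f α (s.1.2 α + δ.1 α)}
  have hE : ∀ δ, E δ = {M | SurjData (shifted n M) 1 s.1.1 (s.1.2 + δ.1) f} := fun δ => by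
    ext M
    change _ ∧ _ ↔ _ ∧ _ ∧ _ ∧ _
    rw [compMat_eq_iff_shifted]
    exact ⟨fun h => ⟨hf, h.1, hω, h.2⟩, fun h => ⟨h.2.1, h.2.2.2⟩⟩
  have hEm : ∀ δ, MeasurableSet (E δ) := fun δ => by
    rw [hE]
    have h1 : ∀ (r : ℕ) (α β : Std ℓ a →+ ZMod (ℓ ^ (n + r))), β ((s.1.2 + δ.1) (scaleDown r α))
        = α ((s.1.2 + δ.1) (scaleDown r β)) + 2 * evalPair α β s.1.1 := fun r α β => by
      rw [AddMonoidHom.add_apply, AddMonoidHom.add_apply, map_add, map_add, s.2.2.2, δ.2 r α β]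
      ring
    let s' : BEGOn ℓ n (Std ℓ a) := ⟨(s.1.1, s.1.2 + δ.1), s.2.1, s.2.2.1, h1⟩
    exact (isOpen_surjData continuous_shifted (s'.toBEG (exists_primary_pow a)) f).measurableSet
  have key := measure_eq_div_of_partition (P := skewHaar ℓ g)
    (F := {M | compMat f M.1 = -(ℓ ^ n • f)}) hEm ?_ ?_ ?_ 0
  · have h1 : {M : skewSymp ℓ g | SurjData (shifted n M) 1 s.1.1 s.1.2 f} = E 0 := by
      rw [hE, ZeroMemClass.coe_zero, add_zero]
    rw [h1, key, measure_skew_comp_eq hk ha hf h0, card_delta (exists_primary_pow a),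
      div_eq_mul_inv]
    rfl
  · intro δ δ' hne
    refine Set.disjoint_left.2 fun M hM hM' => hne (Subtype.ext (AddMonoidHom.ext fun α => ?_))
    exact add_left_cancel ((hM.2 α).unique ((compMat_eq_iff_shifted M).1 hM.1) (hM'.2 α))
  · ext M
    constructor
    · intro hM
      have hM' := (compMat_eq_iff_shifted M).1 hM
      refine Set.mem_iUnion.2 ⟨⟨_, sub_mem_delta_of_psiRel (shifted_isAdmissible M) hM' s hω⟩, hM,
        fun α => ?_⟩
      rw [AddMonoidHom.sub_apply, add_sub_cancel]
      exact psiHom_spec _ _ α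
    · intro hM
      obtain ⟨δ, hδ⟩ := Set.mem_iUnion.1 hM
      exact hδ.1
  · have h1 : ∀ δ δ' : Delta ℓ n (Std ℓ a), skewHaar ℓ g (E δ) ≤ skewHaar ℓ g (E δ') := by
      intro δ δ'
      obtain ⟨L, hL, hδ⟩ := exists_skew_of_mem_delta hk ha hf (δ' - δ).2
      rw [← measure_preimage_add (skewHaar ℓ g) L (E δ')]
      refine measure_mono fun M hM => ?_
      have e : shifted n (L + M) = shifted n M + L.1 := by
        change L.1 + M.1 + _ = M.1 + _ + L.1
        abel
      refine ⟨(compMat_eq_iff_shifted (L + M)).2 fun x => ?_, fun α => ?_⟩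
      · rw [e, Matrix.add_mulVec, map_add, (compMat_eq_iff_shifted M).1 hM.1, hL, add_zero]
      · change PsiRel n (shifted n (L + M)) f α _
        rw [e]
        have := PsiRel.add_matrix hL (hM.2 α) (hδ α)
        convert this using 1
        rw [AddSubgroup.coe_sub, AddMonoidHom.sub_apply]
        abel
    exact fun δ δ' => le_antisymm (h1 δ δ') (h1 δ' δ)

end LinearMoments

/-! ### Finiteness, asymptotic moments and convergence for the linear model. -/

section LinearMain

open MeasureTheory Topology Filter

variable {ℓ : ℕ} [Fact ℓ.Prime] {g n : ℕ} {k : ℕ} {a : Fin k → ℕ} [NeZero ℓ]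

variable (ℓ g a) in
/-- Homomorphisms from the lattice as pairs of tuples. -/
def latHomEquiv : (Lat ℓ g →+ Std ℓ a) ≃ (Fin g → Std ℓ a) × (Fin g → Std ℓ a) where
  toFun f := (fun i => f (vecE i), fun i => f (vecF i))
  invFun p := homOfValues (Sum.elim p.1 p.2)
  left_inv f := lat_hom_ext (exists_primary_pow a) fun i => by
    rw [homOfValues_single]
    cases i <;> rfl
  right_inv p := by
    refine Prod.ext (funext fun i => ?_) (funext fun i => ?_) <;> exact homOfValues_single _ _

theorem card_latHom : Nat.card (Lat ℓ g →+ Std ℓ a)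
    = Nat.card (Std ℓ a) ^ g * Nat.card (Std ℓ a) ^ g := by
  rw [Nat.card_congr (latHomEquiv ℓ g a), Nat.card_prod, Nat.card_fun, Nat.card_fin]

theorem card_orbit_bounds {w : Std ℓ a ⊗[ℤ] Std ℓ a} (hw : w ∈ wedgeSq (Std ℓ a)) :
    2 ^ g * Nat.card (Lat ℓ g →+ Std ℓ a)
        ≤ 2 ^ g * (Nat.card (Orbit g w) * Nat.card (wedgeSq (Std ℓ a)))
          + Nat.card (AddSubgroup (Std ℓ a)) * Nat.card (Lat ℓ g →+ Std ℓ a) ∧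
      2 ^ g * (Nat.card (Orbit g w) * Nat.card (wedgeSq (Std ℓ a)))
        ≤ 2 ^ g * Nat.card (Lat ℓ g →+ Std ℓ a)
          + Nat.card (AddSubgroup (Std ℓ a)) * Nat.card (wedgeSq (Std ℓ a))
            * Nat.card (Lat ℓ g →+ Std ℓ a) := by
  let E := latHomEquiv ℓ g a
  have e : Orbit g w ≃ {p // Function.Surjective (E.symm p) ∧ omegaAdd (E.symm p) 1 = w} :=
    E.subtypeEquiv fun f => by rw [E.symm_apply_apply]
  have hω : ∀ p, omegaAdd (E.symm p) 1 = (wedgeSum p.1 p.2 : Std ℓ a ⊗[ℤ] Std ℓ a) := fun p => by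
    refine Finset.sum_congr rfl fun i _ => ?_
    have h1 : E.symm p (vecE i) = p.1 i := homOfValues_single _ _
    have h2 : E.symm p (vecF i) = p.2 i := homOfValues_single _ _
    rw [one_smul, h1, h2]
  rw [card_latHom, Nat.card_congr e]
  refine card_wedgeSum_fiber_bounds ⟨w, hw⟩ (fun p hp h => ⟨?_, ?_⟩) fun p h => ?_
  · rw [← AddMonoidHom.range_eq_top, ← top_le_iff, ← hp, AddSubgroup.closure_le]
    rintro _ ⟨i, rfl⟩
    exact ⟨vecE i, homOfValues_single _ _⟩
  · rw [hω, h]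
  · exact Subtype.ext ((hω p).symm.trans h.2)

/-- Each admissible f contributes |∧²H| / |Hom(T, H)| times the universal moment, and the orbit
counts the admissible f. -/
theorem rawMoment_skew (hk : k ≤ g) (ha : ∀ i, 1 ≤ a i) (s : BEGOn ℓ n (Std ℓ a)) :
    rawMoment (skewHaar ℓ g) (shifted n) 1 (s.toBEG (exists_primary_pow a))
      = ((Nat.card (Orbit g s.1.1) * Nat.card (wedgeSq (Std ℓ a)) : ℕ) : ENNReal)
        / (Nat.card (Lat ℓ g →+ Std ℓ a) : ENNReal) * univMoment (s.toBEG (exists_primary_pow a)) := by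
  classical
  have hfin := finite_lat_hom (g := g) (H := Std ℓ a) (exists_primary_pow a)
  have := Fintype.ofFinite (Lat ℓ g →+ Std ℓ a)
  have h1 : ∀ f : Lat ℓ g →+ Std ℓ a,
      skewHaar ℓ g {M | SurjData (shifted n M) 1 s.1.1 s.1.2 f}
      = if Function.Surjective f ∧ omegaAdd f 1 = s.1.1 then
        (Nat.card (wedgeSq (Std ℓ a)) : ENNReal) / (Nat.card (Lat ℓ g →+ Std ℓ a) : ENNReal) *
          univMoment (s.toBEG (exists_primary_pow a)) else 0 := fun f => by
    split_ifs with hf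
    · rw [measure_surjData_skew hk ha s f hf.1 hf.2]
      congr 1
      have hc := card_fiber_mul_card (crossWedge_surjective hf.1) 0
      have hW : (Nat.card (wedgeSq (Std ℓ a)) : ENNReal) ≠ 0 := by exact_mod_cast Nat.card_pos.ne'
      rw [← hc, Nat.cast_mul, ENNReal.div_eq_inv_mul,
        ENNReal.mul_inv (Or.inr (ENNReal.natCast_ne_top _)) (Or.inr hW), mul_assoc,
        ENNReal.inv_mul_cancel hW (ENNReal.natCast_ne_top _), mul_one]
    · convert measure_empty (μ := skewHaar ℓ g)
      exact Set.eq_empty_of_forall_notMem fun M hM => hf ⟨hM.1, hM.2.2.1⟩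
  change ∑' f : Lat ℓ g →+ Std ℓ a, skewHaar ℓ g {M | SurjData (shifted n M) 1 s.1.1 s.1.2 f} = _
  rw [tsum_congr h1, tsum_fintype, ← Finset.sum_filter, Finset.sum_const, nsmul_eq_mul,
    ← Fintype.card_subtype, ← Nat.card_eq_fintype_card, ← mul_assoc, ← mul_div_assoc, Nat.cast_mul]
  rfl

theorem card_orbit_le (w : Std ℓ a ⊗[ℤ] Std ℓ a) :
    Nat.card (Orbit g w) ≤ Nat.card (Lat ℓ g →+ Std ℓ a) :=
  have := finite_lat_hom (g := g) (H := Std ℓ a) (exists_primary_pow a)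
  Nat.card_le_card_of_injective _ Subtype.val_injective

omit [Fact ℓ.Prime] in
theorem card_wedgeSq_of_unique (a : Fin 1 → ℕ) : Nat.card (wedgeSq (Std ℓ a)) = 1 := by
  have h : wedgeSq (Std ℓ a) = ⊥ := by
    rw [wedgeSq, Submodule.span_eq_bot]
    rintro _ ⟨x, y, rfl⟩
    have hx : ∀ x : Std ℓ a, x = (x 0).val • Pi.single 0 1 := fun x => by
      funext i
      obtain rfl := Subsingleton.elim i 0
      simp
    rw [hx x, hx y, ← wedgeHom_apply, map_nsmul, map_nsmul, AddMonoidHom.nsmul_apply, wedgeHom_apply,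
      wedge_self, smul_zero, smul_zero]
  rw [h]
  exact Nat.card_unique

theorem measure_skew_infinite_coker (h2 : ℓ ≠ 2) :
    skewHaar ℓ g {M | ¬ Finite (LinCoker n M)} = 0 := by
  rcases Nat.eq_zero_or_pos g with rfl | hg
  · convert measure_empty (μ := skewHaar ℓ 0)
    exact Set.eq_empty_of_forall_notMem fun M hM => hM (finite_coker_zero _)
  · refine measure_mono_null (fun M hM => ?_) (measure_det_eq_zero' (u := 1) h2
      (continuous_shifted (n := n)) shifted_isAdmissible fun a ha s => ?_)
    · by_contra hdet
      exact hM (finite_coker_of_det_ne_zero hdet)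
    -- For a cyclic group ∧² is trivial, so the correction factor is |orbit| / |Hom(T, H)|, at most
    -- 1.
    · rw [rawMoment_skew hg ha, card_wedgeSq_of_unique, mul_one]
      refine mul_le_of_le_one_left zero_le (ENNReal.div_le_of_le_mul ?_)
      rw [one_mul]
      exact_mod_cast card_orbit_le _

omit [NeZero ℓ] in
theorem presents_linBeg (h2 : ℓ ≠ 2) (M : skewSymp ℓ g) (hM : Finite (LinCoker n M)) :
    Presents (linBeg h2 M hM) (shifted n M) 1 :=
  presents_begOf h2 (Submodule.mkQ_surjective _) _ _

theorem isProbabilityMeasure_linear (h2 : ℓ ≠ 2) (g : ℕ) :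
    IsProbabilityMeasure (linearMeasure (ℓ := ℓ) n h2 g) :=
  isProbabilityMeasure_classLaw continuous_shifted (fun M => presents_linBeg h2 M.1 M.2)
    (fun M _ hX => hX.finite_coker fun y => LinearMap.mem_range_self (Matrix.mulVecLin (shifted n M)) y) (measure_skew_infinite_coker h2)

theorem surjMoment_linear (h2 : ℓ ≠ 2) (Y : BEG ℓ n) :
    surjMoment (linearMeasure n h2 g) Y = rawMoment (skewHaar ℓ g) (shifted n) 1 Y :=
  surjMoment_classLaw continuous_shifted (fun M => presents_linBeg h2 M.1 M.2)
    (fun M _ hX => hX.finite_coker fun y => LinearMap.mem_range_self (Matrix.mulVecLin (shifted n M)) y) (measure_skew_infinite_coker h2) Y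

/-- Tuples that fail to generate H are exponentially rare, so the ratio differs from 1 by at most a
constant times 2^(-g). -/
theorem tendsto_card_orbit {w : Std ℓ a ⊗[ℤ] Std ℓ a} (hw : w ∈ wedgeSq (Std ℓ a)) :
    Tendsto (fun g => ((Nat.card (Orbit g w) * Nat.card (wedgeSq (Std ℓ a)) : ℕ) : ENNReal)
      / (Nat.card (Lat ℓ g →+ Std ℓ a) : ENNReal)) atTop (𝓝 1) := by
  have hpos : ∀ g, (0 : ℝ) < Nat.card (Lat ℓ g →+ Std ℓ a) := fun g => by
    have := finite_lat_hom (g := g) (H := Std ℓ a) (exists_primary_pow a)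
    exact_mod_cast Nat.card_pos
  have h0 : ∀ c : ℝ, Tendsto (fun g : ℕ => c / 2 ^ g) atTop (𝓝 0) := fun c => by
    have := (tendsto_pow_atTop_nhds_zero_of_lt_one (r := (1 / 2 : ℝ)) (by norm_num)
      (by norm_num)).const_mul c
    simpa [div_eq_mul_inv] using this
  have hreal : Tendsto (fun g => ((Nat.card (Orbit g w) * Nat.card (wedgeSq (Std ℓ a)) : ℕ) : ℝ)
      / (Nat.card (Lat ℓ g →+ Std ℓ a) : ℝ)) atTop (𝓝 1) := by
    refine tendsto_of_tendsto_of_tendsto_of_le_of_le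
      (g := fun g => 1 - (Nat.card (AddSubgroup (Std ℓ a)) : ℝ) / 2 ^ g)
      (h := fun g => 1 + ((Nat.card (AddSubgroup (Std ℓ a)) * Nat.card (wedgeSq (Std ℓ a)) : ℕ) : ℝ)
        / 2 ^ g) ?_ ?_ (fun g => ?_) fun g => ?_
    · simpa using (h0 _).const_sub 1
    · simpa using (h0 _).const_add 1
    · have h := (card_orbit_bounds (g := g) hw).1
      have h' : (2 : ℝ) ^ g * Nat.card (Lat ℓ g →+ Std ℓ a)
        ≤ 2 ^ g * ((Nat.card (Orbit g w) * Nat.card (wedgeSq (Std ℓ a)) : ℕ) : ℝ)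
          + Nat.card (AddSubgroup (Std ℓ a)) * Nat.card (Lat ℓ g →+ Std ℓ a) := by exact_mod_cast h
      have h2 : (0 : ℝ) < 2 ^ g := by positivity
      have h3 := hpos g
      change 1 - _ / _ ≤ _ / _
      rw [le_div_iff₀ h3, sub_mul, one_mul, div_mul_eq_mul_div, sub_le_iff_le_add,
        ← sub_le_iff_le_add', le_div_iff₀ h2]
      linarith
    · have h := (card_orbit_bounds (g := g) hw).2
      have h' : 2 ^ g * ((Nat.card (Orbit g w) * Nat.card (wedgeSq (Std ℓ a)) : ℕ) : ℝ)
        ≤ (2 : ℝ) ^ g * Nat.card (Lat ℓ g →+ Std ℓ a)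
          + ((Nat.card (AddSubgroup (Std ℓ a)) * Nat.card (wedgeSq (Std ℓ a)) : ℕ) : ℝ)
            * Nat.card (Lat ℓ g →+ Std ℓ a) := by exact_mod_cast h
      have h2 : (0 : ℝ) < 2 ^ g := by positivity
      have h3 := hpos g
      change _ / _ ≤ 1 + _ / _
      rw [div_le_iff₀ h3, add_mul, one_mul, div_mul_eq_mul_div, ← sub_le_iff_le_add',
        le_div_iff₀ h2]
      linarith
  have := ENNReal.tendsto_ofReal hreal
  rw [ENNReal.ofReal_one] at this
  refine this.congr fun g => ?_
  rw [ENNReal.ofReal_div_of_pos (hpos g), ENNReal.ofReal_natCast, ENNReal.ofReal_natCast]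

theorem momentsConverge_linear (h2 : ℓ ≠ 2) :
    MomentsConverge fun g => linearMeasure (ℓ := ℓ) n h2 g := fun Y => by
  obtain ⟨k, a, s, ha, hi⟩ := exists_iso_std Y
  have h := ENNReal.Tendsto.mul_const (b := univMoment (s.toBEG (exists_primary_pow a)))
    (tendsto_card_orbit s.2.1) (Or.inl one_ne_zero)
  rw [one_mul, ← univMoment_congr hi] at h
  refine h.congr' ?_
  filter_upwards [eventually_ge_atTop k] with g hg
  rw [surjMoment_linear, rawMoment_congr hi, rawMoment_skew hg ha, univMoment_congr hi]

omit [NeZero ℓ] in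
theorem momentsConverge_nonlinear (h2 : ℓ ≠ 2) (hn : 1 ≤ n) {q : ℤ_[ℓ]} (hq : ExactlyDivides n q) :
    MomentsConverge fun g => nonlinearMeasure h2 hn hq g := fun Y => by
  obtain ⟨g₀, h⟩ := surjMoment_nonlinear h2 hn Y
  refine tendsto_const_nhds.congr' ?_
  filter_upwards [eventually_ge_atTop g₀] with g hg
  exact (h q hq g hg).symm

end LinearMain

end BilinEnh

end

theorem mainTheorem4 (ℓ : ℕ) [Fact ℓ.Prime] (h2 : ℓ ≠ 2) (n : ℕ) (hn : 1 ≤ n) :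
    -- for every admissible `q` and every `g`, the cokernel is almost surely finite
    (∀ (q : ℤ_[ℓ]) (hq : BilinEnh.ExactlyDivides n q) (g : ℕ),
      MeasureTheory.IsProbabilityMeasure (BilinEnh.nonlinearMeasure h2 hn hq g)) ∧
    -- the moments of the nonlinear model are eventually exactly `1 / |Sym²H[ℓ^n]|`
    (∀ H : BilinEnh.BEG ℓ n, ∃ g₀ : ℕ,
      ∀ (q : ℤ_[ℓ]) (hq : BilinEnh.ExactlyDivides n q) (g : ℕ), g₀ ≤ g →
        BilinEnh.surjMoment (BilinEnh.nonlinearMeasure h2 hn hq g) H =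
          ((BilinEnh.symSqTorsionCard H.G (ℓ ^ n) : ℕ) : ENNReal)⁻¹) ∧
    -- the universal measure `μ` is the only probability measure with these moments; the linear
    -- model and, for every admissible `q`, the nonlinear model converge to it
    (∃ μ : MeasureTheory.Measure (BilinEnh.BEGClass ℓ n),
      BilinEnh.HasUniversalMoments μ ∧
      (∀ μ' : MeasureTheory.Measure (BilinEnh.BEGClass ℓ n),
        BilinEnh.HasUniversalMoments μ' → μ' = μ) ∧
      BilinEnh.WeaklyConverges (fun g => BilinEnh.linearMeasure n h2 g) μ ∧
      ∀ (q : ℤ_[ℓ]) (hq : BilinEnh.ExactlyDivides n q),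
        BilinEnh.WeaklyConverges (fun g => BilinEnh.nonlinearMeasure h2 hn hq g) μ) := by
  have : NeZero ℓ := ⟨(Fact.out : ℓ.Prime).ne_zero⟩
  -- Existence of μ comes from an ultrafilter limit of the linear measures; any sequence with these
  -- limiting moments would serve.
  obtain ⟨μ, hμ⟩ := (BilinEnh.momentsConverge_linear (n := n) h2).exists_universal h2
  exact ⟨fun q hq g => BilinEnh.isProbabilityMeasure_nonlinear h2 hn hq g,
    BilinEnh.surjMoment_nonlinear h2 hn, μ, hμ,
    fun μ' h => BilinEnh.hasUniversalMoments_unique h2 h hμ,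
    (BilinEnh.momentsConverge_linear h2).weaklyConverges h2
      (BilinEnh.isProbabilityMeasure_linear h2) hμ,
    fun q hq => (BilinEnh.momentsConverge_nonlinear h2 hn hq).weaklyConverges h2
      (BilinEnh.isProbabilityMeasure_nonlinear h2 hn hq) hμ⟩
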